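/- **Setting.** Let $(V,\|\cdot\|)$ be a separable Banach space with the Radon–Nikodým property, with dual $(V^*,\|\cdot\|_*)$, and let $T>0$. Let $\Psi,\Phi:V\to[0,\infty)$ be continuous, convex and strictly positive on $V\setminus\{0\}$, with $\Psi(\lambda v)=\lambda\Psi(v)$ for $\lambda\ge 0$, and $\Phi(v)=F(\|v\|)$ for a convex $F\in C^1([0,\infty))$ with $F(r)>0$ for $r>0$, $F(0)=F'(0)=0$, $F'(r)\to\infty$ as $r\to\infty$. Let $D\subset V$ and let $\mathcal E:[0,T]\times D\to\mathbb R$, $(t,u)\mapsto\mathcal E_t(u)$, be lower semicontinuous (put $\mathcal E_t(u)=+\infty$ for $u\notin D$), with Fréchet subdifferential $\partial\mathcal E_t(u)\subset V^*$ with respect to $u$. Put $D_E:=\{u\in D:\Psi(u)+\sup_{t\in[0,T]}\mathcal E_t(u)\le E\}$ and assume: * $D_E$ is compact in $V$ for every $E>0$; * for $u\in D$ the map $t\mapsto\mathcal E_t(u)$ is differentiable on $[0,T]$ with derivative $\mathcal P_t(u)$, and for some $C_P\ge0$ and all $(t,u)\in(0,T)\times D$, $E>0$: $|\mathcal P_t(u)|\le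 C_P(\Psi(u)+\mathcal E_t(u))$ and $\limsup_{w\to u,\,w\in D_E}\mathcal P_t(w)\le\mathcal P_t(u)$; * for every $E>0$ there is an upper semicontinuous $\omega^E:[0,T]\times D_E\times D_E\to\mathbb R$ with $\omega^E_t(u,u)=0$ and $\mathcal E_t(v)\ge\mathcal E_t(u)+\langle\xi,v-u\rangle-\omega^E_t(u,v)\min(\Psi(v-u),\Psi(u-v))$ for all $t\in[0,T]$, $u,v\in D_E$, $\xi\in\partial\mathcal E_t(u)$. **Notation.** $K^*:=\{\xi\in V^*:\langle\xi,w\rangle\le\Psi(w)\ \forall w\in V\}$ and $\mathfrak e_t(u):=\inf\{\|\xi-z\|_*:\xi\in-\partial\mathcal E_t(u),\ z\in K^*\}\in[0,\infty]$; $\mathfrak k_t(u):=0$ if $0\in K^*+\partial\mathcal E_t(u)$ and $+\infty$ otherwise; $0\cdot\infty=0$. For $Z\subset V$, $\mathrm{AC}([a,b];Z,\Psi)$ is the set of $u:[a,b]\to Z$ for which there is $0\le m\in L^1(a,b)$ with $\Psi(u(s_1)-u(s_0))\le\int_{s_0}^{s_1}m\,ds$ for $a\le s_0<s_1\le b$;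 $|u'|_\Psi(s):=\lim_{h\to0}\Psi\big((u(s+h)-u(s))/h\big)$, which exists for a.e. $s$ when $Z=D_E$. $\mathrm{Var}_\Psi(u;[a,b])$ is the supremum of $\sum_{m=1}^M\Psi(u(t_m)-u(t_{m-1}))$ over partitions $a=t_0<\dots<t_M=b$, and $\mathrm{BV}([0,T];Z,\Psi)$ is the set of $u:[0,T]\to Z$ with $\mathrm{Var}_\Psi(u;[0,T])<\infty$. For $u\in\mathrm{BV}([0,T];D_E,\Psi)$, $u(t_\pm)$ denote the one-sided limits (with $u(0_-)=u(0)$, $u(T_+)=u(T)$) and $\mathrm J_u$ is the set of $t\in[0,T]$ with $u(t_-)\ne u(t)$ or $u(t)\neq u(t_+)$. For a pair $(\mathsf t,\mathsf u):[a,b]\to[0,T]\times V$ let $G:=\{s\in[a,b]:\mathfrak e_{\mathsf t(s)}(\mathsf u(s))>0\}$ and, for $[c,d]\subset[a,b]$, $$\mathcal D(\mathsf t,\mathsf u;[c,d]):=\int_c^d|\mathsf u'|_\Psi(s)\,ds+\int_{[c,d]\cap G}\mathfrak e_{\mathsf t(s)}(\mathsf u(s))\,\|\dot{\mathsf u}(s)\|\,ds.$$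 For $t\in[0,T]$ and $u_0,u_1\in D$, the Finsler cost $\Delta_{\mathfrak f_t}(u_0,u_1)\in[0,\infty]$ is the infimum of $\mathcal D(t,\vartheta;[0,1])$ (with $\mathsf t\equiv t$) over all $\vartheta$ with $\vartheta(0)=u_0$, $\vartheta(1)=u_1$ that belong to $\mathrm{AC}([0,1];D_E,\Psi)$ for some $E>0$ and are locally absolutely continuous with respect to $\|\cdot\|$ on $\{r:\mathfrak e_t(\vartheta(r))>0\}$ (and $+\infty$ if there are none). For a family of costs $\Delta_t$ let $$\mathrm{Jmp}_\Delta(u;[a,b]):=\Delta_a(u(a),u(a_+))+\Delta_b(u(b_-),u(b))+\sum_{t\in\mathrm J_u\cap(a,b)}\big(\Delta_t(u(t_-),u(t))+\Delta_t(u(t),u(t_+))\big),$$ write $\mathrm{Jmp}_\Psi$ for the cost $\Psi(u_1-u_0)$ and $\mathrm{Jmp}_{\mathfrak f}$ for the cost $\Delta_{\mathfrak f_t}$, and set $\mathrm{Var}_{\mathfrak f}(u;[a,b]):=\mathrm{Var}_\Psi(u;[a,b])-\mathrm{Jmp}_\Psi(u;[a,b])+\mathrm{Jmp}_{\mathfrak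 f}(u;[a,b])$ for $0\le a<b\le T$. $u$ is *locally stable* if $0\in K^*+\partial\mathcal E_t(u(t))$ for all $t\in[0,T]\setminus\mathrm J_u$. A *BV solution* is a locally stable $u\in\mathrm{BV}([0,T];D_E,\Psi)$, for some $E>0$, with $$\mathrm{Var}_{\mathfrak f}(u;[0,t])+\mathcal E_t(u(t))=\mathcal E_0(u(0))+\int_0^t\mathcal P_r(u(r))\,dr\quad\text{for all }t\in(0,T].$$ $(\mathsf t,\mathsf u):[a,b]\to[0,T]\times V$ ($a<b$) is an *admissible parameterized curve*, $(\mathsf t,\mathsf u)\in\mathscr A(a,b)$, if $\mathsf t$ is nondecreasing and absolutely continuous, $\mathsf u\in\mathrm{AC}([a,b];D_E,\Psi)$ for some $E>0$, $\mathsf u$ is locally absolutely continuous with respect to $\|\cdot\|$ on $G$, $\mathsf t$ is constant on each connected component of $G$, and $\mathcal D(\mathsf t,\mathsf u;[a,b])<\infty$. It is *surjective* if $\mathsf t(a)=0$, $\mathsf t(b)=T$, and *nondegenerate* if $\dot{\mathsf t}+|\mathsf u'|_\Psi>0$ a.e. in $(a,b)$. A *parameterized solution* is a surjective nondegenerate $(\mathsf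 t,\mathsf u)\in\mathscr A(a,b)$ such that for all $a\le s_1\le s_2\le b$ $$\int_{s_1}^{s_2}\Big(|\mathsf u'|_\Psi+\mathfrak k_{\mathsf t}(\mathsf u)\,\dot{\mathsf t}+\mathfrak e_{\mathsf t}(\mathsf u)\|\dot{\mathsf u}\|-\mathcal P_{\mathsf t}(\mathsf u)\,\dot{\mathsf t}\Big)ds+\mathcal E_{\mathsf t(s_2)}(\mathsf u(s_2))=\mathcal E_{\mathsf t(s_1)}(\mathsf u(s_1)),$$ where the term $\mathfrak e_{\mathsf t}(\mathsf u)\|\dot{\mathsf u}\|$ is $0$ outside $G$. A curve $u:[0,T]\to V$ is *selected* from $(\mathsf t,\mathsf u)$ if $u(t)\in\{\mathsf u(s):s\in[a,b],\ \mathsf t(s)=t\}$ for every $t\in[0,T]$. **Proposition.** (BVP1) Let $(\mathsf t,\mathsf u)\in\mathscr A(a,b)$ be surjective and nondegenerate, and let $u$ be selected from $(\mathsf t,\mathsf u)$. Then $u\in\mathrm{BV}([0,T];D_E,\Psi)$ for some $E>0$, $u$ is locally stable, and for every $\mathsf s:[0,T]\to[a,b]$ with $\mathsf t(\mathsf s(t))=t$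 and $\mathsf u(\mathsf s(t))=u(t)$ for all $t\in[0,T]$, $$\mathrm{Var}_{\mathfrak f}(u;[t_0,t_1])\le\int_{\mathsf s(t_0)}^{\mathsf s(t_1)}|\mathsf u'|_\Psi\,ds+\int_{[\mathsf s(t_0),\mathsf s(t_1)]\cap G}\mathfrak e_{\mathsf t(s)}(\mathsf u(s))\|\dot{\mathsf u}(s)\|\,ds\quad\text{for all }0\le t_0<t_1\le T;$$ in particular $\mathrm{Var}_{\mathfrak f}(u;[0,T])<\infty$. (BVP2) If $(\mathsf t,\mathsf u)$ is a parameterized solution, then every curve $u$ selected from $(\mathsf t,\mathsf u)$ is a BV solution. (BVP3) Conversely, let $E>0$ and let $u\in\mathrm{BV}([0,T];D_E,\Psi)$ be locally stable with $\mathrm{Var}_{\mathfrak f}(u;[0,T])<\infty$. Then there are $\mathsf S>0$ and a nondegenerate surjective $(\mathsf t,\mathsf u)\in\mathscr A(0,\mathsf S)$ such that $u$ is selected from $(\mathsf t,\mathsf u)$ and $$\mathrm{Var}_{\mathfrak f}(u;[0,T])=\int_0^{\mathsf S}|\mathsf u'|_\Psi\,ds+\int_{[0,\mathsf S]\cap G}\mathfrak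 e_{\mathsf t(s)}(\mathsf u(s))\|\dot{\mathsf u}(s)\|\,ds,$$ and if $u$ is a BV solution, then this $(\mathsf t,\mathsf u)$ is a parameterized solution. -/

import Mathlib

open Set Filter Topology MeasureTheory
open scoped ENNReal Pointwise

noncomputable section

/-- The Radon–Nikodým property, in its characterization by curves: every absolutely continuous
curve on a compact interval with values in `V` is differentiable almost everywhere. -/
def HasRadonNikodymProperty (V : Type*) [NormedAddCommGroup V] [NormedSpace ℝ V] : Prop :=
  ∀ (a b : ℝ) (f : ℝ → V), a < b → AbsolutelyContinuousOnInterval f a b →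
    ∀ᵐ t ∂(volume.restrict (Ioo a b)), DifferentiableAt ℝ f t

/-- The data of a rate-independent system `(V, ℰ, Ψ, Φ)` on the time interval `[0, T]`.
`energy t u` is meaningful for `t ∈ [0, T]` and `u ∈ D`; outside `D` the energy is understood
to be `+∞`. The assumptions on the data are collected in `RateIndependentSystem.Standing`. -/
structure RateIndependentSystem (V : Type*) [NormedAddCommGroup V] [NormedSpace ℝ V] where
  /-- final time -/
  T : ℝ
  /-- domain of the energy -/
  D : Set V
  /-- the energy `ℰ_t(u)` -/
  energy : ℝ → V → ℝ
  /-- rate-independent dissipation potential -/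
  Psi : V → ℝ
  /-- viscous dissipation potential -/
  Phi : V → ℝ

namespace RateIndependentSystem

variable {V : Type*} [NormedAddCommGroup V] [NormedSpace ℝ V] (S : RateIndependentSystem V)

/-- The sublevel `D_E = {u ∈ D : Ψ(u) + sup_{t ∈ [0,T]} ℰ_t(u) ≤ E}`. -/
def sublevel (E : ℝ) : Set V :=
  {u | u ∈ S.D ∧ ∀ t ∈ Icc 0 S.T, S.Psi u + S.energy t u ≤ E}

/-- The power `𝒫_t(u) = ∂_t ℰ_t(u)` (one-sided at the end points of `[0,T]`). -/
def power (t : ℝ) (u : V) : ℝ :=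
  derivWithin (fun r => S.energy r u) (Icc 0 S.T) t

/-- The Fréchet subdifferential `∂ℰ_t(u) ⊆ V*` of the energy (extended by `+∞` outside `D`);
it is empty if `u ∉ D`. -/
def subdiff (t : ℝ) (u : V) : Set (V →L[ℝ] ℝ) :=
  {ξ | u ∈ S.D ∧ ∀ ε > 0, ∀ᶠ v in 𝓝[S.D] u,
    S.energy t v - S.energy t u - ξ (v - u) ≥ -ε * ‖v - u‖}

/-- The convex set `K* = {ξ ∈ V* : ⟨ξ, w⟩ ≤ Ψ(w) for all w}`. -/
def Kstar : Set (V →L[ℝ] ℝ) :=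
  {ξ | ∀ w, ξ w ≤ S.Psi w}

/-- `Ψ_∧(w) = min (Ψ(w), Ψ(-w))`. -/
def PsiMin (w : V) : ℝ :=
  min (S.Psi w) (S.Psi (-w))

/-- The standing assumptions on the data. -/
structure Standing : Prop where
  T_pos : 0 < S.T
  -- dissipation potentials
  Psi_continuous : Continuous S.Psi
  Psi_convex : ConvexOn ℝ univ S.Psi
  Psi_nonneg : ∀ v, 0 ≤ S.Psi v
  Psi_pos : ∀ v, v ≠ 0 → 0 < S.Psi v
  Psi_smul : ∀ (c : ℝ) (v : V), 0 ≤ c → S.Psi (c • v) = c * S.Psi v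
  Phi_continuous : Continuous S.Phi
  Phi_convex : ConvexOn ℝ univ S.Phi
  Phi_nonneg : ∀ v, 0 ≤ S.Phi v
  Phi_pos : ∀ v, v ≠ 0 → 0 < S.Phi v
  Phi_eq : ∃ F : ℝ → ℝ, ContDiffOn ℝ 1 F (Ici 0) ∧ ConvexOn ℝ (Ici 0) F ∧
    (∀ r, 0 < r → 0 < F r) ∧ F 0 = 0 ∧ derivWithin F (Ici 0) 0 = 0 ∧
    Tendsto (derivWithin F (Ici 0)) atTop atTop ∧ ∀ v, S.Phi v = F ‖v‖
  -- lower semicontinuity of the energy on `[0,T] × D`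
  energy_lsc : LowerSemicontinuousOn (fun p : ℝ × V => S.energy p.1 p.2) (Icc 0 S.T ×ˢ S.D)
  -- coercivity
  sublevel_compact : ∀ E > 0, IsCompact (S.sublevel E)
  -- power control
  energy_diff : ∀ u ∈ S.D, DifferentiableOn ℝ (fun t => S.energy t u) (Icc 0 S.T)
  power_bound : ∃ C : ℝ, 0 ≤ C ∧ ∀ t ∈ Ioo 0 S.T, ∀ u ∈ S.D,
    |S.power t u| ≤ C * (S.Psi u + S.energy t u)
  power_usc : ∀ t ∈ Ioo 0 S.T, ∀ u ∈ S.D, ∀ E > 0,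
    UpperSemicontinuousWithinAt (S.power t) (S.sublevel E) u
  -- `Ψ`-uniform subdifferentiability
  subdiff_unif : ∀ E > 0, ∃ ω : ℝ → V → V → ℝ,
    UpperSemicontinuousOn (fun p : ℝ × V × V => ω p.1 p.2.1 p.2.2)
      (Icc 0 S.T ×ˢ S.sublevel E ×ˢ S.sublevel E) ∧
    (∀ t ∈ Icc 0 S.T, ∀ u ∈ S.sublevel E, ω t u u = 0) ∧
    ∀ t ∈ Icc 0 S.T, ∀ u ∈ S.sublevel E, ∀ v ∈ S.sublevel E, ∀ ξ ∈ S.subdiff t u,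
      S.energy t v ≥ S.energy t u + ξ (v - u) - ω t u v * S.PsiMin (v - u)

/-- `𝔢_t(u) = inf {‖ξ - z‖_* : ξ ∈ -∂ℰ_t(u), z ∈ K*}`, equal to `+∞` if `∂ℰ_t(u)` is empty. -/
def slope (t : ℝ) (u : V) : ℝ≥0∞ :=
  ⨅ ξ ∈ -S.subdiff t u, ⨅ z ∈ S.Kstar, ‖ξ - z‖ₑ

/-- The pointwise stability condition `K* + ∂ℰ_t(u) ∋ 0`. -/
def IsStableAt (t : ℝ) (u : V) : Prop :=
  (0 : V →L[ℝ] ℝ) ∈ S.Kstar + S.subdiff t u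

open Classical in
/-- The indicator `𝔨_t(u)`: `0` if `K* + ∂ℰ_t(u) ∋ 0`, and `+∞` otherwise. -/
def stabInd (t : ℝ) (u : V) : ℝ≥0∞ :=
  if S.IsStableAt t u then 0 else ⊤

/-! ### Absolutely continuous curves and curves of bounded variation with respect to `Ψ` -/

/-- `u ∈ AC([a,b]; Z, Ψ)`. -/
def IsPsiAC (Z : Set V) (u : ℝ → V) (a b : ℝ) : Prop :=
  MapsTo u (Icc a b) Z ∧
  ∃ m : ℝ → ℝ, (∀ s, 0 ≤ m s) ∧ IntegrableOn m (Icc a b) ∧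
    ∀ s₀ ∈ Icc a b, ∀ s₁ ∈ Icc a b, s₀ < s₁ → S.Psi (u s₁ - u s₀) ≤ ∫ s in s₀..s₁, m s

/-- The metric `Ψ`-derivative `|u'|_Ψ(s) = lim_{h → 0} Ψ((u(s+h) - u(s))/h)`. The limit exists
for almost every `s` when `u` is `Ψ`-absolutely continuous with values in a sublevel `D_E`;
the upper limit gives a value at all other points. -/
def metricDeriv (u : ℝ → V) (s : ℝ) : ℝ≥0∞ :=
  limsup (fun h : ℝ => ENNReal.ofReal (S.Psi (h⁻¹ • (u (s + h) - u s)))) (𝓝[≠] 0)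

/-- The pointwise total variation `Var_Ψ(u;[a,b])`. -/
def psiVar (u : ℝ → V) (a b : ℝ) : ℝ≥0∞ :=
  ⨆ (M : ℕ) (r : ℕ → ℝ) (_ : ∀ i < M, r i < r (i + 1)) (_ : r 0 = a) (_ : r M = b),
    ∑ i ∈ Finset.range M, ENNReal.ofReal (S.Psi (u (r (i + 1)) - u (r i)))

/-- `u ∈ BV([0,T]; Z, Ψ)`. -/
def IsPsiBV (Z : Set V) (u : ℝ → V) : Prop :=
  MapsTo u (Icc 0 S.T) Z ∧ S.psiVar u 0 S.T < ⊤

/-- The left limit `u(t₋)`, with the convention `u(0₋) = u(0)`. -/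
def leftVal (u : ℝ → V) (t : ℝ) : V :=
  if t ≤ 0 then u t else Function.leftLim u t

/-- The right limit `u(t₊)`, with the convention `u(T₊) = u(T)`. -/
def rightVal (u : ℝ → V) (t : ℝ) : V :=
  if S.T ≤ t then u t else Function.rightLim u t

/-- The jump set `J_u ⊆ [0,T]`. -/
def jumpSet (u : ℝ → V) : Set ℝ :=
  {t | t ∈ Icc 0 S.T ∧ (leftVal u t ≠ u t ∨ u t ≠ S.rightVal u t)}

/-- The jump variation on `[a,b]` induced by a family of costs `Δ_t(u₀,u₁)`. -/
def jumpVar (cost : ℝ → V → V → ℝ≥0∞) (u : ℝ → V) (a b : ℝ) : ℝ≥0∞ :=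
  cost a (u a) (S.rightVal u a) + cost b (leftVal u b) (u b) +
    ∑' t : ↥(S.jumpSet u ∩ Ioo a b),
      (cost t (leftVal u t) (u t) + cost t (u t) (S.rightVal u t))

/-- The cost `Δ_Ψ(u₀,u₁) = Ψ(u₁ - u₀)`. -/
def psiCost (_t : ℝ) (u₀ u₁ : V) : ℝ≥0∞ :=
  ENNReal.ofReal (S.Psi (u₁ - u₀))

/-! ### The Finsler cost and the `𝔣`-total variation -/

/-- The set `G = {s ∈ [a,b] : 𝔢_{t(s)}(u(s)) > 0}`. -/
def unstableSet (tt : ℝ → ℝ) (uu : ℝ → V) (a b : ℝ) : Set ℝ :=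
  {s | s ∈ Icc a b ∧ 0 < S.slope (tt s) (uu s)}

/-- `u` is locally absolutely continuous, with respect to the norm of `V`, on `G`, i.e. on each
compact interval contained in `G`. -/
def LocallyAC (u : ℝ → V) (G : Set ℝ) : Prop :=
  ∀ c d : ℝ, c < d → Icc c d ⊆ G → AbsolutelyContinuousOnInterval u c d

/-- The dissipation `∫_c^d |u'|_Ψ ds + ∫_{[c,d] ∩ G} 𝔢_{t(s)}(u(s)) ‖u̇(s)‖ ds`, where `G` is the
unstable set of the curve; as usual `∞ · 0 = 0`. -/
def dissipation (tt : ℝ → ℝ) (uu : ℝ → V) (c d : ℝ) : ℝ≥0∞ :=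
  (∫⁻ s in Icc c d, S.metricDeriv uu s) +
    ∫⁻ s in S.unstableSet tt uu c d, S.slope (tt s) (uu s) * ‖deriv uu s‖ₑ

/-- `θ ∈ 𝒯_t(u₀,u₁)`: admissible transition curves from `u₀` to `u₁` at the time `t`. -/
def IsTransition (t : ℝ) (u₀ u₁ : V) (θ : ℝ → V) : Prop :=
  (∃ E > 0, S.IsPsiAC (S.sublevel E) θ 0 1) ∧
  LocallyAC θ (S.unstableSet (fun _ => t) θ 0 1) ∧ θ 0 = u₀ ∧ θ 1 = u₁

/-- The Finsler dissipation cost `Δ_{𝔣_t}(u₀,u₁)`. -/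
def finslerCost (t : ℝ) (u₀ u₁ : V) : ℝ≥0∞ :=
  ⨅ (θ : ℝ → V) (_ : S.IsTransition t u₀ u₁ θ), S.dissipation (fun _ => t) θ 0 1

/-- The `𝔣`-total variation `Var_𝔣(u;[a,b]) = Var_Ψ - Jmp_Ψ + Jmp_𝔣`, for `u` in
`BV([0,T]; D_E, Ψ)` and `0 ≤ a < b ≤ T` (so that `Jmp_Ψ ≤ Var_Ψ < ∞`). -/
def finslerVar (u : ℝ → V) (a b : ℝ) : ℝ≥0∞ :=
  S.psiVar u a b - S.jumpVar S.psiCost u a b + S.jumpVar S.finslerCost u a b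

/-! ### Balanced Viscosity solutions -/

/-- The local stability condition: `K* + ∂ℰ_t(u(t)) ∋ 0` for all `t ∈ [0,T] ∖ J_u`. -/
def LocallyStable (u : ℝ → V) : Prop :=
  ∀ t ∈ Icc 0 S.T \ S.jumpSet u, S.IsStableAt t (u t)

/-- Balanced Viscosity (`BV`) solutions. The curve takes values in some sublevel `D_E`, which is
what the definition of the `𝔣`-total variation presupposes. -/
structure IsBVSolution (u : ℝ → V) : Prop where
  isBV : ∃ E > 0, S.IsPsiBV (S.sublevel E) u
  locallyStable : S.LocallyStable u
  balance : ∀ t ∈ Ioc 0 S.T,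
    (S.finslerVar u 0 t : EReal) + (S.energy t (u t) : EReal) =
      ((S.energy 0 (u 0) + ∫ r in (0 : ℝ)..t, S.power r (u r) : ℝ) : EReal)

/-! ### Parameterized curves and solutions -/

/-- Admissible parameterized curves `(t,u) ∈ 𝒜(a,b;[0,T] × V)`. -/
structure IsAdmissible (tt : ℝ → ℝ) (uu : ℝ → V) (a b : ℝ) : Prop where
  mapsTo : MapsTo tt (Icc a b) (Icc 0 S.T)
  monotone : MonotoneOn tt (Icc a b)
  ac : AbsolutelyContinuousOnInterval tt a b
  psiAC : ∃ E > 0, S.IsPsiAC (S.sublevel E) uu a b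
  locallyAC : LocallyAC uu (S.unstableSet tt uu a b)
  -- `t` is constant on each connected component of `G`
  const : ∀ c d : ℝ, c ≤ d → Icc c d ⊆ S.unstableSet tt uu a b → tt c = tt d
  finite : S.dissipation tt uu a b < ⊤

/-- `t(a) = 0` and `t(b) = T`. -/
def IsSurjective (tt : ℝ → ℝ) (a b : ℝ) : Prop :=
  tt a = 0 ∧ tt b = S.T

/-- `ṫ(s) + |u'|_Ψ(s) > 0` for a.a. `s ∈ (a,b)`. -/
def IsNondegenerate (tt : ℝ → ℝ) (uu : ℝ → V) (a b : ℝ) : Prop :=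
  ∀ᵐ s ∂(volume.restrict (Ioo a b)), 0 < ENNReal.ofReal (deriv tt s) + S.metricDeriv uu s

/-- `𝔊[t,u;ṫ,u̇](s) = 𝔨_{t(s)}(u(s)) ṫ(s) + 𝔢_{t(s)}(u(s)) ‖u̇(s)‖`; the second term vanishes where
`𝔢_{t(s)}(u(s)) = 0`. -/
def paramG (tt : ℝ → ℝ) (uu : ℝ → V) (s : ℝ) : ℝ≥0∞ :=
  S.stabInd (tt s) (uu s) * ENNReal.ofReal (deriv tt s) +
    S.slope (tt s) (uu s) * ‖deriv uu s‖ₑ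

/-- The integral over `[s₁,s₂]` of
`𝔉[t,u;t',u'] = |u'|_Ψ + 𝔊[t,u;ṫ,u̇] - 𝒫_{t}(u) ṫ`, with values in `(-∞,+∞]`. -/
def paramAction (tt : ℝ → ℝ) (uu : ℝ → V) (s₁ s₂ : ℝ) : EReal :=
  ((∫⁻ s in Icc s₁ s₂, (S.metricDeriv uu s + S.paramG tt uu s) : ℝ≥0∞) : EReal) -
    ((∫ s in s₁..s₂, S.power (tt s) (uu s) * deriv tt s : ℝ) : EReal)

/-- Parameterized solutions on `[a,b]`. -/
structure IsParamSolution (tt : ℝ → ℝ) (uu : ℝ → V) (a b : ℝ) : Prop where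
  admissible : S.IsAdmissible tt uu a b
  surjective : S.IsSurjective tt a b
  nondegenerate : S.IsNondegenerate tt uu a b
  balance : ∀ s₁ ∈ Icc a b, ∀ s₂ ∈ Icc a b, s₁ ≤ s₂ →
    S.paramAction tt uu s₁ s₂ + (S.energy (tt s₂) (uu s₂) : EReal) =
      (S.energy (tt s₁) (uu s₁) : EReal)

/-- `u(t) ∈ {u(s) : s ∈ [a,b], t(s) = t}` for every `t ∈ [0,T]`. -/
def IsSelection (tt : ℝ → ℝ) (uu : ℝ → V) (a b : ℝ) (u : ℝ → V) : Prop :=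
  ∀ t ∈ Icc 0 S.T, ∃ s ∈ Icc a b, tt s = t ∧ uu s = u t

end RateIndependentSystem

end

/-! The proof replaces integrals by variations. For a curve `(tt, uu)` give each parameter interval
`[x,y]` the cost `incCost`: the number Ψ(uu y - uu x) plus ‖uu y - uu x‖ times the infimum of the
slope 𝔢 over `[x,y]`. For a regular curve the dissipation equals the variation of this cost over
partitions (`IsRegularCurve.dissipation_eq`). In this form it is visibly additive, invariant under
monotone reparametrization and lower semicontinuous, and the metric derivative is needed only to
pass back and forth. The identity rests on lower semicontinuity of the slope (`Standing.slope_lsc`).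
That comes from closedness of the subdifferential graph, strong in the base point and weak-star in
the functional (`Standing.subdiff_closed`). The Radon–Nikodým property supplies derivatives almost
everywhere on the unstable set G.

The analytic core is the chain rule inequality at a frozen time: an energy drop along a curve is at
most its dissipation, hence at most the Finsler cost (`IsRegularCurve.energy_sub_le`,
`Standing.energy_sub_le_finslerCost`). The energy is only lower semicontinuous along curves. The
inequality is therefore derived from finite increments, by `Standing.exists_energy_sub_le`, and not
by differentiation.

(BVP1) One-sided limits of a selected curve are the values of `uu` at the end points of the fibres
of `tt`. The slope vanishes there, since `tt` is constant on components of G and the fibre would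
otherwise extend further. This is local stability. The part of `uu` between a selected point and an
end of its fibre competes in the Finsler cost of the jump. Hence jump excess plus Ψ-variation is
below the dissipation on every interval, and superadditivity sums these estimates
(`IsSection.finslerVar_le`).

(BVP2) On a single fibre the energy balance says that dissipation equals energy drop. By the chain
rule each fibre piece is then an optimal transition, and the inequality of (BVP1) becomes an
equality (`IsSection.dissipation_le_finslerVar`). The power term is transported by a change of
variables (`IsSection.integral_power`).

(BVP3) Optimal transitions exist by compactness and can be run at unit speed
(`Standing.exists_optimal_transition`). The arclength t + Var_𝔣(u;[0,t]) jumps exactly by the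
Finsler costs, so the gaps in its range are filled by these transitions
(`IsFiniteBV.exists_isCompletion`). Incremental costs are then bounded by increments of x - tt x.
Together with (BVP1) this identifies the dissipation on `[0,x]` with x - tt x, which gives both the
equality of total variations and nondegeneracy. For a BV solution the jump relations for the energy
(`IsBVSolution.left_balance`, `IsBVSolution.right_balance`) and the chain rule force the balance at
every parameter (`IsCompletion.balance`). -/

noncomputable section

/-! ### Variation of interval functions -/

/-- The variation of an interval function `g` over the partitions of `[a,b]`. -/
def ivar (g : ℝ → ℝ → ℝ≥0∞) (a b : ℝ) : ℝ≥0∞ :=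
  ⨆ (M : ℕ) (r : ℕ → ℝ) (_ : ∀ i < M, r i < r (i + 1)) (_ : r 0 = a) (_ : r M = b),
    ∑ i ∈ Finset.range M, g (r i) (r (i + 1))

/-- Interval functions that are superadditive on the subintervals of `[a,b]`. -/
def SuperaddOn (h : ℝ → ℝ → ℝ≥0∞) (a b : ℝ) : Prop :=
  ∀ x y z, a ≤ x → x < y → y < z → z ≤ b → h x y + h y z ≤ h x z

/-- Interval functions that are subadditive on the subintervals of `[a,b]`. -/
def SubaddOn (h : ℝ → ℝ → ℝ≥0∞) (a b : ℝ) : Prop :=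
  ∀ x y z, a ≤ x → x < y → y < z → z ≤ b → h x z ≤ h x y + h y z

theorem sum_le_ivar (g : ℝ → ℝ → ℝ≥0∞) {M : ℕ} {r : ℕ → ℝ} (hr : ∀ i < M, r i < r (i + 1)) :
    ∑ i ∈ Finset.range M, g (r i) (r (i + 1)) ≤ ivar g (r 0) (r M) :=
  le_iSup_of_le M <| le_iSup_of_le r <| le_iSup_of_le hr <| le_iSup_of_le rfl <|
    le_iSup_of_le rfl le_rfl

theorem ivar_le_iff {g : ℝ → ℝ → ℝ≥0∞} {a b : ℝ} {B : ℝ≥0∞} :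
    ivar g a b ≤ B ↔ ∀ (M : ℕ) (r : ℕ → ℝ), (∀ i < M, r i < r (i + 1)) → r 0 = a → r M = b →
      ∑ i ∈ Finset.range M, g (r i) (r (i + 1)) ≤ B := by
  simp only [ivar, iSup_le_iff]

theorem partition_le {M : ℕ} {r : ℕ → ℝ} (hr : ∀ i < M, r i < r (i + 1)) {i j : ℕ} (hij : i ≤ j)
    (hj : j ≤ M) : r i ≤ r j := by
  induction j, hij using Nat.le_induction with
  | base => exact le_rfl
  | succ j _ ih => exact (ih (by omega)).trans (hr j (by omega)).le

theorem le_ivar (g : ℝ → ℝ → ℝ≥0∞) {a b : ℝ} (hab : a < b) : g a b ≤ ivar g a b := by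
  have := sum_le_ivar g (M := 1) (r := fun i => if i = 0 then a else b)
    (by intro i hi; simp [show i = 0 by omega, hab])
  simpa using this

theorem ivar_self (g : ℝ → ℝ → ℝ≥0∞) (a : ℝ) : ivar g a a = 0 := by
  refine le_antisymm (ivar_le_iff.2 ?_) zero_le
  intro M r hr h0 hM
  rcases Nat.eq_zero_or_pos M with rfl | h
  · simp
  · have h1 := hr 0 h
    have h2 := partition_le hr (show 0 + 1 ≤ M by omega) le_rfl
    linarith

theorem ivar_of_lt (g : ℝ → ℝ → ℝ≥0∞) {a b : ℝ} (hab : b < a) : ivar g a b = 0 := by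
  refine le_antisymm (ivar_le_iff.2 ?_) zero_le
  intro M r hr h0 hM
  have h2 := partition_le hr (Nat.zero_le M) le_rfl
  linarith

/-- The partitions of `[a,b]`. -/
def Partitions (a b : ℝ) : Type :=
  {p : ℕ × (ℕ → ℝ) // (∀ i < p.1, p.2 i < p.2 (i + 1)) ∧ p.2 0 = a ∧ p.2 p.1 = b}

theorem nonempty_partitions {a b : ℝ} (hab : a ≤ b) : Nonempty (Partitions a b) := by
  rcases hab.eq_or_lt with rfl | hab
  · exact ⟨⟨(0, fun _ => a), by simp⟩⟩
  · exact ⟨⟨(1, fun i => if i = 0 then a else b), by simp [hab]⟩⟩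

theorem ivar_eq_iSup (g : ℝ → ℝ → ℝ≥0∞) (a b : ℝ) :
    ivar g a b = ⨆ p : Partitions a b, ∑ i ∈ Finset.range p.1.1, g (p.1.2 i) (p.1.2 (i + 1)) := by
  refine le_antisymm (ivar_le_iff.2 fun M r hr h0 hM => ?_) (iSup_le fun p => ?_)
  · exact le_iSup (fun p : Partitions a b =>
      ∑ i ∈ Finset.range p.1.1, g (p.1.2 i) (p.1.2 (i + 1))) ⟨(M, r), hr, h0, hM⟩
  · obtain ⟨⟨M, r⟩, hr, rfl, rfl⟩ := p
    exact sum_le_ivar g hr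

/-- Partitions of adjacent intervals concatenate, so nothing is required of `g`. -/
theorem ivar_superadd (g : ℝ → ℝ → ℝ≥0∞) {a b c : ℝ} (hab : a ≤ b) (hbc : b ≤ c) :
    ivar g a b + ivar g b c ≤ ivar g a c := by
  have := nonempty_partitions hab
  have := nonempty_partitions hbc
  rw [ivar_eq_iSup g a b, ivar_eq_iSup g b c]
  refine ENNReal.iSup_add_iSup_le ?_
  rintro ⟨⟨M, r⟩, hr, h0, hM⟩ ⟨⟨N, q⟩, hq, k0, kN⟩
  dsimp only at hr h0 hM hq k0 kN ⊢
  have key := sum_le_ivar g (M := M + N) (r := fun i => if i ≤ M then r i else q (i - M)) (by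
    intro i hi
    rcases lt_trichotomy i M with h | h | h
    · simpa [h.le, Nat.succ_le_of_lt h] using hr i h
    · subst h
      have := hq 0 (by omega)
      simp only [le_refl, if_true, add_le_iff_nonpos_right, nonpos_iff_eq_zero, one_ne_zero,
        if_false, add_tsub_cancel_left, hM]
      rw [← k0]; simpa using this
    · have := hq (i - M) (by omega)
      simpa [h.not_ge, show ¬ i + 1 ≤ M by omega, show i + 1 - M = i - M + 1 by omega] using this)
  have e : (if M + N ≤ M then r (M + N) else q (M + N - M)) = c := by
    by_cases hN : N = 0
    · subst hN; simp [hM, ← kN, k0]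
    · simp [hN, kN]
  simp only [Nat.zero_le, if_true, h0, e] at key
  refine le_trans (le_of_eq ?_) key
  rw [Finset.sum_range_add]
  congr 1
  · refine Finset.sum_congr rfl fun i hi => ?_
    have := Finset.mem_range.1 hi
    simp [this.le, Nat.succ_le_of_lt this]
  · refine Finset.sum_congr rfl fun i hi => ?_
    rcases Nat.eq_zero_or_pos i with rfl | h
    · simp [hM, k0]
    · simp [show i ≠ 0 by omega, show ¬ M + i + 1 ≤ M by omega, show M + i + 1 - M = i + 1 by omega]

/-- The basic tool for upper bounds of a variation: a superadditive majorant of the summands absorbs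
any partition sum by telescoping. -/
theorem ivar_le_of_superaddOn {g h : ℝ → ℝ → ℝ≥0∞} {a b : ℝ} (hab : a < b)
    (hgh : ∀ x y, a ≤ x → x < y → y ≤ b → g x y ≤ h x y) (hh : SuperaddOn h a b) :
    ivar g a b ≤ h a b := by
  refine ivar_le_iff.2 fun M r hr h0 hM => ?_
  subst h0 hM
  have hM : 0 < M := by
    rcases Nat.eq_zero_or_pos M with rfl | h
    · exact absurd hab (lt_irrefl _)
    · exact h
  have key : ∀ k, 1 ≤ k → k ≤ M →
      ∑ i ∈ Finset.range k, g (r i) (r (i + 1)) ≤ h (r 0) (r k) := by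
    intro k hk
    induction k, hk using Nat.le_induction with
    | base =>
      intro hk
      simpa using hgh _ _ le_rfl (hr 0 hM) (partition_le hr hk le_rfl)
    | succ k hk ih =>
      intro hkM
      rw [Finset.sum_range_succ]
      have h1 := partition_le hr (Nat.zero_le k) (by omega)
      have h2 : r 0 < r k := (hr 0 hM).trans_le (partition_le hr (by omega) (by omega))
      have h3 := partition_le hr hkM le_rfl
      exact (add_le_add (ih (by omega)) (hgh _ _ h1 (hr k (by omega)) h3)).trans
        (hh _ _ _ le_rfl h2 (hr k (by omega)) h3)
  exact key M hM le_rfl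

theorem ivar_mono (g : ℝ → ℝ → ℝ≥0∞) {a b c d : ℝ} (hca : c ≤ a) (hab : a ≤ b) (hbd : b ≤ d) :
    ivar g a b ≤ ivar g c d :=
  calc ivar g a b ≤ ivar g c a + ivar g a b := le_add_self
    _ ≤ ivar g c b := ivar_superadd g hca hab
    _ ≤ ivar g c b + ivar g b d := le_self_add
    _ ≤ ivar g c d := ivar_superadd g (hca.trans hab) hbd

/-- For subadditive `g`, inserting the point `b` into a partition only increases the sum. The
superadditive majorant used here is the variation with a forced cut at `b` whenever `b` is interior.
-/
theorem ivar_add_of_subaddOn {g : ℝ → ℝ → ℝ≥0∞} {a b c : ℝ} (hab : a ≤ b) (hbc : b ≤ c)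
    (hg : SubaddOn g a c) : ivar g a b + ivar g b c = ivar g a c := by
  refine le_antisymm (ivar_superadd g hab hbc) ?_
  rcases hab.eq_or_lt with rfl | hab
  · simp [ivar_self]
  rcases hbc.eq_or_lt with rfl | hbc
  · simp [ivar_self]
  have key := ivar_le_of_superaddOn (g := g)
    (h := fun x y => if x < b ∧ b < y then ivar g x b + ivar g b y else ivar g x y)
    (hab.trans hbc) ?_ ?_
  · simpa [hab, hbc] using key
  · intro x y hx hxy hy
    split_ifs with h
    · exact (hg _ _ _ hx h.1 h.2 hy).trans (add_le_add (le_ivar g h.1) (le_ivar g h.2))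
    · exact le_ivar g hxy
  · intro x y z hx hxy hyz hz
    dsimp only
    rcases lt_trichotomy y b with h | rfl | h
    · rw [if_neg (by rintro ⟨-, h'⟩; exact lt_asymm h h')]
      by_cases hz' : b < z
      · rw [if_pos ⟨h, hz'⟩, if_pos ⟨hxy.trans h, hz'⟩, ← add_assoc]
        exact add_le_add (ivar_superadd g hxy.le h.le) le_rfl
      · rw [if_neg (fun h' => hz' h'.2), if_neg (fun h' => hz' h'.2)]
        exact ivar_superadd g hxy.le hyz.le
    · rw [if_neg (by simp), if_neg (by simp), if_pos ⟨hxy, hyz⟩]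
    · rw [if_neg (c := y < b ∧ b < z) (by rintro ⟨h', -⟩; exact lt_asymm h h')]
      by_cases hx' : x < b
      · rw [if_pos ⟨hx', h⟩, if_pos ⟨hx', h.trans hyz⟩, add_assoc]
        exact add_le_add le_rfl (ivar_superadd g h.le hyz.le)
      · rw [if_neg (fun h' => hx' h'.1), if_neg (fun h' => hx' h'.1)]
        exact ivar_superadd g hxy.le hyz.le

theorem SubaddOn.add {g h : ℝ → ℝ → ℝ≥0∞} {a b : ℝ} (hg : SubaddOn g a b) (hh : SubaddOn h a b) :
    SubaddOn (fun x y => g x y + h x y) a b := fun x y z hx hxy hyz hz =>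
  (add_le_add (hg x y z hx hxy hyz hz) (hh x y z hx hxy hyz hz)).trans_eq (by ring)

theorem SubaddOn.mono {g : ℝ → ℝ → ℝ≥0∞} {a b c d : ℝ} (hg : SubaddOn g a b) (hac : a ≤ c)
    (hdb : d ≤ b) : SubaddOn g c d := fun x y z hx hxy hyz hz =>
  hg x y z (hac.trans hx) hxy hyz (hz.trans hdb)

theorem SubaddOn.le_sum {g : ℝ → ℝ → ℝ≥0∞} {M : ℕ} {r : ℕ → ℝ} (hM : 0 < M)
    (hr : ∀ i < M, r i < r (i + 1)) (hg : SubaddOn g (r 0) (r M)) :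
    g (r 0) (r M) ≤ ∑ i ∈ Finset.range M, g (r i) (r (i + 1)) := by
  have key : ∀ k, 1 ≤ k → k ≤ M → g (r 0) (r k) ≤ ∑ i ∈ Finset.range k, g (r i) (r (i + 1)) := by
    intro k hk
    induction k, hk using Nat.le_induction with
    | base => intro _; simp
    | succ k hk ih =>
      intro hkM
      rw [Finset.sum_range_succ]
      have h2 : r 0 < r k := (hr 0 hM).trans_le (partition_le hr (by omega) (by omega))
      exact (hg _ _ _ le_rfl h2 (hr k (by omega)) (partition_le hr hkM le_rfl)).trans
        (add_le_add (ih (by omega)) le_rfl)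
  exact key M hM le_rfl

/-- The two suprema may be approached along different partitions. Subadditivity lets both be
replaced by refinements: on each cell of a partition for `g`, refining for `h` does not lower the
`g`-sum, which is `local_le`. -/
theorem ivar_add {g h : ℝ → ℝ → ℝ≥0∞} {a b : ℝ} (hg : SubaddOn g a b) (hh : SubaddOn h a b) :
    ivar (fun x y => g x y + h x y) a b = ivar g a b + ivar h a b := by
  rcases lt_trichotomy a b with hab | rfl | hab
  swap; · simp [ivar_self]
  swap; · simp [ivar_of_lt _ hab]
  refine le_antisymm ?_ ?_
  · refine ivar_le_of_superaddOn (h := fun x y => ivar g x y + ivar h x y) hab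
      (fun x y _ hxy _ => add_le_add (le_ivar g hxy) (le_ivar h hxy)) ?_
    intro x y z _ hxy hyz _
    exact (le_of_eq (by ring)).trans
      (add_le_add (ivar_superadd g hxy.le hyz.le) (ivar_superadd h hxy.le hyz.le))
  · have local_le : ∀ x y, a ≤ x → x < y → y ≤ b →
        g x y + ivar h x y ≤ ivar (fun x y => g x y + h x y) x y := by
      intro x y hx hxy hy
      have := nonempty_partitions hxy.le
      rw [ivar_eq_iSup h, ENNReal.add_iSup]
      refine iSup_le ?_
      rintro ⟨⟨M, r⟩, hr, rfl, rfl⟩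
      have hM : 0 < M := by
        rcases Nat.eq_zero_or_pos M with rfl | h
        · exact absurd hxy (lt_irrefl _)
        · exact h
      refine le_trans ?_ (sum_le_ivar _ hr)
      rw [Finset.sum_add_distrib]
      exact add_le_add (SubaddOn.le_sum hM hr (hg.mono hx hy)) le_rfl
    have := nonempty_partitions hab.le
    rw [ivar_eq_iSup g, ENNReal.iSup_add]
    refine iSup_le ?_
    rintro ⟨⟨M, r⟩, hr, rfl, rfl⟩
    have hadd : ∀ k, k ≤ M → ivar h (r 0) (r k) ≤
        ∑ i ∈ Finset.range k, ivar h (r i) (r (i + 1)) := by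
      intro k
      induction k with
      | zero => intro _; simp [ivar_self]
      | succ k ih =>
        intro hk
        rw [Finset.sum_range_succ, ← ivar_add_of_subaddOn (partition_le hr (Nat.zero_le k)
          (by omega)) (hr k (by omega)).le (hh.mono le_rfl (partition_le hr hk le_rfl))]
        exact add_le_add (ih (by omega)) le_rfl
    have hsup : ∀ k, k ≤ M → ∑ i ∈ Finset.range k, ivar (fun x y => g x y + h x y) (r i) (r (i + 1))
        ≤ ivar (fun x y => g x y + h x y) (r 0) (r k) := by
      intro k
      induction k with
      | zero => intro _; simp
      | succ k ih =>
        intro hk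
        rw [Finset.sum_range_succ]
        exact (add_le_add (ih (by omega)) le_rfl).trans (ivar_superadd _
          (partition_le hr (Nat.zero_le k) (by omega)) (hr k (by omega)).le)
    refine (add_le_add le_rfl (hadd M le_rfl)).trans (le_trans ?_ (hsup M le_rfl))
    rw [← Finset.sum_add_distrib]
    refine Finset.sum_le_sum fun i hi => ?_
    have hi := Finset.mem_range.1 hi
    exact local_le _ _ (partition_le hr (Nat.zero_le i) hi.le) (hr i hi) (partition_le hr hi le_rfl)

/-- No continuity of `φ` is assumed, so the estimate applies to sections of a monotone map, which
jump over flat pieces. -/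
theorem ivar_comp_le {g g' : ℝ → ℝ → ℝ≥0∞} {φ : ℝ → ℝ} {a b : ℝ} (hab : a ≤ b)
    (hφ : MonotoneOn φ (Icc a b))
    (hg : ∀ x y, a ≤ x → x < y → y ≤ b → g' x y ≤ ivar g (φ x) (φ y)) :
    ivar g' a b ≤ ivar g (φ a) (φ b) := by
  rcases hab.eq_or_lt with rfl | hab
  · simp [ivar_self]
  refine ivar_le_of_superaddOn (h := fun x y => ivar g (φ x) (φ y)) hab hg ?_
  intro x y z hx hxy hyz hz
  exact ivar_superadd g (hφ ⟨hx, by linarith⟩ ⟨by linarith, by linarith⟩ hxy.le)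
    (hφ ⟨by linarith, by linarith⟩ ⟨by linarith, hz⟩ hyz.le)

/-- A superadditive interval function dominates the sum of its atoms. -/
theorem add_tsum_jumps_le {H : ℝ → ℝ → ℝ≥0∞} {L R : ℝ → ℝ≥0∞} {a b : ℝ} (hab : a < b)
    (hH : SuperaddOn H a b) (hLR : ∀ x y, a ≤ x → x < y → y ≤ b → R x + L y ≤ H x y) :
    R a + L b + ∑' t : ↥(Ioo a b), (L t + R t) ≤ H a b := by
  -- Induction on the largest atom `m`: cut the interval at `m`, so that `L m` is charged to the
  -- left piece and `R m` to the right piece.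
  have key : ∀ K : Finset ℝ, ∀ c, a < c → c ≤ b → (∀ t ∈ K, t ∈ Ioo a c) →
      R a + L c + ∑ t ∈ K, (L t + R t) ≤ H a c := by
    intro K
    induction K using Finset.induction_on_max with
    | empty => intro c hac hcb _; simpa using hLR a c le_rfl hac hcb
    | insert m K hm ih =>
      intro c hac hcb hK
      have hmem := hK m (Finset.mem_insert_self _ _)
      rw [Finset.sum_insert (fun h => lt_irrefl _ (hm m h))]
      have h1 := ih m hmem.1 (hmem.2.le.trans hcb) fun t ht =>
        ⟨(hK t (Finset.mem_insert_of_mem ht)).1, hm t ht⟩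
      have h2 := hLR m c hmem.1.le hmem.2 hcb
      calc _ = (R a + L m + ∑ t ∈ K, (L t + R t)) + (R m + L c) := by ring
        _ ≤ H a m + H m c := add_le_add h1 h2
        _ ≤ H a c := hH _ _ _ le_rfl hmem.1 hmem.2 hcb
  rw [ENNReal.tsum_eq_iSup_sum, ENNReal.add_iSup]
  refine iSup_le fun K => ?_
  have := key (K.map (Function.Embedding.subtype _)) b hab le_rfl (by
    intro t ht
    obtain ⟨x, -, rfl⟩ := Finset.mem_map.1 ht
    exact x.2)
  simpa [Finset.sum_map] using this

namespace RateIndependentSystem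

variable {V : Type*} [NormedAddCommGroup V] [NormedSpace ℝ V] {S : RateIndependentSystem V}

/-! ### The dissipation potential -/

theorem Standing.Psi_zero (hS : S.Standing) : S.Psi 0 = 0 := by
  simpa using hS.Psi_smul 0 0 le_rfl

theorem Standing.Psi_add_le (hS : S.Standing) (v w : V) : S.Psi (v + w) ≤ S.Psi v + S.Psi w := by
  have h := hS.Psi_convex.2 (mem_univ v) (mem_univ w) (show (0 : ℝ) ≤ 1 / 2 by norm_num)
    (show (0 : ℝ) ≤ 1 / 2 by norm_num) (by norm_num)
  rw [← smul_add, hS.Psi_smul _ _ (by norm_num), smul_eq_mul, smul_eq_mul] at h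
  linarith

theorem Standing.Psi_triangle (hS : S.Standing) (x y z : V) :
    S.Psi (z - x) ≤ S.Psi (y - x) + S.Psi (z - y) := by
  have := hS.Psi_add_le (y - x) (z - y)
  rwa [show y - x + (z - y) = z - x by abel] at this

theorem Standing.eq_of_Psi_sub (hS : S.Standing) {x y : V} (h : S.Psi (y - x) ≤ 0) : x = y := by
  by_contra hne
  exact absurd (hS.Psi_pos _ (sub_ne_zero.2 (Ne.symm hne))) (not_lt.2 h)

/-- Continuity at 0 bounds Ψ by 1 on a ball of radius `δ`. Rescaling a vector to norm `δ / 2` and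
positive homogeneity give the constant `2 / δ`. -/
theorem Standing.exists_Psi_le (hS : S.Standing) : ∃ C > 0, ∀ v, S.Psi v ≤ C * ‖v‖ := by
  have h := hS.Psi_continuous.tendsto 0
  rw [hS.Psi_zero] at h
  obtain ⟨δ, hδ, H⟩ := Metric.eventually_nhds_iff.1 (h.eventually (gt_mem_nhds one_pos))
  refine ⟨2 / δ, by positivity, fun v => ?_⟩
  rcases eq_or_ne v 0 with rfl | hv
  · simp [hS.Psi_zero]
  have hn : 0 < ‖v‖ := norm_pos_iff.2 hv
  have h1 : S.Psi ((δ / (2 * ‖v‖)) • v) < 1 := by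
    apply H
    rw [dist_zero_right, norm_smul, Real.norm_of_nonneg (by positivity)]
    field_simp
    linarith
  rw [hS.Psi_smul _ _ (by positivity)] at h1
  have : S.Psi v = (2 * ‖v‖ / δ) * (δ / (2 * ‖v‖) * S.Psi v) := by field_simp
  rw [this]
  calc (2 * ‖v‖ / δ) * (δ / (2 * ‖v‖) * S.Psi v) ≤ (2 * ‖v‖ / δ) * 1 := by gcongr
    _ = 2 / δ * ‖v‖ := by ring

theorem Standing.PsiMin_nonneg (hS : S.Standing) (v : V) : 0 ≤ S.PsiMin v :=
  le_min (hS.Psi_nonneg _) (hS.Psi_nonneg _)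

theorem PsiMin_le (v : V) : S.PsiMin v ≤ S.Psi v := min_le_left _ _

theorem Standing.PsiMin_continuous (hS : S.Standing) : Continuous S.PsiMin :=
  hS.Psi_continuous.min (hS.Psi_continuous.comp continuous_neg)

/-- On a sublevel, smallness of `Ψ` controls the norm. -/
theorem Standing.exists_modulus (hS : S.Standing) {E : ℝ} (hE : 0 < E) {ε : ℝ} (hε : 0 < ε) :
    ∃ δ > 0, ∀ x ∈ S.sublevel E, ∀ y ∈ S.sublevel E, S.Psi (y - x) < δ → ‖y - x‖ < ε := by
  have hc := hS.sublevel_compact E hE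
  -- Pairs at distance at least `ε` form a compact set off the diagonal, where Ψ of the difference
  -- attains a positive minimum; this minimum is `δ`.
  have hK : IsCompact ((S.sublevel E ×ˢ S.sublevel E) ∩ {p : V × V | ε ≤ ‖p.2 - p.1‖}) :=
    (hc.prod hc).inter_right (isClosed_le continuous_const (by fun_prop))
  rcases Set.eq_empty_or_nonempty
    ((S.sublevel E ×ˢ S.sublevel E) ∩ {p : V × V | ε ≤ ‖p.2 - p.1‖}) with h | h
  · refine ⟨1, one_pos, fun x hx y hy _ => ?_⟩
    by_contra hlt
    have : (x, y) ∈ (∅ : Set (V × V)) := h ▸ ⟨⟨hx, hy⟩, not_lt.1 hlt⟩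
    exact this
  · obtain ⟨p, hp, hmin⟩ := hK.exists_isMinOn h (f := fun p : V × V => S.Psi (p.2 - p.1))
      (hS.Psi_continuous.comp (by fun_prop)).continuousOn
    refine ⟨S.Psi (p.2 - p.1), hS.Psi_pos _ ?_, fun x hx y hy hxy => ?_⟩
    · intro h0
      have := hp.2
      simp only [mem_ofPred_eq, h0, norm_zero] at this
      linarith
    · by_contra hlt
      exact absurd (hmin (show (x, y) ∈ _ from ⟨⟨hx, hy⟩, not_lt.1 hlt⟩)) (not_le.2 hxy)

/-! ### Energies and sublevels -/

theorem sublevel_mono {E E' : ℝ} (h : E ≤ E') : S.sublevel E ⊆ S.sublevel E' :=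
  fun _ hu => ⟨hu.1, fun t ht => (hu.2 t ht).trans h⟩

theorem Standing.sublevel_closed (hS : S.Standing) {E : ℝ} (hE : 0 < E) :
    IsClosed (S.sublevel E) := (hS.sublevel_compact E hE).isClosed

theorem Standing.energy_continuousOn (hS : S.Standing) {u : V} (hu : u ∈ S.D) :
    ContinuousOn (fun t => S.energy t u) (Icc 0 S.T) := (hS.energy_diff u hu).continuousOn

theorem Standing.hasDerivAt_energy (hS : S.Standing) {u : V} (hu : u ∈ S.D) {t : ℝ}
    (ht : t ∈ Ioo 0 S.T) : HasDerivAt (fun r => S.energy r u) (S.power t u) t := by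
  have h := (hS.energy_diff u hu t (Ioo_subset_Icc_self ht)).hasDerivWithinAt
  exact h.hasDerivAt (Icc_mem_nhds ht.1 ht.2)

/-- Gronwall: the power bound makes exp(-Cr)(Ψ + ℰ_r) nonincreasing and exp(Cr)(Ψ + ℰ_r)
nondecreasing in r. The bound on the open interval suffices because the energy is continuous in time
up to the end points. -/
theorem Standing.exists_energy_le_exp (hS : S.Standing) : ∃ C, 0 ≤ C ∧ ∀ u ∈ S.D,
    ∀ s ∈ Icc 0 S.T, ∀ t ∈ Icc 0 S.T,
      S.Psi u + S.energy t u ≤ Real.exp (C * |t - s|) * (S.Psi u + S.energy s u) := by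
  obtain ⟨C, hC, hP⟩ := hS.power_bound
  refine ⟨C, hC, fun u hu s hs t ht => ?_⟩
  have hcont := hS.energy_continuousOn hu
  have hder : ∀ c : ℝ, ∀ r ∈ Ioo 0 S.T,
      HasDerivAt (fun r => Real.exp (c * r) * (S.Psi u + S.energy r u))
        (Real.exp (c * r) * c * (S.Psi u + S.energy r u) + Real.exp (c * r) * S.power r u) r := by
    intro c r hr
    have h1 : HasDerivAt (fun r => Real.exp (c * r)) (Real.exp (c * r) * c) r := by
      simpa using ((hasDerivAt_id r).const_mul c).exp
    exact h1.mul ((hS.hasDerivAt_energy hu hr).const_add _)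
  have hco : ∀ c : ℝ, ContinuousOn
      (fun r => Real.exp (c * r) * (S.Psi u + S.energy r u)) (Icc 0 S.T) := fun c =>
    ContinuousOn.mul (by fun_prop) (continuousOn_const.add hcont)
  rcases le_total s t with hst | hst
  · have hanti : AntitoneOn (fun r => Real.exp (-C * r) * (S.Psi u + S.energy r u))
        (Icc 0 S.T) := by
      refine antitoneOn_of_deriv_nonpos (convex_Icc _ _) (hco _) ?_ ?_
      · rw [interior_Icc]
        exact fun r hr => (hder _ r hr).differentiableAt.differentiableWithinAt
      · rw [interior_Icc]
        intro r hr
        rw [(hder _ r hr).deriv]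
        have h1 := (abs_le.1 (hP r hr u hu)).2
        have := Real.exp_pos (-C * r)
        nlinarith
    have := hanti hs ht hst
    dsimp only at this
    rw [abs_of_nonneg (by linarith), mul_sub, Real.exp_sub]
    rw [neg_mul, neg_mul, Real.exp_neg, Real.exp_neg] at this
    have e1 := Real.exp_pos (C * t)
    have e2 := Real.exp_pos (C * s)
    rw [inv_mul_le_iff₀ e1] at this
    refine this.trans (le_of_eq ?_)
    field_simp
  · have hmono : MonotoneOn (fun r => Real.exp (C * r) * (S.Psi u + S.energy r u))
        (Icc 0 S.T) := by
      refine monotoneOn_of_deriv_nonneg (convex_Icc _ _) (hco _) ?_ ?_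
      · rw [interior_Icc]
        exact fun r hr => (hder _ r hr).differentiableAt.differentiableWithinAt
      · rw [interior_Icc]
        intro r hr
        rw [(hder _ r hr).deriv]
        have h1 := (abs_le.1 (hP r hr u hu)).1
        have := Real.exp_pos (C * r)
        nlinarith
    have := hmono ht hs hst
    dsimp only at this
    rw [abs_of_nonpos (by linarith), neg_sub, mul_sub, Real.exp_sub]
    have e1 := Real.exp_pos (C * t)
    rw [← le_div_iff₀' e1] at this
    refine this.trans (le_of_eq ?_)
    field_simp

/-- A bound of the energy at one time gives membership in a sublevel. -/
theorem Standing.exists_mem_sublevel (hS : S.Standing) : ∃ κ > 0, ∀ u ∈ S.D, ∀ t ∈ Icc 0 S.T,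
    ∀ M, 0 ≤ M → S.Psi u + S.energy t u ≤ M → u ∈ S.sublevel (κ * M) := by
  obtain ⟨C, hC, H⟩ := hS.exists_energy_le_exp
  refine ⟨Real.exp (C * S.T), Real.exp_pos _, fun u hu t ht M hM hle => ⟨hu, fun s hs => ?_⟩⟩
  refine (H u hu t ht s hs).trans ?_
  have : |s - t| ≤ S.T := abs_le.2 ⟨by linarith [hs.1, ht.2], by linarith [hs.2, ht.1]⟩
  calc _ ≤ Real.exp (C * |s - t|) * M := by gcongr
    _ ≤ Real.exp (C * S.T) * M := by gcongr

/-! ### The subdifferential and the slope -/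

/-- A converse to uniform subdifferentiability: the inequality with remainder `ω`, tested only
inside a large enough sublevel, already yields a Fréchet subgradient. Points near `u` with moderate
energy lie in that sublevel, where upper semicontinuity makes `ω` small. Points of high energy
satisfy the subgradient inequality trivially. -/
theorem Standing.mem_subdiff_of_le (hS : S.Standing) {t : ℝ} (ht : t ∈ Icc 0 S.T) {u : V}
    (hu : u ∈ S.D) : ∃ E₀ > 0, ∀ E, E₀ ≤ E → ∀ ω : ℝ → V → V → ℝ,
      UpperSemicontinuousOn (fun p : ℝ × V × V => ω p.1 p.2.1 p.2.2)
        (Icc 0 S.T ×ˢ S.sublevel E ×ˢ S.sublevel E) →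
      u ∈ S.sublevel E → ω t u u = 0 → ∀ ξ : V →L[ℝ] ℝ,
      (∀ v ∈ S.sublevel E,
        S.energy t v ≥ S.energy t u + ξ (v - u) - ω t u v * S.PsiMin (v - u)) →
      ξ ∈ S.subdiff t u := by
  obtain ⟨κ, hκ, H⟩ := hS.exists_mem_sublevel
  obtain ⟨C, hC, hPsi⟩ := hS.exists_Psi_le
  -- The summand 2 allows Ψ and the energy to exceed their values at `u` by 1 each; the last 1 only
  -- makes the constant positive.
  refine ⟨κ * (|S.Psi u + S.energy t u + 2| + 1), by positivity, ?_⟩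
  intro E hE ω hω huE hω0 ξ hξ
  refine ⟨hu, fun ε hε => ?_⟩
  have h1 : ∀ᶠ v in 𝓝 u, ξ (v - u) < 1 := by
    have : Tendsto (fun v => ξ (v - u)) (𝓝 u) (𝓝 (ξ (u - u))) :=
      (Continuous.tendsto (by fun_prop) u)
    rw [sub_self, map_zero] at this
    exact this.eventually (gt_mem_nhds one_pos)
  have h2 : ∀ᶠ v in 𝓝 u, S.Psi v < S.Psi u + 1 :=
    (hS.Psi_continuous.tendsto u).eventually (gt_mem_nhds (by linarith))
  have h3 : ∀ᶠ v in 𝓝 u, v ∈ S.sublevel E → ω t u v < ε / C := by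
    have h := hω (t, u, u) ⟨ht, huE, huE⟩ (ε / C) (by simp only [hω0]; positivity)
    have hc : Tendsto (fun v => (t, u, v)) (𝓝[S.sublevel E] u)
        (𝓝[Icc 0 S.T ×ˢ S.sublevel E ×ˢ S.sublevel E] (t, u, u)) := by
      refine tendsto_nhdsWithin_iff.2 ⟨?_, ?_⟩
      · exact ((Continuous.tendsto (by fun_prop : Continuous fun v : V => (t, u, v)) u)).mono_left
          nhdsWithin_le_nhds
      · filter_upwards [self_mem_nhdsWithin] with v hv using ⟨ht, huE, hv⟩
    exact eventually_nhdsWithin_iff.1 (hc.eventually h)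
  refine eventually_nhdsWithin_iff.2 ?_
  filter_upwards [h1, h2, h3] with v hv1 hv2 hv3 hvD
  by_cases hle : S.energy t v ≤ S.energy t u + 1
  · have hvE : v ∈ S.sublevel E := by
      refine sublevel_mono hE (H v hvD t ht _ (by positivity) ?_)
      have := le_abs_self (S.Psi u + S.energy t u + 2)
      linarith
    have := hξ v hvE
    have h4 : ω t u v * S.PsiMin (v - u) ≤ ε * ‖v - u‖ := by
      calc ω t u v * S.PsiMin (v - u) ≤ ε / C * S.PsiMin (v - u) :=
            mul_le_mul_of_nonneg_right (hv3 hvE).le (hS.PsiMin_nonneg _)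
        _ ≤ ε / C * (C * ‖v - u‖) := by
            gcongr
            exact (PsiMin_le _).trans (hPsi _)
        _ = ε * ‖v - u‖ := by field_simp
    linarith
  -- Here the energy rises by more than 1, while `ξ (v - u) < 1`.
  · have : 0 ≤ ε * ‖v - u‖ := by positivity
    linarith

/-- Bounded families of functionals have weak-star limits along ultrafilters. -/
theorem exists_weak_limit {ι : Type*} (l : Ultrafilter ι) (ξ : ι → V →L[ℝ] ℝ) {M : ℝ}
    (h : ∀ᶠ i in (l : Filter ι), ‖ξ i‖ ≤ M) :
    ∃ ξ₀ : V →L[ℝ] ℝ, ∀ w, Tendsto (fun i => ξ i w) l (𝓝 (ξ₀ w)) := by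
  have hc := WeakDual.isCompact_closedBall (𝕜 := ℝ) (E := V) 0 M
  obtain ⟨x, -, hx⟩ := hc.ultrafilter_le_nhds (l.map fun i => StrongDual.toWeakDual (ξ i)) (by
    simp only [Ultrafilter.coe_map, le_principal_iff, mem_map]
    filter_upwards [h] with i hi
    simpa using hi)
  refine ⟨WeakDual.toStrongDual x, fun w => ?_⟩
  have := (WeakDual.eval_continuous w (𝕜 := ℝ)).tendsto x
  exact this.comp hx

theorem norm_le_of_mem_Kstar {C : ℝ} (hC : 0 < C)
    (hPsi : ∀ v, S.Psi v ≤ C * ‖v‖) {z : V →L[ℝ] ℝ} (hz : z ∈ S.Kstar) : ‖z‖ ≤ C := by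
  refine z.opNorm_le_bound hC.le fun w => abs_le.2 ⟨?_, (hz w).trans (hPsi w)⟩
  have := (hz (-w)).trans (hPsi (-w))
  rw [map_neg, norm_neg] at this
  linarith

/-- The functionals in `K*` are bounded, hence so are the subgradients at bounded distance from it,
and both have weak-star limits. In the inequality with remainder `ω` all limits go the right way:
the energy of the fixed test point is continuous in time, the energy of the moving base point is
lower semicontinuous on the smaller side, and `ω` is upper semicontinuous. Ultrafilters avoid any
extraction of subsequences. -/
theorem Standing.subdiff_closed (hS : S.Standing) {ι : Type*} (l : Ultrafilter ι) {E : ℝ}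
    (hE : 0 < E) {τ : ι → ℝ} {x : ι → V} {ξ z : ι → V →L[ℝ] ℝ} {c : ι → ℝ} {t c₀ : ℝ} {u : V}
    (hτ : ∀ᶠ i in (l : Filter ι), τ i ∈ Icc 0 S.T)
    (hx : ∀ᶠ i in (l : Filter ι), x i ∈ S.sublevel E)
    (hξ : ∀ᶠ i in (l : Filter ι), ξ i ∈ S.subdiff (τ i) (x i))
    (hz : ∀ᶠ i in (l : Filter ι), z i ∈ S.Kstar)
    (hc : ∀ᶠ i in (l : Filter ι), ‖-ξ i - z i‖ ≤ c i)
    (hτt : Tendsto τ l (𝓝 t)) (hxu : Tendsto x l (𝓝 u)) (hcc : Tendsto c l (𝓝 c₀)) :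
    ∃ ξ₀ ∈ S.subdiff t u, ∃ z₀ ∈ S.Kstar, ‖-ξ₀ - z₀‖ ≤ c₀ := by
  obtain ⟨C, hC, hPsi⟩ := hS.exists_Psi_le
  have ht : t ∈ Icc 0 S.T := isClosed_Icc.mem_of_tendsto hτt hτ
  have hu : u ∈ S.sublevel E := (hS.sublevel_closed hE).mem_of_tendsto hxu hx
  have hzb : ∀ᶠ i in (l : Filter ι), ‖z i‖ ≤ C := hz.mono fun i hi =>
    norm_le_of_mem_Kstar hC hPsi hi
  have hξb : ∀ᶠ i in (l : Filter ι), ‖ξ i‖ ≤ c₀ + 1 + C := by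
    filter_upwards [hzb, hc, hcc.eventually (gt_mem_nhds (show c₀ < c₀ + 1 by linarith))]
      with i h1 h2 h3
    calc ‖ξ i‖ = ‖-(-ξ i - z i) - z i‖ := by congr 1; abel
      _ ≤ ‖-ξ i - z i‖ + ‖z i‖ := (norm_sub_le _ _).trans_eq (by rw [norm_neg])
      _ ≤ c₀ + 1 + C := by linarith
  obtain ⟨ξ₀, hξ₀⟩ := exists_weak_limit l ξ hξb
  obtain ⟨z₀, hz₀⟩ := exists_weak_limit l z hzb
  refine ⟨ξ₀, ?_, z₀, ?_, ?_⟩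
  · obtain ⟨E₀, hE₀, H⟩ := hS.mem_subdiff_of_le ht hu.1
    set E' := max E E₀
    obtain ⟨ω, hω, hω0, hωe⟩ := hS.subdiff_unif E' (lt_max_of_lt_left hE)
    have huE' : u ∈ S.sublevel E' := sublevel_mono (le_max_left _ _) hu
    have hxE' := hx.mono fun i hi => sublevel_mono (le_max_left E E₀) hi
    refine H E' (le_max_right _ _) ω hω huE' (hω0 t ht u huE') ξ₀ fun v hv => ?_
    have hlim1 : Tendsto (fun i => S.energy (τ i) v) l (𝓝 (S.energy t v)) :=
      (hS.energy_continuousOn hv.1 t ht).tendsto.comp (tendsto_nhdsWithin_iff.2 ⟨hτt, hτ⟩)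
    -- Weak-star convergence is paired with a strongly convergent argument: the error `ξ i (u - x
    -- i)` vanishes because the norms of `ξ i` are bounded.
    have hlim2 : Tendsto (fun i => ξ i (v - x i)) l (𝓝 (ξ₀ (v - u))) := by
      have h0 : Tendsto (fun i => ξ i (u - x i)) l (𝓝 0) := by
        refine squeeze_zero_norm' (a := fun i => (c₀ + 1 + C) * ‖u - x i‖) ?_ ?_
        · filter_upwards [hξb] with i hi
          exact (ξ i).le_of_opNorm_le hi _
        · have : Tendsto (fun i => ‖u - x i‖) l (𝓝 ‖u - u‖) := (tendsto_const_nhds.sub hxu).norm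
          simpa using this.const_mul (c₀ + 1 + C)
      have := (hξ₀ (v - u)).add h0
      simp only [add_zero] at this
      refine this.congr fun i => ?_
      rw [← map_add]; congr 1; abel
    have hlim3 : Tendsto (fun i => S.PsiMin (v - x i)) l (𝓝 (S.PsiMin (v - u))) :=
      (hS.PsiMin_continuous.tendsto _).comp (tendsto_const_nhds.sub hxu)
    have htup : Tendsto (fun i => (τ i, x i, v)) l
        (𝓝[Icc 0 S.T ×ˢ S.sublevel E' ×ˢ S.sublevel E'] (t, u, v)) := by
      refine tendsto_nhdsWithin_iff.2 ⟨hτt.prodMk_nhds (hxu.prodMk_nhds tendsto_const_nhds), ?_⟩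
      filter_upwards [hτ, hxE'] with i h1 h2 using ⟨h1, h2, hv⟩
    have htup2 : Tendsto (fun i => (τ i, x i)) l (𝓝[Icc 0 S.T ×ˢ S.D] (t, u)) := by
      refine tendsto_nhdsWithin_iff.2 ⟨hτt.prodMk_nhds hxu, ?_⟩
      filter_upwards [hτ, hx] with i h1 h2 using ⟨h1, h2.1⟩
    refine le_of_forall_pos_le_add fun ε hε => ?_
    set P := S.PsiMin (v - u) with hP
    have hP0 : 0 ≤ P := hS.PsiMin_nonneg _
    set η := ε / (2 * (P + 1)) with hη
    have hηpos : 0 < η := by positivity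
    have hω' := htup.eventually (hω (t, u, v) ⟨ht, huE', hv⟩ (ω t u v + η)
      (by dsimp only; linarith))
    have hlsc := htup2.eventually (hS.energy_lsc (t, u) ⟨ht, hu.1⟩ (S.energy t u - ε / 2)
      (by dsimp only; linarith))
    have hev : ∀ᶠ i in (l : Filter ι), S.energy t u - ε / 2 + ξ i (v - x i) -
        (ω t u v + η) * S.PsiMin (v - x i) ≤ S.energy (τ i) v := by
      filter_upwards [hω', hlsc, hτ, hxE', hξ] with i h1 h2 h3 h4 h5
      have := hωe (τ i) h3 (x i) h4 v hv (ξ i) h5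
      have h6 := mul_le_mul_of_nonneg_right h1.le (hS.PsiMin_nonneg (v - x i))
      linarith
    have hL := le_of_tendsto_of_tendsto
      ((tendsto_const_nhds.add hlim2).sub (hlim3.const_mul _)) hlim1 hev
    have : η * P ≤ ε / 2 := by
      rw [hη, div_mul_eq_mul_div, div_le_div_iff₀ (by positivity) (by norm_num)]
      nlinarith
    linarith
  · exact fun w => le_of_tendsto (hz₀ w) (hz.mono fun i hi => hi w)
  · have hc0 : 0 ≤ c₀ := ge_of_tendsto hcc (hc.mono fun i hi => (norm_nonneg _).trans hi)
    refine ContinuousLinearMap.opNorm_le_bound _ hc0 fun w => ?_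
    have h1 : Tendsto (fun i => ‖(-ξ i - z i) w‖) l (𝓝 ‖(-ξ₀ - z₀) w‖) :=
      (((hξ₀ w).neg).sub (hz₀ w)).norm
    refine le_of_tendsto_of_tendsto h1 (hcc.mul_const ‖w‖) ?_
    filter_upwards [hc] with i hi
    exact (-ξ i - z i).le_of_opNorm_le hi w

theorem slope_le {t : ℝ} {u : V} {ξ z : V →L[ℝ] ℝ} (hξ : ξ ∈ S.subdiff t u) (hz : z ∈ S.Kstar) :
    S.slope t u ≤ ‖-ξ - z‖ₑ :=
  iInf₂_le_of_le (-ξ) (by simpa using hξ) (iInf₂_le z hz)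

theorem exists_of_slope_lt {t : ℝ} {u : V} {c : ℝ≥0∞} (h : S.slope t u < c) :
    ∃ ξ ∈ S.subdiff t u, ∃ z ∈ S.Kstar, ‖-ξ - z‖ₑ < c := by
  simp only [slope, iInf_lt_iff] at h
  obtain ⟨ξ, hξ, z, hz, hlt⟩ := h
  exact ⟨-ξ, hξ, z, hz, by simpa using hlt⟩

/-- Closedness of the graph applied to a minimizing sequence at a fixed point. Consequently zero
slope is the same as stability on sublevels. -/
theorem Standing.exists_slope_attained (hS : S.Standing) {E : ℝ} (hE : 0 < E) {t : ℝ}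
    (ht : t ∈ Icc 0 S.T) {u : V} (hu : u ∈ S.sublevel E) (h : S.slope t u ≠ ⊤) :
    ∃ ξ ∈ S.subdiff t u, ∃ z ∈ S.Kstar, ‖-ξ - z‖ ≤ (S.slope t u).toReal := by
  have : ∀ n : ℕ, ∃ ξ ∈ S.subdiff t u, ∃ z ∈ S.Kstar,
      ‖-ξ - z‖ ≤ (S.slope t u).toReal + 1 / ((n : ℝ) + 1) := by
    intro n
    have hpos : (0 : ℝ) < 1 / ((n : ℝ) + 1) := by positivity
    obtain ⟨ξ, hξ, z, hz, hlt⟩ := exists_of_slope_lt (S := S) (t := t) (u := u)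
      (c := ENNReal.ofReal ((S.slope t u).toReal + 1 / ((n : ℝ) + 1))) (by
        rw [ENNReal.lt_ofReal_iff_toReal_lt h]; linarith)
    refine ⟨ξ, hξ, z, hz, ?_⟩
    rw [← ofReal_norm, ENNReal.ofReal_lt_ofReal_iff (by positivity)] at hlt
    exact hlt.le
  choose ξ hξ z hz hn using this
  have hl := Nat.hyperfilter_le_atTop
  refine hS.subdiff_closed (Filter.hyperfilter ℕ) hE (τ := fun _ => t) (x := fun _ => u)
    (ξ := ξ) (z := z) (c := fun n : ℕ => (S.slope t u).toReal + 1 / ((n : ℝ) + 1))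
    (Eventually.of_forall fun _ => ht) (Eventually.of_forall fun _ => hu)
    (Eventually.of_forall hξ) (Eventually.of_forall hz) (Eventually.of_forall hn)
    tendsto_const_nhds tendsto_const_nhds ?_
  have := (tendsto_one_div_add_atTop_nhds_zero_nat (𝕜 := ℝ)).const_add (S.slope t u).toReal
  rw [add_zero] at this
  exact this.mono_left hl

theorem slope_eq_zero_of_isStableAt {t : ℝ} {u : V} (h : S.IsStableAt t u) : S.slope t u = 0 := by
  obtain ⟨z, hz, ξ, hξ, h0⟩ := Set.mem_add.1 h
  refine le_antisymm ((slope_le hξ hz).trans ?_) zero_le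
  rw [show -ξ - z = -(z + ξ) by abel, h0, neg_zero, ← ofReal_norm, norm_zero, ENNReal.ofReal_zero]

theorem Standing.isStableAt_of_slope_eq_zero (hS : S.Standing) {E : ℝ} (hE : 0 < E) {t : ℝ}
    (ht : t ∈ Icc 0 S.T) {u : V} (hu : u ∈ S.sublevel E) (h : S.slope t u = 0) :
    S.IsStableAt t u := by
  obtain ⟨ξ, hξ, z, hz, hn⟩ := hS.exists_slope_attained hE ht hu (by simp [h])
  rw [h, ENNReal.toReal_zero] at hn
  have h0 : -ξ - z = 0 := norm_le_zero_iff.1 hn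
  refine Set.mem_add.2 ⟨z, hz, ξ, hξ, ?_⟩
  rw [← neg_eq_zero, ← h0]; abel

/-- If values at most `y` persisted near `p₀`, subgradients with distance below an intermediate `y'`
would have a limit realizing a distance at most `y'` at `p₀`, contradicting `y' < 𝔢(p₀)`. -/
theorem Standing.slope_lsc (hS : S.Standing) {E : ℝ} (hE : 0 < E) :
    LowerSemicontinuousOn (fun p : ℝ × V => S.slope p.1 p.2) (Icc 0 S.T ×ˢ S.sublevel E) := by
  intro p₀ hp₀ y hy
  by_contra hcon
  have hfreq : ∃ᶠ p in 𝓝[Icc 0 S.T ×ˢ S.sublevel E] p₀, S.slope p.1 p.2 ≤ y := by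
    intro h
    exact hcon (h.mono fun p hp => not_le.1 hp)
  obtain ⟨y', hy1, hy2⟩ := exists_between hy
  have hy'top : y' ≠ ⊤ := ne_top_of_lt hy2
  have hne : NeBot (𝓝[Icc 0 S.T ×ˢ S.sublevel E] p₀ ⊓ 𝓟 {p | S.slope p.1 p.2 ≤ y}) :=
    frequently_mem_iff_neBot.1 hfreq
  let l := Ultrafilter.of (𝓝[Icc 0 S.T ×ˢ S.sublevel E] p₀ ⊓ 𝓟 {p | S.slope p.1 p.2 ≤ y})
  have hl : (l : Filter (ℝ × V)) ≤ _ := Ultrafilter.of_le _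
  have hl1 : (l : Filter (ℝ × V)) ≤ 𝓝[Icc 0 S.T ×ˢ S.sublevel E] p₀ := hl.trans inf_le_left
  have hl2 : ∀ᶠ p in (l : Filter (ℝ × V)), S.slope p.1 p.2 ≤ y :=
    (hl.trans inf_le_right) (mem_principal_self _)
  have hmem : ∀ᶠ p in (l : Filter (ℝ × V)), p ∈ Icc 0 S.T ×ˢ S.sublevel E :=
    hl1 self_mem_nhdsWithin
  have hlim : Tendsto id (l : Filter (ℝ × V)) (𝓝 p₀) := hl1.trans nhdsWithin_le_nhds
  have hex : ∀ p : ℝ × V, ∃ q : (V →L[ℝ] ℝ) × (V →L[ℝ] ℝ), S.slope p.1 p.2 ≤ y →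
      q.1 ∈ S.subdiff p.1 p.2 ∧ q.2 ∈ S.Kstar ∧ ‖-q.1 - q.2‖ ≤ y'.toReal := by
    intro p
    by_cases hp : S.slope p.1 p.2 ≤ y
    · obtain ⟨ξ, hξ, z, hz, hlt⟩ := exists_of_slope_lt (hp.trans_lt hy1)
      refine ⟨(ξ, z), fun _ => ⟨hξ, hz, ?_⟩⟩
      rw [← toReal_enorm]
      exact ENNReal.toReal_mono hy'top hlt.le
    · exact ⟨0, fun h => absurd h hp⟩
  choose q hq using hex
  obtain ⟨ξ₀, hξ₀, z₀, hz₀, hn⟩ := hS.subdiff_closed l hE (τ := Prod.fst) (x := Prod.snd)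
    (ξ := fun p => (q p).1) (z := fun p => (q p).2) (c := fun _ => y'.toReal) (t := p₀.1)
    (u := p₀.2) (hmem.mono fun p hp => hp.1) (hmem.mono fun p hp => hp.2)
    (hl2.mono fun p hp => (hq p hp).1) (hl2.mono fun p hp => (hq p hp).2.1)
    (hl2.mono fun p hp => (hq p hp).2.2)
    ((continuous_fst.tendsto p₀).comp hlim) ((continuous_snd.tendsto p₀).comp hlim)
    tendsto_const_nhds
  refine absurd (slope_le hξ₀ hz₀) (not_le.2 (lt_of_le_of_lt ?_ hy2))
  rw [← ofReal_norm, ← ENNReal.ofReal_toReal hy'top]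
  exact ENNReal.ofReal_le_ofReal hn

/-- The basic energy inequality: the energy cannot drop faster than the slopes allow. -/
theorem Standing.exists_energy_sub_le (hS : S.Standing) {E : ℝ} (hE : 0 < E) {ε : ℝ}
    (hε : 0 < ε) : ∃ δ > 0, ∀ t ∈ Icc 0 S.T, ∀ x ∈ S.sublevel E, ∀ y ∈ S.sublevel E,
      ‖y - x‖ < δ → S.slope t x ≠ ⊤ → S.energy t x - S.energy t y ≤
        (1 + ε) * S.Psi (y - x) + (S.slope t x).toReal * ‖y - x‖ := by
  obtain ⟨ω, hω, hω0, hωe⟩ := hS.subdiff_unif E hE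
  have hc := hS.sublevel_compact E hE
  -- The set `{ω ≥ ε}` is compact by upper semicontinuity and misses the diagonal, where `ω`
  -- vanishes; `δ` is its distance from the diagonal.
  have hδ : ∃ δ > 0, ∀ t ∈ Icc 0 S.T, ∀ x ∈ S.sublevel E, ∀ y ∈ S.sublevel E,
      ‖y - x‖ < δ → ω t x y < ε := by
    have hK := hω.isCompact_inter_preimage_Ici ((isCompact_Icc (a := 0) (b := S.T)).prod
      (hc.prod hc)) ε
    rcases Set.eq_empty_or_nonempty ((Icc 0 S.T ×ˢ S.sublevel E ×ˢ S.sublevel E) ∩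
      (fun p : ℝ × V × V => ω p.1 p.2.1 p.2.2) ⁻¹' Ici ε) with h | h
    · refine ⟨1, one_pos, fun t ht x hx y hy _ => ?_⟩
      by_contra hlt
      have : (t, x, y) ∈ (∅ : Set (ℝ × V × V)) := h ▸ ⟨⟨ht, hx, hy⟩, not_lt.1 hlt⟩
      exact this
    · obtain ⟨p, hp, hmin⟩ := hK.exists_isMinOn h (f := fun p : ℝ × V × V => ‖p.2.2 - p.2.1‖)
        (by fun_prop)
      refine ⟨‖p.2.2 - p.2.1‖, norm_pos_iff.2 fun h0 => ?_, fun t ht x hx y hy hxy => ?_⟩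
      · have h1 := hp.2
        simp only [mem_preimage, mem_Ici, sub_eq_zero.1 h0] at h1
        rw [hω0 _ hp.1.1 _ hp.1.2.1] at h1
        linarith
      · by_contra hlt
        exact absurd (hmin (show (t, x, y) ∈ _ from ⟨⟨ht, hx, hy⟩, not_lt.1 hlt⟩)) (not_le.2 hxy)
  obtain ⟨δ, hδ, H⟩ := hδ
  refine ⟨δ, hδ, fun t ht x hx y hy hxy htop => ?_⟩
  obtain ⟨ξ, hξ, z, hz, hn⟩ := hS.exists_slope_attained hE ht hx htop
  have h1 := hωe t ht x hx y hy ξ hξ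
  have h2 : ω t x y * S.PsiMin (y - x) ≤ ε * S.Psi (y - x) :=
    (mul_le_mul_of_nonneg_right (H t ht x hx y hy hxy).le (hS.PsiMin_nonneg _)).trans
      (mul_le_mul_of_nonneg_left (PsiMin_le _) hε.le)
  have h3 : (-ξ - z) (y - x) ≤ (S.slope t x).toReal * ‖y - x‖ :=
    (le_abs_self _).trans ((-ξ - z).le_of_opNorm_le hn _)
  have h4 := hz (y - x)
  rw [sub_apply, neg_apply] at h3
  linarith

end RateIndependentSystem

/-! ### Derivatives of monotone and absolutely continuous functions -/

theorem MonotoneOn.ae_differentiableAt_Icc {f : ℝ → ℝ} {a b : ℝ} (hf : MonotoneOn f (Icc a b)) :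
    ∀ᵐ x ∂volume.restrict (Icc a b), x ∈ Ioo a b ∧ DifferentiableAt ℝ f x := by
  rw [← restrict_Ioo_eq_restrict_Icc, ae_restrict_iff' measurableSet_Ioo]
  filter_upwards [hf.ae_differentiableWithinAt_of_mem] with x hx hxab
  exact ⟨hxab, (hx (Ioo_subset_Icc_self hxab)).differentiableAt (Icc_mem_nhds hxab.1 hxab.2)⟩

theorem MonotoneOn.deriv_nonneg_of_mem_Ioo {f : ℝ → ℝ} {a b x : ℝ} (hf : MonotoneOn f (Icc a b))
    (hx : x ∈ Ioo a b) : 0 ≤ deriv f x := by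
  rw [← derivWithin_of_mem_nhds (Icc_mem_nhds hx.1 hx.2)]
  exact hf.derivWithin_nonneg

theorem MonotoneOn.ae_deriv_nonneg {f : ℝ → ℝ} {a b : ℝ} (hf : MonotoneOn f (Icc a b)) :
    0 ≤ᵐ[volume.restrict (Icc a b)] deriv f := by
  rw [← restrict_Ioo_eq_restrict_Icc, EventuallyLE, ae_restrict_iff' measurableSet_Ioo]
  exact Eventually.of_forall fun x hx => hf.deriv_nonneg_of_mem_Ioo hx

theorem MonotoneOn.integrableOn_deriv_Icc {f : ℝ → ℝ} {a b : ℝ} (hab : a ≤ b)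
    (hf : MonotoneOn f (Icc a b)) : IntegrableOn (deriv f) (Icc a b) := by
  rw [← uIcc_of_le hab] at hf
  exact (intervalIntegrable_iff_integrableOn_Icc_of_le hab).1 hf.intervalIntegrable_deriv

theorem MonotoneOn.lintegral_deriv_le {f : ℝ → ℝ} {a b : ℝ} (hab : a ≤ b)
    (hf : MonotoneOn f (Icc a b)) :
    ∫⁻ x in Icc a b, ENNReal.ofReal (deriv f x) ≤ ENNReal.ofReal (f b - f a) := by
  rw [← ofReal_integral_eq_lintegral_ofReal (hf.integrableOn_deriv_Icc hab) hf.ae_deriv_nonneg]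
  apply ENNReal.ofReal_le_ofReal
  have h := (uIcc_of_le hab ▸ hf : MonotoneOn f (uIcc a b)).intervalIntegral_deriv_mem_uIcc
  rw [uIcc_of_le (by linarith [hf (left_mem_Icc.2 hab) (right_mem_Icc.2 hab) hab]),
    intervalIntegral.integral_of_le hab, ← integral_Icc_eq_integral_Ioc] at h
  exact h.2

theorem ofReal_integral_le_lintegral {α : Type*} [MeasurableSpace α] {μ : Measure α} {f : α → ℝ}
    (hf : Integrable f μ) : ENNReal.ofReal (∫ x, f x ∂μ) ≤ ∫⁻ x, ENNReal.ofReal (f x) ∂μ := by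
  rw [integral_eq_lintegral_pos_part_sub_lintegral_neg_part hf]
  refine (ENNReal.ofReal_le_ofReal (sub_le_self _ ENNReal.toReal_nonneg)).trans ?_
  exact ENNReal.ofReal_toReal_le

theorem setLIntegral_Icc_add (f : ℝ → ℝ≥0∞) {a b c : ℝ} (hab : a ≤ b) (hbc : b ≤ c) :
    (∫⁻ x in Icc a b, f x) + ∫⁻ x in Icc b c, f x = ∫⁻ x in Icc a c, f x := by
  simp only [← restrict_Ioc_eq_restrict_Icc]
  rw [← Ioc_union_Ioc_eq_Ioc hab hbc, lintegral_union measurableSet_Ioc]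
  exact Set.disjoint_left.2 fun x hx hx' => absurd hx.2 (not_le.2 hx'.1)

theorem tendsto_slope_ofReal {f : ℝ → ℝ} {s : ℝ} (hf : DifferentiableAt ℝ f s) :
    Tendsto (fun h : ℝ => ENNReal.ofReal (h⁻¹ * (f (s + h) - f s))) (𝓝[≠] 0)
      (𝓝 (ENNReal.ofReal (deriv f s))) := by
  have := hasDerivAt_iff_tendsto_slope_zero.1 hf.hasDerivAt
  simp only [smul_eq_mul] at this
  exact ENNReal.tendsto_ofReal this

theorem AbsolutelyContinuousOnInterval.norm_sub {V : Type*} [NormedAddCommGroup V] {u : ℝ → V}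
    {a b : ℝ} (hu : AbsolutelyContinuousOnInterval u a b) (v : V) :
    AbsolutelyContinuousOnInterval (fun s => ‖u s - v‖) a b := by
  rw [absolutelyContinuousOnInterval_iff] at hu ⊢
  intro ε hε
  obtain ⟨δ, hδ, H⟩ := hu ε hε
  refine ⟨δ, hδ, fun E hE hlt => lt_of_le_of_lt (Finset.sum_le_sum fun i _ => ?_) (H E hE hlt)⟩
  rw [Real.dist_eq, dist_eq_norm]
  refine (abs_norm_sub_norm_le _ _).trans_eq ?_
  congr 1; abel

/-- The scalar function ‖u s - u a‖ is absolutely continuous, so the real fundamental theorem of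
calculus applies to it. Its derivative is at most ‖u'‖ wherever `u` is differentiable, which is
almost everywhere by the Radon–Nikodým property. -/
theorem enorm_sub_le_lintegral_deriv {V : Type*} [NormedAddCommGroup V] [NormedSpace ℝ V]
    (hV : HasRadonNikodymProperty V) {u : ℝ → V} {a b : ℝ} (hab : a < b)
    (hu : AbsolutelyContinuousOnInterval u a b) :
    ‖u b - u a‖ₑ ≤ ∫⁻ s in Icc a b, ‖deriv u s‖ₑ := by
  have hφ := hu.norm_sub (u a)
  have hInt := hφ.integral_deriv_eq_sub
  simp only [sub_self, norm_zero, sub_zero] at hInt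
  rw [← ofReal_norm, ← hInt, intervalIntegral.integral_of_le hab.le, ← integral_Icc_eq_integral_Ioc]
  have hi : IntegrableOn (deriv fun s => ‖u s - u a‖) (Icc a b) :=
    (intervalIntegrable_iff_integrableOn_Icc_of_le hab.le).1 hφ.intervalIntegrable_deriv
  refine (ofReal_integral_le_lintegral hi).trans (lintegral_mono_ae ?_)
  have h1 := hV a b u hab hu
  rw [restrict_Ioo_eq_restrict_Icc] at h1
  have h2 : ∀ᵐ s ∂volume.restrict (Icc a b), DifferentiableAt ℝ (fun s => ‖u s - u a‖) s := by
    rw [ae_restrict_iff' measurableSet_Icc]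
    filter_upwards [hφ.ae_differentiableAt] with s hs hsab
    exact hs (by rwa [uIcc_of_le hab.le])
  filter_upwards [h1, h2] with s hs1 hs2
  rw [← ofReal_norm]
  apply ENNReal.ofReal_le_ofReal
  have t1 := hasDerivAt_iff_tendsto_slope_zero.1 hs2.hasDerivAt
  have t2 := (hasDerivAt_iff_tendsto_slope_zero.1 hs1.hasDerivAt).norm
  refine le_of_tendsto_of_tendsto t1 t2 (Eventually.of_forall fun h => ?_)
  dsimp only
  rw [smul_eq_mul, norm_smul]
  refine (le_abs_self _).trans ?_
  rw [abs_mul, Real.norm_eq_abs]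
  gcongr
  refine (abs_norm_sub_norm_le _ _).trans_eq ?_
  congr 1; abel

namespace RateIndependentSystem

variable {V : Type*} [NormedAddCommGroup V] [NormedSpace ℝ V] {S : RateIndependentSystem V}

/-! ### The metric derivative and the variation -/

theorem psiVar_eq_ivar (u : ℝ → V) (a b : ℝ) :
    S.psiVar u a b = ivar (fun x y => S.psiCost 0 (u x) (u y)) a b := rfl

theorem Standing.psiCost_triangle (hS : S.Standing) (t : ℝ) (x y z : V) :
    S.psiCost t x z ≤ S.psiCost t x y + S.psiCost t y z := by
  simp only [psiCost]
  rw [← ENNReal.ofReal_add (hS.Psi_nonneg _) (hS.Psi_nonneg _)]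
  exact ENNReal.ofReal_le_ofReal (hS.Psi_triangle _ _ _)

theorem Standing.psiCost_subaddOn (hS : S.Standing) (u : ℝ → V) (a b : ℝ) :
    SubaddOn (fun x y => S.psiCost 0 (u x) (u y)) a b :=
  fun _ _ _ _ _ _ _ => hS.psiCost_triangle _ _ _ _

theorem Standing.psiVar_add (hS : S.Standing) (u : ℝ → V) {a b c : ℝ} (hab : a ≤ b) (hbc : b ≤ c) :
    S.psiVar u a b + S.psiVar u b c = S.psiVar u a c := by
  simp only [psiVar_eq_ivar]
  exact ivar_add_of_subaddOn hab hbc (hS.psiCost_subaddOn u a c)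

theorem psiVar_mono (u : ℝ → V) {a b c d : ℝ} (hca : c ≤ a) (hab : a ≤ b) (hbd : b ≤ d) :
    S.psiVar u a b ≤ S.psiVar u c d := by
  simp only [psiVar_eq_ivar]
  exact ivar_mono _ hca hab hbd

theorem psiCost_le_psiVar (u : ℝ → V) {a b : ℝ} (hab : a < b) :
    ENNReal.ofReal (S.Psi (u b - u a)) ≤ S.psiVar u a b := by
  rw [psiVar_eq_ivar]
  exact le_ivar (fun x y => S.psiCost 0 (u x) (u y)) hab

theorem Standing.metricDeriv_le (hS : S.Standing) {u : ℝ → V} {w : ℝ → ℝ} {a b s : ℝ}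
    (hs : s ∈ Ioo a b) (hw : DifferentiableAt ℝ w s)
    (h : ∀ x ∈ Icc a b, ∀ y ∈ Icc a b, x < y → S.Psi (u y - u x) ≤ w y - w x) :
    S.metricDeriv u s ≤ ENNReal.ofReal (deriv w s) := by
  rw [← (tendsto_slope_ofReal hw).limsup_eq]
  refine limsup_le_limsup ?_
  have hmem : ∀ᶠ h : ℝ in 𝓝[≠] 0, s + h ∈ Icc a b := by
    have : Tendsto (fun h : ℝ => s + h) (𝓝[≠] 0) (𝓝 s) := by
      have := (by fun_prop : Continuous fun h : ℝ => s + h).tendsto 0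
      rw [add_zero] at this
      exact this.mono_left nhdsWithin_le_nhds
    exact this.eventually (Icc_mem_nhds hs.1 hs.2)
  filter_upwards [hmem, self_mem_nhdsWithin] with r hr hr0
  apply ENNReal.ofReal_le_ofReal
  -- Since Ψ is only positively homogeneous, a negative step is rewritten as a positive factor times
  -- the reversed increment.
  rcases lt_or_gt_of_ne (show r ≠ 0 from hr0) with hneg | hpos
  · have e : r⁻¹ • (u (s + r) - u s) = (-r)⁻¹ • (u s - u (s + r)) := by
      rw [inv_neg, neg_smul, ← smul_neg, neg_sub]
    rw [e, hS.Psi_smul _ _ (by rw [inv_nonneg]; linarith)]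
    have := h _ hr _ (Ioo_subset_Icc_self hs) (by linarith)
    have e2 : r⁻¹ * (w (s + r) - w s) = (-r)⁻¹ * (w s - w (s + r)) := by
      rw [inv_neg]; ring
    rw [e2]
    exact mul_le_mul_of_nonneg_left this (by rw [inv_nonneg]; linarith)
  · rw [hS.Psi_smul _ _ (by rw [inv_nonneg]; linarith)]
    have := h _ (Ioo_subset_Icc_self hs) _ hr (by linarith)
    exact mul_le_mul_of_nonneg_left this (by rw [inv_nonneg]; linarith)

theorem Standing.metricDeriv_of_differentiableAt (hS : S.Standing) {u : ℝ → V} {s : ℝ}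
    (hu : DifferentiableAt ℝ u s) :
    S.metricDeriv u s = ENNReal.ofReal (S.Psi (deriv u s)) := by
  have h := hasDerivAt_iff_tendsto_slope_zero.1 hu.hasDerivAt
  exact (ENNReal.tendsto_ofReal ((hS.Psi_continuous.tendsto _).comp h)).limsup_eq

theorem toReal_ivar_sub (g : ℝ → ℝ → ℝ≥0∞) {a b x y : ℝ} (hfin : ivar g a b ≠ ⊤) (hax : a ≤ x)
    (hxy : x ≤ y) (hyb : y ≤ b) :
    ivar g x y ≤ ENNReal.ofReal ((ivar g a y).toReal - (ivar g a x).toReal) := by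
  have h1 : ivar g a y ≠ ⊤ := ne_top_of_le_ne_top hfin (ivar_mono g le_rfl (hax.trans hxy) hyb)
  have h2 : ivar g a x ≠ ⊤ := ne_top_of_le_ne_top h1 (ivar_mono g le_rfl hax hxy)
  have h3 : ivar g x y ≠ ⊤ := ne_top_of_le_ne_top h1 (ivar_mono g hax hxy le_rfl)
  have h := ENNReal.toReal_mono h1 (ivar_superadd g hax hxy)
  rw [ENNReal.toReal_add h2 h3] at h
  rw [← ENNReal.ofReal_toReal h3]
  exact ENNReal.ofReal_le_ofReal (by linarith)

theorem monotoneOn_toReal_ivar (g : ℝ → ℝ → ℝ≥0∞) {a b : ℝ} (hfin : ivar g a b ≠ ⊤) :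
    MonotoneOn (fun s => (ivar g a s).toReal) (Icc a b) := fun _ hx _ hy hxy =>
  ENNReal.toReal_mono (ne_top_of_le_ne_top hfin (ivar_mono g le_rfl hy.1 hy.2))
    (ivar_mono g le_rfl hx.1 hxy)

theorem Standing.ae_metricDeriv_le (hS : S.Standing) {u : ℝ → V} {a b : ℝ}
    (hfin : S.psiVar u a b ≠ ⊤) : ∀ᵐ s ∂volume.restrict (Icc a b),
      S.metricDeriv u s ≤ ENNReal.ofReal (deriv (fun s => (S.psiVar u a s).toReal) s) := by
  simp only [psiVar_eq_ivar] at hfin ⊢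
  have hmono := monotoneOn_toReal_ivar _ hfin
  filter_upwards [hmono.ae_differentiableAt_Icc] with s hs
  refine hS.metricDeriv_le hs.1 hs.2 fun x hx y hy hxy => ?_
  have h := (le_ivar (fun x y => S.psiCost 0 (u x) (u y)) hxy).trans
    (toReal_ivar_sub _ hfin hx.1 hxy.le hy.2)
  exact (ENNReal.ofReal_le_ofReal_iff (sub_nonneg.2 (hmono hx hy hxy.le))).1 h

theorem IsPsiAC.mono {Z : Set V} {u : ℝ → V} {a b c d : ℝ} (hu : S.IsPsiAC Z u a b) (hac : a ≤ c)
    (hdb : d ≤ b) : S.IsPsiAC Z u c d := by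
  obtain ⟨h1, m, hm, hmi, h2⟩ := hu
  have hsub : Icc c d ⊆ Icc a b := Icc_subset_Icc hac hdb
  exact ⟨h1.mono_left hsub, m, hm, hmi.mono_set hsub,
    fun s₀ h₀ s₁ h₁ hlt => h2 s₀ (hsub h₀) s₁ (hsub h₁) hlt⟩

theorem IsPsiAC.psiVar_ne_top {Z : Set V} {u : ℝ → V} {a b : ℝ} (hu : S.IsPsiAC Z u a b) :
    S.psiVar u a b ≠ ⊤ := by
  obtain ⟨-, m, hm, hmi, h2⟩ := hu
  rw [psiVar_eq_ivar]
  rcases lt_trichotomy a b with hab | rfl | hab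
  swap; · simp [ivar_self]
  swap; · simp [ivar_of_lt _ hab]
  have hii : ∀ x y, a ≤ x → x ≤ y → y ≤ b → IntervalIntegrable m volume x y := by
    intro x y hx hxy hy
    exact (intervalIntegrable_iff_integrableOn_Icc_of_le hxy).2
      (hmi.mono_set (Icc_subset_Icc hx hy))
  refine ne_top_of_le_ne_top ENNReal.ofReal_ne_top (ivar_le_of_superaddOn
    (h := fun x y => ENNReal.ofReal (∫ s in x..y, m s)) hab ?_ ?_)
  · intro x y hx hxy hy
    exact ENNReal.ofReal_le_ofReal (h2 x ⟨hx, by linarith⟩ y ⟨by linarith, hy⟩ hxy)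
  · intro x y z hx hxy hyz hz
    dsimp only
    rw [← ENNReal.ofReal_add (intervalIntegral.integral_nonneg hxy.le fun s _ => hm s)
      (intervalIntegral.integral_nonneg hyz.le fun s _ => hm s),
      intervalIntegral.integral_add_adjacent_intervals (hii x y hx hxy.le (by linarith))
        (hii y z (by linarith) hyz.le hz)]

/-- With φ(s) = Ψ(u s - u a) and `N` the primitive of `m`, the function `N - φ` is monotone, so the
integral of its derivative is at most its increment. This gives φ(b) ≤ ∫ φ', and φ' is bounded
almost everywhere by the metric derivative through the triangle inequality. -/
theorem Standing.psiCost_le_lintegral (hS : S.Standing) {Z : Set V} {u : ℝ → V} {a b : ℝ}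
    (hab : a < b) (hu : S.IsPsiAC Z u a b) :
    ENNReal.ofReal (S.Psi (u b - u a)) ≤ ∫⁻ s in Icc a b, S.metricDeriv u s := by
  obtain ⟨-, m, hm, hmi, h2⟩ := hu
  have hii : IntervalIntegrable m volume a b :=
    (intervalIntegrable_iff_integrableOn_Icc_of_le hab.le).2 hmi
  set φ : ℝ → ℝ := fun s => S.Psi (u s - u a) with hφ
  set N : ℝ → ℝ := fun s => ∫ r in a..s, m r with hN
  have hinc : ∀ x y, φ y - φ x ≤ S.Psi (u y - u x) := fun x y => by
    have := hS.Psi_triangle (u a) (u x) (u y)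
    simp only [hφ]; linarith
  have hmono : MonotoneOn (fun s => N s - φ s) (Icc a b) := by
    intro x hx y hy hxy
    rcases hxy.eq_or_lt with rfl | hxy
    · exact le_rfl
    have h3 := h2 x hx y hy hxy
    have h4 : N y - N x = ∫ s in x..y, m s := by
      apply intervalIntegral.integral_interval_sub_left
      · exact hii.mono_set (by rw [uIcc_of_le hab.le, uIcc_of_le hy.1]; exact Icc_subset_Icc le_rfl hy.2)
      · exact hii.mono_set (by rw [uIcc_of_le hab.le, uIcc_of_le hx.1]; exact Icc_subset_Icc le_rfl hx.2)
    have := hinc x y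
    dsimp only
    linarith
  have hInt := hmono.integrableOn_deriv_Icc hab.le
  have hle : φ b ≤ ∫ s in Icc a b, (m s - deriv (fun s => N s - φ s) s) := by
    rw [integral_sub hmi hInt]
    have h5 := (uIcc_of_le hab.le ▸ hmono :
      MonotoneOn (fun s => N s - φ s) (uIcc a b)).intervalIntegral_deriv_mem_uIcc
    have h6 := hmono (left_mem_Icc.2 hab.le) (right_mem_Icc.2 hab.le) hab.le
    rw [uIcc_of_le (by linarith), intervalIntegral.integral_of_le hab.le,
      ← integral_Icc_eq_integral_Ioc] at h5
    have h7 := h5.2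
    have h8 : N a = 0 := by simp [hN]
    have h9 : φ a = 0 := by simp [hφ, hS.Psi_zero]
    have h10 : N b = ∫ s in Icc a b, m s := by
      simp only [hN]
      rw [intervalIntegral.integral_of_le hab.le, integral_Icc_eq_integral_Ioc]
    linarith
  refine (ENNReal.ofReal_le_ofReal hle).trans
    ((ofReal_integral_le_lintegral (hmi.sub hInt)).trans (lintegral_mono_ae ?_))
  have hNd : ∀ᵐ s ∂volume.restrict (Icc a b), HasDerivAt N (m s) s := by
    rw [ae_restrict_iff' measurableSet_Icc]
    filter_upwards [hii.ae_hasDerivAt_integral] with s hs hsab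
    exact hs (by rwa [uIcc_of_le hab.le]) a (by simp)
  filter_upwards [hNd, hmono.ae_differentiableAt_Icc] with s hs1 hs2
  have hd : HasDerivAt φ (m s - deriv (fun s => N s - φ s) s) s := by
    have := hs1.sub hs2.2.hasDerivAt
    convert! this using 1
    ext r; simp
  have ht := ENNReal.tendsto_ofReal (hasDerivAt_iff_tendsto_slope_zero.1 hd)
  -- Only right difference quotients are compared: for positive steps the factor passes through Ψ.
  -- The restricted upper limit is below the two-sided one.
  have ht' := ht.mono_left (nhdsWithin_mono 0 (show Ioi (0 : ℝ) ⊆ {0}ᶜ from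
    fun x hx => (ne_of_gt hx)))
  rw [Pi.sub_apply, ← ht'.limsup_eq]
  refine le_trans (limsup_le_limsup ?_) (limsup_le_limsup_of_le
    (nhdsWithin_mono 0 (show Ioi (0 : ℝ) ⊆ {0}ᶜ from fun x hx => (ne_of_gt hx))))
  filter_upwards [self_mem_nhdsWithin] with r hr
  apply ENNReal.ofReal_le_ofReal
  have hr0 : 0 ≤ r⁻¹ := inv_nonneg.2 (le_of_lt hr)
  rw [hS.Psi_smul _ _ hr0, smul_eq_mul]
  exact mul_le_mul_of_nonneg_left (hinc _ _) hr0

theorem Standing.lintegral_metricDeriv (hS : S.Standing) {Z : Set V} {u : ℝ → V} {a b : ℝ}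
    (hab : a ≤ b) (hu : S.IsPsiAC Z u a b) :
    ∫⁻ s in Icc a b, S.metricDeriv u s = S.psiVar u a b := by
  refine le_antisymm ?_ ?_
  · have hfin := hu.psiVar_ne_top
    refine (lintegral_mono_ae (hS.ae_metricDeriv_le hfin)).trans ?_
    simp only [psiVar_eq_ivar] at hfin ⊢
    refine ((monotoneOn_toReal_ivar _ hfin).lintegral_deriv_le hab).trans ?_
    simp only [ivar_self, ENNReal.toReal_zero, sub_zero]
    exact ENNReal.ofReal_toReal_le
  · rw [psiVar_eq_ivar]
    rcases hab.eq_or_lt with rfl | hab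
    · simp [ivar_self]
    refine ivar_le_of_superaddOn (h := fun x y => ∫⁻ s in Icc x y, S.metricDeriv u s) hab ?_ ?_
    · exact fun x y hx hxy hy => hS.psiCost_le_lintegral hxy (hu.mono hx hy)
    · exact fun x y z _ hxy hyz _ => (setLIntegral_Icc_add _ hxy.le hyz.le).le

/-- One inequality holds almost everywhere and the integrals agree. This also gives measurability of
the metric derivative, which is not evident from its definition as an upper limit. -/
theorem Standing.metricDeriv_ae_eq (hS : S.Standing) {Z : Set V} {u : ℝ → V} {a b : ℝ}
    (hab : a ≤ b) (hu : S.IsPsiAC Z u a b) :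
    S.metricDeriv u =ᵐ[volume.restrict (Icc a b)]
      fun s => ENNReal.ofReal (deriv (fun s => (S.psiVar u a s).toReal) s) := by
  have hfin := hu.psiVar_ne_top
  have hL := hS.lintegral_metricDeriv hab hu
  refine ae_eq_of_ae_le_of_lintegral_le (hS.ae_metricDeriv_le hfin) (hL ▸ hfin)
    (measurable_deriv _).ennreal_ofReal.aemeasurable ?_
  rw [hL]
  simp only [psiVar_eq_ivar] at hfin ⊢
  refine ((monotoneOn_toReal_ivar _ hfin).lintegral_deriv_le hab).trans ?_
  simp only [ivar_self, ENNReal.toReal_zero, sub_zero]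
  exact ENNReal.ofReal_toReal_le

theorem Standing.aemeasurable_metricDeriv (hS : S.Standing) {Z : Set V} {u : ℝ → V} {a b : ℝ}
    (hab : a ≤ b) (hu : S.IsPsiAC Z u a b) :
    AEMeasurable (S.metricDeriv u) (volume.restrict (Icc a b)) :=
  (measurable_deriv _).ennreal_ofReal.aemeasurable.congr (hS.metricDeriv_ae_eq hab hu).symm

/-- Norm continuity, although Ψ need not dominate the norm: on a compact sublevel small Ψ-distance
forces small norm distance. -/
theorem Standing.continuousOn_of_isPsiAC (hS : S.Standing) {E : ℝ} (hE : 0 < E) {u : ℝ → V}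
    {a b : ℝ} (hu : S.IsPsiAC (S.sublevel E) u a b) : ContinuousOn u (Icc a b) := by
  obtain ⟨h1, m, hm, hmi, h2⟩ := hu
  rcases lt_or_ge b a with hab | hab
  · simp [Icc_eq_empty (not_le.2 hab)]
  have hii : IntervalIntegrable m volume a b :=
    (intervalIntegrable_iff_integrableOn_Icc_of_le hab).2 hmi
  have hNc : ContinuousOn (fun s => ∫ r in a..s, m r) (Icc a b) := by
    have := intervalIntegral.continuousOn_primitive_interval (f := m) (μ := volume)
      (a := a) (b := b) (by rwa [uIcc_of_le hab])
    rwa [uIcc_of_le hab] at this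
  intro s hs
  refine Metric.tendsto_nhds.2 fun ε hε => ?_
  obtain ⟨δ, hδ, H⟩ := hS.exists_modulus hE hε
  have hev := Metric.tendsto_nhds.1 (hNc s hs) δ hδ
  filter_upwards [hev, self_mem_nhdsWithin] with r hr hrab
  rw [Real.dist_eq] at hr
  have hsub : ∀ x ∈ Icc a b, ∀ y ∈ Icc a b,
      (∫ r in a..y, m r) - (∫ r in a..x, m r) = ∫ s in x..y, m s := by
    intro x hx y hy
    apply intervalIntegral.integral_interval_sub_left
    · exact hii.mono_set (by rw [uIcc_of_le hab, uIcc_of_le hy.1]; exact Icc_subset_Icc le_rfl hy.2)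
    · exact hii.mono_set (by rw [uIcc_of_le hab, uIcc_of_le hx.1]; exact Icc_subset_Icc le_rfl hx.2)
  rcases lt_trichotomy r s with h | rfl | h
  · rw [dist_comm, dist_eq_norm]
    refine H _ (h1 hrab) _ (h1 hs) (lt_of_le_of_lt (h2 r hrab s hs h) ?_)
    rw [← hsub r hrab s hs]
    rw [abs_sub_comm] at hr
    exact (le_abs_self _).trans_lt hr
  · simpa using hε
  · rw [dist_eq_norm]
    refine H _ (h1 hs) _ (h1 hrab) (lt_of_le_of_lt (h2 s hs r hrab h) ?_)
    rw [← hsub s hs r hrab]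
    exact (le_abs_self _).trans_lt hr

/-! ### The dissipation as a variation -/

variable (S) in
/-- The viscous cost of an increment, with the smallest slope along the interval. -/
def slopeCost (tt : ℝ → ℝ) (uu : ℝ → V) (x y : ℝ) : ℝ≥0∞ :=
  (⨅ z ∈ Icc x y, S.slope (tt z) (uu z)) * ‖uu y - uu x‖ₑ

variable (S) in
/-- The total cost of an increment. -/
def incCost (tt : ℝ → ℝ) (uu : ℝ → V) (x y : ℝ) : ℝ≥0∞ :=
  S.psiCost 0 (uu x) (uu y) + S.slopeCost tt uu x y

/-- Taking the infimum of the slope over the interval makes the weight decrease when the interval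
grows, so the triangle inequality survives. -/
theorem slopeCost_subaddOn (tt : ℝ → ℝ) (uu : ℝ → V) (a b : ℝ) :
    SubaddOn (S.slopeCost tt uu) a b := by
  intro x y z _ hxy hyz _
  have h1 : (⨅ r ∈ Icc x z, S.slope (tt r) (uu r)) ≤ ⨅ r ∈ Icc x y, S.slope (tt r) (uu r) :=
    biInf_mono (Icc_subset_Icc le_rfl hyz.le)
  have h2 : (⨅ r ∈ Icc x z, S.slope (tt r) (uu r)) ≤ ⨅ r ∈ Icc y z, S.slope (tt r) (uu r) :=
    biInf_mono (Icc_subset_Icc hxy.le le_rfl)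
  have h3 : ‖uu z - uu x‖ₑ ≤ ‖uu y - uu x‖ₑ + ‖uu z - uu y‖ₑ := by
    rw [show uu z - uu x = (uu y - uu x) + (uu z - uu y) by abel]
    exact enorm_add_le _ _
  calc S.slopeCost tt uu x z ≤ (⨅ r ∈ Icc x z, S.slope (tt r) (uu r)) *
        (‖uu y - uu x‖ₑ + ‖uu z - uu y‖ₑ) := by unfold slopeCost; gcongr
    _ ≤ _ := by
      rw [mul_add]
      exact add_le_add (mul_le_mul_left h1 _) (mul_le_mul_left h2 _)

theorem Standing.incCost_subaddOn (hS : S.Standing) (tt : ℝ → ℝ) (uu : ℝ → V) (a b : ℝ) :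
    SubaddOn (S.incCost tt uu) a b :=
  (hS.psiCost_subaddOn uu a b).add (slopeCost_subaddOn tt uu a b)

theorem Standing.ivar_incCost (hS : S.Standing) (tt : ℝ → ℝ) (uu : ℝ → V) (a b : ℝ) :
    ivar (S.incCost tt uu) a b = S.psiVar uu a b + ivar (S.slopeCost tt uu) a b := by
  rw [psiVar_eq_ivar]
  exact ivar_add (hS.psiCost_subaddOn uu a b) (slopeCost_subaddOn tt uu a b)

theorem Standing.ivar_incCost_add (hS : S.Standing) (tt : ℝ → ℝ) (uu : ℝ → V) {a b c : ℝ}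
    (hab : a ≤ b) (hbc : b ≤ c) :
    ivar (S.incCost tt uu) a b + ivar (S.incCost tt uu) b c = ivar (S.incCost tt uu) a c :=
  ivar_add_of_subaddOn hab hbc (hS.incCost_subaddOn tt uu a c)

variable (S) in
/-- Curves `(t,u)` with continuous `t` and `Ψ`-absolutely continuous `u` that is locally absolutely
continuous on the unstable set. -/
structure IsRegularCurve (E : ℝ) (tt : ℝ → ℝ) (uu : ℝ → V) (a b : ℝ) : Prop where
  mapsTo : MapsTo tt (Icc a b) (Icc 0 S.T)
  cont : ContinuousOn tt (Icc a b)
  psiAC : S.IsPsiAC (S.sublevel E) uu a b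
  locallyAC : LocallyAC uu (S.unstableSet tt uu a b)

theorem unstableSet_subset {tt : ℝ → ℝ} {uu : ℝ → V} {a b c d : ℝ} (hac : a ≤ c) (hdb : d ≤ b) :
    S.unstableSet tt uu c d ⊆ S.unstableSet tt uu a b :=
  fun _ hs => ⟨Icc_subset_Icc hac hdb hs.1, hs.2⟩

theorem IsRegularCurve.mono {E : ℝ} {tt : ℝ → ℝ} {uu : ℝ → V} {a b c d : ℝ}
    (h : S.IsRegularCurve E tt uu a b) (hac : a ≤ c) (hdb : d ≤ b) :
    S.IsRegularCurve E tt uu c d where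
  mapsTo := h.mapsTo.mono_left (Icc_subset_Icc hac hdb)
  cont := h.cont.mono (Icc_subset_Icc hac hdb)
  psiAC := h.psiAC.mono hac hdb
  locallyAC := fun p q hpq hsub => h.locallyAC p q hpq (hsub.trans (unstableSet_subset hac hdb))

theorem IsRegularCurve.continuousOn {E : ℝ} {tt : ℝ → ℝ} {uu : ℝ → V} {a b : ℝ}
    (h : S.IsRegularCurve E tt uu a b) (hS : S.Standing) (hE : 0 < E) :
    ContinuousOn uu (Icc a b) := hS.continuousOn_of_isPsiAC hE h.psiAC

theorem Standing.slope_comp_lsc (hS : S.Standing) {E : ℝ} (hE : 0 < E) {X : Type*}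
    [TopologicalSpace X] {tt : X → ℝ} {uu : X → V} {K : Set X} (ht : ContinuousOn tt K)
    (hu : ContinuousOn uu K) (htm : MapsTo tt K (Icc 0 S.T)) (hum : MapsTo uu K (S.sublevel E)) :
    LowerSemicontinuousOn (fun s => S.slope (tt s) (uu s)) K := by
  intro s hs y hy
  have h := hS.slope_lsc hE (tt s, uu s) ⟨htm hs, hum hs⟩ y hy
  have hc : Tendsto (fun s => (tt s, uu s)) (𝓝[K] s)
      (𝓝[Icc 0 S.T ×ˢ S.sublevel E] (tt s, uu s)) := by
    refine tendsto_nhdsWithin_iff.2 ⟨(ht s hs).prodMk_nhds (hu s hs), ?_⟩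
    filter_upwards [self_mem_nhdsWithin] with r hr using ⟨htm hr, hum hr⟩
  exact hc.eventually h

theorem IsRegularCurve.slope_lsc {E : ℝ} {tt : ℝ → ℝ} {uu : ℝ → V} {a b : ℝ}
    (h : S.IsRegularCurve E tt uu a b) (hS : S.Standing) (hE : 0 < E) :
    LowerSemicontinuousOn (fun s => S.slope (tt s) (uu s)) (Icc a b) :=
  hS.slope_comp_lsc hE h.cont (h.continuousOn hS hE) h.mapsTo h.psiAC.1

theorem IsRegularCurve.measurableSet_unstableSet {E : ℝ} {tt : ℝ → ℝ} {uu : ℝ → V} {a b : ℝ}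
    (h : S.IsRegularCurve E tt uu a b) (hS : S.Standing) (hE : 0 < E) :
    MeasurableSet (S.unstableSet tt uu a b) := by
  obtain ⟨O, hO, heq⟩ := lowerSemicontinuousOn_iff_preimage_Ioi.1 (h.slope_lsc hS hE) 0
  have : S.unstableSet tt uu a b = Icc a b ∩ O := by
    rw [← heq]; rfl
  rw [this]
  exact measurableSet_Icc.inter hO.measurableSet

/-- The unstable set is relatively open. -/
theorem IsRegularCurve.eventually_unstable {E : ℝ} {tt : ℝ → ℝ} {uu : ℝ → V} {a b s : ℝ}
    (h : S.IsRegularCurve E tt uu a b) (hS : S.Standing) (hE : 0 < E)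
    (hs : s ∈ S.unstableSet tt uu a b) :
    ∃ ε > 0, ∀ r ∈ Icc a b, |r - s| < ε → r ∈ S.unstableSet tt uu a b := by
  have := h.slope_lsc hS hE s hs.1 0 hs.2
  obtain ⟨ε, hε, H⟩ := Metric.eventually_nhds_iff.1 (eventually_nhdsWithin_iff.1 this)
  exact ⟨ε, hε, fun r hr hrs => ⟨hr, H (by rwa [Real.dist_eq]) hr⟩⟩

theorem setLIntegral_unstableSet_le (tt : ℝ → ℝ) (uu : ℝ → V) (a b : ℝ) :
    ∫⁻ s in S.unstableSet tt uu a b, S.slope (tt s) (uu s) * ‖deriv uu s‖ₑ ≤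
      ∫⁻ s in Icc a b, S.slope (tt s) (uu s) * ‖deriv uu s‖ₑ :=
  lintegral_mono_set fun _ hs => hs.1

theorem IsRegularCurve.setLIntegral_unstableSet {E : ℝ} {tt : ℝ → ℝ} {uu : ℝ → V} {a b : ℝ}
    (h : S.IsRegularCurve E tt uu a b) (hS : S.Standing) (hE : 0 < E) :
    ∫⁻ s in S.unstableSet tt uu a b, S.slope (tt s) (uu s) * ‖deriv uu s‖ₑ =
      ∫⁻ s in Icc a b, S.slope (tt s) (uu s) * ‖deriv uu s‖ₑ := by
  refine le_antisymm (setLIntegral_unstableSet_le tt uu a b) ?_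
  have hm := h.measurableSet_unstableSet hS hE
  rw [← lintegral_inter_add_sdiff _ (Icc a b) hm]
  have h0 : ∫⁻ s in Icc a b \ S.unstableSet tt uu a b, S.slope (tt s) (uu s) * ‖deriv uu s‖ₑ = 0 := by
    rw [setLIntegral_congr_fun (g := fun _ => 0) (measurableSet_Icc.diff hm)]
    · simp
    · intro s hs
      have : S.slope (tt s) (uu s) = 0 := by
        by_contra hne
        exact hs.2 ⟨hs.1, pos_iff_ne_zero.2 hne⟩
      simp [this]
  rw [h0, add_zero]
  exact lintegral_mono_set inter_subset_right

/-- The unstable set is relatively open, so its interior points lie in countably many rational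
intervals contained in it. On each of these the curve is absolutely continuous and the Radon–Nikodým
property applies. -/
theorem IsRegularCurve.ae_differentiableAt {E : ℝ} {tt : ℝ → ℝ} {uu : ℝ → V} {a b : ℝ}
    (h : S.IsRegularCurve E tt uu a b) (hV : HasRadonNikodymProperty V) (hS : S.Standing)
    (hE : 0 < E) : ∀ᵐ s ∂volume.restrict (Icc a b), s ∈ S.unstableSet tt uu a b →
      DifferentiableAt ℝ uu s := by
  have h1 : ∀ᵐ s : ℝ, ∀ q : ℚ × ℚ, (q.1 : ℝ) < q.2 → Icc (q.1 : ℝ) q.2 ⊆ S.unstableSet tt uu a b →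
      s ∈ Ioo (q.1 : ℝ) q.2 → DifferentiableAt ℝ uu s := by
    rw [ae_all_iff]
    intro q
    by_cases hq : (q.1 : ℝ) < q.2 ∧ Icc (q.1 : ℝ) q.2 ⊆ S.unstableSet tt uu a b
    · have := hV _ _ uu hq.1 (h.locallyAC _ _ hq.1 hq.2)
      rw [ae_restrict_iff' measurableSet_Ioo] at this
      filter_upwards [this] with s hs _ _ using hs
    · exact Eventually.of_forall fun s h1 h2 => absurd ⟨h1, h2⟩ hq
  rw [← restrict_Ioo_eq_restrict_Icc, ae_restrict_iff' measurableSet_Ioo]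
  filter_upwards [h1] with s hs hsab hsG
  obtain ⟨ε, hε, H⟩ := h.eventually_unstable hS hE hsG
  obtain ⟨p, hp1, hp2⟩ := exists_rat_btwn (show max a (s - ε) < s from max_lt hsab.1 (by linarith))
  obtain ⟨q, hq1, hq2⟩ := exists_rat_btwn (show s < min b (s + ε) from lt_min hsab.2 (by linarith))
  refine hs (p, q) (hp2.trans hq1) (fun r hr => ?_) ⟨hp2, hq1⟩
  have e1 := (max_lt_iff.1 hp1)
  have e2 := (lt_min_iff.1 hq2)
  exact H r ⟨by linarith [hr.1], by linarith [hr.2]⟩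
    (abs_lt.2 ⟨by linarith [hr.1], by linarith [hr.2]⟩)

/-- Either the infimum of the slope is zero, and so is the cost, or the whole interval is unstable,
and the curve is absolutely continuous there. -/
theorem IsRegularCurve.slopeCost_le {E : ℝ} {tt : ℝ → ℝ} {uu : ℝ → V} {a b : ℝ}
    (h : S.IsRegularCurve E tt uu a b) (hV : HasRadonNikodymProperty V) (hab : a < b) :
    S.slopeCost tt uu a b ≤ ∫⁻ s in Icc a b, S.slope (tt s) (uu s) * ‖deriv uu s‖ₑ := by
  unfold slopeCost
  set q := ⨅ z ∈ Icc a b, S.slope (tt z) (uu z) with hq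
  rcases eq_or_ne q 0 with h0 | h0
  · simp [h0]
  have hle : ∀ s ∈ Icc a b, q ≤ S.slope (tt s) (uu s) := fun s hs => iInf₂_le s hs
  have hsub : Icc a b ⊆ S.unstableSet tt uu a b := fun s hs =>
    ⟨hs, (pos_iff_ne_zero.2 h0).trans_le (hle s hs)⟩
  calc q * ‖uu b - uu a‖ₑ ≤ q * ∫⁻ s in Icc a b, ‖deriv uu s‖ₑ := by
        gcongr
        exact enorm_sub_le_lintegral_deriv hV hab (h.locallyAC a b hab hsub)
    _ ≤ ∫⁻ s in Icc a b, q * ‖deriv uu s‖ₑ := lintegral_const_mul_le _ _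
    _ ≤ _ := setLIntegral_mono' measurableSet_Icc fun s hs => by gcongr; exact hle s hs

/-- By lower semicontinuity any `q` below the slope at `s` bounds the slope from below on short
intervals to the right of `s`. Hence `q` times the norm increment is at most the slope cost, and
difference quotients pass to the limit. -/
theorem IsRegularCurve.slope_mul_le_deriv {E : ℝ} {tt : ℝ → ℝ} {uu : ℝ → V} {a b s : ℝ}
    (h : S.IsRegularCurve E tt uu a b) (hS : S.Standing) (hE : 0 < E)
    (hfin : ivar (S.slopeCost tt uu) a b ≠ ⊤) (hs : s ∈ Ioo a b)
    (hw : DifferentiableAt ℝ (fun s => (ivar (S.slopeCost tt uu) a s).toReal) s)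
    (hu : DifferentiableAt ℝ uu s) :
    S.slope (tt s) (uu s) * ‖deriv uu s‖ₑ ≤
      ENNReal.ofReal (deriv (fun s => (ivar (S.slopeCost tt uu) a s).toReal) s) := by
  set B := ENNReal.ofReal (deriv (fun s => (ivar (S.slopeCost tt uu) a s).toReal) s) with hB
  rcases eq_or_ne ‖deriv uu s‖ₑ 0 with h0 | h0
  · simp [h0]
  have key : ∀ q, q < S.slope (tt s) (uu s) → q * ‖deriv uu s‖ₑ ≤ B := by
    intro q hq
    have hqt : q ≠ ⊤ := ne_top_of_lt hq
    have hsub : Ioi (0 : ℝ) ⊆ {0}ᶜ := fun x hx => ne_of_gt hx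
    have t1 := (tendsto_slope_ofReal hw).mono_left (nhdsWithin_mono 0 hsub)
    have t2 := (hasDerivAt_iff_tendsto_slope_zero.1 hu.hasDerivAt).mono_left
      (nhdsWithin_mono 0 hsub)
    have t3 := ENNReal.Tendsto.const_mul (a := q) t2.enorm (Or.inr hqt)
    refine le_of_tendsto_of_tendsto t3 t1 ?_
    have hl := h.slope_lsc hS hE s (Ioo_subset_Icc_self hs) q hq
    obtain ⟨ε, hε, H⟩ := Metric.eventually_nhds_iff.1 (eventually_nhdsWithin_iff.1 hl)
    have hmem : Ioo (0 : ℝ) (min ε (b - s)) ∈ 𝓝[>] (0 : ℝ) :=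
      Ioo_mem_nhdsGT (lt_min hε (by linarith [hs.2]))
    filter_upwards [hmem] with r hr
    have hr2 := lt_min_iff.1 hr.2
    have hc : q * ‖uu (s + r) - uu s‖ₑ ≤ S.slopeCost tt uu s (s + r) := by
      unfold slopeCost
      gcongr
      refine le_iInf₂ fun z hz => ?_
      refine (H ?_ ⟨by linarith [hs.1, hz.1], by linarith [hz.2]⟩).le
      rw [Real.dist_eq, abs_of_nonneg (by linarith [hz.1])]
      linarith [hz.2]
    have hc2 := hc.trans ((le_ivar (S.slopeCost tt uu) (show s < s + r by linarith [hr.1])).trans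
      (toReal_ivar_sub _ hfin hs.1.le (by linarith [hr.1]) (by linarith)))
    rw [ENNReal.ofReal_mul (inv_nonneg.2 hr.1.le), enorm_smul, Real.enorm_of_nonneg
      (inv_nonneg.2 hr.1.le)]
    calc _ = ENNReal.ofReal r⁻¹ * (q * ‖uu (s + r) - uu s‖ₑ) := by ring
      _ ≤ _ := by gcongr
  -- Dividing by the nonzero speed allows the slope, which may be infinite, to be approached by
  -- smaller `q`.
  rw [← ENNReal.le_div_iff_mul_le (Or.inl h0) (Or.inl (by simp))]
  refine le_of_forall_lt_imp_le_of_dense fun q hq => ?_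
  rw [ENNReal.le_div_iff_mul_le (Or.inl h0) (Or.inl (by simp))]
  exact key q hq

theorem IsRegularCurve.ae_slope_mul_le {E : ℝ} {tt : ℝ → ℝ} {uu : ℝ → V} {a b : ℝ}
    (h : S.IsRegularCurve E tt uu a b) (hV : HasRadonNikodymProperty V) (hS : S.Standing)
    (hE : 0 < E) (hfin : ivar (S.slopeCost tt uu) a b ≠ ⊤) :
    ∀ᵐ s ∂volume.restrict (Icc a b), S.slope (tt s) (uu s) * ‖deriv uu s‖ₑ ≤
      ENNReal.ofReal (deriv (fun s => (ivar (S.slopeCost tt uu) a s).toReal) s) := by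
  filter_upwards [h.ae_differentiableAt hV hS hE,
    (monotoneOn_toReal_ivar _ hfin).ae_differentiableAt_Icc] with s h1 h2
  rcases eq_or_ne (S.slope (tt s) (uu s)) 0 with h0 | h0
  · simp [h0]
  · exact h.slope_mul_le_deriv hS hE hfin h2.1 h2.2
      (h1 ⟨Ioo_subset_Icc_self h2.1, pos_iff_ne_zero.2 h0⟩)

theorem IsRegularCurve.lintegral_slope {E : ℝ} {tt : ℝ → ℝ} {uu : ℝ → V} {a b : ℝ}
    (h : S.IsRegularCurve E tt uu a b) (hV : HasRadonNikodymProperty V) (hS : S.Standing)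
    (hE : 0 < E) (hab : a ≤ b) :
    ∫⁻ s in Icc a b, S.slope (tt s) (uu s) * ‖deriv uu s‖ₑ = ivar (S.slopeCost tt uu) a b := by
  refine le_antisymm ?_ ?_
  · rcases eq_or_ne (ivar (S.slopeCost tt uu) a b) ⊤ with hfin | hfin
    · simp [hfin]
    refine (lintegral_mono_ae (h.ae_slope_mul_le hV hS hE hfin)).trans ?_
    refine ((monotoneOn_toReal_ivar _ hfin).lintegral_deriv_le hab).trans ?_
    simp only [ivar_self, ENNReal.toReal_zero, sub_zero]
    exact ENNReal.ofReal_toReal_le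
  · rcases hab.eq_or_lt with rfl | hab
    · simp [ivar_self]
    refine ivar_le_of_superaddOn (h := fun x y => ∫⁻ s in Icc x y,
      S.slope (tt s) (uu s) * ‖deriv uu s‖ₑ) hab ?_ ?_
    · exact fun x y hx hxy hy => (h.mono hx hy).slopeCost_le hV hxy
    · exact fun x y z _ hxy hyz _ => (setLIntegral_Icc_add _ hxy.le hyz.le).le

/-- The bridge between integrals and partition sums. Additivity, monotonicity in the interval and
reparametrization of the dissipation are all obtained through this identity. -/
theorem IsRegularCurve.dissipation_eq {E : ℝ} {tt : ℝ → ℝ} {uu : ℝ → V} {a b : ℝ}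
    (h : S.IsRegularCurve E tt uu a b) (hV : HasRadonNikodymProperty V) (hS : S.Standing)
    (hE : 0 < E) (hab : a ≤ b) :
    S.dissipation tt uu a b = ivar (S.incCost tt uu) a b := by
  rw [hS.ivar_incCost, dissipation, h.setLIntegral_unstableSet hS hE,
    h.lintegral_slope hV hS hE hab, hS.lintegral_metricDeriv hab h.psiAC]

theorem IsRegularCurve.slope_ae_eq {E : ℝ} {tt : ℝ → ℝ} {uu : ℝ → V} {a b : ℝ}
    (h : S.IsRegularCurve E tt uu a b) (hV : HasRadonNikodymProperty V) (hS : S.Standing)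
    (hE : 0 < E) (hab : a ≤ b) (hfin : ivar (S.slopeCost tt uu) a b ≠ ⊤) :
    (fun s => S.slope (tt s) (uu s) * ‖deriv uu s‖ₑ) =ᵐ[volume.restrict (Icc a b)]
      fun s => ENNReal.ofReal (deriv (fun s => (ivar (S.slopeCost tt uu) a s).toReal) s) := by
  have hL := h.lintegral_slope hV hS hE hab
  refine ae_eq_of_ae_le_of_lintegral_le (h.ae_slope_mul_le hV hS hE hfin) (hL ▸ hfin)
    (measurable_deriv _).ennreal_ofReal.aemeasurable ?_
  rw [hL]
  refine ((monotoneOn_toReal_ivar _ hfin).lintegral_deriv_le hab).trans ?_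
  simp only [ivar_self, ENNReal.toReal_zero, sub_zero]
  exact ENNReal.ofReal_toReal_le

theorem IsRegularCurve.dissipation_add {E : ℝ} {tt : ℝ → ℝ} {uu : ℝ → V} {a b c : ℝ}
    (h : S.IsRegularCurve E tt uu a c) (hV : HasRadonNikodymProperty V) (hS : S.Standing)
    (hE : 0 < E) (hab : a ≤ b) (hbc : b ≤ c) :
    S.dissipation tt uu a b + S.dissipation tt uu b c = S.dissipation tt uu a c := by
  rw [(h.mono le_rfl hbc).dissipation_eq hV hS hE hab, (h.mono hab le_rfl).dissipation_eq hV hS hE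
    hbc, h.dissipation_eq hV hS hE (hab.trans hbc), hS.ivar_incCost_add _ _ hab hbc]

end RateIndependentSystem

/-! ### Auxiliary facts on real functions -/

theorem LowerSemicontinuousOn.aemeasurable_restrict {β : Type*} [TopologicalSpace β]
    [LinearOrder β] [OrderTopology β] [SecondCountableTopology β] [MeasurableSpace β]
    [BorelSpace β] {f : ℝ → β} {K : Set ℝ} (hf : LowerSemicontinuousOn f K)
    (hK : MeasurableSet K) : AEMeasurable f (volume.restrict K) :=
  aemeasurable_restrict_of_measurable_subtype hK
    (lowerSemicontinuous_restrict_iff.2 hf).measurable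

/-- Change of variables for a monotone function with density `κ`. -/
theorem map_withDensity_of_primitive {κ : ℝ → ℝ≥0∞} {l : ℝ → ℝ} {c d : ℝ} (hcd : c ≤ d)
    (hl : MonotoneOn l (Icc c d)) (hlc : ContinuousOn l (Icc c d))
    (hκ : ∀ r ∈ Icc c d, ∫⁻ s in Icc c r, κ s = ENNReal.ofReal (l r - l c)) :
    Measure.map l ((volume.restrict (Icc c d)).withDensity κ) =
      volume.restrict (Icc (l c) (l d)) := by
  set μ := (volume.restrict (Icc c d)).withDensity κ with hμ
  have hae : l =ᵐ[μ] IccExtend hcd (fun s : Icc c d => l s) := by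
    refine (withDensity_absolutelyContinuous _ _).ae_le ?_
    filter_upwards [ae_restrict_mem measurableSet_Icc] with s hs
    simp [IccExtend_of_mem hcd _ hs]
  have hcont : Continuous (IccExtend hcd (fun s : Icc c d => l s)) :=
    (continuousOn_iff_continuous_domRestrict.1 hlc).Icc_extend'
  rw [Measure.map_congr hae]
  have hμfin : IsFiniteMeasure μ := by
    refine ⟨?_⟩
    rw [hμ, withDensity_apply _ MeasurableSet.univ, Measure.restrict_univ, hκ d ⟨hcd, le_rfl⟩]
    exact ENNReal.ofReal_lt_top
  -- Finite measures on the line agree once they agree on half-lines. The part of `[c,d]` where `l ≤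
  -- x` is an interval starting at `c`, whose mass is known by hypothesis.
  refine Measure.ext_of_Iic _ _ fun x => ?_
  rw [Measure.map_apply hcont.measurable measurableSet_Iic, hμ,
    withDensity_apply _ (hcont.measurable measurableSet_Iic),
    Measure.restrict_restrict (hcont.measurable measurableSet_Iic),
    Measure.restrict_apply measurableSet_Iic]
  have hset : IccExtend hcd (fun s : Icc c d => l s) ⁻¹' Iic x ∩ Icc c d = Icc c d ∩ l ⁻¹' Iic x := by
    ext s
    refine ⟨fun ⟨h1, h2⟩ => ⟨h2, ?_⟩, fun ⟨h1, h2⟩ => ⟨?_, h1⟩⟩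
    · simpa [IccExtend_of_mem hcd _ h2] using h1
    · simpa [IccExtend_of_mem hcd _ h1] using h2
  rw [hset]
  rcases lt_or_ge x (l c) with hx | hx
  · have h1 : Icc c d ∩ l ⁻¹' Iic x = ∅ := by
      refine eq_empty_of_forall_notMem fun s hs => ?_
      have := hl (left_mem_Icc.2 hcd) hs.1 hs.1.1
      exact absurd (this.trans hs.2) (not_le.2 hx)
    have h2 : Iic x ∩ Icc (l c) (l d) = ∅ :=
      eq_empty_of_forall_notMem fun s hs => absurd (hs.2.1.trans hs.1) (not_le.2 hx)
    simp [h1, h2]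
  · have hcomp : IsCompact (Icc c d ∩ l ⁻¹' Iic x) :=
      hlc.lowerSemicontinuousOn.isCompact_inter_preimage_Iic isCompact_Icc x
    obtain ⟨r, hr, hmax⟩ := hcomp.exists_isGreatest ⟨c, left_mem_Icc.2 hcd, hx⟩
    have h1 : Icc c d ∩ l ⁻¹' Iic x = Icc c r := by
      ext s
      exact ⟨fun hs => ⟨hs.1.1, hmax hs⟩, fun hs => ⟨⟨hs.1, hs.2.trans hr.1.2⟩,
        (hl ⟨hs.1, hs.2.trans hr.1.2⟩ hr.1 hs.2).trans hr.2⟩⟩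
    rw [h1, hκ r hr.1]
    have h2 : Iic x ∩ Icc (l c) (l d) = Icc (l c) (min x (l d)) := by
      ext s
      simp only [mem_inter_iff, mem_Iic, mem_Icc, le_min_iff]
      tauto
    rw [h2, Real.volume_Icc]
    congr 2
    rcases le_total x (l d) with hxd | hxd
    · rw [min_eq_left hxd]
      obtain ⟨r', hr', hr'x⟩ := intermediate_value_Icc hcd hlc ⟨hx, hxd⟩
      refine le_antisymm hr.2 ?_
      rw [← hr'x]
      exact hl hr' hr.1 (hmax ⟨hr', hr'x.le⟩)
    · rw [min_eq_right hxd]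
      have : d ≤ r := hmax ⟨right_mem_Icc.2 hcd, hxd⟩
      rw [le_antisymm hr.1.2 this]

/-- A translation frozen at the right end. Its difference from the original integral consists of two
boundary terms of length `r`. -/
theorem integral_comp_min_add {F : ℝ → ℝ} {Λ r : ℝ} (hr : 0 ≤ r) (hrΛ : r ≤ Λ)
    (hF : IntegrableOn F (Icc 0 Λ)) :
    IntegrableOn (fun x => F (min (x + r) Λ)) (Icc 0 Λ) ∧
    ∫ x in Icc 0 Λ, F (min (x + r) Λ) =
      (∫ x in Icc 0 Λ, F x) - (∫ x in Icc 0 r, F x) + r * F Λ := by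
  have hΛ : 0 ≤ Λ := hr.trans hrΛ
  have hF' : IntervalIntegrable F volume 0 Λ :=
    (intervalIntegrable_iff_integrableOn_Icc_of_le hΛ).2 hF
  have hFr : IntervalIntegrable F volume r Λ := hF'.mono_set (by
    rw [uIcc_of_le hΛ, uIcc_of_le hrΛ]; exact Icc_subset_Icc hr le_rfl)
  have hF0 : IntervalIntegrable F volume 0 r := hF'.mono_set (by
    rw [uIcc_of_le hΛ, uIcc_of_le hr]; exact Icc_subset_Icc le_rfl hrΛ)
  have hs := hFr.comp_add_right r
  rw [sub_self] at hs
  have i1 : IntervalIntegrable (fun x => F (min (x + r) Λ)) volume 0 (Λ - r) := by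
    refine hs.congr fun x hx => ?_
    rw [uIoc_of_le (by linarith)] at hx
    rw [min_eq_left (by linarith [hx.2])]
  have i2 : IntervalIntegrable (fun x => F (min (x + r) Λ)) volume (Λ - r) Λ := by
    refine (intervalIntegrable_const (c := F Λ)).congr fun x hx => ?_
    rw [uIoc_of_le (by linarith)] at hx
    rw [min_eq_right (by linarith [hx.1])]
  refine ⟨(intervalIntegrable_iff_integrableOn_Icc_of_le hΛ).1 (i1.trans i2), ?_⟩
  simp only [integral_Icc_eq_integral_Ioc]
  rw [← intervalIntegral.integral_of_le hΛ, ← intervalIntegral.integral_of_le hΛ,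
    ← intervalIntegral.integral_of_le hr, ← intervalIntegral.integral_add_adjacent_intervals i1 i2]
  have e1 : ∫ x in (0 : ℝ)..(Λ - r), F (min (x + r) Λ) = ∫ x in r..Λ, F x := by
    have : ∫ x in (0 : ℝ)..(Λ - r), F (min (x + r) Λ) = ∫ x in (0 : ℝ)..(Λ - r), F (x + r) := by
      refine intervalIntegral.integral_congr fun x hx => ?_
      rw [uIcc_of_le (by linarith)] at hx
      rw [min_eq_left (by linarith [hx.2])]
    rw [this, intervalIntegral.integral_comp_add_right]
    simp
  have e2 : ∫ x in (Λ - r)..Λ, F (min (x + r) Λ) = r * F Λ := by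
    have : ∫ x in (Λ - r)..Λ, F (min (x + r) Λ) = ∫ x in (Λ - r)..Λ, F Λ := by
      refine intervalIntegral.integral_congr fun x hx => ?_
      rw [uIcc_of_le (by linarith)] at hx
      rw [min_eq_right (by linarith [hx.1])]
    rw [this, intervalIntegral.integral_const]
    simp
  rw [e1, e2, ← intervalIntegral.integral_add_adjacent_intervals hF0 hFr]
  ring

/-- If the forward increments of a lower semicontinuous function are controlled by those of `v` and
by an integrable slope `e`, then so is its total decrease. -/
theorem sub_le_of_forward_increments {f v e : ℝ → ℝ} {Λ A : ℝ} (hΛ : 0 < Λ) (hA : 0 ≤ A)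
    (hf : IntegrableOn f (Icc 0 Λ)) (hv : IntegrableOn v (Icc 0 Λ)) (he : IntegrableOn e (Icc 0 Λ))
    (hlsc : LowerSemicontinuousWithinAt f (Icc 0 Λ) 0) (hv0 : ∀ x ∈ Icc 0 Λ, 0 ≤ v x)
    (hinc : ∃ δ > 0, ∀ r, 0 < r → r < δ → ∀ᵐ x ∂volume.restrict (Icc 0 Λ),
      f x - f (min (x + r) Λ) ≤ A * (v (min (x + r) Λ) - v x) + e x * r) :
    f 0 - f Λ ≤ A * v Λ + ∫ x in Icc 0 Λ, e x := by
  obtain ⟨δ, hδ, H⟩ := hinc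
  refine le_of_forall_pos_le_add fun η hη => ?_
  obtain ⟨δ', hδ', H'⟩ := Metric.eventually_nhds_iff.1
    (eventually_nhdsWithin_iff.1 (hlsc (f 0 - η) (by linarith)))
  obtain ⟨r, hr0, hr⟩ := exists_between (lt_min hδ (lt_min hδ' hΛ))
  have hrδ := lt_min_iff.1 hr
  have hrδ' := lt_min_iff.1 hrδ.2
  have h1 := integral_comp_min_add hr0.le hrδ'.2.le hf
  have h2 := integral_comp_min_add hr0.le hrδ'.2.le hv
  -- The increment inequality for one fixed step `r` is integrated in `x`. The increments telescope
  -- to boundary terms of order `r`, so no derivative of `f` is needed.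
  have hI := integral_mono_ae (hf.sub h1.1) (((h2.1.sub hv).const_mul A).add (he.mul_const r))
    (H r hr0 hrδ.1)
  have e1 : ∫ x in Icc 0 Λ, (f - fun x => f (min (x + r) Λ)) x =
      (∫ x in Icc 0 r, f x) - r * f Λ := by
    simp only [Pi.sub_apply]
    rw [integral_sub hf h1.1, h1.2]; ring
  have e2 : ∫ x in Icc 0 Λ, ((fun x => A * ((fun x => v (min (x + r) Λ)) - v) x) +
      fun x => e x * r) x = A * (r * v Λ - ∫ x in Icc 0 r, v x) + (∫ x in Icc 0 Λ, e x) * r := by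
    simp only [Pi.add_apply, Pi.sub_apply]
    have i1 : IntegrableOn (fun x => A * (v (min (x + r) Λ) - v x)) (Icc 0 Λ) :=
      (h2.1.sub hv).const_mul A
    rw [integral_add i1 (he.mul_const r), integral_const_mul,
      integral_sub h2.1 hv, h2.2, integral_mul_const]
    ring
  have hI' : (∫ x in Icc 0 r, f x) - r * f Λ ≤
      A * (r * v Λ - ∫ x in Icc 0 r, v x) + (∫ x in Icc 0 Λ, e x) * r := by
    rw [← e1, ← e2]; exact hI
  have hsub : Icc 0 r ⊆ Icc 0 Λ := Icc_subset_Icc le_rfl hrδ'.2.le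
  have hvr : 0 ≤ ∫ x in Icc 0 r, v x :=
    setIntegral_nonneg measurableSet_Icc fun x hx => hv0 x (hsub hx)
  -- Lower semicontinuity at 0 bounds the average of `f` over `[0,r]` from below by `f 0 - η`.
  have hfr : r * (f 0 - η) ≤ ∫ x in Icc 0 r, f x := by
    have := setIntegral_mono_on (μ := volume) (f := fun _ => f 0 - η) (g := f) (s := Icc 0 r)
      (by simp) (hf.mono_set hsub) measurableSet_Icc fun x hx =>
        (H' (by rw [Real.dist_eq, sub_zero, abs_of_nonneg hx.1]; linarith [hx.2]) (hsub hx)).le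
    simpa [hr0.le] using this
  have hAv : 0 ≤ A * ∫ x in Icc 0 r, v x := mul_nonneg hA hvr
  have : r * (f 0 - η - f Λ) ≤ r * (A * v Λ + ∫ x in Icc 0 Λ, e x) := by nlinarith
  have := le_of_mul_le_mul_left this hr0
  linarith

theorem exists_setLIntegral_Icc_lt {κ : ℝ → ℝ≥0∞} {c d : ℝ} (hκ : ∫⁻ s in Icc c d, κ s ≠ ⊤)
    {ε : ℝ} (hε : 0 < ε) : ∃ δ > 0, ∀ x ∈ Icc c d, ∀ y ∈ Icc c d, x ≤ y → y - x < δ →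
      ∫⁻ s in Icc x y, κ s < ENNReal.ofReal ε := by
  obtain ⟨δ, hδ, H⟩ := exists_pos_setLIntegral_lt_of_measure_lt hκ
    (ε := ENNReal.ofReal ε) (by simpa using hε)
  obtain ⟨δ', hδ', hlt⟩ := ENNReal.lt_iff_exists_real_btwn.1 hδ
  refine ⟨δ', by simpa using hlt.1, fun x hx y hy hxy hd => ?_⟩
  have hsub : Icc x y ⊆ Icc c d := Icc_subset_Icc hx.1 hy.2
  have := H (Icc x y) (by
    rw [Measure.restrict_apply measurableSet_Icc, inter_eq_left.2 hsub, Real.volume_Icc]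
    exact (ENNReal.ofReal_le_ofReal hd.le).trans_lt hlt.2)
  rwa [Measure.restrict_restrict measurableSet_Icc, inter_eq_left.2 hsub] at this

/-- Additive interval functions with small values on short intervals have continuous primitives. -/
theorem continuousOn_toReal_of_additive {A : ℝ → ℝ → ℝ≥0∞} {c d : ℝ} (hfin : A c d ≠ ⊤)
    (hadd : ∀ x y z, c ≤ x → x ≤ y → y ≤ z → z ≤ d → A x y + A y z = A x z)
    (hsmall : ∀ ε > 0, ∃ δ > 0, ∀ x ∈ Icc c d, ∀ y ∈ Icc c d, x ≤ y → y - x < δ →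
      A x y < ENNReal.ofReal ε) :
    ContinuousOn (fun r => (A c r).toReal) (Icc c d) := by
  have hsub : ∀ x ∈ Icc c d, ∀ y ∈ Icc c d, x ≤ y →
      (A c y).toReal - (A c x).toReal = (A x y).toReal := by
    intro x hx y hy hxy
    have h1 := hadd c x y le_rfl hx.1 hxy hy.2
    have h2 : A c y ≠ ⊤ := ne_top_of_le_ne_top hfin
      (le_self_add.trans_eq (hadd c y d le_rfl hy.1 hy.2 le_rfl))
    rw [← h1] at h2 ⊢
    rw [ENNReal.toReal_add (ENNReal.add_ne_top.1 h2).1 (ENNReal.add_ne_top.1 h2).2]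
    ring
  refine Metric.continuousOn_iff.2 fun s hs ε hε => ?_
  obtain ⟨δ, hδ, H⟩ := hsmall ε hε
  have key : ∀ x ∈ Icc c d, ∀ y ∈ Icc c d, x ≤ y → y - x < δ →
      |(A c y).toReal - (A c x).toReal| < ε := by
    intro x hx y hy hxy hlt
    rw [hsub x hx y hy hxy, abs_of_nonneg ENNReal.toReal_nonneg]
    exact (ENNReal.lt_ofReal_iff_toReal_lt (ne_top_of_lt (H x hx y hy hxy hlt))).1
      (H x hx y hy hxy hlt)
  refine ⟨δ, hδ, fun r hr hrs => ?_⟩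
  rw [Real.dist_eq] at hrs ⊢
  rcases le_total s r with h | h
  · exact key s hs r hr h ((le_abs_self _).trans_lt hrs)
  · rw [abs_sub_comm] at hrs ⊢
    exact key r hr s hs h ((le_abs_self _).trans_lt hrs)

namespace RateIndependentSystem

variable {V : Type*} [NormedAddCommGroup V] [NormedSpace ℝ V] {S : RateIndependentSystem V}

/-! ### The chain rule inequality at a fixed time -/

theorem Standing.energy_comp_lsc (hS : S.Standing) {tt : ℝ → ℝ} {θ : ℝ → V} {K : Set ℝ}
    (htc : ContinuousOn tt K) (htm : MapsTo tt K (Icc 0 S.T)) (hθ : ContinuousOn θ K)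
    (hm : MapsTo θ K S.D) : LowerSemicontinuousOn (fun s => S.energy (tt s) (θ s)) K := by
  intro s hs y hy
  have h := hS.energy_lsc (tt s, θ s) ⟨htm hs, hm hs⟩ y hy
  have hc : Tendsto (fun s => (tt s, θ s)) (𝓝[K] s) (𝓝[Icc 0 S.T ×ˢ S.D] (tt s, θ s)) := by
    refine tendsto_nhdsWithin_iff.2 ⟨(htc s hs).prodMk_nhds (hθ s hs), ?_⟩
    filter_upwards [self_mem_nhdsWithin] with r hr using ⟨htm hr, hm hr⟩
  exact hc.eventually h

theorem Standing.energy_le_of_mem (hS : S.Standing) {E t : ℝ} (ht : t ∈ Icc 0 S.T) {u : V}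
    (hu : u ∈ S.sublevel E) : S.energy t u ≤ E := by
  linarith [hu.2 t ht, hS.Psi_nonneg u]

/-- The chain rule inequality along curves of finite length. -/
theorem Standing.energy_sub_le_of_length (hS : S.Standing) {E t : ℝ} (hE : 0 < E)
    (ht : t ∈ Icc 0 S.T) {θ : ℝ → V} {c d : ℝ} (hcd : c < d)
    (hθ : S.IsPsiAC (S.sublevel E) θ c d) {κ : ℝ → ℝ≥0∞} (hκm : Measurable κ)
    (hκ : ∫⁻ s in Icc c d, κ s ≠ ⊤)
    (hlen : ∀ x y, c ≤ x → x < y → y ≤ d → ‖θ y - θ x‖ₑ ≤ ∫⁻ s in Icc x y, κ s) :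
    ENNReal.ofReal (S.energy t (θ c) - S.energy t (θ d)) ≤
      S.psiVar θ c d + ∫⁻ s in Icc c d, S.slope t (θ s) * κ s := by
  rcases eq_or_ne (∫⁻ s in Icc c d, S.slope t (θ s) * κ s) ⊤ with hI | hI
  · simp [hI]
  have hvfin := hθ.psiVar_ne_top
  -- The length bound `l` becomes the new parameter, so that the curve is 1-Lipschitz in norm.
  set l : ℝ → ℝ := fun r => (∫⁻ s in Icc c r, κ s).toReal with hl
  have hκr : ∀ x y, c ≤ x → y ≤ d → ∫⁻ s in Icc x y, κ s ≠ ⊤ := fun x y hx hy =>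
    ne_top_of_le_ne_top hκ (lintegral_mono_set (Icc_subset_Icc hx hy))
  have hsub : ∀ x y, c ≤ x → x ≤ y → y ≤ d →
      l y - l x = (∫⁻ s in Icc x y, κ s).toReal := by
    intro x y hx hxy hy
    simp only [hl]
    rw [← setLIntegral_Icc_add κ hx hxy, ENNReal.toReal_add (hκr _ _ le_rfl (hxy.trans hy))
      (hκr _ _ hx hy)]
    ring
  have hlc : l c = 0 := by simp [hl]
  have hmono : MonotoneOn l (Icc c d) := fun x hx y hy hxy => by
    have := hsub x y hx.1 hxy hy.2
    linarith [ENNReal.toReal_nonneg (a := ∫⁻ s in Icc x y, κ s)]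
  have hcont : ContinuousOn l (Icc c d) :=
    continuousOn_toReal_of_additive (A := fun x y => ∫⁻ s in Icc x y, κ s) hκ
      (fun x y z _ hxy hyz _ => setLIntegral_Icc_add κ hxy hyz)
      (fun ε hε => exists_setLIntegral_Icc_lt hκ hε)
  have hnorm : ∀ x y, c ≤ x → x ≤ y → y ≤ d → ‖θ y - θ x‖ ≤ l y - l x := by
    intro x y hx hxy hy
    rcases hxy.eq_or_lt with rfl | hxy
    · simp
    rw [hsub x y hx hxy.le hy, ← toReal_enorm]
    exact ENNReal.toReal_mono (hκr _ _ hx hy) (hlen x y hx hxy hy)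
  have heq : ∀ x ∈ Icc c d, ∀ y ∈ Icc c d, l x = l y → θ x = θ y := by
    intro x hx y hy hxy
    rcases le_total x y with h | h
    · have := hnorm x y hx.1 h hy.2
      rw [hxy, sub_self] at this
      exact (sub_eq_zero.1 (norm_le_zero_iff.1 this)).symm
    · have := hnorm y x hy.1 h hx.2
      rw [hxy, sub_self] at this
      exact sub_eq_zero.1 (norm_le_zero_iff.1 this)
  have hcmem : c ∈ Icc c d := left_mem_Icc.2 hcd.le
  have hdmem : d ∈ Icc c d := right_mem_Icc.2 hcd.le
  set Λ := l d with hΛ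
  have hΛ0 : 0 ≤ Λ := hlc ▸ hmono hcmem hdmem hcd.le
  rcases hΛ0.eq_or_lt with h0 | hΛpos
  · rw [heq c hcmem d hdmem (by rw [hlc, h0])]
    simp
  have hsurj : ∀ x, ∃ r, x ∈ Icc 0 Λ → r ∈ Icc c d ∧ l r = x := by
    intro x
    by_cases hx : x ∈ Icc 0 Λ
    · obtain ⟨r, hr, hrx⟩ := intermediate_value_Icc hcd.le hcont (show x ∈ Icc (l c) (l d) by
        rwa [hlc])
      exact ⟨r, fun _ => ⟨hr, hrx⟩⟩
    · exact ⟨0, fun h => absurd h hx⟩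
  -- An arbitrary right inverse of `l` is enough: `θ` is constant wherever `l` is, so `θ ∘ ρ` does
  -- not depend on the choice.
  choose ρ hρ using hsurj
  have hρl : ∀ r ∈ Icc c d, θ (ρ (l r)) = θ r := by
    intro r hr
    have hmem : l r ∈ Icc 0 Λ := ⟨hlc ▸ hmono hcmem hr hr.1, hmono hr hdmem hr.2⟩
    exact heq _ (hρ _ hmem).1 _ hr (hρ _ hmem).2
  have hρmono : ∀ x ∈ Icc 0 Λ, ∀ y ∈ Icc 0 Λ, x ≤ y → ρ x ≤ ρ y := by
    intro x hx y hy hxy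
    rcases hxy.eq_or_lt with rfl | hxy
    · exact le_rfl
    by_contra hlt
    have := hmono (hρ y hy).1 (hρ x hx).1 (not_le.1 hlt).le
    rw [(hρ x hx).2, (hρ y hy).2] at this
    linarith
  have hlip : ∀ x ∈ Icc 0 Λ, ∀ y ∈ Icc 0 Λ, x ≤ y → ‖θ (ρ y) - θ (ρ x)‖ ≤ y - x := by
    intro x hx y hy hxy
    have := hnorm _ _ (hρ x hx).1.1 (hρmono x hx y hy hxy) (hρ y hy).1.2
    rwa [(hρ x hx).2, (hρ y hy).2] at this
  have hθc : ContinuousOn (fun x => θ (ρ x)) (Icc 0 Λ) := by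
    refine Metric.continuousOn_iff.2 fun s hs ε hε => ⟨ε, hε, fun r hr hrs => ?_⟩
    rw [Real.dist_eq] at hrs
    rcases le_total s r with h | h
    · rw [dist_eq_norm]
      exact (hlip s hs r hr h).trans_lt ((le_abs_self _).trans_lt hrs)
    · rw [dist_comm, dist_eq_norm]
      rw [abs_sub_comm] at hrs
      exact (hlip r hr s hs h).trans_lt ((le_abs_self _).trans_lt hrs)
  have hmaps : MapsTo (fun x => θ (ρ x)) (Icc 0 Λ) (S.sublevel E) := fun x hx => hθ.1 (hρ x hx).1
  set f : ℝ → ℝ := fun x => S.energy t (θ (ρ x)) with hf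
  set e : ℝ → ℝ≥0∞ := fun x => S.slope t (θ (ρ x)) with he
  set v : ℝ → ℝ := fun x => (S.psiVar θ c (ρ x)).toReal with hv
  have hflsc : LowerSemicontinuousOn f (Icc 0 Λ) :=
    hS.energy_comp_lsc (tt := fun _ => t) continuousOn_const (fun _ _ => ht) hθc
      fun x hx => (hmaps hx).1
  have helsc : LowerSemicontinuousOn e (Icc 0 Λ) :=
    hS.slope_comp_lsc (tt := fun _ => t) hE continuousOn_const hθc (fun _ _ => ht) hmaps
  have hem := helsc.aemeasurable_restrict measurableSet_Icc
  have hvr : ∀ r ∈ Icc c d, S.psiVar θ c r ≠ ⊤ := fun r hr =>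
    ne_top_of_le_ne_top hvfin (psiVar_mono θ le_rfl hr.1 hr.2)
  have hfint : IntegrableOn f (Icc 0 Λ) := by
    obtain ⟨B, hB⟩ := hflsc.bddBelow_of_isCompact isCompact_Icc
    refine Integrable.of_bound
      (hflsc.aemeasurable_restrict measurableSet_Icc).aestronglyMeasurable (max |B| |E|) ?_
    filter_upwards [ae_restrict_mem measurableSet_Icc] with x hx
    have h1 : B ≤ f x := hB ⟨x, hx, rfl⟩
    have h2 : f x ≤ E := hS.energy_le_of_mem ht (hmaps hx)
    exact abs_le_max_abs_abs h1 h2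
  have hvmono : MonotoneOn v (Icc 0 Λ) := fun x hx y hy hxy =>
    ENNReal.toReal_mono (hvr _ (hρ y hy).1)
      (psiVar_mono θ le_rfl (hρ x hx).1.1 (hρmono x hx y hy hxy))
  have hvint : IntegrableOn v (Icc 0 Λ) := hvmono.integrableOn_isCompact isCompact_Icc
  -- The image of `κ ds` under `l` is Lebesgue measure on `[0,Λ]`, which turns the slope integral in
  -- the length parameter into the integral of slope times `κ`.
  have hmap := map_withDensity_of_primitive (κ := κ) hcd.le hmono hcont (fun r hr => by
    rw [hlc, sub_zero]; exact (ENNReal.ofReal_toReal (hκr _ _ le_rfl hr.2)).symm)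
  rw [hlc] at hmap
  have hlae : AEMeasurable l ((volume.restrict (Icc c d)).withDensity κ) :=
    (hcont.aemeasurable measurableSet_Icc).mono_ac (withDensity_absolutelyContinuous _ _)
  have heint : ∫⁻ x in Icc 0 Λ, e x = ∫⁻ s in Icc c d, S.slope t (θ s) * κ s := by
    have hem' : AEMeasurable e (Measure.map l ((volume.restrict (Icc c d)).withDensity κ)) := by
      rw [hmap]; exact hem
    rw [← hmap, lintegral_map' hem' hlae,
      lintegral_withDensity_eq_lintegral_mul₀' (g := fun a => e (l a)) hκm.aemeasurable
        (hem'.comp_aemeasurable hlae)]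
    refine setLIntegral_congr_fun measurableSet_Icc fun s hs => ?_
    simp only [Pi.mul_apply, he, hρl s hs, mul_comm]
  have hefin : ∫⁻ x in Icc 0 Λ, e x ≠ ⊤ := heint ▸ hI
  have heint' : IntegrableOn (fun x => (e x).toReal) (Icc 0 Λ) :=
    integrable_toReal_of_lintegral_ne_top hem hefin
  have hetop := ae_lt_top' hem hefin
  -- Finite slope holds almost everywhere in the length parameter. At such points the basic energy
  -- inequality is exactly the forward increment bound, with factor `1 + ε` in front of Ψ and with
  -- norm increment at most `r`.
  have main : ∀ ε > 0, f 0 - f Λ ≤ (1 + ε) * v Λ + ∫ x in Icc 0 Λ, (e x).toReal := by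
    intro ε hε
    refine sub_le_of_forward_increments hΛpos (by linarith) hfint hvint heint'
      (hflsc 0 ⟨le_rfl, hΛ0⟩) (fun _ _ => ENNReal.toReal_nonneg) ?_
    obtain ⟨δ, hδ, H⟩ := hS.exists_energy_sub_le hE hε
    refine ⟨δ, hδ, fun r hr0 hrδ => ?_⟩
    filter_upwards [hetop, ae_restrict_mem measurableSet_Icc] with x hx1 hx
    set y := min (x + r) Λ with hy
    have hxy : x ≤ y := le_min (by linarith) hx.2
    have hyr : y - x ≤ r := by linarith [min_le_left (x + r) Λ]
    have hymem : y ∈ Icc 0 Λ := ⟨hx.1.trans hxy, min_le_right _ _⟩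
    have hn := (hlip x hx y hymem hxy).trans hyr
    have h1 := H t ht _ (hmaps hx) _ (hmaps hymem) (hn.trans_lt hrδ) hx1.ne
    have h2 : S.Psi (θ (ρ y) - θ (ρ x)) ≤ v y - v x := by
      have hle := hρmono x hx y hymem hxy
      rcases hle.eq_or_lt with heq' | hlt
      · simp [hv, heq', hS.Psi_zero]
      have h3 := hS.psiVar_add θ (hρ x hx).1.1 hle
      have h4 := (psiCost_le_psiVar (S := S) θ hlt)
      have h5 : S.psiVar θ (ρ x) (ρ y) ≠ ⊤ := by
        refine ne_top_of_le_ne_top (hvr _ (hρ y hymem).1) ?_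
        rw [← h3]; exact le_add_self
      simp only [hv]
      rw [← h3, ENNReal.toReal_add (hvr _ (hρ x hx).1) h5]
      have := (ENNReal.ofReal_le_iff_le_toReal h5).1 h4
      linarith
    have h6 : (e x).toReal * ‖θ (ρ y) - θ (ρ x)‖ ≤ (e x).toReal * r := by gcongr
    have h7 : (1 + ε) * S.Psi (θ (ρ y) - θ (ρ x)) ≤ (1 + ε) * (v y - v x) := by gcongr
    simp only [hf]
    exact h1.trans (add_le_add h7 h6)
  have hf0 : f 0 = S.energy t (θ c) := by
    simp only [hf]; rw [← hρl c hcmem, hlc]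
  have hfΛ : f Λ = S.energy t (θ d) := by
    simp only [hf]; rw [← hρl d hdmem]
  have hvΛ : v Λ ≤ (S.psiVar θ c d).toReal :=
    ENNReal.toReal_mono hvfin (psiVar_mono θ le_rfl (hρ Λ ⟨hΛ0, le_rfl⟩).1.1
      (hρ Λ ⟨hΛ0, le_rfl⟩).1.2)
  have hv0 : 0 ≤ v Λ := ENNReal.toReal_nonneg
  have final : S.energy t (θ c) - S.energy t (θ d) ≤
      (S.psiVar θ c d).toReal + (∫⁻ s in Icc c d, S.slope t (θ s) * κ s).toReal := by
    rw [← heint, ← hf0, ← hfΛ, ← integral_toReal hem hetop]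
    refine le_of_forall_pos_le_add fun η hη => ?_
    have := main (η / (v Λ + 1)) (by positivity)
    have h8 : η / (v Λ + 1) * v Λ ≤ η := by
      rw [div_mul_eq_mul_div, div_le_iff₀ (by positivity)]
      nlinarith
    linarith
  rw [← ENNReal.ofReal_toReal hvfin, ← ENNReal.ofReal_toReal hI,
    ← ENNReal.ofReal_add ENNReal.toReal_nonneg ENNReal.toReal_nonneg]
  exact ENNReal.ofReal_le_ofReal final

/-- A positive lower bound of the slope turns finite dissipation into finite length, so the chain
rule for curves of finite length applies. The end point `d` is left out because the slope may vanish
there. -/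
theorem IsRegularCurve.energy_sub_le_of_slope_ge [CompleteSpace V] {E t c d : ℝ} {θ : ℝ → V}
    (h : S.IsRegularCurve E (fun _ => t) θ c d) (hV : HasRadonNikodymProperty V) (hS : S.Standing)
    (hE : 0 < E) (hcd : c < d) {q : ℝ≥0∞} (hq : q ≠ 0)
    (hslope : ∀ r ∈ Ico c d, q ≤ S.slope t (θ r))
    (hfin : ∫⁻ s in Icc c d, S.slope t (θ s) * ‖deriv θ s‖ₑ ≠ ⊤) :
    ENNReal.ofReal (S.energy t (θ c) - S.energy t (θ d)) ≤
      S.psiVar θ c d + ∫⁻ s in Icc c d, S.slope t (θ s) * ‖deriv θ s‖ₑ := by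
  have ht : t ∈ Icc 0 S.T := h.mapsTo (left_mem_Icc.2 hcd.le)
  have hcont := h.continuousOn hS hE
  let _ : MeasurableSpace V := borel V
  have _ : BorelSpace V := ⟨rfl⟩
  refine hS.energy_sub_le_of_length hE ht hcd h.psiAC (measurable_deriv θ).enorm ?_ ?_
  · have hle : q * ∫⁻ s in Icc c d, ‖deriv θ s‖ₑ ≤
        ∫⁻ s in Icc c d, S.slope t (θ s) * ‖deriv θ s‖ₑ := by
      rw [← lintegral_const_mul _ (measurable_deriv θ).enorm, ← restrict_Ico_eq_restrict_Icc]
      exact setLIntegral_mono' measurableSet_Ico fun s hs => by gcongr; exact hslope s hs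
    intro htop
    rw [htop, ENNReal.mul_top hq] at hle
    exact hfin (top_le_iff.1 hle)
  · have key : ∀ x y, c ≤ x → x < y → y < d →
        ‖θ y - θ x‖ₑ ≤ ∫⁻ s in Icc x y, ‖deriv θ s‖ₑ := by
      intro x y hx hxy hy
      refine enorm_sub_le_lintegral_deriv hV hxy (h.locallyAC x y hxy fun r hr => ?_)
      have hr' : r ∈ Ico c d := ⟨hx.trans hr.1, hr.2.trans_lt hy⟩
      exact ⟨Ico_subset_Icc_self hr', (pos_iff_ne_zero.2 hq).trans_le (hslope r hr')⟩
    -- Intervals ending at `d` need not lie in the unstable set; the length bound extends to them by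
    -- continuity of `θ`.
    intro x y hx hxy hy
    rcases hy.lt_or_eq with hy | rfl
    · exact key x y hx hxy hy
    have hlim : Tendsto (fun r => ‖θ r - θ x‖ₑ) (𝓝[<] y) (𝓝 ‖θ y - θ x‖ₑ) := by
      have h1 : Tendsto θ (𝓝[Icc c y] y) (𝓝 (θ y)) := hcont y (right_mem_Icc.2 hcd.le)
      have h2 : 𝓝[<] y ≤ 𝓝[Icc c y] y := by
        rw [← nhdsWithin_Ico_eq_nhdsLT hcd]
        exact nhdsWithin_mono _ Ico_subset_Icc_self
      exact ((h1.mono_left h2).sub_const _).enorm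
    refine le_of_tendsto hlim ?_
    filter_upwards [Ioo_mem_nhdsLT hxy] with r hr
    exact (key x r hx hr.1 hr.2).trans (lintegral_mono_set (Icc_subset_Icc le_rfl hr.2.le))

theorem IsRegularCurve.exists_slope_ge {E : ℝ} {tt : ℝ → ℝ} {θ : ℝ → V} {c d : ℝ}
    (h : S.IsRegularCurve E tt θ c d) (hS : S.Standing) (hE : 0 < E) (hcd : c ≤ d)
    (hsub : Icc c d ⊆ S.unstableSet tt θ c d) :
    ∃ q : ℝ≥0∞, q ≠ 0 ∧ ∀ r ∈ Icc c d, q ≤ S.slope (tt r) (θ r) := by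
  obtain ⟨x, hx, hmin⟩ := (h.slope_lsc hS hE).exists_isMinOn (nonempty_Icc.2 hcd) isCompact_Icc
  refine ⟨S.slope (tt x) (θ x), ?_, fun r hr => hmin hr⟩
  exact (hsub hx).2.ne'

/-- The chain rule inequality up to the end point of a component of the unstable set. -/
theorem IsRegularCurve.energy_sub_le_of_unstable [CompleteSpace V] {E t c d : ℝ} {θ : ℝ → V}
    (h : S.IsRegularCurve E (fun _ => t) θ c d) (hV : HasRadonNikodymProperty V) (hS : S.Standing)
    (hE : 0 < E) (hcd : c < d) (hsub : Ico c d ⊆ S.unstableSet (fun _ => t) θ c d)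
    (hfin : ∫⁻ s in Icc c d, S.slope t (θ s) * ‖deriv θ s‖ₑ ≠ ⊤) :
    ENNReal.ofReal (S.energy t (θ c) - S.energy t (θ d)) ≤
      S.psiVar θ c d + ∫⁻ s in Icc c d, S.slope t (θ s) * ‖deriv θ s‖ₑ := by
  have ht : t ∈ Icc 0 S.T := h.mapsTo (left_mem_Icc.2 hcd.le)
  have hcompact : ∀ x ∈ Ico c d, ∃ q : ℝ≥0∞, q ≠ 0 ∧ ∀ r ∈ Icc c x,
      q ≤ S.slope t (θ r) := fun x hx =>
    (h.mono le_rfl hx.2.le).exists_slope_ge hS hE hx.1 fun r hr =>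
      ⟨hr, (hsub ⟨hr.1, hr.2.trans_lt hx.2⟩).2⟩
  -- Near `d` either the slope stays above 1, and the length is finite, or there are points
  -- arbitrarily close to `d` with slope below 1. In the second case the curve is followed to such a
  -- point, and the small remaining step to `d` is handled directly by the basic energy inequality.
  by_cases hA : ∃ x ∈ Ico c d, ∀ r ∈ Ico x d, 1 ≤ S.slope t (θ r)
  · obtain ⟨x, hx, hx1⟩ := hA
    obtain ⟨q, hq0, hq⟩ := hcompact x hx
    refine h.energy_sub_le_of_slope_ge hV hS hE hcd (q := min 1 q)
      (lt_min one_pos (pos_iff_ne_zero.2 hq0)).ne'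
      (fun r hr => ?_) hfin
    rcases le_total r x with hrx | hrx
    · exact (min_le_right _ _).trans (hq r ⟨hr.1, hrx⟩)
    · exact (min_le_left _ _).trans (hx1 r ⟨hrx, hr.2⟩)
  push Not at hA
  have hcont := h.continuousOn hS hE
  obtain ⟨δ, hδ, H⟩ := hS.exists_energy_sub_le hE one_pos
  have hlim : Tendsto (fun r => ENNReal.ofReal ((1 + 1) * S.Psi (θ d - θ r) + ‖θ d - θ r‖))
      (𝓝[<] d) (𝓝 0) := by
    have h1 : Tendsto θ (𝓝[Icc c d] d) (𝓝 (θ d)) := hcont d (right_mem_Icc.2 hcd.le)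
    have h2 : 𝓝[<] d ≤ 𝓝[Icc c d] d := by
      rw [← nhdsWithin_Ico_eq_nhdsLT hcd]
      exact nhdsWithin_mono _ Ico_subset_Icc_self
    have h3 : Tendsto (fun r => θ d - θ r) (𝓝[<] d) (𝓝 0) := by
      simpa using (h1.mono_left h2).const_sub (θ d)
    have h4 : Tendsto (fun v => ENNReal.ofReal ((1 + 1) * S.Psi v + ‖v‖)) (𝓝 0) (𝓝 0) := by
      have : Continuous fun v => ENNReal.ofReal ((1 + 1) * S.Psi v + ‖v‖) := by
        have := hS.Psi_continuous
        exact ENNReal.continuous_ofReal.comp (by fun_prop)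
      simpa [hS.Psi_zero] using this.tendsto 0
    exact h4.comp h3
  have hdist : ∀ᶠ r in 𝓝[<] d, ‖θ d - θ r‖ < δ := by
    have h1 : Tendsto θ (𝓝[Icc c d] d) (𝓝 (θ d)) := hcont d (right_mem_Icc.2 hcd.le)
    have h2 : 𝓝[<] d ≤ 𝓝[Icc c d] d := by
      rw [← nhdsWithin_Ico_eq_nhdsLT hcd]
      exact nhdsWithin_mono _ Ico_subset_Icc_self
    have h3 : Tendsto (fun r => ‖θ d - θ r‖) (𝓝[<] d) (𝓝 0) := by
      simpa using ((h1.mono_left h2).const_sub (θ d)).norm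
    exact h3.eventually_lt_const hδ
  refine ENNReal.le_of_forall_pos_le_add fun η hη _ => ?_
  have hη' : (0 : ℝ≥0∞) < η := by simpa using hη
  obtain ⟨x₀, hx₀, hx₁⟩ := mem_nhdsLT_iff_exists_Ioo_subset.1
    ((hlim.eventually_lt_const hη').and hdist)
  obtain ⟨r, hr, hr1⟩ := hA ((max c x₀ + d) / 2)
    ⟨by linarith [le_max_left c x₀, max_lt hcd hx₀], by linarith [max_lt hcd hx₀]⟩
  have hrm : max c x₀ < r := by linarith [hr.1, max_lt hcd hx₀]
  have hcr : c < r := (le_max_left _ _).trans_lt hrm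
  obtain ⟨h5, h6⟩ := hx₁ ⟨(le_max_right _ _).trans_lt hrm, hr.2⟩
  have h7 := H t ht (θ r) (h.psiAC.1 ⟨hcr.le, hr.2.le⟩) (θ d)
    (h.psiAC.1 (right_mem_Icc.2 hcd.le)) h6 (ne_top_of_lt hr1)
  have h8 : (S.slope t (θ r)).toReal ≤ 1 :=
    ENNReal.toReal_mono ENNReal.one_ne_top hr1.le
  have h9 : S.energy t (θ r) - S.energy t (θ d) ≤
      (1 + 1) * S.Psi (θ d - θ r) + ‖θ d - θ r‖ := by
    nlinarith [norm_nonneg (θ d - θ r)]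
  obtain ⟨q, hq0, hq⟩ := hcompact r ⟨hcr.le, hr.2⟩
  have hI : ∫⁻ s in Icc c r, S.slope t (θ s) * ‖deriv θ s‖ₑ ≤
      ∫⁻ s in Icc c d, S.slope t (θ s) * ‖deriv θ s‖ₑ :=
    lintegral_mono_set (Icc_subset_Icc le_rfl hr.2.le)
  have h10 := (h.mono le_rfl hr.2.le).energy_sub_le_of_slope_ge hV hS hE hcr hq0
    (fun s hs => hq s (Ico_subset_Icc_self hs)) (ne_top_of_le_ne_top hfin hI)
  calc ENNReal.ofReal (S.energy t (θ c) - S.energy t (θ d))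
      = ENNReal.ofReal ((S.energy t (θ c) - S.energy t (θ r)) +
          (S.energy t (θ r) - S.energy t (θ d))) := by ring_nf
    _ ≤ _ := ENNReal.ofReal_add_le
    _ ≤ _ := add_le_add (h10.trans (add_le_add (psiVar_mono θ le_rfl hcr.le hr.2.le) hI))
        ((ENNReal.ofReal_le_ofReal h9).trans h5.le)

/-- The chain rule inequality at a fixed time. -/
theorem IsRegularCurve.energy_sub_le [CompleteSpace V] {E t c d : ℝ} {θ : ℝ → V}
    (h : S.IsRegularCurve E (fun _ => t) θ c d) (hV : HasRadonNikodymProperty V) (hS : S.Standing)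
    (hE : 0 < E) (hcd : c ≤ d) :
    ENNReal.ofReal (S.energy t (θ c) - S.energy t (θ d)) ≤ S.dissipation (fun _ => t) θ c d := by
  have ht : t ∈ Icc 0 S.T := h.mapsTo (left_mem_Icc.2 hcd)
  rcases eq_or_ne (S.dissipation (fun _ => t) θ c d) ⊤ with htop | hfin
  · simp [htop]
  rw [dissipation, h.setLIntegral_unstableSet hS hE, hS.lintegral_metricDeriv hcd h.psiAC] at hfin ⊢
  obtain ⟨hvfin, hI⟩ := ENNReal.add_ne_top.1 hfin
  set I : ℝ → ℝ → ℝ≥0∞ := fun x y => ∫⁻ s in Icc x y, S.slope t (θ s) * ‖deriv θ s‖ₑ with hIdef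
  -- The factor `1 + ε` comes from the finite steps taken at stable points and is removed at the
  -- end.
  have key : ∀ ε > 0, ENNReal.ofReal (S.energy t (θ c) - S.energy t (θ d)) ≤
      ENNReal.ofReal (1 + ε) * S.psiVar θ c d + I c d := by
    intro ε hε
    set B : ℝ → ℝ → ℝ≥0∞ := fun x y => ENNReal.ofReal (1 + ε) * S.psiVar θ x y + I x y with hB
    have hadd : ∀ x y, c ≤ x → x ≤ y → B c x + B x y = B c y := by
      intro x y hx hxy
      simp only [hB, hIdef]
      rw [← hS.psiVar_add θ hx hxy, ← setLIntegral_Icc_add _ hx hxy]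
      ring
    have hone : (1 : ℝ≥0∞) ≤ ENNReal.ofReal (1 + ε) := by
      rw [← ENNReal.ofReal_one]; exact ENNReal.ofReal_le_ofReal (by linarith)
    have hcomb : ∀ x y, c ≤ x → x ≤ y →
        ENNReal.ofReal (S.energy t (θ c) - S.energy t (θ x)) ≤ B c x →
        ENNReal.ofReal (S.energy t (θ x) - S.energy t (θ y)) ≤ B x y →
        ENNReal.ofReal (S.energy t (θ c) - S.energy t (θ y)) ≤ B c y := by
      intro x y hx hxy h1 h2
      rw [← hadd x y hx hxy]
      refine le_trans ?_ (add_le_add h1 h2)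
      refine le_trans (le_of_eq ?_) ENNReal.ofReal_add_le
      ring_nf
    obtain ⟨δ₀, hδ₀, H⟩ := hS.exists_energy_sub_le hE hε
    have hunif := isCompact_Icc.uniformContinuousOn_of_continuous (h.continuousOn hS hE)
    obtain ⟨δ, hδ, hδu⟩ := Metric.uniformContinuousOn_iff.1 hunif δ₀ hδ₀
    -- At a stable point the slope term disappears, and a jump of any length below a uniform `δ` is
    -- permitted.
    have hstable : ∀ x ∈ Icc c d, ∀ y ∈ Icc c d, x ≤ y → y - x < δ →
        x ∉ S.unstableSet (fun _ => t) θ c d →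
        ENNReal.ofReal (S.energy t (θ x) - S.energy t (θ y)) ≤ B x y := by
      intro x hx y hy hxy hlt hxG
      rcases hxy.eq_or_lt with rfl | hxy
      · simp
      have h0 : S.slope t (θ x) = 0 := by
        by_contra hne
        exact hxG ⟨hx, pos_iff_ne_zero.2 hne⟩
      have hd : ‖θ y - θ x‖ < δ₀ := by
        rw [← dist_eq_norm]
        exact hδu y hy x hx (by rw [Real.dist_eq, abs_of_nonneg (by linarith)]; exact hlt)
      have h1 := H t ht _ (h.psiAC.1 hx) _ (h.psiAC.1 hy) hd (by simp [h0])
      rw [h0] at h1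
      simp only [ENNReal.toReal_zero, zero_mul, add_zero] at h1
      calc _ ≤ ENNReal.ofReal ((1 + ε) * S.Psi (θ y - θ x)) := ENNReal.ofReal_le_ofReal h1
        _ = ENNReal.ofReal (1 + ε) * ENNReal.ofReal (S.Psi (θ y - θ x)) :=
            ENNReal.ofReal_mul (by linarith)
        _ ≤ ENNReal.ofReal (1 + ε) * S.psiVar θ x y := by
            gcongr; exact psiCost_le_psiVar θ hxy
        _ ≤ B x y := le_self_add
    have hunst : ∀ x y, c ≤ x → x < y → y ≤ d →
        Ico x y ⊆ S.unstableSet (fun _ => t) θ c d →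
        ENNReal.ofReal (S.energy t (θ x) - S.energy t (θ y)) ≤ B x y := by
      intro x y hx hxy hy hsub
      have h1 := (h.mono hx hy).energy_sub_le_of_unstable hV hS hE hxy
        (fun r hr => ⟨Ico_subset_Icc_self hr, (hsub hr).2⟩)
        (ne_top_of_le_ne_top hI (lintegral_mono_set (Icc_subset_Icc hx hy)))
      refine h1.trans (add_le_add ?_ le_rfl)
      calc S.psiVar θ x y = 1 * S.psiVar θ x y := (one_mul _).symm
        _ ≤ _ := by gcongr
    -- Continuation argument: `A` is the set of points reached with the desired bound. If `d` were
    -- not in `A`, a stable point of `A` close to its supremum would allow a step beyond the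
    -- supremum.
    set A : Set ℝ := {x | x ∈ Icc c d ∧
      ENNReal.ofReal (S.energy t (θ c) - S.energy t (θ x)) ≤ B c x} with hA
    have hcA : c ∈ A := ⟨left_mem_Icc.2 hcd, by simp⟩
    have hbdd : BddAbove A := ⟨d, fun x hx => hx.1.2⟩
    suffices hd : d ∈ A from hd.2
    by_contra hdA
    have hst : ∀ x ∈ A, x ∉ S.unstableSet (fun _ => t) θ c d → x + δ / 2 ≤ sSup A := by
      intro x hx hxG
      have hxd : x < d := lt_of_le_of_ne hx.1.2 fun h => hdA (h ▸ hx)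
      have hmem : ∀ y ∈ Icc c d, x ≤ y → y - x < δ → y ∈ A := fun y hy hxy hlt =>
        ⟨hy, hcomb x y hx.1.1 hxy hx.2 (hstable x hx.1 y hy hxy hlt hxG)⟩
      have hlt : x + δ / 2 < d := by
        by_contra hge
        exact hdA (hmem d (right_mem_Icc.2 hcd) hxd.le (by linarith))
      exact le_csSup hbdd (hmem _ ⟨by linarith [hx.1.1], hlt.le⟩ (by linarith) (by linarith))
    obtain ⟨x, hxA, hx⟩ := exists_lt_of_lt_csSup ⟨c, hcA⟩
      (show sSup A - δ / 2 < sSup A by linarith)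
    by_cases hxG : x ∈ S.unstableSet (fun _ => t) θ c d
    · set N := {r | r ∈ Icc x d ∧ r ∉ S.unstableSet (fun _ => t) θ c d} with hN
      have hxd : x < d := lt_of_le_of_ne hxA.1.2 fun h => hdA (h ▸ hxA)
      rcases N.eq_empty_or_nonempty with hNe | hNe
      · refine hdA ⟨right_mem_Icc.2 hcd, hcomb x d hxA.1.1 hxd.le hxA.2
          (hunst x d hxA.1.1 hxd le_rfl fun r hr => ?_)⟩
        by_contra hrG
        exact (hNe ▸ (⟨Ico_subset_Icc_self hr, hrG⟩ : r ∈ N) : r ∈ (∅ : Set ℝ))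
      · have hNb : BddBelow N := ⟨x, fun r hr => hr.1.1⟩
        -- The first stable point after `x`. It is itself stable because the unstable set is
        -- relatively open, and `[x, r₀)` is unstable, so the bound extends from `x` to `r₀`.
        set r₀ := sInf N with hr₀
        have hxr : x ≤ r₀ := le_csInf hNe fun r hr => hr.1.1
        have hrd : r₀ ≤ d := by
          obtain ⟨r, hr⟩ := hNe
          exact (csInf_le hNb hr).trans hr.1.2
        have hr₀mem : r₀ ∈ Icc c d := ⟨hxA.1.1.trans hxr, hrd⟩
        have hr₀G : r₀ ∉ S.unstableSet (fun _ => t) θ c d := by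
          intro hG
          obtain ⟨η, hη, hη'⟩ := h.eventually_unstable hS hE hG
          obtain ⟨r, hrN, hr⟩ := exists_lt_of_csInf_lt hNe (show sInf N < r₀ + η by linarith)
          have : r₀ ≤ r := csInf_le hNb hrN
          exact hrN.2 (hη' r ⟨hxA.1.1.trans hrN.1.1, hrN.1.2⟩
            (by rw [abs_of_nonneg (by linarith)]; linarith))
        have hxr' : x < r₀ := lt_of_le_of_ne hxr fun h => hr₀G (h ▸ hxG)
        have hr₀A : r₀ ∈ A := ⟨hr₀mem, hcomb x r₀ hxA.1.1 hxr hxA.2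
          (hunst x r₀ hxA.1.1 hxr' hrd fun r hr => by
            by_contra hrG
            exact absurd (csInf_le hNb ⟨⟨hr.1, hr.2.le.trans hrd⟩, hrG⟩) (not_le.2 hr.2))⟩
        linarith [hst r₀ hr₀A hr₀G]
    · linarith [hst x hxA hxG]
  have hlim : Tendsto (fun ε : ℝ => ENNReal.ofReal (1 + ε) * S.psiVar θ c d + I c d) (𝓝[>] 0)
      (𝓝 (S.psiVar θ c d + I c d)) := by
    have h1 : Tendsto (fun ε : ℝ => ENNReal.ofReal (1 + ε)) (𝓝[>] 0) (𝓝 1) := by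
      have : Continuous fun ε : ℝ => ENNReal.ofReal (1 + ε) :=
        ENNReal.continuous_ofReal.comp (by fun_prop)
      simpa using (this.tendsto 0).mono_left nhdsWithin_le_nhds
    simpa using (ENNReal.Tendsto.mul_const h1 (Or.inr hvfin)).add_const (I c d)
  exact ge_of_tendsto hlim (by filter_upwards [self_mem_nhdsWithin] with ε hε using key ε hε)

end RateIndependentSystem

/-! ### Sums of jumps -/

/-- The sum of the right jumps `R` on `[a,b)` and of the left jumps `L` on `(a,b]`. -/
def jumpSum (L R : ℝ → ℝ≥0∞) (a b : ℝ) : ℝ≥0∞ :=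
  R a + L b + ∑' t : ↥(Ioo a b), (L t + R t)

/-- The left jump at `c` belongs to the first interval and the right jump to the second, so the atom
at `c` is counted exactly once. -/
theorem jumpSum_add (L R : ℝ → ℝ≥0∞) {a c b : ℝ} (hac : a < c) (hcb : c < b) :
    jumpSum L R a c + jumpSum L R c b = jumpSum L R a b := by
  have h1 : Ioo a b = (Ioo a c ∪ {c}) ∪ Ioo c b := by
    rw [Ioo_union_right hac, Ioc_union_Ioo_eq_Ioo hac.le hcb]
  have hd1 : Disjoint (Ioo a c) {c} := by simp
  have hd2 : Disjoint (Ioo a c ∪ {c}) (Ioo c b) := by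
    rw [Ioo_union_right hac]
    exact Set.disjoint_left.2 fun x hx hx' => absurd hx.2 (not_le.2 hx'.1)
  have h2 : ∑' t : ↥(Ioo a b), (L t + R t) = (∑' t : ↥(Ioo a c), (L t + R t)) + (L c + R c) +
      ∑' t : ↥(Ioo c b), (L t + R t) := by
    rw [h1, ENNReal.summable.tsum_union_disjoint (f := fun t => L t + R t) hd2 ENNReal.summable,
      ENNReal.summable.tsum_union_disjoint (f := fun t => L t + R t) hd1 ENNReal.summable,
      tsum_singleton c (fun t => L t + R t)]
  simp only [jumpSum]
  rw [h2]
  ring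

theorem jumpSum_add_fun (L R L' R' : ℝ → ℝ≥0∞) (a b : ℝ) :
    jumpSum (fun t => L t + L' t) (fun t => R t + R' t) a b =
      jumpSum L R a b + jumpSum L' R' a b := by
  simp only [jumpSum]
  rw [show (fun t : ↥(Ioo a b) => L t + L' t + (R t + R' t)) =
    fun t : ↥(Ioo a b) => (L t + R t) + (L' t + R' t) by ext t; ring, ENNReal.tsum_add]
  ring

/-- All but finitely many terms have small total mass, and an interval close enough to `b` avoids
the finitely many exceptions. -/
theorem exists_tsum_Ico_le {f : ℝ → ℝ≥0∞} {a b : ℝ} (hab : a < b)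
    (hf : ∑' t : ↥(Ioo a b), f t ≠ ⊤) {ε : ℝ≥0∞} (hε : 0 < ε) :
    ∃ r ∈ Ioo a b, ∑' t : ↥(Ico r b), f t ≤ ε := by
  rw [tsum_subtype] at hf
  obtain ⟨F, hF⟩ := ((ENNReal.tendsto_tsum_compl_atTop_zero hf).eventually_lt_const hε).exists
  have h1 : ∀ᶠ r in 𝓝[<] b, ∀ x ∈ F, x < b → x < r := by
    refine (Filter.eventually_all_finset F).2 fun x _ => ?_
    by_cases hx : x < b
    · filter_upwards [Ioo_mem_nhdsLT hx] with r hr _ using hr.1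
    · exact Eventually.of_forall fun r h => absurd h hx
  obtain ⟨r, hr, hrab⟩ := (h1.and (Ioo_mem_nhdsLT hab)).exists
  refine ⟨r, hrab, le_trans ?_ hF.le⟩
  change ∑' t : ↥(Ico r b), f t ≤ ∑' x : ↥{x | x ∉ F}, (Ioo a b).indicator f x
  rw [tsum_subtype, tsum_subtype]
  refine ENNReal.tsum_le_tsum fun x => ?_
  by_cases hx : x ∈ Ico r b
  · have hxF : x ∉ F := fun h => absurd (hr x h hx.2) (not_lt.2 hx.1)
    have hxab : x ∈ Ioo a b := ⟨hrab.1.trans_le hx.1, hx.2⟩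
    rw [indicator_of_mem hx, indicator_of_mem (show x ∈ {x | x ∉ F} from hxF),
      indicator_of_mem hxab]
  · simp [indicator_of_notMem hx]

theorem exists_tsum_Ioc_le {f : ℝ → ℝ≥0∞} {a b : ℝ} (hab : a < b)
    (hf : ∑' t : ↥(Ioo a b), f t ≠ ⊤) {ε : ℝ≥0∞} (hε : 0 < ε) :
    ∃ r ∈ Ioo a b, ∑' t : ↥(Ioc a r), f t ≤ ε := by
  rw [tsum_subtype] at hf
  obtain ⟨F, hF⟩ := ((ENNReal.tendsto_tsum_compl_atTop_zero hf).eventually_lt_const hε).exists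
  have h1 : ∀ᶠ r in 𝓝[>] a, ∀ x ∈ F, a < x → r < x := by
    refine (Filter.eventually_all_finset F).2 fun x _ => ?_
    by_cases hx : a < x
    · filter_upwards [Ioo_mem_nhdsGT hx] with r hr _ using hr.2
    · exact Eventually.of_forall fun r h => absurd h hx
  obtain ⟨r, hr, hrab⟩ := (h1.and (Ioo_mem_nhdsGT hab)).exists
  refine ⟨r, hrab, le_trans ?_ hF.le⟩
  change ∑' t : ↥(Ioc a r), f t ≤ ∑' x : ↥{x | x ∉ F}, (Ioo a b).indicator f x
  rw [tsum_subtype, tsum_subtype]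
  refine ENNReal.tsum_le_tsum fun x => ?_
  by_cases hx : x ∈ Ioc a r
  · have hxF : x ∉ F := fun h => absurd (hr x h hx.1) (not_lt.2 hx.2)
    have hxab : x ∈ Ioo a b := ⟨hx.1, hx.2.trans_lt hrab.2⟩
    rw [indicator_of_mem hx, indicator_of_mem (show x ∈ {x | x ∉ F} from hxF),
      indicator_of_mem hxab]
  · simp [indicator_of_notMem hx]

theorem exists_jumpSum_le_left {L R : ℝ → ℝ≥0∞} {a b : ℝ} (hab : a < b)
    (hf : jumpSum L R a b ≠ ⊤) {ε : ℝ≥0∞} (hε : 0 < ε) :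
    ∃ r ∈ Ioo a b, ∀ r' ∈ Ico r b, jumpSum L R r' b ≤ L b + ε := by
  obtain ⟨r, hr, h⟩ := exists_tsum_Ico_le (f := fun t => L t + R t) hab
    (ENNReal.add_ne_top.1 hf).2 hε
  refine ⟨r, hr, fun r' hr' => ?_⟩
  have h1 : R r' + ∑' t : ↥(Ioo r' b), (L t + R t) ≤ ∑' t : ↥(Ico r b), (L t + R t) := by
    have hd : Disjoint {r'} (Ioo r' b) := by simp
    calc R r' + ∑' t : ↥(Ioo r' b), (L t + R t)
        ≤ (L r' + R r') + ∑' t : ↥(Ioo r' b), (L t + R t) := by gcongr; exact le_add_self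
      _ = ∑' t : ↥({r'} ∪ Ioo r' b), (L t + R t) := by
          rw [ENNReal.summable.tsum_union_disjoint (f := fun t => L t + R t) hd ENNReal.summable,
            tsum_singleton r' (fun t => L t + R t)]
      _ ≤ _ := ENNReal.tsum_mono_subtype (fun t => L t + R t) (by
          rw [singleton_union, Ioo_insert_left hr'.2]
          exact Ico_subset_Ico_left hr'.1)
  calc jumpSum L R r' b = L b + (R r' + ∑' t : ↥(Ioo r' b), (L t + R t)) := by
        simp only [jumpSum]; ring
    _ ≤ _ := by gcongr; exact h1.trans h

theorem exists_jumpSum_le_right {L R : ℝ → ℝ≥0∞} {a b : ℝ} (hab : a < b)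
    (hf : jumpSum L R a b ≠ ⊤) {ε : ℝ≥0∞} (hε : 0 < ε) :
    ∃ r ∈ Ioo a b, ∀ r' ∈ Ioc a r, jumpSum L R a r' ≤ R a + ε := by
  obtain ⟨r, hr, h⟩ := exists_tsum_Ioc_le (f := fun t => L t + R t) hab
    (ENNReal.add_ne_top.1 hf).2 hε
  refine ⟨r, hr, fun r' hr' => ?_⟩
  have h1 : (∑' t : ↥(Ioo a r'), (L t + R t)) + L r' ≤ ∑' t : ↥(Ioc a r), (L t + R t) := by
    have hd : Disjoint (Ioo a r') {r'} := by simp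
    calc (∑' t : ↥(Ioo a r'), (L t + R t)) + L r'
        ≤ (∑' t : ↥(Ioo a r'), (L t + R t)) + (L r' + R r') := by gcongr; exact le_self_add
      _ = ∑' t : ↥(Ioo a r' ∪ {r'}), (L t + R t) := by
          rw [ENNReal.summable.tsum_union_disjoint (f := fun t => L t + R t) hd ENNReal.summable,
            tsum_singleton r' (fun t => L t + R t)]
      _ ≤ _ := ENNReal.tsum_mono_subtype (fun t => L t + R t) (by
          rw [Ioo_union_right hr'.1]
          exact Ioc_subset_Ioc_right hr'.2)
  calc jumpSum L R a r' = R a + ((∑' t : ↥(Ioo a r'), (L t + R t)) + L r') := by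
        simp only [jumpSum]; ring
    _ ≤ _ := by gcongr; exact h1.trans h

namespace RateIndependentSystem

variable {V : Type*} [NormedAddCommGroup V] [NormedSpace ℝ V] {S : RateIndependentSystem V}

/-! ### One-sided limits -/

/-- Increments are controlled by a bounded monotone function, which is Cauchy at `q`. On a sublevel
this makes `u` Cauchy in norm, and the sublevel is closed. -/
theorem Standing.exists_tendsto_nhdsLT [CompleteSpace V] (hS : S.Standing) {E : ℝ} (hE : 0 < E)
    {u : ℝ → V} {v : ℝ → ℝ} {p q : ℝ} (hpq : p < q) (hu : MapsTo u (Icc p q) (S.sublevel E))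
    (hv : MonotoneOn v (Icc p q))
    (huv : ∀ x ∈ Icc p q, ∀ y ∈ Icc p q, x < y → S.Psi (u y - u x) ≤ v y - v x) :
    ∃ y ∈ S.sublevel E, Tendsto u (𝓝[<] q) (𝓝 y) := by
  have hc : Cauchy (map u (𝓝[<] q)) := by
    refine Metric.cauchy_iff.2 ⟨inferInstance, fun ε hε => ?_⟩
    obtain ⟨δ, hδ, H⟩ := hS.exists_modulus hE hε
    have hb : BddAbove (v '' Ico p q) := ⟨v q, by
      rintro _ ⟨x, hx, rfl⟩
      exact hv (Ico_subset_Icc_self hx) (right_mem_Icc.2 hpq.le) hx.2.le⟩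
    obtain ⟨_, ⟨r, hr, rfl⟩, hrlt⟩ := exists_lt_of_lt_csSup
      ((nonempty_Ico.2 hpq).image v)
      (show sSup (v '' Ico p q) - δ < sSup (v '' Ico p q) by linarith)
    refine ⟨u '' Ioo r q, image_mem_map (Ioo_mem_nhdsLT hr.2), ?_⟩
    have key : ∀ x ∈ Ioo r q, ∀ y ∈ Ioo r q, x < y → ‖u y - u x‖ < ε := by
      intro x hx y hy hxy
      have hx' : x ∈ Icc p q := ⟨hr.1.trans hx.1.le, hx.2.le⟩
      have hy' : y ∈ Icc p q := ⟨hr.1.trans hy.1.le, hy.2.le⟩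
      refine H _ (hu hx') _ (hu hy') ((huv x hx' y hy' hxy).trans_lt ?_)
      have h1 : v y ≤ sSup (v '' Ico p q) := le_csSup hb ⟨y, ⟨hy'.1, hy.2⟩, rfl⟩
      have h2 : v r ≤ v x := hv (Ico_subset_Icc_self hr) hx' hx.1.le
      linarith
    rintro _ ⟨x, hx, rfl⟩ _ ⟨y, hy, rfl⟩
    rcases lt_trichotomy x y with h | rfl | h
    · rw [dist_comm, dist_eq_norm]; exact key x hx y hy h
    · simpa using hε
    · rw [dist_eq_norm]; exact key y hy x hx h
  obtain ⟨y, hy⟩ := CompleteSpace.complete hc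
  refine ⟨y, (hS.sublevel_closed hE).mem_of_tendsto hy ?_, hy⟩
  filter_upwards [Ioo_mem_nhdsLT hpq] with r hr using hu (Ioo_subset_Icc_self hr)

theorem Standing.exists_tendsto_nhdsGT [CompleteSpace V] (hS : S.Standing) {E : ℝ} (hE : 0 < E)
    {u : ℝ → V} {v : ℝ → ℝ} {p q : ℝ} (hpq : p < q) (hu : MapsTo u (Icc p q) (S.sublevel E))
    (hv : MonotoneOn v (Icc p q))
    (huv : ∀ x ∈ Icc p q, ∀ y ∈ Icc p q, x < y → S.Psi (u y - u x) ≤ v y - v x) :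
    ∃ y ∈ S.sublevel E, Tendsto u (𝓝[>] p) (𝓝 y) := by
  have hc : Cauchy (map u (𝓝[>] p)) := by
    refine Metric.cauchy_iff.2 ⟨inferInstance, fun ε hε => ?_⟩
    obtain ⟨δ, hδ, H⟩ := hS.exists_modulus hE hε
    have hb : BddBelow (v '' Ioc p q) := ⟨v p, by
      rintro _ ⟨x, hx, rfl⟩
      exact hv (left_mem_Icc.2 hpq.le) (Ioc_subset_Icc_self hx) hx.1.le⟩
    obtain ⟨_, ⟨r, hr, rfl⟩, hrlt⟩ := exists_lt_of_csInf_lt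
      ((nonempty_Ioc.2 hpq).image v)
      (show sInf (v '' Ioc p q) < sInf (v '' Ioc p q) + δ by linarith)
    refine ⟨u '' Ioo p r, image_mem_map (Ioo_mem_nhdsGT hr.1), ?_⟩
    have key : ∀ x ∈ Ioo p r, ∀ y ∈ Ioo p r, x < y → ‖u y - u x‖ < ε := by
      intro x hx y hy hxy
      have hx' : x ∈ Icc p q := ⟨hx.1.le, hx.2.le.trans hr.2⟩
      have hy' : y ∈ Icc p q := ⟨hy.1.le, hy.2.le.trans hr.2⟩
      refine H _ (hu hx') _ (hu hy') ((huv x hx' y hy' hxy).trans_lt ?_)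
      have h1 : sInf (v '' Ioc p q) ≤ v x := csInf_le hb ⟨x, ⟨hx.1, hx'.2⟩, rfl⟩
      have h2 : v y ≤ v r := hv hy' (Ioc_subset_Icc_self hr) hy.2.le
      linarith
    rintro _ ⟨x, hx, rfl⟩ _ ⟨y, hy, rfl⟩
    rcases lt_trichotomy x y with h | rfl | h
    · rw [dist_comm, dist_eq_norm]; exact key x hx y hy h
    · simpa using hε
    · rw [dist_eq_norm]; exact key y hy x hx h
  obtain ⟨y, hy⟩ := CompleteSpace.complete hc
  refine ⟨y, (hS.sublevel_closed hE).mem_of_tendsto hy ?_, hy⟩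
  filter_upwards [Ioo_mem_nhdsGT hpq] with r hr using hu (Ioo_subset_Icc_self hr)

variable (S) in
/-- The variation `Var_Ψ(u;[0,t])` as a real number. -/
def realVar (u : ℝ → V) (t : ℝ) : ℝ := (S.psiVar u 0 t).toReal

theorem IsPsiBV.psiVar_ne_top {Z : Set V} {u : ℝ → V} (hu : S.IsPsiBV Z u) {a b : ℝ} (ha : 0 ≤ a)
    (hab : a ≤ b) (hb : b ≤ S.T) : S.psiVar u a b ≠ ⊤ :=
  ne_top_of_le_ne_top hu.2.ne (psiVar_mono u ha hab hb)

theorem IsPsiBV.psiVar_eq {Z : Set V} {u : ℝ → V} (hu : S.IsPsiBV Z u) (hS : S.Standing) {a b : ℝ}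
    (ha : 0 ≤ a) (hab : a ≤ b) (hb : b ≤ S.T) :
    S.psiVar u a b = ENNReal.ofReal (S.realVar u b - S.realVar u a) := by
  rw [realVar, realVar, ← hS.psiVar_add u ha hab, ENNReal.toReal_add
    (hu.psiVar_ne_top le_rfl ha (hab.trans hb)) (hu.psiVar_ne_top ha hab hb), add_sub_cancel_left,
    ENNReal.ofReal_toReal (hu.psiVar_ne_top ha hab hb)]

theorem IsPsiBV.monotoneOn_realVar {Z : Set V} {u : ℝ → V} (hu : S.IsPsiBV Z u) :
    MonotoneOn (S.realVar u) (Icc 0 S.T) := fun _ hx _ hy hxy =>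
  ENNReal.toReal_mono (hu.psiVar_ne_top le_rfl hy.1 hy.2) (psiVar_mono u le_rfl hx.1 hxy)

theorem IsPsiBV.Psi_le {Z : Set V} {u : ℝ → V} (hu : S.IsPsiBV Z u) (hS : S.Standing) {x y : ℝ}
    (hx : x ∈ Icc 0 S.T) (hy : y ∈ Icc 0 S.T) (hxy : x < y) :
    S.Psi (u y - u x) ≤ S.realVar u y - S.realVar u x := by
  have h := psiCost_le_psiVar (S := S) u hxy
  rw [hu.psiVar_eq hS hx.1 hxy.le hy.2] at h
  exact (ENNReal.ofReal_le_ofReal_iff (sub_nonneg.2 (hu.monotoneOn_realVar hx hy hxy.le))).1 h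

theorem leftVal_eq_of_tendsto {u : ℝ → V} {t : ℝ} {y : V} (ht : 0 < t)
    (h : Tendsto u (𝓝[<] t) (𝓝 y)) : leftVal u t = y := by
  rw [leftVal, if_neg (not_le.2 ht)]
  exact leftLim_eq_of_tendsto h

theorem rightVal_eq_of_tendsto {u : ℝ → V} {t : ℝ} {y : V} (ht : t < S.T)
    (h : Tendsto u (𝓝[>] t) (𝓝 y)) : S.rightVal u t = y := by
  rw [rightVal, if_neg (not_le.2 ht)]
  exact rightLim_eq_of_tendsto h

theorem leftVal_zero (u : ℝ → V) : leftVal u 0 = u 0 := by simp [leftVal]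

theorem rightVal_T (u : ℝ → V) : S.rightVal u S.T = u S.T := by simp [rightVal]

theorem IsPsiBV.leftVal_spec [CompleteSpace V] {E : ℝ} {u : ℝ → V}
    (hu : S.IsPsiBV (S.sublevel E) u) (hS : S.Standing) (hE : 0 < E) {t : ℝ} (ht : t ∈ Ioc 0 S.T) :
    leftVal u t ∈ S.sublevel E ∧ Tendsto u (𝓝[<] t) (𝓝 (leftVal u t)) := by
  have hsub : Icc 0 t ⊆ Icc 0 S.T := Icc_subset_Icc le_rfl ht.2
  obtain ⟨y, hy, h⟩ := hS.exists_tendsto_nhdsLT hE ht.1 (hu.1.mono_left hsub)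
    (hu.monotoneOn_realVar.mono hsub) (fun x hx y hy => hu.Psi_le hS (hsub hx) (hsub hy))
  rw [leftVal_eq_of_tendsto ht.1 h]
  exact ⟨hy, h⟩

theorem IsPsiBV.rightVal_spec [CompleteSpace V] {E : ℝ} {u : ℝ → V}
    (hu : S.IsPsiBV (S.sublevel E) u) (hS : S.Standing) (hE : 0 < E) {t : ℝ} (ht : t ∈ Ico 0 S.T) :
    S.rightVal u t ∈ S.sublevel E ∧ Tendsto u (𝓝[>] t) (𝓝 (S.rightVal u t)) := by
  have hsub : Icc t S.T ⊆ Icc 0 S.T := Icc_subset_Icc ht.1 le_rfl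
  obtain ⟨y, hy, h⟩ := hS.exists_tendsto_nhdsGT hE ht.2 (hu.1.mono_left hsub)
    (hu.monotoneOn_realVar.mono hsub) (fun x hx y hy => hu.Psi_le hS (hsub hx) (hsub hy))
  rw [rightVal_eq_of_tendsto ht.2 h]
  exact ⟨hy, h⟩

theorem IsPsiBV.leftVal_mem [CompleteSpace V] {E : ℝ} {u : ℝ → V}
    (hu : S.IsPsiBV (S.sublevel E) u) (hS : S.Standing) (hE : 0 < E) {t : ℝ} (ht : t ∈ Icc 0 S.T) :
    leftVal u t ∈ S.sublevel E := by
  rcases ht.1.eq_or_lt with rfl | h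
  · rw [leftVal_zero]; exact hu.1 ht
  · exact (hu.leftVal_spec hS hE ⟨h, ht.2⟩).1

theorem IsPsiBV.rightVal_mem [CompleteSpace V] {E : ℝ} {u : ℝ → V}
    (hu : S.IsPsiBV (S.sublevel E) u) (hS : S.Standing) (hE : 0 < E) {t : ℝ} (ht : t ∈ Icc 0 S.T) :
    S.rightVal u t ∈ S.sublevel E := by
  rcases ht.2.eq_or_lt with rfl | h
  · rw [rightVal_T]; exact hu.1 ht
  · exact (hu.rightVal_spec hS hE ⟨ht.1, h⟩).1

/-- The variation on `[x,y]` controls the jumps at the end points. -/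
theorem IsPsiBV.jumps_le_psiVar [CompleteSpace V] {E : ℝ} {u : ℝ → V}
    (hu : S.IsPsiBV (S.sublevel E) u) (hS : S.Standing) (hE : 0 < E) {x y : ℝ} (hx : 0 ≤ x)
    (hxy : x < y) (hy : y ≤ S.T) :
    S.psiCost x (u x) (S.rightVal u x) + S.psiCost 0 (S.rightVal u x) (leftVal u y) +
      S.psiCost y (leftVal u y) (u y) ≤ S.psiVar u x y := by
  have h1 := (hu.rightVal_spec hS hE ⟨hx, hxy.trans_le hy⟩).2
  have h2 := (hu.leftVal_spec hS hE ⟨hx.trans_lt hxy, hy⟩).2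
  have hc : Continuous fun v : V => ENNReal.ofReal (S.Psi v) :=
    ENNReal.continuous_ofReal.comp hS.Psi_continuous
  have h1' : Tendsto (fun p : ℝ × ℝ => u p.1) (𝓝[>] x ×ˢ 𝓝[<] y) (𝓝 (S.rightVal u x)) :=
    h1.comp tendsto_fst
  have h2' : Tendsto (fun p : ℝ × ℝ => u p.2) (𝓝[>] x ×ˢ 𝓝[<] y) (𝓝 (leftVal u y)) :=
    h2.comp tendsto_snd
  have hlim : Tendsto (fun p : ℝ × ℝ => ENNReal.ofReal (S.Psi (u p.1 - u x)) +
      ENNReal.ofReal (S.Psi (u p.2 - u p.1)) + ENNReal.ofReal (S.Psi (u y - u p.2)))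
      (𝓝[>] x ×ˢ 𝓝[<] y) (𝓝 (S.psiCost x (u x) (S.rightVal u x) +
        S.psiCost 0 (S.rightVal u x) (leftVal u y) + S.psiCost y (leftVal u y) (u y))) :=
    (((hc.tendsto _).comp (h1'.sub_const _)).add ((hc.tendsto _).comp (h2'.sub h1'))).add
      ((hc.tendsto _).comp (h2'.const_sub _))
  refine le_of_tendsto hlim ?_
  set m := (x + y) / 2 with hm
  filter_upwards [prod_mem_prod (Ioo_mem_nhdsGT (show x < m by linarith))
    (Ioo_mem_nhdsLT (show m < y by linarith))] with p hp
  obtain ⟨hp1, hp2⟩ := hp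
  have hpp : p.1 < p.2 := hp1.2.trans hp2.1
  rw [← hS.psiVar_add u (hp1.1.le.trans hpp.le) hp2.2.le, ← hS.psiVar_add u hp1.1.le hpp.le]
  exact add_le_add (add_le_add (psiCost_le_psiVar u hp1.1) (psiCost_le_psiVar u hpp))
    (psiCost_le_psiVar u hp2.2)

/-- Modifying a curve at the end points of an interval. -/
theorem Standing.psiVar_le_of_eqOn_Ioo (hS : S.Standing) {u z : ℝ → V} {x y : ℝ} (hxy : x < y)
    (huz : EqOn u z (Ioo x y)) :
    S.psiVar u x y ≤ S.psiCost x (u x) (z x) + S.psiVar z x y + S.psiCost y (z y) (u y) := by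
  classical
  set h : ℝ → ℝ → ℝ≥0∞ := fun p q => (if p = x then S.psiCost x (u x) (z x) else 0) +
    S.psiVar z p q + (if q = y then S.psiCost y (z y) (u y) else 0) with hh
  have key : S.psiVar u x y ≤ h x y := by
    rw [psiVar_eq_ivar]
    refine ivar_le_of_superaddOn hxy (fun p q hp hpq hq => ?_) (fun p q r hp hpq hqr hr => ?_)
    · have h1 : S.psiCost 0 (u p) (z p) ≤ if p = x then S.psiCost x (u x) (z x) else 0 := by
        split_ifs with hpx
        · rw [hpx]; exact le_rfl
        · rw [huz ⟨lt_of_le_of_ne hp (Ne.symm hpx), hpq.trans_le hq⟩]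
          simp [psiCost, hS.Psi_zero]
      have h2 : S.psiCost 0 (z q) (u q) ≤ if q = y then S.psiCost y (z y) (u y) else 0 := by
        split_ifs with hqy
        · rw [hqy]; exact le_rfl
        · rw [huz ⟨hp.trans_lt hpq, lt_of_le_of_ne hq hqy⟩]
          simp [psiCost, hS.Psi_zero]
      calc S.psiCost 0 (u p) (u q) ≤ S.psiCost 0 (u p) (z q) + S.psiCost 0 (z q) (u q) :=
            hS.psiCost_triangle _ _ _ _
        _ ≤ S.psiCost 0 (u p) (z p) + S.psiCost 0 (z p) (z q) + S.psiCost 0 (z q) (u q) := by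
            gcongr; exact hS.psiCost_triangle _ _ _ _
        _ ≤ _ := add_le_add (add_le_add h1 (psiCost_le_psiVar z hpq)) h2
    · simp only [hh]
      rw [if_neg (by linarith : q ≠ y), if_neg (by linarith : q ≠ x), add_zero, zero_add,
        ← add_assoc, add_assoc _ (S.psiVar z p q), hS.psiVar_add z hpq.le hqr.le]
  simpa [hh] using key

/-- The variation on short intervals on the left of `t` is close to the jump at `t`. -/
theorem IsPsiBV.exists_psiVar_le_left [CompleteSpace V] {E : ℝ} {u : ℝ → V}
    (hu : S.IsPsiBV (S.sublevel E) u) (hS : S.Standing) (hE : 0 < E) {t : ℝ} (ht : t ∈ Ioc 0 S.T)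
    {ε : ℝ} (hε : 0 < ε) : ∃ r ∈ Ico 0 t, ∀ r' ∈ Ico r t,
      S.psiVar u r' t ≤ S.psiCost t (leftVal u t) (u t) + ENNReal.ofReal ε := by
  classical
  have hsub : Ico 0 t ⊆ Icc 0 S.T := fun x hx => ⟨hx.1, hx.2.le.trans ht.2⟩
  have hb : BddAbove (S.realVar u '' Ico 0 t) := ⟨S.realVar u t, by
    rintro _ ⟨x, hx, rfl⟩
    exact hu.monotoneOn_realVar (hsub hx) ⟨ht.1.le, ht.2⟩ hx.2.le⟩
  set M := sSup (S.realVar u '' Ico 0 t) with hM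
  have hle : ∀ x ∈ Ico 0 t, S.realVar u x ≤ M := fun x hx => le_csSup hb ⟨x, hx, rfl⟩
  obtain ⟨_, ⟨r, hr, rfl⟩, hrlt⟩ := exists_lt_of_lt_csSup ((nonempty_Ico.2 ht.1).image (S.realVar u))
    (show M - ε < M by linarith)
  refine ⟨r, hr, fun r' hr' => ?_⟩
  -- Replacing the value at `t` by the left limit isolates the jump. The modified curve has
  -- variation controlled by the variation function with its value at `t` replaced by its left limit
  -- `M`.
  set z : ℝ → V := Function.update u t (leftVal u t) with hz
  have hzlt : ∀ x, x < t → z x = u x := fun x hx => Function.update_of_ne hx.ne _ _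
  have hzt : z t = leftVal u t := Function.update_self _ _ _
  have h0r' : 0 ≤ r' := hr.1.trans hr'.1
  have h1 := hS.psiVar_le_of_eqOn_Ioo (u := u) (z := z) hr'.2 fun x hx => (hzlt x hx.2).symm
  rw [hzt, hzlt r' hr'.2] at h1
  set N : ℝ → ℝ := Function.update (S.realVar u) t M with hN
  have hNlt : ∀ x, x < t → N x = S.realVar u x := fun x hx => Function.update_of_ne hx.ne _ _
  have hNt : N t = M := Function.update_self _ _ _
  have hNmono : ∀ x y, 0 ≤ x → x < y → y ≤ t → N x ≤ N y := by
    intro x y hx hxy hy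
    rw [hNlt x (hxy.trans_le hy)]
    rcases hy.eq_or_lt with rfl | hy
    · rw [hNt]; exact hle x ⟨hx, hxy⟩
    · rw [hNlt y hy]
      exact hu.monotoneOn_realVar (hsub ⟨hx, hxy.trans hy⟩) (hsub ⟨hx.trans hxy.le, hy⟩) hxy.le
  have h2 : S.psiVar z r' t ≤ ENNReal.ofReal (N t - N r') := by
    rw [psiVar_eq_ivar]
    refine ivar_le_of_superaddOn (h := fun x y => ENNReal.ofReal (N y - N x)) hr'.2 ?_ ?_
    · intro x y hx hxy hy
      refine ENNReal.ofReal_le_ofReal ?_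
      have hx0 : 0 ≤ x := h0r'.trans hx
      rw [hzlt x (hxy.trans_le hy), hNlt x (hxy.trans_le hy)]
      rcases hy.eq_or_lt with rfl | hy
      · rw [hzt, hNt]
        have hlim : Tendsto (fun q => S.Psi (u q - u x)) (𝓝[<] y)
            (𝓝 (S.Psi (leftVal u y - u x))) :=
          (hS.Psi_continuous.tendsto _).comp ((hu.leftVal_spec hS hE ht).2.sub_const _)
        refine le_of_tendsto hlim ?_
        filter_upwards [Ioo_mem_nhdsLT hxy] with q hq
        linarith [hu.Psi_le hS (hsub ⟨hx0, hxy⟩) (hsub ⟨hx0.trans hq.1.le, hq.2⟩) hq.1,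
          hle q ⟨hx0.trans hq.1.le, hq.2⟩]
      · rw [hzlt y hy, hNlt y hy]
        exact hu.Psi_le hS (hsub ⟨hx0, hxy.trans hy⟩) (hsub ⟨hx0.trans hxy.le, hy⟩) hxy
    · intro x y w hx hxy hyw hw
      have a1 := hNmono x y (h0r'.trans hx) hxy (hyw.le.trans hw)
      have a2 := hNmono y w ((h0r'.trans hx).trans hxy.le) hyw hw
      rw [← ENNReal.ofReal_add (by linarith) (by linarith)]
      exact ENNReal.ofReal_le_ofReal (by linarith)
  have h3 : N t - N r' ≤ ε := by
    rw [hNt, hNlt r' hr'.2]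
    linarith [hu.monotoneOn_realVar (hsub hr) (hsub ⟨h0r', hr'.2⟩) hr'.1]
  calc S.psiVar u r' t ≤ _ := h1
    _ ≤ 0 + ENNReal.ofReal ε + S.psiCost t (leftVal u t) (u t) := by
        gcongr
        · simp [psiCost, hS.Psi_zero]
        · exact h2.trans (ENNReal.ofReal_le_ofReal h3)
    _ = _ := by ring

/-- The variation on short intervals on the right of `t` is close to the jump at `t`. -/
theorem IsPsiBV.exists_psiVar_le_right [CompleteSpace V] {E : ℝ} {u : ℝ → V}
    (hu : S.IsPsiBV (S.sublevel E) u) (hS : S.Standing) (hE : 0 < E) {t : ℝ} (ht : t ∈ Ico 0 S.T)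
    {ε : ℝ} (hε : 0 < ε) : ∃ r ∈ Ioc t S.T, ∀ r' ∈ Ioc t r,
      S.psiVar u t r' ≤ S.psiCost t (u t) (S.rightVal u t) + ENNReal.ofReal ε := by
  classical
  have hsub : Ioc t S.T ⊆ Icc 0 S.T := fun x hx => ⟨ht.1.trans hx.1.le, hx.2⟩
  have hb : BddBelow (S.realVar u '' Ioc t S.T) := ⟨S.realVar u t, by
    rintro _ ⟨x, hx, rfl⟩
    exact hu.monotoneOn_realVar ⟨ht.1, ht.2.le⟩ (hsub hx) hx.1.le⟩
  set M := sInf (S.realVar u '' Ioc t S.T) with hM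
  have hle : ∀ x ∈ Ioc t S.T, M ≤ S.realVar u x := fun x hx => csInf_le hb ⟨x, hx, rfl⟩
  obtain ⟨_, ⟨r, hr, rfl⟩, hrlt⟩ := exists_lt_of_csInf_lt ((nonempty_Ioc.2 ht.2).image (S.realVar u))
    (show M < M + ε by linarith)
  refine ⟨r, hr, fun r' hr' => ?_⟩
  set z : ℝ → V := Function.update u t (S.rightVal u t) with hz
  have hzlt : ∀ x, t < x → z x = u x := fun x hx => Function.update_of_ne hx.ne' _ _
  have hzt : z t = S.rightVal u t := Function.update_self _ _ _
  have h0r' : r' ≤ S.T := hr'.2.trans hr.2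
  have h1 := hS.psiVar_le_of_eqOn_Ioo (u := u) (z := z) hr'.1 fun x hx => (hzlt x hx.1).symm
  rw [hzt, hzlt r' hr'.1] at h1
  set N : ℝ → ℝ := Function.update (S.realVar u) t M with hN
  have hNlt : ∀ x, t < x → N x = S.realVar u x := fun x hx => Function.update_of_ne hx.ne' _ _
  have hNt : N t = M := Function.update_self _ _ _
  have hNmono : ∀ x y, t ≤ x → x < y → y ≤ S.T → N x ≤ N y := by
    intro x y hx hxy hy
    rw [hNlt y (hx.trans_lt hxy)]
    rcases hx.eq_or_lt with rfl | hx
    · rw [hNt]; exact hle y ⟨hxy, hy⟩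
    · rw [hNlt x hx]
      exact hu.monotoneOn_realVar (hsub ⟨hx, hxy.le.trans hy⟩) (hsub ⟨hx.trans hxy, hy⟩) hxy.le
  have h2 : S.psiVar z t r' ≤ ENNReal.ofReal (N r' - N t) := by
    rw [psiVar_eq_ivar]
    refine ivar_le_of_superaddOn (h := fun x y => ENNReal.ofReal (N y - N x)) hr'.1 ?_ ?_
    · intro x y hx hxy hy
      refine ENNReal.ofReal_le_ofReal ?_
      have hyT : y ≤ S.T := hy.trans h0r'
      rw [hzlt y (hx.trans_lt hxy), hNlt y (hx.trans_lt hxy)]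
      rcases hx.eq_or_lt with rfl | hx
      · rw [hzt, hNt]
        have hlim : Tendsto (fun q => S.Psi (u y - u q)) (𝓝[>] t)
            (𝓝 (S.Psi (u y - S.rightVal u t))) :=
          (hS.Psi_continuous.tendsto _).comp ((hu.rightVal_spec hS hE ht).2.const_sub _)
        refine le_of_tendsto hlim ?_
        filter_upwards [Ioo_mem_nhdsGT hxy] with q hq
        linarith [hu.Psi_le hS (hsub ⟨hq.1, hq.2.le.trans hyT⟩) (hsub ⟨hxy, hyT⟩) hq.2,
          hle q ⟨hq.1, hq.2.le.trans hyT⟩]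
      · rw [hzlt x hx, hNlt x hx]
        exact hu.Psi_le hS (hsub ⟨hx, hxy.le.trans hyT⟩) (hsub ⟨hx.trans hxy, hyT⟩) hxy
    · intro x y w hx hxy hyw hw
      have a1 := hNmono x y hx hxy (hyw.le.trans (hw.trans h0r'))
      have a2 := hNmono y w (hx.trans hxy.le) hyw (hw.trans h0r')
      rw [← ENNReal.ofReal_add (by linarith) (by linarith)]
      exact ENNReal.ofReal_le_ofReal (by linarith)
  have h3 : N r' - N t ≤ ε := by
    rw [hNt, hNlt r' hr'.1]
    linarith [hu.monotoneOn_realVar (hsub ⟨hr'.1, h0r'⟩) (hsub hr) hr'.2]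
  calc S.psiVar u t r' ≤ _ := h1
    _ ≤ S.psiCost t (u t) (S.rightVal u t) + ENNReal.ofReal ε + 0 := by
        gcongr
        · exact h2.trans (ENNReal.ofReal_le_ofReal h3)
        · simp [psiCost, hS.Psi_zero]
    _ = _ := add_zero _

/-- A discontinuity of `u` is a discontinuity of the monotone function Var_Ψ(u;[0,·]), because small
variation forces small norm increments. -/
theorem IsPsiBV.countable_not_continuousWithinAt {E : ℝ} {u : ℝ → V}
    (hu : S.IsPsiBV (S.sublevel E) u) (hS : S.Standing) (hE : 0 < E) :
    {t | t ∈ Icc 0 S.T ∧ ¬ContinuousWithinAt u (Icc 0 S.T) t}.Countable := by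
  refine (hu.monotoneOn_realVar.countable_not_continuousWithinAt).mono fun t ht => ?_
  refine ⟨ht.1, fun hc => ht.2 ?_⟩
  refine Metric.continuousWithinAt_iff.2 fun ε hε => ?_
  obtain ⟨δ, hδ, H⟩ := hS.exists_modulus hE hε
  obtain ⟨η, hη, hη'⟩ := Metric.continuousWithinAt_iff.1 hc δ hδ
  refine ⟨η, hη, fun {x} hx hxt => ?_⟩
  have h1 := hη' hx hxt
  rw [Real.dist_eq] at h1
  rcases lt_trichotomy x t with h | rfl | h
  · rw [dist_comm, dist_eq_norm]
    refine H _ (hu.1 hx) _ (hu.1 ht.1) ((hu.Psi_le hS hx ht.1 h).trans_lt ?_)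
    rw [abs_sub_comm] at h1
    exact (le_abs_self _).trans_lt h1
  · simpa using hε
  · rw [dist_eq_norm]
    exact H _ (hu.1 ht.1) _ (hu.1 hx) ((hu.Psi_le hS ht.1 hx h).trans_lt
      ((le_abs_self _).trans_lt h1))

/-- The set of jump times is countable. -/
theorem IsPsiBV.countable_jumpSet {E : ℝ} {u : ℝ → V}
    (hu : S.IsPsiBV (S.sublevel E) u) (hS : S.Standing) (hE : 0 < E) :
    (S.jumpSet u).Countable := by
  refine Countable.mono (fun t ht => ?_) (hu.countable_not_continuousWithinAt hS hE)
  refine ⟨ht.1, fun key => ?_⟩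
  have hl : leftVal u t = u t := by
    rcases ht.1.1.eq_or_lt with rfl | h0
    · exact leftVal_zero u
    · refine leftVal_eq_of_tendsto h0 (key.mono_left ?_)
      rw [← nhdsWithin_Ioo_eq_nhdsLT h0]
      exact nhdsWithin_mono _ fun x hx => ⟨hx.1.le, hx.2.le.trans ht.1.2⟩
  have hr : S.rightVal u t = u t := by
    rcases ht.1.2.eq_or_lt with rfl | h0
    · exact rightVal_T u
    · refine rightVal_eq_of_tendsto h0 (key.mono_left ?_)
      rw [← nhdsWithin_Ioo_eq_nhdsGT h0]
      exact nhdsWithin_mono _ fun x hx => ⟨ht.1.1.trans hx.1.le, hx.2.le⟩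
  exact ht.2.elim (fun h => h hl) fun h => h hr.symm

/-! ### The Finsler cost and the total variation induced by it -/

theorem Standing.psiCost_self (hS : S.Standing) (t : ℝ) (x : V) : S.psiCost t x x = 0 := by
  simp [psiCost, hS.Psi_zero]

theorem Standing.finslerCost_self (hS : S.Standing) {E : ℝ} (hE : 0 < E) (t : ℝ) {x : V}
    (hx : x ∈ S.sublevel E) : S.finslerCost t x x = 0 := by
  have hθ : S.IsTransition t x x fun _ => x := by
    refine ⟨⟨E, hE, fun _ _ => hx, fun _ => 0, fun _ => le_rfl, integrableOn_zero, ?_⟩, ?_, rfl, rfl⟩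
    · simp [hS.Psi_zero]
    · intro c d _ _
      exact (LipschitzWith.const x).lipschitzOnWith.absolutelyContinuousOnInterval
  refine le_antisymm ((iInf₂_le _ hθ).trans ?_) zero_le
  have h0 : S.metricDeriv (fun _ => x) = fun _ => 0 := by
    ext s
    simp [metricDeriv, hS.Psi_zero]
  simp [dissipation, h0]

theorem Standing.psiCost_le_finslerCost (hS : S.Standing) (t : ℝ) (x y : V) :
    S.psiCost t x y ≤ S.finslerCost t x y := by
  refine le_iInf₂ fun θ hθ => ?_
  obtain ⟨⟨E, _, hE⟩, _, h0, h1⟩ := hθ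
  have := hS.psiCost_le_lintegral one_pos hE
  rw [h0, h1] at this
  exact this.trans le_self_add

/-- Times without a jump contribute cost zero, so the sum over jump times may be taken over the
whole open interval, where splitting is easier. -/
theorem jumpVar_eq_jumpSum {cost : ℝ → V → V → ℝ≥0∞} {u : ℝ → V}
    (hcost : ∀ t ∈ Icc 0 S.T, cost t (u t) (u t) = 0) {a b : ℝ} (ha : 0 ≤ a) (hb : b ≤ S.T) :
    S.jumpVar cost u a b = jumpSum (fun t => cost t (leftVal u t) (u t))
      (fun t => cost t (u t) (S.rightVal u t)) a b := by
  rw [jumpVar, jumpSum]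
  congr 1
  rw [tsum_subtype (S.jumpSet u ∩ Ioo a b)
      (fun t => cost t (leftVal u t) (u t) + cost t (u t) (S.rightVal u t)),
    tsum_subtype (Ioo a b) (fun t => cost t (leftVal u t) (u t) + cost t (u t) (S.rightVal u t))]
  refine tsum_congr fun t => ?_
  by_cases ht : t ∈ Ioo a b
  · by_cases hj : t ∈ S.jumpSet u
    · rw [indicator_of_mem (show t ∈ S.jumpSet u ∩ Ioo a b from ⟨hj, ht⟩), indicator_of_mem ht]
    · rw [indicator_of_notMem (fun h => hj h.1), indicator_of_mem ht]
      have htm : t ∈ Icc 0 S.T := ⟨ha.trans ht.1.le, ht.2.le.trans hb⟩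
      have hl : leftVal u t = u t := by
        by_contra hne
        exact hj ⟨htm, Or.inl hne⟩
      have hr : u t = S.rightVal u t := by
        by_contra hne
        exact hj ⟨htm, Or.inr hne⟩
      rw [hl, ← hr, hcost t htm, add_zero]
  · rw [indicator_of_notMem (fun h => ht h.2), indicator_of_notMem ht]

variable (S) in
/-- The excess of the Finsler cost over `Ψ` at the left jump. -/
def leftExcess (u : ℝ → V) (t : ℝ) : ℝ≥0∞ :=
  S.finslerCost t (leftVal u t) (u t) - S.psiCost t (leftVal u t) (u t)

variable (S) in
/-- The excess of the Finsler cost over `Ψ` at the right jump. -/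
def rightExcess (u : ℝ → V) (t : ℝ) : ℝ≥0∞ :=
  S.finslerCost t (u t) (S.rightVal u t) - S.psiCost t (u t) (S.rightVal u t)

theorem Standing.psiCost_add_leftExcess (hS : S.Standing) (u : ℝ → V) (t : ℝ) :
    S.psiCost t (leftVal u t) (u t) + S.leftExcess u t = S.finslerCost t (leftVal u t) (u t) :=
  add_tsub_cancel_of_le (hS.psiCost_le_finslerCost _ _ _)

theorem Standing.psiCost_add_rightExcess (hS : S.Standing) (u : ℝ → V) (t : ℝ) :
    S.psiCost t (u t) (S.rightVal u t) + S.rightExcess u t =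
      S.finslerCost t (u t) (S.rightVal u t) :=
  add_tsub_cancel_of_le (hS.psiCost_le_finslerCost _ _ _)

/-- The jump variation for Ψ is at most the total Ψ-variation, so the truncated subtraction in
`finslerVar` is a genuine one. It cancels against the Ψ-part of the Finsler costs, leaving a sum of
two additive quantities. -/
theorem IsPsiBV.finslerVar_eq [CompleteSpace V] {E : ℝ} {u : ℝ → V}
    (hu : S.IsPsiBV (S.sublevel E) u) (hS : S.Standing) (hE : 0 < E) {a b : ℝ} (ha : 0 ≤ a)
    (hab : a < b) (hb : b ≤ S.T) :
    S.finslerVar u a b = S.psiVar u a b + jumpSum (S.leftExcess u) (S.rightExcess u) a b := by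
  have h1 : S.jumpVar S.psiCost u a b ≤ S.psiVar u a b := by
    rw [jumpVar_eq_jumpSum (fun t _ => hS.psiCost_self t _) ha hb]
    refine add_tsum_jumps_le (L := fun t => S.psiCost t (leftVal u t) (u t))
      (R := fun t => S.psiCost t (u t) (S.rightVal u t)) hab (H := S.psiVar u) ?_ ?_
    · exact fun x y z _ hxy hyz _ => (hS.psiVar_add u hxy.le hyz.le).le
    · intro x y hx hxy hy
      refine le_trans ?_ (hu.jumps_le_psiVar hS hE (ha.trans hx) hxy (hy.trans hb))
      gcongr
      exact le_self_add
  have h2 : S.jumpVar S.finslerCost u a b = S.jumpVar S.psiCost u a b +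
      jumpSum (S.leftExcess u) (S.rightExcess u) a b := by
    rw [jumpVar_eq_jumpSum (fun t ht => hS.finslerCost_self hE t (hu.1 ht)) ha hb,
      jumpVar_eq_jumpSum (fun t _ => hS.psiCost_self t _) ha hb, ← jumpSum_add_fun]
    simp only [hS.psiCost_add_leftExcess, hS.psiCost_add_rightExcess]
  rw [finslerVar, h2, ← add_assoc, tsub_add_cancel_of_le h1]

theorem IsPsiBV.finslerVar_add [CompleteSpace V] {E : ℝ} {u : ℝ → V}
    (hu : S.IsPsiBV (S.sublevel E) u) (hS : S.Standing) (hE : 0 < E) {a b c : ℝ} (ha : 0 ≤ a)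
    (hab : a < b) (hbc : b < c) (hc : c ≤ S.T) :
    S.finslerVar u a b + S.finslerVar u b c = S.finslerVar u a c := by
  rw [hu.finslerVar_eq hS hE ha hab (hbc.le.trans hc), hu.finslerVar_eq hS hE (ha.trans hab.le) hbc
    hc, hu.finslerVar_eq hS hE ha (hab.trans hbc) hc, ← hS.psiVar_add u hab.le hbc.le,
    ← jumpSum_add _ _ hab hbc]
  ring

theorem IsPsiBV.jumps_le_finslerVar [CompleteSpace V] {E : ℝ} {u : ℝ → V}
    (hu : S.IsPsiBV (S.sublevel E) u) (hS : S.Standing) (hE : 0 < E) {x y : ℝ} (hx : 0 ≤ x)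
    (hxy : x < y) (hy : y ≤ S.T) :
    S.finslerCost x (u x) (S.rightVal u x) + S.psiCost 0 (S.rightVal u x) (leftVal u y) +
      S.finslerCost y (leftVal u y) (u y) ≤ S.finslerVar u x y := by
  rw [hu.finslerVar_eq hS hE hx hxy hy, ← hS.psiCost_add_leftExcess, ← hS.psiCost_add_rightExcess]
  have h1 := hu.jumps_le_psiVar hS hE hx hxy hy
  have h2 : S.rightExcess u x + S.leftExcess u y ≤
      jumpSum (S.leftExcess u) (S.rightExcess u) x y := le_self_add
  refine le_trans (le_of_eq ?_) (add_le_add h1 h2)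
  ring

theorem IsPsiBV.exists_finslerVar_le_left [CompleteSpace V] {E : ℝ} {u : ℝ → V}
    (hu : S.IsPsiBV (S.sublevel E) u) (hS : S.Standing) (hE : 0 < E) {t : ℝ} (ht : t ∈ Ioc 0 S.T)
    (hfin : S.finslerVar u 0 t ≠ ⊤) {ε : ℝ} (hε : 0 < ε) : ∃ r ∈ Ico 0 t, ∀ r' ∈ Ico r t,
      S.finslerVar u r' t ≤ S.finslerCost t (leftVal u t) (u t) + ENNReal.ofReal ε := by
  rw [hu.finslerVar_eq hS hE le_rfl ht.1 ht.2] at hfin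
  have hε2 : 0 < ε / 2 := by linarith
  obtain ⟨r₁, hr₁, h₁⟩ := hu.exists_psiVar_le_left hS hE ht hε2
  obtain ⟨r₂, hr₂, h₂⟩ := exists_jumpSum_le_left ht.1 (ENNReal.add_ne_top.1 hfin).2
    (ENNReal.ofReal_pos.2 hε2)
  refine ⟨max r₁ r₂, ⟨le_max_of_le_left hr₁.1, max_lt hr₁.2 hr₂.2⟩, fun r' hr' => ?_⟩
  have hr1 : r₁ ≤ r' := (le_max_left _ _).trans hr'.1
  rw [hu.finslerVar_eq hS hE (hr₁.1.trans hr1) hr'.2 ht.2, ← hS.psiCost_add_leftExcess]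
  refine (add_le_add (h₁ r' ⟨hr1, hr'.2⟩) (h₂ r' ⟨(le_max_right _ _).trans hr'.1, hr'.2⟩)).trans
    (le_of_eq ?_)
  rw [show ε = ε / 2 + ε / 2 by ring, ENNReal.ofReal_add hε2.le hε2.le, ← show ε = ε / 2 + ε / 2 by ring]
  ring

theorem IsPsiBV.exists_finslerVar_le_right [CompleteSpace V] {E : ℝ} {u : ℝ → V}
    (hu : S.IsPsiBV (S.sublevel E) u) (hS : S.Standing) (hE : 0 < E) {t : ℝ} (ht : t ∈ Ico 0 S.T)
    (hfin : S.finslerVar u t S.T ≠ ⊤) {ε : ℝ} (hε : 0 < ε) : ∃ r ∈ Ioc t S.T, ∀ r' ∈ Ioc t r,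
      S.finslerVar u t r' ≤ S.finslerCost t (u t) (S.rightVal u t) + ENNReal.ofReal ε := by
  rw [hu.finslerVar_eq hS hE ht.1 ht.2 le_rfl] at hfin
  have hε2 : 0 < ε / 2 := by linarith
  obtain ⟨r₁, hr₁, h₁⟩ := hu.exists_psiVar_le_right hS hE ht hε2
  obtain ⟨r₂, hr₂, h₂⟩ := exists_jumpSum_le_right ht.2 (ENNReal.add_ne_top.1 hfin).2
    (ENNReal.ofReal_pos.2 hε2)
  refine ⟨min r₁ r₂, ⟨lt_min hr₁.1 hr₂.1, (min_le_left _ _).trans hr₁.2⟩, fun r' hr' => ?_⟩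
  have hr1 : r' ≤ r₁ := hr'.2.trans (min_le_left _ _)
  rw [hu.finslerVar_eq hS hE ht.1 hr'.1 (hr1.trans hr₁.2), ← hS.psiCost_add_rightExcess]
  refine (add_le_add (h₁ r' ⟨hr'.1, hr1⟩) (h₂ r' ⟨hr'.1, hr'.2.trans (min_le_right _ _)⟩)).trans
    (le_of_eq ?_)
  rw [show ε = ε / 2 + ε / 2 by ring, ENNReal.ofReal_add hε2.le hε2.le, ← show ε = ε / 2 + ε / 2 by ring]
  ring

theorem IsTransition.isRegularCurve {t : ℝ} (ht : t ∈ Icc 0 S.T) {x y : V} {θ : ℝ → V}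
    (hθ : S.IsTransition t x y θ) : ∃ E > 0, S.IsRegularCurve E (fun _ => t) θ 0 1 := by
  obtain ⟨⟨E, hE, h⟩, hAC, _, _⟩ := hθ
  exact ⟨E, hE, fun _ _ => ht, continuousOn_const, h, hAC⟩

/-- The energy drop along a jump is bounded by the Finsler cost. -/
theorem Standing.energy_sub_le_finslerCost [CompleteSpace V] (hS : S.Standing)
    (hV : HasRadonNikodymProperty V) {t : ℝ} (ht : t ∈ Icc 0 S.T) (x y : V) :
    ENNReal.ofReal (S.energy t x - S.energy t y) ≤ S.finslerCost t x y := by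
  refine le_iInf₂ fun θ hθ => ?_
  obtain ⟨E, hE, h⟩ := hθ.isRegularCurve ht
  have := h.energy_sub_le hV hS hE zero_le_one
  rwa [hθ.2.2.1, hθ.2.2.2] at this

/-! ### Curves with bounded speed and reparametrization -/

/-- Curves whose increments have bounded cost are regular. -/
theorem Standing.isRegularCurve_of_incCost_le (hS : S.Standing) {E : ℝ} (hE : 0 < E) {tt : ℝ → ℝ}
    {uu : ℝ → V} {a b K : ℝ} (hK : 0 ≤ K) (htm : MapsTo tt (Icc a b) (Icc 0 S.T))
    (htc : ContinuousOn tt (Icc a b)) (hum : MapsTo uu (Icc a b) (S.sublevel E))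
    (hinc : ∀ x y, a ≤ x → x < y → y ≤ b → S.incCost tt uu x y ≤ ENNReal.ofReal (K * (y - x))) :
    S.IsRegularCurve E tt uu a b := by
  have hAC : S.IsPsiAC (S.sublevel E) uu a b := by
    refine ⟨hum, fun _ => K, fun _ => hK, integrableOn_const (by simp), fun x hx y hy hxy => ?_⟩
    have h1 : ENNReal.ofReal (S.Psi (uu y - uu x)) ≤ ENNReal.ofReal (K * (y - x)) :=
      le_self_add.trans (hinc x y hx.1 hxy hy.2)
    have h2 : 0 ≤ K * (y - x) := mul_nonneg hK (by linarith)
    rw [intervalIntegral.integral_const, smul_eq_mul, mul_comm]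
    exact (ENNReal.ofReal_le_ofReal_iff h2).1 h1
  have huc := hS.continuousOn_of_isPsiAC hE hAC
  have hlsc := hS.slope_comp_lsc hE htc huc htm hum
  refine ⟨htm, htc, hAC, fun p q hpq hsub => ?_⟩
  have hpa : a ≤ p := (hsub (left_mem_Icc.2 hpq.le)).1.1
  have hqb : q ≤ b := (hsub (right_mem_Icc.2 hpq.le)).1.2
  obtain ⟨s, hs, hmin⟩ := (hlsc.mono (Icc_subset_Icc hpa hqb)).exists_isMinOn
    (nonempty_Icc.2 hpq.le) isCompact_Icc
  -- On a compact unstable interval the slope has a positive minimum. Truncating it at 1 keeps the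
  -- number finite, and the cost bound becomes a norm Lipschitz estimate with constant `K / q₀`.
  set q₀ := min 1 (S.slope (tt s) (uu s)) with hq₀
  have hq0 : q₀ ≠ 0 := (lt_min one_pos (hsub hs).2).ne'
  have hqt : q₀ ≠ ⊤ := (min_lt_of_left_lt ENNReal.one_lt_top).ne
  have hq0' : 0 < q₀.toReal := ENNReal.toReal_pos hq0 hqt
  have hlip : ∀ x ∈ Icc p q, ∀ y ∈ Icc p q, x < y → ‖uu y - uu x‖ ≤ K / q₀.toReal * (y - x) := by
    intro x hx y hy hxy
    have h1 : q₀ * ‖uu y - uu x‖ₑ ≤ ENNReal.ofReal (K * (y - x)) := by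
      refine le_trans ?_ (le_add_self.trans (hinc x y (hpa.trans hx.1) hxy (hy.2.trans hqb)))
      refine mul_le_mul_left (le_iInf₂ fun z hz => ?_) _
      exact (min_le_right _ _).trans (hmin ⟨hx.1.trans hz.1, hz.2.trans hy.2⟩)
    have h2 := ENNReal.toReal_mono ENNReal.ofReal_ne_top h1
    rw [ENNReal.toReal_mul, toReal_enorm, ENNReal.toReal_ofReal (mul_nonneg hK (by linarith))] at h2
    rw [div_mul_eq_mul_div, le_div_iff₀ hq0', mul_comm]
    exact h2
  refine LipschitzOnWith.absolutelyContinuousOnInterval (K := (K / q₀.toReal).toNNReal) ?_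
  rw [uIcc_of_le hpq.le]
  refine LipschitzOnWith.of_dist_le_mul fun x hx y hy => ?_
  rw [Real.coe_toNNReal _ (by positivity)]
  rcases lt_trichotomy x y with h | rfl | h
  · rw [dist_comm, dist_eq_norm, dist_comm, Real.dist_eq, abs_of_pos (by linarith)]
    exact hlip x hx y hy h
  · simp
  · rw [dist_eq_norm, Real.dist_eq, abs_of_pos (by linarith)]
    exact hlip y hy x hx h

/-- The only requirement is that `ρ` hits every point between its end values: then the infimum of
the slope after composition is no larger. -/
theorem incCost_comp_le {tt ρ : ℝ → ℝ} {uu : ℝ → V} {x y : ℝ}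
    (hsurj : Icc (ρ x) (ρ y) ⊆ ρ '' Icc x y) :
    S.incCost (fun r => tt (ρ r)) (fun r => uu (ρ r)) x y ≤ S.incCost tt uu (ρ x) (ρ y) := by
  refine add_le_add le_rfl (mul_le_mul_left (le_iInf₂ fun w hw => ?_) _)
  obtain ⟨z, hz, rfl⟩ := hsurj hw
  exact iInf₂_le z hz

/-- Reparametrization on `[0,1]` with bounded speed. -/
theorem IsRegularCurve.exists_reparam {E : ℝ} {tt : ℝ → ℝ} {uu : ℝ → V} {c d : ℝ}
    (h : S.IsRegularCurve E tt uu c d) (hV : HasRadonNikodymProperty V) (hS : S.Standing)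
    (hE : 0 < E) (hcd : c < d) (hfin : S.dissipation tt uu c d ≠ ⊤) {η : ℝ} (hη : 0 < η) :
    ∃ ρ : ℝ → ℝ, MapsTo ρ (Icc 0 1) (Icc c d) ∧ MonotoneOn ρ (Icc 0 1) ∧ ρ 0 = c ∧ ρ 1 = d ∧
      ∀ x y, 0 ≤ x → x < y → y ≤ 1 →
        S.incCost (fun r => tt (ρ r)) (fun r => uu (ρ r)) x y ≤
          ivar (S.incCost tt uu) (ρ x) (ρ y) ∧
        ivar (S.incCost tt uu) (ρ x) (ρ y) ≤
          ENNReal.ofReal ((η + (S.dissipation tt uu c d).toReal) * (y - x)) := by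
  set A := ivar (S.incCost tt uu) with hA
  have hAcd : A c d = S.dissipation tt uu c d := (h.dissipation_eq hV hS hE hcd.le).symm
  rw [← hAcd] at hfin ⊢
  have hadd : ∀ x y z, c ≤ x → x ≤ y → y ≤ z → z ≤ d → A x y + A y z = A x z :=
    fun x y z _ hxy hyz _ => hS.ivar_incCost_add tt uu hxy hyz
  have hAr : ∀ x y, c ≤ x → x ≤ y → y ≤ d → A x y ≠ ⊤ := fun x y hx hxy hy =>
    ne_top_of_le_ne_top hfin (ivar_mono _ hx hxy hy)
  have hcont : ContinuousOn (fun r => (A c r).toReal) (Icc c d) := by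
    refine continuousOn_toReal_of_additive hfin hadd fun ε hε => ?_
    have hsplit := hAcd
    rw [dissipation, h.setLIntegral_unstableSet hS hE] at hsplit
    rw [hsplit] at hfin
    obtain ⟨f1, f2⟩ := ENNReal.add_ne_top.1 hfin
    obtain ⟨δ₁, hδ₁, H₁⟩ := exists_setLIntegral_Icc_lt f1 (half_pos hε)
    obtain ⟨δ₂, hδ₂, H₂⟩ := exists_setLIntegral_Icc_lt f2 (half_pos hε)
    refine ⟨min δ₁ δ₂, lt_min hδ₁ hδ₂, fun x hx y hy hxy hlt => ?_⟩
    have hr := h.mono hx.1 hy.2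
    have : A x y = S.dissipation tt uu x y := (hr.dissipation_eq hV hS hE hxy).symm
    rw [this, dissipation, hr.setLIntegral_unstableSet hS hE]
    calc _ < ENNReal.ofReal (ε / 2) + ENNReal.ofReal (ε / 2) :=
          ENNReal.add_lt_add (H₁ x hx y hy hxy (hlt.trans_le (min_le_left _ _)))
            (H₂ x hx y hy hxy (hlt.trans_le (min_le_right _ _)))
      _ = ENNReal.ofReal ε := by
          rw [← ENNReal.ofReal_add (by linarith) (by linarith)]; ring_nf
  have hdc : 0 < d - c := by linarith
  -- The arclength with an added linear term of total mass `η`. It is strictly increasing even where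
  -- the cost vanishes, so `ρ` is its inverse rescaled to `[0,1]`.
  set W : ℝ → ℝ := fun r => η / (d - c) * (r - c) + (A c r).toReal with hW
  have hWc : ContinuousOn W (Icc c d) := by
    refine ContinuousOn.add ?_ hcont
    fun_prop
  have hsub : ∀ x y, c ≤ x → x ≤ y → y ≤ d →
      W y - W x = η / (d - c) * (y - x) + (A x y).toReal := by
    intro x y hx hxy hy
    simp only [hW]
    rw [← hadd c x y le_rfl hx hxy hy, ENNReal.toReal_add (hAr _ _ le_rfl hx (hxy.trans hy))
      (hAr _ _ hx hxy hy)]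
    ring
  have hmono : ∀ x y, c ≤ x → x < y → y ≤ d → W x < W y := by
    intro x y hx hxy hy
    have h1 := hsub x y hx hxy.le hy
    have h2 : 0 < η / (d - c) * (y - x) := mul_pos (div_pos hη hdc) (by linarith)
    linarith [ENNReal.toReal_nonneg (a := A x y)]
  have hW0 : W c = 0 := by simp [hW, hA, ivar_self]
  set Λ := η + (A c d).toReal with hΛ
  have hWd : W d = Λ := by
    have : d - c ≠ 0 := hdc.ne'
    simp only [hW, hΛ]
    field_simp
  have hΛ0 : 0 < Λ := by rw [← hWd, ← hW0]; exact hmono c d le_rfl hcd le_rfl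
  have hinj : ∀ x ∈ Icc c d, ∀ y ∈ Icc c d, W x = W y → x = y := by
    intro x hx y hy hxy
    rcases lt_trichotomy x y with hl | hl | hl
    · exact absurd hxy (hmono x y hx.1 hl hy.2).ne
    · exact hl
    · exact absurd hxy (hmono y x hy.1 hl hx.2).ne'
  have hex : ∀ z, ∃ r, z ∈ Icc (0 : ℝ) 1 → r ∈ Icc c d ∧ W r = Λ * z := by
    intro z
    by_cases hz : z ∈ Icc (0 : ℝ) 1
    · obtain ⟨r, hr, hrz⟩ := intermediate_value_Icc hcd.le hWc
        (show Λ * z ∈ Icc (W c) (W d) by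
          rw [hW0, hWd]
          exact ⟨mul_nonneg hΛ0.le hz.1, mul_le_of_le_one_right hΛ0.le hz.2⟩)
      exact ⟨r, fun _ => ⟨hr, hrz⟩⟩
    · exact ⟨0, fun h => absurd h hz⟩
  choose ρ hρ using hex
  have hρmono : MonotoneOn ρ (Icc 0 1) := by
    intro x hx y hy hxy
    by_contra hlt
    have h1 := hmono _ _ (hρ y hy).1.1 (not_le.1 hlt) (hρ x hx).1.2
    rw [(hρ x hx).2, (hρ y hy).2] at h1
    nlinarith
  refine ⟨ρ, fun z hz => (hρ z hz).1, hρmono, ?_, ?_, ?_⟩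
  · refine hinj _ (hρ 0 (by simp)).1 _ (left_mem_Icc.2 hcd.le) ?_
    rw [(hρ 0 (by simp)).2, hW0, mul_zero]
  · refine hinj _ (hρ 1 (by simp)).1 _ (right_mem_Icc.2 hcd.le) ?_
    rw [(hρ 1 (by simp)).2, hWd, mul_one]
  · intro x y hx hxy hy
    have hxm : x ∈ Icc (0 : ℝ) 1 := ⟨hx, hxy.le.trans hy⟩
    have hym : y ∈ Icc (0 : ℝ) 1 := ⟨hx.trans hxy.le, hy⟩
    have hlt : ρ x < ρ y := by
      refine lt_of_le_of_ne (hρmono hxm hym hxy.le) fun heq => ?_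
      have := (hρ x hxm).2
      rw [heq, (hρ y hym).2] at this
      nlinarith
    constructor
    · refine (incCost_comp_le fun w hw => ?_).trans (le_ivar _ hlt)
      have hwm : w ∈ Icc c d := ⟨(hρ x hxm).1.1.trans hw.1, hw.2.trans (hρ y hym).1.2⟩
      have hWle : ∀ p q, c ≤ p → p ≤ q → q ≤ d → W p ≤ W q := fun p q hp hpq hq => by
        rcases hpq.eq_or_lt with rfl | hpq
        · exact le_rfl
        · exact (hmono p q hp hpq hq).le
      have h1 : Λ * x ≤ W w := by
        rw [← (hρ x hxm).2]; exact hWle _ _ (hρ x hxm).1.1 hw.1 hwm.2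
      have h2 : W w ≤ Λ * y := by
        rw [← (hρ y hym).2]; exact hWle _ _ hwm.1 hw.2 (hρ y hym).1.2
      have hz : W w / Λ ∈ Icc x y :=
        ⟨by rw [le_div_iff₀ hΛ0]; linarith, by rw [div_le_iff₀ hΛ0]; linarith⟩
      have hz1 : W w / Λ ∈ Icc (0 : ℝ) 1 := ⟨hx.trans hz.1, hz.2.trans hy⟩
      refine ⟨W w / Λ, hz, hinj _ (hρ _ hz1).1 _ hwm ?_⟩
      rw [(hρ _ hz1).2]
      field_simp
    · have h1 := hsub _ _ (hρ x hxm).1.1 hlt.le (hρ y hym).1.2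
      rw [(hρ x hxm).2, (hρ y hym).2] at h1
      rw [← ENNReal.ofReal_toReal (hAr _ _ (hρ x hxm).1.1 hlt.le (hρ y hym).1.2)]
      refine ENNReal.ofReal_le_ofReal ?_
      have : 0 ≤ η / (d - c) * (ρ y - ρ x) := mul_nonneg (div_pos hη hdc).le (by linarith)
      linarith

/-- A piece of a regular curve at a fixed time is a competitor for the Finsler cost. -/
theorem IsRegularCurve.finslerCost_le {E : ℝ} {tt : ℝ → ℝ} {uu : ℝ → V} {c d t : ℝ}
    (h : S.IsRegularCurve E tt uu c d) (hV : HasRadonNikodymProperty V) (hS : S.Standing)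
    (hE : 0 < E) (hcd : c ≤ d) (htt : ∀ s ∈ Icc c d, tt s = t) :
    S.finslerCost t (uu c) (uu d) ≤ S.dissipation tt uu c d := by
  rcases hcd.eq_or_lt with rfl | hcd
  · rw [hS.finslerCost_self hE t (h.psiAC.1 (left_mem_Icc.2 le_rfl))]
    exact zero_le
  rcases eq_or_ne (S.dissipation tt uu c d) ⊤ with htop | hfin
  · simp [htop]
  have ht : t ∈ Icc 0 S.T := htt c (left_mem_Icc.2 hcd.le) ▸ h.mapsTo (left_mem_Icc.2 hcd.le)
  -- Bounded speed restores Ψ-absolute continuity and local absolute continuity on the unstable set,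
  -- while the variation of the cost does not increase.
  obtain ⟨ρ, hρm, hρ, h0, h1, H⟩ := h.exists_reparam hV hS hE hcd hfin one_pos
  set θ : ℝ → V := fun r => uu (ρ r) with hθ
  have hcost : ∀ x y, 0 ≤ x → x < y → y ≤ 1 → S.incCost (fun _ => t) θ x y ≤
      ivar (S.incCost tt uu) (ρ x) (ρ y) := by
    intro x y hx hxy hy
    refine le_trans (le_of_eq ?_) (H x y hx hxy hy).1
    unfold incCost slopeCost
    congr 2
    refine biInf_congr fun z hz => ?_
    beta_reduce
    rw [htt (ρ z) (hρm ⟨hx.trans hz.1, hz.2.trans hy⟩)]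
  have hreg : S.IsRegularCurve E (fun _ => t) θ 0 1 :=
    hS.isRegularCurve_of_incCost_le hE (K := 1 + (S.dissipation tt uu c d).toReal) (by positivity)
      (fun _ _ => ht) continuousOn_const (fun r hr => h.psiAC.1 (hρm hr))
      (fun x y hx hxy hy => (hcost x y hx hxy hy).trans (H x y hx hxy hy).2)
  have htr : S.IsTransition t (uu c) (uu d) θ :=
    ⟨⟨E, hE, hreg.psiAC⟩, hreg.locallyAC, by simp [hθ, h0], by simp [hθ, h1]⟩
  refine (iInf₂_le θ htr).trans ?_
  rw [hreg.dissipation_eq hV hS hE zero_le_one, h.dissipation_eq hV hS hE hcd.le, ← h0, ← h1]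
  exact ivar_comp_le zero_le_one hρ hcost

end RateIndependentSystem

/-! ### Fibres of monotone functions -/

/-- The smallest point of `[a,b]` at which `f` takes the value `t`. -/
def fiberMin (f : ℝ → ℝ) (a b t : ℝ) : ℝ := sInf {s | s ∈ Icc a b ∧ f s = t}

/-- The largest point of `[a,b]` at which `f` takes the value `t`. -/
def fiberMax (f : ℝ → ℝ) (a b t : ℝ) : ℝ := sSup {s | s ∈ Icc a b ∧ f s = t}

theorem fiberMin_le {f : ℝ → ℝ} {a b s : ℝ} (hs : s ∈ Icc a b) : fiberMin f a b (f s) ≤ s :=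
  csInf_le ⟨a, fun _ hr => hr.1.1⟩ ⟨hs, rfl⟩

theorem le_fiberMax {f : ℝ → ℝ} {a b s : ℝ} (hs : s ∈ Icc a b) : s ≤ fiberMax f a b (f s) :=
  le_csSup ⟨b, fun _ hr => hr.1.2⟩ ⟨hs, rfl⟩

theorem isCompact_fiber {f : ℝ → ℝ} {a b : ℝ} (hf : ContinuousOn f (Icc a b)) (t : ℝ) :
    IsCompact {s | s ∈ Icc a b ∧ f s = t} := by
  have : {s | s ∈ Icc a b ∧ f s = t} = Icc a b ∩ f ⁻¹' {t} := rfl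
  rw [this]
  exact isCompact_Icc.of_isClosed_subset (hf.preimage_isClosed_of_isClosed isClosed_Icc
    isClosed_singleton) inter_subset_left

theorem nonempty_fiber {f : ℝ → ℝ} {a b t : ℝ} (hab : a ≤ b) (hf : ContinuousOn f (Icc a b))
    (ht : t ∈ Icc (f a) (f b)) : {s | s ∈ Icc a b ∧ f s = t}.Nonempty := by
  obtain ⟨s, hs, h⟩ := intermediate_value_Icc hab hf ht
  exact ⟨s, hs, h⟩

theorem fiberMin_mem {f : ℝ → ℝ} {a b t : ℝ} (hab : a ≤ b) (hf : ContinuousOn f (Icc a b))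
    (ht : t ∈ Icc (f a) (f b)) : fiberMin f a b t ∈ Icc a b ∧ f (fiberMin f a b t) = t :=
  (isCompact_fiber hf t).sInf_mem (nonempty_fiber hab hf ht)

theorem fiberMax_mem {f : ℝ → ℝ} {a b t : ℝ} (hab : a ≤ b) (hf : ContinuousOn f (Icc a b))
    (ht : t ∈ Icc (f a) (f b)) : fiberMax f a b t ∈ Icc a b ∧ f (fiberMax f a b t) = t :=
  (isCompact_fiber hf t).sSup_mem (nonempty_fiber hab hf ht)

theorem MonotoneOn.lt_of_lt_Icc {f : ℝ → ℝ} {a b x y : ℝ} (hf : MonotoneOn f (Icc a b))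
    (hx : x ∈ Icc a b) (hy : y ∈ Icc a b) (h : f x < f y) : x < y := by
  by_contra hlt
  exact absurd (hf hy hx (not_lt.1 hlt)) (not_le.2 h)

/-- Sections of a monotone continuous function converge to the end points of the fibres. -/
theorem tendsto_section_left {f σ : ℝ → ℝ} {a b t : ℝ} (hab : a ≤ b) (hm : MonotoneOn f (Icc a b))
    (hf : ContinuousOn f (Icc a b)) (hσ : ∀ r ∈ Icc (f a) (f b), σ r ∈ Icc a b ∧ f (σ r) = r)
    (ht : t ∈ Ioc (f a) (f b)) :
    Tendsto σ (𝓝[<] t) (𝓝[Icc a b] (fiberMin f a b t)) := by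
  obtain ⟨hmem, hmt⟩ := fiberMin_mem hab hf (Ioc_subset_Icc_self ht)
  have hI : ∀ᶠ r in 𝓝[<] t, r ∈ Ioo (f a) t := Ioo_mem_nhdsLT ht.1
  have hsub : ∀ r ∈ Ioo (f a) t, r ∈ Icc (f a) (f b) := fun r hr => ⟨hr.1.le, hr.2.le.trans ht.2⟩
  refine tendsto_nhdsWithin_iff.2 ⟨tendsto_order.2 ⟨fun p hp => ?_, fun q hq => ?_⟩, ?_⟩
  · have ham : a < fiberMin f a b t := by
      refine lt_of_le_of_ne hmem.1 fun h => ?_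
      rw [← h] at hmt
      exact ht.1.ne hmt
    have hlt : max p a < fiberMin f a b t := max_lt hp ham
    have hpm : max p a ∈ Icc a b := ⟨le_max_right _ _, hlt.le.trans hmem.2⟩
    have hft : f (max p a) < t := by
      refine lt_of_le_of_ne (hmt ▸ hm hpm hmem hlt.le) fun h => ?_
      exact absurd (h ▸ fiberMin_le (f := f) hpm) (not_le.2 hlt)
    filter_upwards [hI, Ioo_mem_nhdsLT hft] with r hr hr'
    have h1 := hσ r (hsub r hr)
    exact (le_max_left _ _).trans_lt (hm.lt_of_lt_Icc hpm h1.1 (by rw [h1.2]; exact hr'.1))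
  · filter_upwards [hI] with r hr
    have h1 := hσ r (hsub r hr)
    exact (hm.lt_of_lt_Icc h1.1 hmem (by rw [h1.2, hmt]; exact hr.2)).trans hq
  · filter_upwards [hI] with r hr using (hσ r (hsub r hr)).1

theorem tendsto_section_right {f σ : ℝ → ℝ} {a b t : ℝ} (hab : a ≤ b)
    (hm : MonotoneOn f (Icc a b)) (hf : ContinuousOn f (Icc a b))
    (hσ : ∀ r ∈ Icc (f a) (f b), σ r ∈ Icc a b ∧ f (σ r) = r) (ht : t ∈ Ico (f a) (f b)) :
    Tendsto σ (𝓝[>] t) (𝓝[Icc a b] (fiberMax f a b t)) := by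
  obtain ⟨hmem, hmt⟩ := fiberMax_mem hab hf (Ico_subset_Icc_self ht)
  have hI : ∀ᶠ r in 𝓝[>] t, r ∈ Ioo t (f b) := Ioo_mem_nhdsGT ht.2
  have hsub : ∀ r ∈ Ioo t (f b), r ∈ Icc (f a) (f b) := fun r hr => ⟨ht.1.trans hr.1.le, hr.2.le⟩
  refine tendsto_nhdsWithin_iff.2 ⟨tendsto_order.2 ⟨fun p hp => ?_, fun q hq => ?_⟩, ?_⟩
  · filter_upwards [hI] with r hr
    have h1 := hσ r (hsub r hr)
    exact hp.trans (hm.lt_of_lt_Icc hmem h1.1 (by rw [h1.2, hmt]; exact hr.1))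
  · have hbm : fiberMax f a b t < b := by
      refine lt_of_le_of_ne hmem.2 fun h => ?_
      rw [h] at hmt
      exact ht.2.ne' hmt
    have hlt : fiberMax f a b t < min q b := lt_min hq hbm
    have hqm : min q b ∈ Icc a b := ⟨hmem.1.trans hlt.le, min_le_right _ _⟩
    have hft : t < f (min q b) := by
      refine lt_of_le_of_ne (hmt ▸ hm hmem hqm hlt.le) fun h => ?_
      exact absurd (h ▸ le_fiberMax (f := f) hqm) (not_le.2 hlt)
    filter_upwards [hI, Ioo_mem_nhdsGT hft] with r hr hr'
    have h1 := hσ r (hsub r hr)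
    exact (hm.lt_of_lt_Icc h1.1 hqm (by rw [h1.2]; exact hr'.2)).trans_le (min_le_left _ _)
  · filter_upwards [hI] with r hr using (hσ r (hsub r hr)).1

namespace RateIndependentSystem

variable {V : Type*} [NormedAddCommGroup V] [NormedSpace ℝ V] {S : RateIndependentSystem V}

/-! ### Curves selected from admissible parameterized curves -/

theorem IsAdmissible.isRegularCurve {tt : ℝ → ℝ} {uu : ℝ → V} {a b : ℝ}
    (h : S.IsAdmissible tt uu a b) (hab : a ≤ b) : ∃ E > 0, S.IsRegularCurve E tt uu a b := by
  obtain ⟨E, hE, hu⟩ := h.psiAC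
  refine ⟨E, hE, h.mapsTo, ?_, hu, h.locallyAC⟩
  have := h.ac.continuousOn
  rwa [uIcc_of_le hab] at this

variable (S) in
/-- `σ` is a section of `tt` along which `u` is the trace of `uu`. -/
def IsSection (tt : ℝ → ℝ) (uu : ℝ → V) (a b : ℝ) (u : ℝ → V) (σ : ℝ → ℝ) : Prop :=
  ∀ t ∈ Icc 0 S.T, σ t ∈ Icc a b ∧ tt (σ t) = t ∧ uu (σ t) = u t

theorem IsSelection.exists_isSection {tt : ℝ → ℝ} {uu : ℝ → V} {a b : ℝ} {u : ℝ → V}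
    (h : S.IsSelection tt uu a b u) : ∃ σ, S.IsSection tt uu a b u σ := by
  have : ∀ t, ∃ s, t ∈ Icc 0 S.T → s ∈ Icc a b ∧ tt s = t ∧ uu s = u t := by
    intro t
    by_cases ht : t ∈ Icc 0 S.T
    · obtain ⟨s, hs, h1⟩ := h t ht
      exact ⟨s, fun _ => ⟨hs, h1⟩⟩
    · exact ⟨0, fun h => absurd h ht⟩
  choose σ hσ using this
  exact ⟨σ, hσ⟩

section Selected

variable {tt : ℝ → ℝ} {uu : ℝ → V} {a b : ℝ} {u : ℝ → V} {σ : ℝ → ℝ}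

theorem IsSection.lt (hσ : S.IsSection tt uu a b u σ) (h : S.IsAdmissible tt uu a b) {x y : ℝ}
    (hx : x ∈ Icc 0 S.T) (hy : y ∈ Icc 0 S.T) (hxy : x < y) : σ x < σ y :=
  h.monotone.lt_of_lt_Icc (hσ x hx).1 (hσ y hy).1 (by rwa [(hσ x hx).2.1, (hσ y hy).2.1])

/-- Whatever points the section picks, for times below `t` they converge to the left end of the
fibre over `t`. -/
theorem IsSection.leftVal_eq (hσ : S.IsSection tt uu a b u σ) (h : S.IsAdmissible tt uu a b)
    (hS : S.Standing) (hab : a ≤ b) (hsurj : S.IsSurjective tt a b) {t : ℝ} (ht : t ∈ Ioc 0 S.T) :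
    leftVal u t = uu (fiberMin tt a b t) := by
  obtain ⟨E, hE, hr⟩ := h.isRegularCurve hab
  have hmem := (fiberMin_mem hab hr.cont (t := t)
    (by rw [hsurj.1, hsurj.2]; exact Ioc_subset_Icc_self ht)).1
  refine leftVal_eq_of_tendsto ht.1 ?_
  have h1 := tendsto_section_left hab h.monotone hr.cont (σ := σ)
    (fun r hr => by
      rw [hsurj.1, hsurj.2] at hr
      exact ⟨(hσ r hr).1, (hσ r hr).2.1⟩) (t := t) (by rwa [hsurj.1, hsurj.2])
  refine Tendsto.congr' ?_ ((hr.continuousOn hS hE _ hmem).tendsto.comp h1)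
  filter_upwards [Ioo_mem_nhdsLT ht.1] with r hr
  exact (hσ r ⟨hr.1.le, hr.2.le.trans ht.2⟩).2.2

theorem IsSection.rightVal_eq (hσ : S.IsSection tt uu a b u σ) (h : S.IsAdmissible tt uu a b)
    (hS : S.Standing) (hab : a ≤ b) (hsurj : S.IsSurjective tt a b) {t : ℝ} (ht : t ∈ Ico 0 S.T) :
    S.rightVal u t = uu (fiberMax tt a b t) := by
  obtain ⟨E, hE, hr⟩ := h.isRegularCurve hab
  have hmem := (fiberMax_mem hab hr.cont (t := t)
    (by rw [hsurj.1, hsurj.2]; exact Ico_subset_Icc_self ht)).1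
  refine rightVal_eq_of_tendsto ht.2 ?_
  have h1 := tendsto_section_right hab h.monotone hr.cont (σ := σ)
    (fun r hr => by
      rw [hsurj.1, hsurj.2] at hr
      exact ⟨(hσ r hr).1, (hσ r hr).2.1⟩) (t := t) (by rwa [hsurj.1, hsurj.2])
  refine Tendsto.congr' ?_ ((hr.continuousOn hS hE _ hmem).tendsto.comp h1)
  filter_upwards [Ioo_mem_nhdsGT ht.2] with r hr
  exact (hσ r ⟨ht.1.trans hr.1.le, hr.2.le⟩).2.2

/-- Were the left end of the fibre unstable, a left neighbourhood of it would be unstable too. Then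
`tt` would be constant there and the fibre would reach further left. The condition `t > 0` provides
room on the left. -/
theorem IsAdmissible.slope_fiberMin (h : S.IsAdmissible tt uu a b) (hS : S.Standing) (hab : a ≤ b)
    (hsurj : S.IsSurjective tt a b) {t : ℝ} (ht : t ∈ Ioc 0 S.T) :
    S.slope t (uu (fiberMin tt a b t)) = 0 := by
  obtain ⟨E, hE, hr⟩ := h.isRegularCurve hab
  obtain ⟨hmem, hmt⟩ := fiberMin_mem hab hr.cont (t := t)
    (by rw [hsurj.1, hsurj.2]; exact Ioc_subset_Icc_self ht)
  by_contra hne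
  have hG : fiberMin tt a b t ∈ S.unstableSet tt uu a b :=
    ⟨hmem, by rw [hmt]; exact pos_iff_ne_zero.2 hne⟩
  obtain ⟨ε, hε, H⟩ := hr.eventually_unstable hS hE hG
  set m := fiberMin tt a b t with hm
  have ham : a < m := by
    refine lt_of_le_of_ne hmem.1 fun h' => ?_
    rw [← h', hsurj.1] at hmt
    exact ht.1.ne hmt
  set p := max a (m - ε / 2) with hp
  have hpm : p < m := max_lt ham (by linarith)
  have hpmem : p ∈ Icc a b := ⟨le_max_left _ _, hpm.le.trans hmem.2⟩
  have hc := h.const p m hpm.le fun r hr => H r ⟨hpmem.1.trans hr.1, hr.2.trans hmem.2⟩ (by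
    rw [abs_sub_comm, abs_of_nonneg (by linarith [hr.2])]
    linarith [hr.1, le_max_right a (m - ε / 2)])
  rw [hmt] at hc
  have := fiberMin_le (f := tt) hpmem
  rw [hc] at this
  linarith

theorem IsAdmissible.slope_fiberMax (h : S.IsAdmissible tt uu a b) (hS : S.Standing) (hab : a ≤ b)
    (hsurj : S.IsSurjective tt a b) {t : ℝ} (ht : t ∈ Ico 0 S.T) :
    S.slope t (uu (fiberMax tt a b t)) = 0 := by
  obtain ⟨E, hE, hr⟩ := h.isRegularCurve hab
  obtain ⟨hmem, hmt⟩ := fiberMax_mem hab hr.cont (t := t)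
    (by rw [hsurj.1, hsurj.2]; exact Ico_subset_Icc_self ht)
  by_contra hne
  have hG : fiberMax tt a b t ∈ S.unstableSet tt uu a b :=
    ⟨hmem, by rw [hmt]; exact pos_iff_ne_zero.2 hne⟩
  obtain ⟨ε, hε, H⟩ := hr.eventually_unstable hS hE hG
  set m := fiberMax tt a b t with hm
  have hmb : m < b := by
    refine lt_of_le_of_ne hmem.2 fun h' => ?_
    rw [h', hsurj.2] at hmt
    exact ht.2.ne' hmt
  set p := min b (m + ε / 2) with hp
  have hpm : m < p := lt_min hmb (by linarith)
  have hpmem : p ∈ Icc a b := ⟨hmem.1.trans hpm.le, min_le_left _ _⟩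
  have hc := h.const m p hpm.le fun r hr => H r ⟨hmem.1.trans hr.1, hr.2.trans hpmem.2⟩ (by
    rw [abs_of_nonneg (by linarith [hr.1])]
    linarith [hr.2, min_le_right b (m + ε / 2)])
  rw [hmt] at hc
  have := le_fiberMax (f := tt) hpmem
  rw [← hc] at this
  linarith

theorem IsSection.isPsiBV (hσ : S.IsSection tt uu a b u σ) (h : S.IsAdmissible tt uu a b)
    (hS : S.Standing) {E : ℝ} (hu : S.IsPsiAC (S.sublevel E) uu a b) :
    S.IsPsiBV (S.sublevel E) u := by
  refine ⟨fun t ht => (hσ t ht).2.2 ▸ hu.1 (hσ t ht).1, ?_⟩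
  have h0 : (0 : ℝ) ∈ Icc 0 S.T := left_mem_Icc.2 hS.T_pos.le
  have hT : S.T ∈ Icc 0 S.T := right_mem_Icc.2 hS.T_pos.le
  have h1 : S.psiVar u 0 S.T ≤ S.psiVar uu (σ 0) (σ S.T) := by
    simp only [psiVar_eq_ivar]
    refine ivar_comp_le hS.T_pos.le (fun x hx y hy hxy => ?_) fun x y hx hxy hy => ?_
    · rcases hxy.eq_or_lt with rfl | hxy
      · exact le_rfl
      · exact (hσ.lt h hx hy hxy).le
    · have hxm : x ∈ Icc 0 S.T := ⟨hx, hxy.le.trans hy⟩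
      have hym : y ∈ Icc 0 S.T := ⟨hx.trans hxy.le, hy⟩
      rw [← (hσ x hxm).2.2, ← (hσ y hym).2.2]
      exact le_ivar (fun x y => S.psiCost 0 (uu x) (uu y)) (hσ.lt h hxm hym hxy)
  refine h1.trans_lt (lt_top_iff_ne_top.2 (hu.mono (hσ 0 h0).1.1 (hσ S.T hT).1.2).psiVar_ne_top)

theorem IsSection.locallyStable (hσ : S.IsSection tt uu a b u σ) (h : S.IsAdmissible tt uu a b)
    (hS : S.Standing) (hab : a ≤ b) (hsurj : S.IsSurjective tt a b) : S.LocallyStable u := by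
  intro t ht
  obtain ⟨E, hE, hr⟩ := h.isRegularCurve hab
  have humem : u t ∈ S.sublevel E := (hσ t ht.1).2.2 ▸ hr.psiAC.1 (hσ t ht.1).1
  refine hS.isStableAt_of_slope_eq_zero hE ht.1 humem ?_
  have hl : leftVal u t = u t := by
    by_contra hne
    exact ht.2 ⟨ht.1, Or.inl hne⟩
  have hr' : u t = S.rightVal u t := by
    by_contra hne
    exact ht.2 ⟨ht.1, Or.inr hne⟩
  -- Off the jump set `u t` equals both one-sided limits. The left one is uninformative at time 0,
  -- by its convention, so the right one is used there.
  rcases ht.1.1.eq_or_lt with h0 | h0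
  · have htm : t ∈ Ico 0 S.T := ⟨ht.1.1, h0 ▸ hS.T_pos⟩
    rw [hr', hσ.rightVal_eq h hS hab hsurj htm]
    exact h.slope_fiberMax hS hab hsurj htm
  · have htm : t ∈ Ioc 0 S.T := ⟨h0, ht.1.2⟩
    rw [← hl, hσ.leftVal_eq h hS hab hsurj htm]
    exact h.slope_fiberMin hS hab hsurj htm

end Selected

end RateIndependentSystem

theorem MonotoneOn.eq_of_mem_Icc {f : ℝ → ℝ} {a b x y s : ℝ} (hf : MonotoneOn f (Icc a b))
    (hx : x ∈ Icc a b) (hy : y ∈ Icc a b) (hxy : f x = f y) (hs : s ∈ Icc x y) : f s = f y :=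
  le_antisymm (hf ⟨hx.1.trans hs.1, hs.2.trans hy.2⟩ hy hs.2)
    (hxy ▸ hf hx ⟨hx.1.trans hs.1, hs.2.trans hy.2⟩ hs.1)

namespace RateIndependentSystem

variable {V : Type*} [NormedAddCommGroup V] [NormedSpace ℝ V] {S : RateIndependentSystem V}

/-! ### Bounding the 𝔣-variation by the dissipation -/

section Selected

variable {tt : ℝ → ℝ} {uu : ℝ → V} {a b : ℝ} {u : ℝ → V} {σ : ℝ → ℝ}

/-- The parameter interval splits at the right end `p` of the fibre over `x` and the left end `q` of
the fibre over `y`. The outer pieces run at a fixed time and compete for the Finsler costs of the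
two jumps. The inner piece controls the Ψ-variation of `u` with its end values replaced by the
one-sided limits. -/
theorem IsSection.psiVar_add_excess_le (hσ : S.IsSection tt uu a b u σ)
    (h : S.IsAdmissible tt uu a b) (hV : HasRadonNikodymProperty V) (hS : S.Standing) (hab : a ≤ b)
    (hsurj : S.IsSurjective tt a b) {x y : ℝ} (hx : 0 ≤ x) (hxy : x < y) (hy : y ≤ S.T) :
    S.rightExcess u x + S.leftExcess u y + S.psiVar u x y ≤ S.dissipation tt uu (σ x) (σ y) := by
  classical
  obtain ⟨E, hE, hr⟩ := h.isRegularCurve hab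
  have hxm : x ∈ Icc 0 S.T := ⟨hx, hxy.le.trans hy⟩
  have hym : y ∈ Icc 0 S.T := ⟨hx.trans hxy.le, hy⟩
  obtain ⟨hp, hpt⟩ := fiberMax_mem hab hr.cont (t := x) (by rwa [hsurj.1, hsurj.2])
  obtain ⟨hq, hqt⟩ := fiberMin_mem hab hr.cont (t := y) (by rwa [hsurj.1, hsurj.2])
  have hrx := hσ.rightVal_eq h hS hab hsurj (t := x) ⟨hx, hxy.trans_le hy⟩
  have hly := hσ.leftVal_eq h hS hab hsurj (t := y) ⟨hx.trans_lt hxy, hy⟩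
  obtain ⟨hσx, hσxt, hσxu⟩ := hσ x hxm
  obtain ⟨hσy, hσyt, hσyu⟩ := hσ y hym
  have hxp : σ x ≤ fiberMax tt a b x := by
    have := le_fiberMax (f := tt) hσx
    rwa [hσxt] at this
  have hqy : fiberMin tt a b y ≤ σ y := by
    have := fiberMin_le (f := tt) hσy
    rwa [hσyt] at this
  set p := fiberMax tt a b x with hpdef
  set q := fiberMin tt a b y with hqdef
  have hpq : p < q := h.monotone.lt_of_lt_Icc hp hq (by rw [hpt, hqt]; exact hxy)
  -- The section is moved to `p` over `x` and to `q` over `y`, so that `uu ∘ τ` has no jump at the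
  -- two ends.
  set τ : ℝ → ℝ := Function.update (Function.update σ x p) y q with hτ
  have hτx : τ x = p := by
    rw [hτ, Function.update_of_ne hxy.ne, Function.update_self]
  have hτy : τ y = q := Function.update_self _ _ _
  have hτm : ∀ r ∈ Ioo x y, τ r = σ r := fun r hr => by
    rw [hτ, Function.update_of_ne hr.2.ne, Function.update_of_ne hr.1.ne']
  have hττ : ∀ r ∈ Icc x y, τ r ∈ Icc a b ∧ tt (τ r) = r := by
    intro r hr
    rcases hr.1.eq_or_lt with rfl | h1
    · rw [hτx]; exact ⟨hp, hpt⟩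
    rcases hr.2.eq_or_lt with rfl | h2
    · rw [hτy]; exact ⟨hq, hqt⟩
    rw [hτm r ⟨h1, h2⟩]
    have := hσ r ⟨hx.trans h1.le, h2.le.trans hy⟩
    exact ⟨this.1, this.2.1⟩
  have hτlt : ∀ r ∈ Icc x y, ∀ r' ∈ Icc x y, r < r' → τ r < τ r' := fun r hr r' hr' hlt =>
    h.monotone.lt_of_lt_Icc (hττ r hr).1 (hττ r' hr').1
      (by rwa [(hττ r hr).2, (hττ r' hr').2])
  have h1 := hS.psiVar_le_of_eqOn_Ioo (u := u) (z := fun r => uu (τ r)) hxy fun r hr => by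
    beta_reduce
    rw [hτm r hr]
    exact ((hσ r ⟨hx.trans hr.1.le, hr.2.le.trans hy⟩).2.2).symm
  have h2 : S.psiVar (fun r => uu (τ r)) x y ≤ S.psiVar uu (τ x) (τ y) := by
    simp only [psiVar_eq_ivar]
    refine ivar_comp_le hxy.le (fun r hr r' hr' hle => ?_) fun r r' hr hlt hr' => ?_
    · rcases hle.eq_or_lt with rfl | hlt
      · exact le_rfl
      · exact (hτlt r hr r' hr' hlt).le
    · exact le_ivar (fun x y => S.psiCost 0 (uu x) (uu y))
        (hτlt r ⟨hr, hlt.le.trans hr'⟩ r' ⟨hr.trans hlt.le, hr'⟩ hlt)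
  simp only [hτx, hτy] at h1 h2
  have h3 : S.psiVar uu p q ≤ S.dissipation tt uu p q := by
    rw [(hr.mono hp.1 hq.2).dissipation_eq hV hS hE hpq.le, hS.ivar_incCost]
    exact le_self_add
  have h4 : S.finslerCost x (uu (σ x)) (uu p) ≤ S.dissipation tt uu (σ x) p :=
    (hr.mono hσx.1 hp.2).finslerCost_le hV hS hE hxp fun s hs => by
      rw [h.monotone.eq_of_mem_Icc hσx hp (hσxt.trans hpt.symm) hs, hpt]
  have h5 : S.finslerCost y (uu q) (uu (σ y)) ≤ S.dissipation tt uu q (σ y) :=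
    (hr.mono hq.1 hσy.2).finslerCost_le hV hS hE hqy fun s hs => by
      rw [h.monotone.eq_of_mem_Icc hq hσy (hqt.trans hσyt.symm) hs, hσyt]
  rw [hσxu, ← hrx, ← hS.psiCost_add_rightExcess] at h4
  rw [hσyu, ← hly, ← hS.psiCost_add_leftExcess] at h5
  rw [← hrx, ← hly] at h1
  have hrxy := hr.mono hσx.1 hσy.2
  rw [← hrxy.dissipation_add hV hS hE (hxp.trans hpq.le) hqy,
    ← (hrxy.mono le_rfl hqy).dissipation_add hV hS hE hxp hpq.le]
  calc S.rightExcess u x + S.leftExcess u y + S.psiVar u x y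
      ≤ S.rightExcess u x + S.leftExcess u y + (S.psiCost x (u x) (S.rightVal u x) +
          S.dissipation tt uu p q + S.psiCost y (leftVal u y) (u y)) := by
        gcongr
        refine h1.trans ?_
        gcongr
        exact h2.trans h3
    _ = (S.psiCost x (u x) (S.rightVal u x) + S.rightExcess u x) + S.dissipation tt uu p q +
          (S.psiCost y (leftVal u y) (u y) + S.leftExcess u y) := by ring
    _ ≤ _ := add_le_add (add_le_add h4 le_rfl) h5

/-- The difference of dissipation and Ψ-variation is superadditive, being a difference of additive
functions, and it dominates the jump excesses at the ends of each interval. Hence it dominates the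
sum of all excesses. -/
theorem IsSection.finslerVar_le [CompleteSpace V] (hσ : S.IsSection tt uu a b u σ)
    (h : S.IsAdmissible tt uu a b) (hV : HasRadonNikodymProperty V) (hS : S.Standing) (hab : a ≤ b)
    (hsurj : S.IsSurjective tt a b) {t₀ t₁ : ℝ} (h0 : 0 ≤ t₀) (h01 : t₀ < t₁) (h1 : t₁ ≤ S.T) :
    S.finslerVar u t₀ t₁ ≤ S.dissipation tt uu (σ t₀) (σ t₁) := by
  obtain ⟨E, hE, hr⟩ := h.isRegularCurve hab
  have hu := hσ.isPsiBV h hS hr.psiAC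
  rw [hu.finslerVar_eq hS hE h0 h01 h1]
  have hbase : ∀ x y, t₀ ≤ x → x < y → y ≤ t₁ → S.rightExcess u x + S.leftExcess u y +
      S.psiVar u x y ≤ S.dissipation tt uu (σ x) (σ y) := fun x y hx hxy hy =>
    hσ.psiVar_add_excess_le h hV hS hab hsurj (h0.trans hx) hxy (hy.trans h1)
  have hvfin : ∀ x y, t₀ ≤ x → x < y → y ≤ t₁ → S.psiVar u x y ≠ ⊤ := fun x y hx hxy hy =>
    hu.psiVar_ne_top (h0.trans hx) hxy.le (hy.trans h1)
  have hvle : ∀ x y, t₀ ≤ x → x < y → y ≤ t₁ →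
      S.psiVar u x y ≤ S.dissipation tt uu (σ x) (σ y) := fun x y hx hxy hy =>
    le_add_self.trans (hbase x y hx hxy hy)
  have key := add_tsum_jumps_le (L := S.leftExcess u) (R := S.rightExcess u)
    (H := fun x y => S.dissipation tt uu (σ x) (σ y) - S.psiVar u x y) h01 ?_ ?_
  · rw [add_comm]
    exact (add_le_add key le_rfl).trans_eq (tsub_add_cancel_of_le (hvle t₀ t₁ le_rfl h01 le_rfl))
  · intro x y z hx hxy hyz hz
    have hm : ∀ r, t₀ ≤ r → r ≤ t₁ → r ∈ Icc 0 S.T := fun r hr hr' => ⟨h0.trans hr, hr'.trans h1⟩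
    have hxm := hm x hx (hxy.le.trans (hyz.le.trans hz))
    have hym := hm y (hx.trans hxy.le) (hyz.le.trans hz)
    have hzm := hm z (hx.trans (hxy.le.trans hyz.le)) hz
    refine ENNReal.le_sub_of_add_le_right (hvfin x z hx (hxy.trans hyz) hz) ?_
    rw [← hS.psiVar_add u hxy.le hyz.le, ← (hr.mono (hσ x hxm).1.1 (hσ z hzm).1.2).dissipation_add
      hV hS hE (hσ.lt h hxm hym hxy).le (hσ.lt h hym hzm hyz).le]
    rw [add_add_add_comm, tsub_add_cancel_of_le (hvle x y hx hxy (hyz.le.trans hz)),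
      tsub_add_cancel_of_le (hvle y z (hx.trans hxy.le) hyz hz)]
  · intro x y hx hxy hy
    exact ENNReal.le_sub_of_add_le_right (hvfin x y hx hxy hy) (hbase x y hx hxy hy)

/-- Properties of curves selected from admissible parameterized curves. -/
theorem IsAdmissible.selection_properties [CompleteSpace V] (h : S.IsAdmissible tt uu a b)
    (hV : HasRadonNikodymProperty V) (hS : S.Standing) (hab : a < b)
    (hsurj : S.IsSurjective tt a b) (hu : S.IsSelection tt uu a b u) :
    (∃ E > 0, S.IsPsiBV (S.sublevel E) u) ∧ S.LocallyStable u ∧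
      (∀ σ : ℝ → ℝ, (∀ t ∈ Icc 0 S.T, σ t ∈ Icc a b ∧ tt (σ t) = t ∧ uu (σ t) = u t) →
        ∀ t₀ t₁ : ℝ, 0 ≤ t₀ → t₀ < t₁ → t₁ ≤ S.T →
          S.finslerVar u t₀ t₁ ≤ S.dissipation tt uu (σ t₀) (σ t₁)) ∧
      S.finslerVar u 0 S.T < ⊤ := by
  obtain ⟨E, hE, hr⟩ := h.isRegularCurve hab.le
  obtain ⟨σ, hσ⟩ := hu.exists_isSection
  refine ⟨⟨E, hE, hσ.isPsiBV h hS hr.psiAC⟩, hσ.locallyStable h hS hab.le hsurj, ?_, ?_⟩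
  · intro τ hτ t₀ t₁ h0 h01 h1
    exact IsSection.finslerVar_le (σ := τ) hτ h hV hS hab.le hsurj h0 h01 h1
  · refine (hσ.finslerVar_le h hV hS hab.le hsurj le_rfl hS.T_pos le_rfl).trans_lt ?_
    have h0 := (hσ 0 (left_mem_Icc.2 hS.T_pos.le)).1
    have hT := (hσ S.T (right_mem_Icc.2 hS.T_pos.le)).1
    have hle := (hσ.lt h (left_mem_Icc.2 hS.T_pos.le) (right_mem_Icc.2 hS.T_pos.le) hS.T_pos).le
    refine lt_of_le_of_lt ?_ h.finite
    rw [hr.dissipation_eq hV hS hE hab.le, (hr.mono h0.1 hT.2).dissipation_eq hV hS hE hle]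
    exact ivar_mono _ h0.1 hle hT.2

end Selected

end RateIndependentSystem

/-- The derivative vanishes at the points of a nondegenerate interval on which the function is
constant. -/
theorem deriv_eq_zero_of_eqOn_Icc {f : ℝ → ℝ} {p q s c : ℝ} (hpq : p < q) (hs : s ∈ Icc p q)
    (hf : ∀ r ∈ Icc p q, f r = c) : deriv f s = 0 := by
  by_cases hd : DifferentiableAt ℝ f s
  · have h1 : HasDerivWithinAt f (deriv f s) (Icc p q) s := hd.hasDerivAt.hasDerivWithinAt
    have h2 : HasDerivWithinAt f 0 (Icc p q) s :=
      (hasDerivWithinAt_const s (Icc p q) c).congr hf (hf s hs)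
    exact (uniqueDiffOn_Icc hpq s hs).eq_deriv _ h1 h2
  · exact deriv_zero_of_not_differentiableAt hd

theorem MonotoneOn.lintegral_deriv_of_ac {f : ℝ → ℝ} {a b : ℝ} (hf : MonotoneOn f (Icc a b))
    (hac : AbsolutelyContinuousOnInterval f a b) (hab : a ≤ b) :
    ∫⁻ s in Icc a b, ENNReal.ofReal (deriv f s) = ENNReal.ofReal (f b - f a) := by
  rw [← ofReal_integral_eq_lintegral_ofReal (hf.integrableOn_deriv_Icc hab) hf.ae_deriv_nonneg,
    ← hac.integral_deriv_eq_sub, intervalIntegral.integral_of_le hab, integral_Icc_eq_integral_Ioc]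

namespace RateIndependentSystem

variable {V : Type*} [NormedAddCommGroup V] [NormedSpace ℝ V] {S : RateIndependentSystem V}

/-! ### The power along curves of bounded variation -/

/-- The power is an almost everywhere limit of forward difference quotients in time. After removing
the countably many discontinuities of `u`, both energies in such a quotient are lower
semicontinuous, hence measurable. The minimum with `S.T` keeps the shifted time admissible. -/
theorem IsPsiBV.aemeasurable_power {E : ℝ} {u : ℝ → V} (hu : S.IsPsiBV (S.sublevel E) u)
    (hS : S.Standing) (hE : 0 < E) :
    AEMeasurable (fun r => S.power r (u r)) (volume.restrict (Icc 0 S.T)) := by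
  set N := {t | t ∈ Icc 0 S.T ∧ ¬ContinuousWithinAt u (Icc 0 S.T) t} with hN
  have hNc : N.Countable := hu.countable_not_continuousWithinAt hS hE
  set K := Icc 0 S.T \ N with hK
  have hKm : MeasurableSet K := measurableSet_Icc.diff hNc.measurableSet
  have hKsub : K ⊆ Icc 0 S.T := sdiff_subset
  have hcont : ContinuousOn u K := fun t ht => by
    have : ContinuousWithinAt u (Icc 0 S.T) t := by
      by_contra hne
      exact ht.2 ⟨ht.1, hne⟩
    exact this.mono hKsub
  have hmD : MapsTo u K S.D := fun t ht => (hu.1 (hKsub ht)).1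
  have hae : (K : Set ℝ) =ᵐ[volume] Icc 0 S.T := by
    have h0 : volume N = 0 := hNc.measure_zero volume
    exact sdiff_null_ae_eq_self h0
  rw [← Measure.restrict_congr_set hae]
  have hmeas : ∀ n : ℕ, AEMeasurable (fun r => ((n : ℝ) + 1) *
      (S.energy (min (r + 1 / ((n : ℝ) + 1)) S.T) (u r) - S.energy r (u r)))
      (volume.restrict K) := by
    intro n
    have h1 := (hS.energy_comp_lsc (tt := fun r => min (r + 1 / ((n : ℝ) + 1)) S.T) (K := K)
      (by fun_prop) (fun r hr => ⟨le_min (add_nonneg (hKsub hr).1 (by positivity)) hS.T_pos.le,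
        min_le_right _ _⟩) hcont hmD).aemeasurable_restrict hKm
    have h2 := (hS.energy_comp_lsc (tt := fun r => r) (K := K) continuousOn_id
      (fun r hr => hKsub hr) hcont hmD).aemeasurable_restrict hKm
    exact (h1.sub h2).const_mul _
  refine aemeasurable_of_tendsto_metrizable_ae' hmeas ?_
  have hends : ∀ᵐ r ∂volume.restrict K, r ∈ Ioo 0 S.T := by
    have : volume.restrict K = volume.restrict (Ioo 0 S.T) :=
      Measure.restrict_congr_set (hae.trans Ioo_ae_eq_Icc.symm)
    rw [this]
    exact ae_restrict_mem measurableSet_Ioo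
  filter_upwards [hends] with r hr
  have hd := hS.hasDerivAt_energy (hu.1 (Ioo_subset_Icc_self hr)).1 hr
  have h1 : Tendsto (fun n : ℕ => 1 / ((n : ℝ) + 1)) atTop (𝓝[≠] 0) := by
    refine tendsto_nhdsWithin_iff.2 ⟨tendsto_one_div_add_atTop_nhds_zero_nat, ?_⟩
    exact Eventually.of_forall fun n => (show (1 : ℝ) / ((n : ℝ) + 1) ≠ 0 by positivity)
  have h2 := (hasDerivAt_iff_tendsto_slope_zero.1 hd).comp h1
  have h3 : ∀ᶠ n : ℕ in atTop, 1 / ((n : ℝ) + 1) < S.T - r :=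
    tendsto_one_div_add_atTop_nhds_zero_nat.eventually_lt_const (by linarith [hr.2])
  refine h2.congr' ?_
  filter_upwards [h3] with n hn
  have : min (r + 1 / ((n : ℝ) + 1)) S.T = r + 1 / ((n : ℝ) + 1) := min_eq_left (by linarith)
  rw [this]
  simp [smul_eq_mul]

theorem IsPsiBV.integrableOn_power {E : ℝ} {u : ℝ → V} (hu : S.IsPsiBV (S.sublevel E) u)
    (hS : S.Standing) (hE : 0 < E) : IntegrableOn (fun r => S.power r (u r)) (Icc 0 S.T) := by
  obtain ⟨C, hC, H⟩ := hS.power_bound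
  refine Integrable.of_bound (hu.aemeasurable_power hS hE).aestronglyMeasurable (C * E) ?_
  rw [← restrict_Ioo_eq_restrict_Icc]
  filter_upwards [ae_restrict_mem measurableSet_Ioo] with r hr
  have hm := hu.1 (Ioo_subset_Icc_self hr)
  exact (H r hr _ hm.1).trans
    (mul_le_mul_of_nonneg_left (hm.2 r (Ioo_subset_Icc_self hr)) hC)

section Selected

variable {tt : ℝ → ℝ} {uu : ℝ → V} {a b : ℝ} {u : ℝ → V} {σ : ℝ → ℝ}

theorem IsAdmissible.mono_ac (h : S.IsAdmissible tt uu a b) {c d : ℝ} (hac : a ≤ c) (hcd : c ≤ d)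
    (hdb : d ≤ b) : AbsolutelyContinuousOnInterval tt c d := by
  refine h.ac.mono ?_
  rw [uIcc_of_le hcd, uIcc_of_le (hac.trans (hcd.trans hdb))]
  exact Icc_subset_Icc hac hdb

/-- Change of variables for the power integral. -/
theorem IsSection.integral_power (hσ : S.IsSection tt uu a b u σ) (h : S.IsAdmissible tt uu a b)
    (hS : S.Standing) {s₁ s₂ : ℝ} (h1 : a ≤ s₁) (h12 : s₁ ≤ s₂) (h2 : s₂ ≤ b) :
    ∫ s in s₁..s₂, S.power (tt s) (uu s) * deriv tt s =
      ∫ r in (tt s₁)..(tt s₂), S.power r (u r) := by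
  obtain ⟨E, hE, hr⟩ := h.isRegularCurve (h1.trans (h12.trans h2))
  have hu := hσ.isPsiBV h hS hr.psiAC
  have hsub : Icc s₁ s₂ ⊆ Icc a b := Icc_subset_Icc h1 h2
  have hmono := h.monotone.mono hsub
  have hcont := hr.cont.mono hsub
  have hm1 : s₁ ∈ Icc s₁ s₂ := left_mem_Icc.2 h12
  have hm2 : s₂ ∈ Icc s₁ s₂ := right_mem_Icc.2 h12
  set κ : ℝ → ℝ≥0∞ := fun s => ENNReal.ofReal (deriv tt s) with hκ
  have hκm : Measurable κ := (measurable_deriv tt).ennreal_ofReal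
  have hmap := map_withDensity_of_primitive (κ := κ) h12 hmono hcont fun r hr' =>
    (hmono.mono (Icc_subset_Icc le_rfl hr'.2)).lintegral_deriv_of_ac
      (h.mono_ac h1 hr'.1 (hr'.2.trans h2)) hr'.1
  have hae : AEMeasurable tt ((volume.restrict (Icc s₁ s₂)).withDensity κ) :=
    (hcont.aemeasurable measurableSet_Icc).mono_ac (withDensity_absolutelyContinuous _ _)
  have hsubT : Icc (tt s₁) (tt s₂) ⊆ Icc 0 S.T :=
    Icc_subset_Icc (h.mapsTo (hsub hm1)).1 (h.mapsTo (hsub hm2)).2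
  have hpm : AEStronglyMeasurable (fun r => S.power r (u r))
      (volume.restrict (Icc (tt s₁) (tt s₂))) :=
    ((hu.aemeasurable_power hS hE).mono_measure (Measure.restrict_mono hsubT le_rfl)
      ).aestronglyMeasurable
  rw [intervalIntegral.integral_of_le h12, intervalIntegral.integral_of_le (hmono hm1 hm2 h12),
    ← integral_Icc_eq_integral_Ioc, ← integral_Icc_eq_integral_Ioc, ← hmap,
    integral_map hae (by rw [hmap]; exact hpm),
    integral_withDensity_eq_integral_toReal_smul hκm
      (Eventually.of_forall fun s => ENNReal.ofReal_lt_top)]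
  refine integral_congr_ae ?_
  filter_upwards [hmono.ae_deriv_nonneg, ae_restrict_mem measurableSet_Icc] with s hs hsm
  rw [hκ, ENNReal.toReal_ofReal hs, smul_eq_mul, mul_comm]
  -- Where the derivative of `tt` is nonzero, the fibre through `s` is a single point. The section
  -- then returns `s` itself, and `uu s` is the value of `u` at time `tt s`.
  by_cases h0 : deriv tt s = 0
  · simp [h0]
  obtain ⟨hm, ht, hu'⟩ := hσ (tt s) (h.mapsTo (hsub hsm))
  have : σ (tt s) = s := by
    rcases lt_trichotomy (σ (tt s)) s with hl | hl | hl
    · exact absurd (deriv_eq_zero_of_eqOn_Icc hl (right_mem_Icc.2 hl.le) fun r hr =>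
        h.monotone.eq_of_mem_Icc hm (hsub hsm) ht hr) h0
    · exact hl
    · exact absurd (deriv_eq_zero_of_eqOn_Icc hl (left_mem_Icc.2 hl.le) fun r hr =>
        h.monotone.eq_of_mem_Icc (hsub hsm) hm ht.symm hr) h0
  rw [this] at hu'
  rw [hu']

/-- An infinite indicator occurs only at unstable points, and `tt` is locally constant there. The
term is therefore `∞ · 0 = 0`. -/
theorem IsAdmissible.stabInd_mul_deriv (h : S.IsAdmissible tt uu a b) (hS : S.Standing) {s : ℝ}
    (hs : s ∈ Ioo a b) :
    S.stabInd (tt s) (uu s) * ENNReal.ofReal (deriv tt s) = 0 := by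
  obtain ⟨E, hE, hr⟩ := h.isRegularCurve (hs.1.trans hs.2).le
  have hsm := Ioo_subset_Icc_self hs
  by_cases hst : S.IsStableAt (tt s) (uu s)
  · simp [stabInd, hst]
  have hG : s ∈ S.unstableSet tt uu a b := by
    refine ⟨hsm, pos_iff_ne_zero.2 fun h0 => hst ?_⟩
    exact hS.isStableAt_of_slope_eq_zero hE (h.mapsTo hsm) (hr.psiAC.1 hsm) h0
  obtain ⟨ε, hε, H⟩ := hr.eventually_unstable hS hE hG
  set q := min b (s + ε / 2) with hq
  have hsq : s < q := lt_min hs.2 (by linarith)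
  have : deriv tt s = 0 := by
    refine deriv_eq_zero_of_eqOn_Icc hsq (left_mem_Icc.2 hsq.le) fun r hr =>
      (h.const s r hr.1 fun z hz => ?_).symm
    have hzq : z ≤ q := hz.2.trans hr.2
    refine H z ⟨hs.1.le.trans hz.1, hzq.trans (min_le_left _ _)⟩ ?_
    rw [abs_of_nonneg (by linarith [hz.1])]
    linarith [min_le_right b (s + ε / 2)]
  simp [this]

theorem IsSection.paramAction_eq (hσ : S.IsSection tt uu a b u σ) (h : S.IsAdmissible tt uu a b)
    (hS : S.Standing) {s₁ s₂ : ℝ} (h1 : a ≤ s₁) (h12 : s₁ ≤ s₂) (h2 : s₂ ≤ b) :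
    S.paramAction tt uu s₁ s₂ = (S.dissipation tt uu s₁ s₂ : EReal) -
      ((∫ r in (tt s₁)..(tt s₂), S.power r (u r) : ℝ) : EReal) := by
  obtain ⟨E, hE, hr⟩ := h.isRegularCurve (h1.trans (h12.trans h2))
  have hr' := hr.mono h1 h2
  rw [paramAction, hσ.integral_power h hS h1 h12 h2, dissipation, hr'.setLIntegral_unstableSet hS hE,
    ← lintegral_add_left' (hS.aemeasurable_metricDeriv h12 hr'.psiAC)]
  congr 2
  refine lintegral_congr_ae ?_
  rw [← restrict_Ioo_eq_restrict_Icc]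
  filter_upwards [ae_restrict_mem measurableSet_Ioo] with s hs
  rw [paramG, h.stabInd_mul_deriv hS ⟨h1.trans_lt hs.1, hs.2.trans_le h2⟩, zero_add]

theorem IsAdmissible.dissipation_ne_top (h : S.IsAdmissible tt uu a b)
    (hV : HasRadonNikodymProperty V) (hS : S.Standing) {s₁ s₂ : ℝ} (h1 : a ≤ s₁) (h12 : s₁ ≤ s₂)
    (h2 : s₂ ≤ b) : S.dissipation tt uu s₁ s₂ ≠ ⊤ := by
  obtain ⟨E, hE, hr⟩ := h.isRegularCurve (h1.trans (h12.trans h2))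
  refine ne_top_of_le_ne_top h.finite.ne ?_
  rw [hr.dissipation_eq hV hS hE (h1.trans (h12.trans h2)),
    (hr.mono h1 h2).dissipation_eq hV hS hE h12]
  exact ivar_mono _ h1 h12 h2

/-- The energy balance of parameterized curves in terms of real numbers. -/
theorem IsSection.balance_iff (hσ : S.IsSection tt uu a b u σ) (h : S.IsAdmissible tt uu a b)
    (hV : HasRadonNikodymProperty V) (hS : S.Standing) {s₁ s₂ : ℝ} (h1 : a ≤ s₁) (h12 : s₁ ≤ s₂)
    (h2 : s₂ ≤ b) (e₁ e₂ : ℝ) :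
    S.paramAction tt uu s₁ s₂ + (e₂ : EReal) = (e₁ : EReal) ↔
      (S.dissipation tt uu s₁ s₂).toReal - (∫ r in (tt s₁)..(tt s₂), S.power r (u r)) + e₂ = e₁ := by
  rw [hσ.paramAction_eq h hS h1 h12 h2,
    ← EReal.coe_ennreal_toReal (h.dissipation_ne_top hV hS h1 h12 h2)]
  exact_mod_cast Iff.rfl

end Selected

/-! ### Parameterized solutions induce `BV` solutions -/

variable (S) in
/-- `Var_𝔣(u;[0,t])` as a real number, equal to `0` for `t = 0`. -/
def realFinslerVar (u : ℝ → V) (t : ℝ) : ℝ :=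
  if t ≤ 0 then 0 else (S.finslerVar u 0 t).toReal

theorem realFinslerVar_zero (u : ℝ → V) : S.realFinslerVar u 0 = 0 := by simp [realFinslerVar]

theorem IsPsiBV.finslerVar_ne_top [CompleteSpace V] {E : ℝ} {u : ℝ → V}
    (hu : S.IsPsiBV (S.sublevel E) u) (hS : S.Standing) (hE : 0 < E)
    (hfin : S.finslerVar u 0 S.T ≠ ⊤) {x y : ℝ} (hx : 0 ≤ x) (hxy : x < y) (hy : y ≤ S.T) :
    S.finslerVar u x y ≠ ⊤ := by
  have h1 : S.finslerVar u x S.T ≠ ⊤ := by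
    rcases hx.eq_or_lt with rfl | hx
    · exact hfin
    · rw [← hu.finslerVar_add hS hE le_rfl hx (hxy.trans_le hy) le_rfl] at hfin
      exact (ENNReal.add_ne_top.1 hfin).2
  rcases hy.eq_or_lt with rfl | hy
  · exact h1
  · rw [← hu.finslerVar_add hS hE hx hxy hy le_rfl] at h1
    exact (ENNReal.add_ne_top.1 h1).1

theorem IsPsiBV.finslerVar_eq_ofReal [CompleteSpace V] {E : ℝ} {u : ℝ → V}
    (hu : S.IsPsiBV (S.sublevel E) u) (hS : S.Standing) (hE : 0 < E)
    (hfin : S.finslerVar u 0 S.T ≠ ⊤) {x y : ℝ} (hx : 0 ≤ x) (hxy : x < y) (hy : y ≤ S.T) :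
    S.finslerVar u x y = ENNReal.ofReal (S.realFinslerVar u y - S.realFinslerVar u x) ∧
      S.realFinslerVar u x ≤ S.realFinslerVar u y := by
  have h1 := hu.finslerVar_ne_top hS hE hfin hx hxy hy
  have h2 := hu.finslerVar_ne_top hS hE hfin le_rfl (hx.trans_lt hxy) hy
  have hy' : S.realFinslerVar u y = (S.finslerVar u 0 y).toReal := if_neg (by linarith)
  have key : S.realFinslerVar u y - S.realFinslerVar u x = (S.finslerVar u x y).toReal := by
    rcases hx.eq_or_lt with rfl | hx
    · rw [realFinslerVar_zero, sub_zero, hy']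
    · have hx' : S.realFinslerVar u x = (S.finslerVar u 0 x).toReal := if_neg (by linarith)
      rw [hy', hx', ← hu.finslerVar_add hS hE le_rfl hx hxy hy, ENNReal.toReal_add
        (hu.finslerVar_ne_top hS hE hfin le_rfl hx (hxy.le.trans hy)) h1, add_sub_cancel_left]
  rw [key, ENNReal.ofReal_toReal h1]
  exact ⟨rfl, by linarith [ENNReal.toReal_nonneg (a := S.finslerVar u x y)]⟩

section Selected

variable {tt : ℝ → ℝ} {uu : ℝ → V} {a b : ℝ} {u : ℝ → V} {σ : ℝ → ℝ}

theorem IsAdmissible.dissipation_eq_ofReal (h : S.IsAdmissible tt uu a b)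
    (hV : HasRadonNikodymProperty V) (hS : S.Standing) {x y : ℝ} (hx : a ≤ x) (hxy : x ≤ y)
    (hy : y ≤ b) : (S.dissipation tt uu x y).toReal =
      (S.dissipation tt uu a y).toReal - (S.dissipation tt uu a x).toReal := by
  obtain ⟨E, hE, hr⟩ := h.isRegularCurve (hx.trans (hxy.trans hy))
  rw [← (hr.mono le_rfl hy).dissipation_add hV hS hE hx hxy, ENNReal.toReal_add
    (h.dissipation_ne_top hV hS le_rfl hx (hxy.trans hy)) (h.dissipation_ne_top hV hS hx hxy hy),
    add_sub_cancel_left]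

theorem IsRegularCurve.Psi_le_dissipation {E : ℝ} (hr : S.IsRegularCurve E tt uu a b)
    (hV : HasRadonNikodymProperty V) (hS : S.Standing) (hE : 0 < E) (hab : a ≤ b)
    (hfin : S.dissipation tt uu a b ≠ ⊤) :
    S.Psi (uu b - uu a) ≤ (S.dissipation tt uu a b).toReal := by
  rcases hab.eq_or_lt with rfl | hab
  · simp [hS.Psi_zero]
  rw [← ENNReal.ofReal_le_iff_le_toReal hfin, hr.dissipation_eq hV hS hE hab.le, hS.ivar_incCost]
  exact (psiCost_le_psiVar uu hab).trans le_self_add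

/-- If the pieces of the parameterized curve in the jumps are optimal, then the dissipation is
bounded by the total variation of the selected curve. -/
theorem IsSection.dissipation_le_finslerVar [CompleteSpace V] (hσ : S.IsSection tt uu a b u σ)
    (h : S.IsAdmissible tt uu a b) (hV : HasRadonNikodymProperty V) (hS : S.Standing)
    (hab : a < b) (hsurj : S.IsSurjective tt a b)
    (hR : ∀ t ∈ Ico 0 S.T, S.dissipation tt uu (σ t) (fiberMax tt a b t) ≤
      S.finslerCost t (u t) (S.rightVal u t))
    (hL : ∀ t ∈ Ioc 0 S.T, S.dissipation tt uu (fiberMin tt a b t) (σ t) ≤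
      S.finslerCost t (leftVal u t) (u t))
    {t₀ t₁ : ℝ} (h0 : 0 ≤ t₀) (h01 : t₀ < t₁) (h1 : t₁ ≤ S.T) :
    S.dissipation tt uu (σ t₀) (σ t₁) ≤ S.finslerVar u t₀ t₁ := by
  obtain ⟨E, hE, hr⟩ := h.isRegularCurve hab.le
  have hu := hσ.isPsiBV h hS hr.psiAC
  have hfin : S.finslerVar u 0 S.T ≠ ⊤ :=
    (h.selection_properties hV hS hab hsurj
      (fun t ht => ⟨σ t, hσ t ht⟩)).2.2.2.ne
  set F := S.realFinslerVar u with hF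
  set W : ℝ → ℝ := fun x => (S.dissipation tt uu a x).toReal with hW
  have hWsub : ∀ x y, a ≤ x → x ≤ y → y ≤ b → (S.dissipation tt uu x y).toReal = W y - W x :=
    fun x y hx hxy hy => h.dissipation_eq_ofReal hV hS hx hxy hy
  have hPsi : ∀ x y, a ≤ x → x ≤ y → y ≤ b → S.Psi (uu y - uu x) ≤ W y - W x := by
    intro x y hx hxy hy
    rw [← hWsub x y hx hxy hy]
    exact (hr.mono hx hy).Psi_le_dissipation hV hS hE hxy (h.dissipation_ne_top hV hS hx hxy hy)
  -- A potential whose increments dominate `incCost`. It follows the 𝔣-variation from one time to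
  -- the next and the dissipation within a fibre, measured from the selected point. At selected
  -- points the two dissipation terms cancel, so its increments there are those of the 𝔣-variation.
  set N : ℝ → ℝ := fun x => F (tt x) + W x - W (σ (tt x)) with hN
  have hm0 : t₀ ∈ Icc 0 S.T := ⟨h0, h01.le.trans h1⟩
  have hm1 : t₁ ∈ Icc 0 S.T := ⟨h0.trans h01.le, h1⟩
  have hlt := hσ.lt h hm0 hm1 h01
  have hbase : ∀ x y, a ≤ x → x < y → y ≤ b →
      S.incCost tt uu x y ≤ ENNReal.ofReal (N y - N x) ∧ N x ≤ N y := by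
    intro x y hx hxy hy
    have hxm : x ∈ Icc a b := ⟨hx, hxy.le.trans hy⟩
    have hym : y ∈ Icc a b := ⟨hx.trans hxy.le, hy⟩
    rcases (h.monotone hxm hym hxy.le).eq_or_lt with heq | httlt
    · have e1 : N y - N x = W y - W x := by simp only [hN, heq]; ring
      have e2 := hWsub x y hx hxy.le hy
      constructor
      · rw [e1, ← e2, ENNReal.ofReal_toReal (h.dissipation_ne_top hV hS hx hxy.le hy),
          (hr.mono hx hy).dissipation_eq hV hS hE hxy.le]
        exact le_ivar _ hxy
      · linarith [ENNReal.toReal_nonneg (a := S.dissipation tt uu x y)]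
    set t := tt x with ht
    set t' := tt y with ht'
    have htm : t ∈ Icc 0 S.T := h.mapsTo hxm
    have htm' : t' ∈ Icc 0 S.T := h.mapsTo hym
    have htI : t ∈ Ico 0 S.T := ⟨htm.1, httlt.trans_le htm'.2⟩
    have htI' : t' ∈ Ioc 0 S.T := ⟨htm.1.trans_lt httlt, htm'.2⟩
    obtain ⟨hp, hpt⟩ := fiberMax_mem hab.le hr.cont (t := t) (by rwa [hsurj.1, hsurj.2])
    obtain ⟨hq, hqt⟩ := fiberMin_mem hab.le hr.cont (t := t') (by rwa [hsurj.1, hsurj.2])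
    obtain ⟨hσm, hσt, hσu⟩ := hσ t htm
    obtain ⟨hσm', hσt', hσu'⟩ := hσ t' htm'
    have hxp : x ≤ fiberMax tt a b t := le_fiberMax hxm
    have hqy : fiberMin tt a b t' ≤ y := fiberMin_le hym
    have hσp : σ t ≤ fiberMax tt a b t := by
      have := le_fiberMax (f := tt) hσm
      rwa [hσt] at this
    have hqσ : fiberMin tt a b t' ≤ σ t' := by
      have := fiberMin_le (f := tt) hσm'
      rwa [hσt'] at this
    have hslope := h.slope_fiberMax hS hab.le hsurj htI
    have hjump := hu.jumps_le_finslerVar hS hE htI.1 httlt htI'.2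
    rw [(hu.finslerVar_eq_ofReal hS hE hfin htI.1 httlt htI'.2).1] at hjump
    have hR' := hR t htI
    have hL' := hL t' htI'
    rw [hσ.rightVal_eq h hS hab.le hsurj htI, hσ.leftVal_eq h hS hab.le hsurj htI'] at hjump
    rw [hσ.rightVal_eq h hS hab.le hsurj htI] at hR'
    rw [hσ.leftVal_eq h hS hab.le hsurj htI'] at hL'
    set p := fiberMax tt a b t with hpdef
    set q := fiberMin tt a b t' with hqdef
    have hpq : p < q := h.monotone.lt_of_lt_Icc hp hq (by rw [hpt, hqt]; exact httlt)
    -- The optimality hypotheses `hR` and `hL` enter here: the Finsler costs in the jump estimate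
    -- are bounded below by the dissipation of the fibre pieces.
    have hreal : (W p - W (σ t)) + S.Psi (uu q - uu p) + (W (σ t') - W q) ≤ F t' - F t := by
      have e1 := hWsub (σ t) p hσm.1 hσp hp.2
      have e2 := hWsub q (σ t') hq.1 hqσ hσm'.2
      have f1 : 0 ≤ W p - W (σ t) := e1 ▸ ENNReal.toReal_nonneg
      have f2 : 0 ≤ W (σ t') - W q := e2 ▸ ENNReal.toReal_nonneg
      have hFt : F t ≤ F t' := (hu.finslerVar_eq_ofReal hS hE hfin htI.1 httlt htI'.2).2
      rw [← ENNReal.ofReal_le_ofReal_iff (by linarith), ENNReal.ofReal_add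
        (add_nonneg f1 (hS.Psi_nonneg _)) f2, ENNReal.ofReal_add f1 (hS.Psi_nonneg _), ← e1, ← e2,
        ENNReal.ofReal_toReal (h.dissipation_ne_top hV hS hσm.1 hσp hp.2),
        ENNReal.ofReal_toReal (h.dissipation_ne_top hV hS hq.1 hqσ hσm'.2)]
      exact (add_le_add (add_le_add hR' le_rfl) hL').trans hjump
    have g1 := hPsi x p hx hxp hp.2
    have g2 := hPsi q y hq.1 hqy hy
    have g3 := hS.Psi_triangle (uu x) (uu p) (uu y)
    have g4 := hS.Psi_triangle (uu p) (uu q) (uu y)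
    have hNle : S.Psi (uu y - uu x) ≤ N y - N x := by
      simp only [hN, ← ht, ← ht']
      linarith
    -- An interval spanning two times contains the end `p` of a fibre, where the slope vanishes.
    have hsc : S.slopeCost tt uu x y = 0 := by
      have : (⨅ z ∈ Icc x y, S.slope (tt z) (uu z)) = 0 := by
        refine le_antisymm ((iInf₂_le p ⟨hxp, hpq.le.trans hqy⟩).trans ?_) zero_le
        rw [hpt, hslope]
      rw [slopeCost, this, zero_mul]
    constructor
    · rw [incCost, hsc, add_zero]
      exact ENNReal.ofReal_le_ofReal hNle
    · linarith [hS.Psi_nonneg (uu y - uu x)]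
  have hσ0 := hσ t₀ hm0
  have hσ1 := hσ t₁ hm1
  rw [(hr.mono hσ0.1.1 hσ1.1.2).dissipation_eq hV hS hE hlt.le]
  have key := ivar_le_of_superaddOn (g := S.incCost tt uu)
    (h := fun x y => ENNReal.ofReal (N y - N x)) hlt
    (fun x y hx hxy hy => (hbase x y (hσ0.1.1.trans hx) hxy (hy.trans hσ1.1.2)).1)
    (fun x y z hx hxy hyz hz => by
      have i1 := (hbase x y (hσ0.1.1.trans hx) hxy (hyz.le.trans (hz.trans hσ1.1.2))).2
      have i2 := (hbase y z (hσ0.1.1.trans (hx.trans hxy.le)) hyz (hz.trans hσ1.1.2)).2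
      rw [← ENNReal.ofReal_add (by linarith) (by linarith)]
      exact ENNReal.ofReal_le_ofReal (by linarith))
  refine key.trans (le_of_eq ?_)
  rw [(hu.finslerVar_eq_ofReal hS hE hfin h0 h01 h1).1]
  simp only [hN, hσ0.2.1, hσ1.2.1, hF]
  ring_nf

/-- Curves selected from parameterized solutions are `BV` solutions. -/
theorem IsParamSolution.isBVSolution [CompleteSpace V] (h : S.IsParamSolution tt uu a b)
    (hV : HasRadonNikodymProperty V) (hS : S.Standing) (hab : a < b)
    (hu : S.IsSelection tt uu a b u) : S.IsBVSolution u := by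
  have hadm := h.admissible
  have hsurj := h.surjective
  obtain ⟨E, hE, hr⟩ := hadm.isRegularCurve hab.le
  obtain ⟨σ, hσ⟩ := hu.exists_isSection
  have hprop := hadm.selection_properties hV hS hab hsurj hu
  have hbal : ∀ s₁ s₂, a ≤ s₁ → s₁ ≤ s₂ → s₂ ≤ b → (S.dissipation tt uu s₁ s₂).toReal -
      (∫ r in (tt s₁)..(tt s₂), S.power r (u r)) + S.energy (tt s₂) (uu s₂) =
        S.energy (tt s₁) (uu s₁) := fun s₁ s₂ h1 h12 h2 =>
    (hσ.balance_iff hadm hV hS h1 h12 h2 _ _).1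
      (h.balance s₁ ⟨h1, h12.trans h2⟩ s₂ ⟨h1.trans h12, h2⟩ h12)
  -- Within a fibre the power integral is empty, so the balance reads dissipation equals energy
  -- drop, and the drop is at most the Finsler cost.
  have hpiece : ∀ t ∈ Icc 0 S.T, ∀ s₁ s₂, a ≤ s₁ → s₁ ≤ s₂ → s₂ ≤ b → tt s₁ = t → tt s₂ = t →
      S.dissipation tt uu s₁ s₂ ≤ S.finslerCost t (uu s₁) (uu s₂) := by
    intro t ht s₁ s₂ h1 h12 h2 e1 e2
    have := hbal s₁ s₂ h1 h12 h2
    rw [e1, e2, intervalIntegral.integral_same, sub_zero] at this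
    rw [← ENNReal.ofReal_toReal (hadm.dissipation_ne_top hV hS h1 h12 h2),
      show (S.dissipation tt uu s₁ s₂).toReal = S.energy t (uu s₁) - S.energy t (uu s₂) by linarith]
    exact hS.energy_sub_le_finslerCost hV ht _ _
  refine ⟨hprop.1, hprop.2.1, fun t ht => ?_⟩
  have h0m : (0 : ℝ) ∈ Icc 0 S.T := left_mem_Icc.2 hS.T_pos.le
  have htm := Ioc_subset_Icc_self ht
  have heq : S.finslerVar u 0 t = S.dissipation tt uu (σ 0) (σ t) := by
    refine le_antisymm (hprop.2.2.1 σ hσ 0 t le_rfl ht.1 ht.2) ?_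
    refine hσ.dissipation_le_finslerVar hadm hV hS hab hsurj ?_ ?_ le_rfl ht.1 ht.2
    · intro r hr'
      have hrm := Ico_subset_Icc_self hr'
      obtain ⟨hp, hpt⟩ := fiberMax_mem hab.le hr.cont (t := r) (by rwa [hsurj.1, hsurj.2])
      obtain ⟨hσm, hσt, hσu⟩ := hσ r hrm
      have hle := le_fiberMax (f := tt) hσm
      rw [hσt] at hle
      rw [hσ.rightVal_eq hadm hS hab.le hsurj hr', ← hσu]
      exact hpiece r hrm _ _ hσm.1 hle hp.2 hσt hpt
    · intro r hr'
      have hrm := Ioc_subset_Icc_self hr'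
      obtain ⟨hp, hpt⟩ := fiberMin_mem hab.le hr.cont (t := r) (by rwa [hsurj.1, hsurj.2])
      obtain ⟨hσm, hσt, hσu⟩ := hσ r hrm
      have hle := fiberMin_le (f := tt) hσm
      rw [hσt] at hle
      rw [hσ.leftVal_eq hadm hS hab.le hsurj hr', ← hσu]
      exact hpiece r hrm _ _ hp.1 hle hσm.2 hpt hσt
  obtain ⟨hσ0, hσ0t, hσ0u⟩ := hσ 0 h0m
  obtain ⟨hσ1, hσ1t, hσ1u⟩ := hσ t htm
  have hle := (hσ.lt hadm h0m htm ht.1).le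
  have hb := hbal (σ 0) (σ t) hσ0.1 hle hσ1.2
  rw [hσ0t, hσ1t, hσ0u, hσ1u] at hb
  rw [heq, ← EReal.coe_ennreal_toReal (hadm.dissipation_ne_top hV hS hσ0.1 hle hσ1.2),
    ← EReal.coe_add]
  congr 1
  linarith

end Selected

/-! ### Optimal transitions -/

/-- Lower semicontinuity of the incremental cost along curves with uniformly bounded speed. -/
theorem Standing.incCost_le_of_tendsto (hS : S.Standing) {ι : Type*} (l : Ultrafilter ι) {E : ℝ}
    (hE : 0 < E) {t : ℝ} (ht : t ∈ Icc 0 S.T) {θ : ι → ℝ → V} {θ₀ : ℝ → V} {x y : ℝ} (hxy : x < y)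
    {K : ι → ℝ} {K₀ K₁ : ℝ} (hm : ∀ i, MapsTo (θ i) (Icc x y) (S.sublevel E))
    (hinc : ∀ i p q, x ≤ p → p < q → q ≤ y →
      S.incCost (fun _ => t) (θ i) p q ≤ ENNReal.ofReal (K i * (q - p)))
    (hK1 : ∀ i, K i ≤ K₁) (hK : Tendsto K l (𝓝 K₀))
    (hθ : ∀ z ∈ Icc x y, Tendsto (fun i => θ i z) l (𝓝 (θ₀ z))) :
    S.incCost (fun _ => t) θ₀ x y ≤ ENNReal.ofReal (K₀ * (y - x)) := by
  have hθm : ∀ z ∈ Icc x y, θ₀ z ∈ S.sublevel E := fun z hz =>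
    (hS.sublevel_closed hE).mem_of_tendsto (hθ z hz) (Eventually.of_forall fun i => hm i hz)
  have hxm : x ∈ Icc x y := left_mem_Icc.2 hxy.le
  have hym : y ∈ Icc x y := right_mem_Icc.2 hxy.le
  -- Equicontinuity: the common speed bound `K₁` controls Ψ-increments, and the sublevel modulus
  -- converts them to norm increments uniformly in `i`.
  have hclose : ∀ ε > 0, ∃ δ > 0, ∀ i, ∀ p ∈ Icc x y, ∀ q ∈ Icc x y, p ≤ q → q - p < δ →
      ‖θ i q - θ i p‖ < ε := by
    intro ε hε
    obtain ⟨δ, hδ, H⟩ := hS.exists_modulus hE hε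
    refine ⟨δ / (|K₁| + 1), by positivity, fun i p hp q hq hpq hlt => ?_⟩
    rcases hpq.eq_or_lt with rfl | hpq
    · simpa using hε
    refine H _ (hm i hp) _ (hm i hq) ?_
    have h1 : ENNReal.ofReal (S.Psi (θ i q - θ i p)) ≤ ENNReal.ofReal ((|K₁| + 1) * (q - p)) := by
      refine (le_self_add.trans (hinc i p q hp.1 hpq hq.2)).trans (ENNReal.ofReal_le_ofReal ?_)
      have : K i ≤ |K₁| + 1 := by linarith [hK1 i, le_abs_self K₁]
      exact mul_le_mul_of_nonneg_right this (by linarith)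
    have h2 := (ENNReal.ofReal_le_ofReal_iff (mul_nonneg (by positivity) (by linarith))).1 h1
    refine h2.trans_lt ?_
    rw [lt_div_iff₀ (by positivity)] at hlt
    linarith
  set I := ⨅ z ∈ Icc x y, S.slope t (θ₀ z) with hI
  -- A lower bound `q` below the limiting infimum is eventually uniform in `z`. Otherwise points `z
  -- i` with slope below `q` would accumulate at some `z₀`, and by equicontinuity `θ i (z i)` would
  -- tend to `θ₀ z₀`, against lower semicontinuity of the slope.
  have hslope : ∀ q, q < I → ∀ᶠ i in (l : Filter ι), ∀ z ∈ Icc x y, q ≤ S.slope t (θ i z) := by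
    intro q hq
    by_contra hne
    have hfreq := (Ultrafilter.frequently_iff_eventually.1 (not_eventually.1 hne))
    have hex : ∀ i, ∃ z ∈ Icc x y, (∃ w ∈ Icc x y, ¬q ≤ S.slope t (θ i w)) →
        S.slope t (θ i z) < q := by
      intro i
      by_cases h : ∃ w ∈ Icc x y, ¬q ≤ S.slope t (θ i w)
      · obtain ⟨w, hw, hlt⟩ := h
        exact ⟨w, hw, fun _ => not_le.1 hlt⟩
      · exact ⟨x, hxm, fun h' => absurd h' h⟩
    choose z hzm hz using hex
    obtain ⟨z₀, hz₀, hlim⟩ := isCompact_Icc.ultrafilter_le_nhds (l.map z)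
      (tendsto_principal.2 (Eventually.of_forall hzm))
    have hlim' : Tendsto z l (𝓝 z₀) := hlim
    have hconv : Tendsto (fun i => θ i (z i)) l (𝓝 (θ₀ z₀)) := by
      have h1 : Tendsto (fun i => θ i (z i) - θ i z₀) l (𝓝 0) := by
        refine Metric.tendsto_nhds.2 fun ε hε => ?_
        obtain ⟨δ, hδ, H⟩ := hclose ε hε
        filter_upwards [Metric.tendsto_nhds.1 hlim' δ hδ] with i hi
        rw [Real.dist_eq] at hi
        rw [dist_zero_right]
        rcases le_total (z i) z₀ with hle | hle
        · rw [norm_sub_rev]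
          rw [abs_sub_comm] at hi
          exact H i _ (hzm i) _ hz₀ hle ((le_abs_self _).trans_lt hi)
        · exact H i _ hz₀ _ (hzm i) hle ((le_abs_self _).trans_lt hi)
      simpa using h1.add (hθ z₀ hz₀)
    have hlsc := hS.slope_lsc hE (t, θ₀ z₀) ⟨ht, hθm z₀ hz₀⟩ q (hq.trans_le (iInf₂_le z₀ hz₀))
    have hc : Tendsto (fun i => (t, θ i (z i))) l (𝓝[Icc 0 S.T ×ˢ S.sublevel E] (t, θ₀ z₀)) :=
      tendsto_nhdsWithin_iff.2 ⟨tendsto_const_nhds.prodMk_nhds hconv,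
        Eventually.of_forall fun i => ⟨ht, hm i (hzm i)⟩⟩
    obtain ⟨i, hi1, hi2⟩ := ((hc.eventually hlsc).and hfreq).exists
    push Not at hi2
    obtain ⟨w, hw, hlt⟩ := hi2
    exact absurd hi1 (not_lt.2 (hz i ⟨w, hw, not_le.2 hlt⟩).le)
  have hPc : Continuous fun v : V => ENNReal.ofReal (S.Psi v) :=
    ENNReal.continuous_ofReal.comp hS.Psi_continuous
  have hdiff : Tendsto (fun i => θ i y - θ i x) l (𝓝 (θ₀ y - θ₀ x)) := (hθ y hym).sub (hθ x hxm)
  have key : ∀ q, q ≠ ⊤ → (∀ᶠ i in (l : Filter ι), ∀ z ∈ Icc x y, q ≤ S.slope t (θ i z)) →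
      ENNReal.ofReal (S.Psi (θ₀ y - θ₀ x)) + q * ‖θ₀ y - θ₀ x‖ₑ ≤ ENNReal.ofReal (K₀ * (y - x)) := by
    intro q hqt hq
    have h1 : Tendsto (fun i => ENNReal.ofReal (S.Psi (θ i y - θ i x)) + q * ‖θ i y - θ i x‖ₑ) l
        (𝓝 (ENNReal.ofReal (S.Psi (θ₀ y - θ₀ x)) + q * ‖θ₀ y - θ₀ x‖ₑ)) :=
      ((hPc.tendsto _).comp hdiff).add (ENNReal.Tendsto.const_mul hdiff.enorm (Or.inr hqt))
    have h2 : Tendsto (fun i => ENNReal.ofReal (K i * (y - x))) l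
        (𝓝 (ENNReal.ofReal (K₀ * (y - x)))) :=
      (ENNReal.continuous_ofReal.tendsto _).comp (hK.mul_const _)
    refine le_of_tendsto_of_tendsto h1 h2 ?_
    filter_upwards [hq] with i hi
    refine le_trans (add_le_add le_rfl (mul_le_mul_left (le_iInf₂ hi) _)) (hinc i x y le_rfl hxy le_rfl)
  rcases eq_or_ne I 0 with hI0 | hI0
  · have := key 0 ENNReal.zero_ne_top (Eventually.of_forall fun i z _ => zero_le)
    rw [incCost, slopeCost, ← hI, hI0]
    exact this
  -- The infimum `I` may be infinite, so it is approached by finite `q` from below.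
  · have : (𝓝[<] I).NeBot := nhdsLT_neBot_of_exists_lt ⟨0, pos_iff_ne_zero.2 hI0⟩
    have hlim : Tendsto (fun q => ENNReal.ofReal (S.Psi (θ₀ y - θ₀ x)) + q * ‖θ₀ y - θ₀ x‖ₑ)
        (𝓝[<] I) (𝓝 (ENNReal.ofReal (S.Psi (θ₀ y - θ₀ x)) + I * ‖θ₀ y - θ₀ x‖ₑ)) :=
      (ENNReal.Tendsto.mul_const (tendsto_id.mono_left nhdsWithin_le_nhds)
        (Or.inl hI0)).const_add _
    refine le_of_tendsto hlim ?_
    filter_upwards [self_mem_nhdsWithin] with q hq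
    exact key q (ne_top_of_lt hq) (hslope q hq)

/-- Transitions of bounded cost take values in a common sublevel. -/
theorem Standing.exists_transition_bound [CompleteSpace V] (hS : S.Standing)
    (hV : HasRadonNikodymProperty V) {E : ℝ} (hE : 0 < E) {B : ℝ} (hB : 0 ≤ B) :
    ∃ E' > 0, ∀ t ∈ Icc 0 S.T, ∀ x₀ ∈ S.sublevel E, ∀ x₁ ∈ S.sublevel E, ∀ θ,
      S.IsTransition t x₀ x₁ θ → S.dissipation (fun _ => t) θ 0 1 ≤ ENNReal.ofReal B →
      MapsTo θ (Icc 0 1) (S.sublevel E') := by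
  obtain ⟨κ, hκ, H⟩ := hS.exists_mem_sublevel
  obtain ⟨C, hC⟩ := (hS.sublevel_compact E hE).bddAbove_image hS.Psi_continuous.continuousOn
  -- Along a transition the chain rule on `[r,1]` bounds the energy by `E + B`. The Ψ-distance from
  -- the start bounds Ψ by `max C 0 + B`.
  set M := max C 0 + E + 2 * B with hM
  have hM0 : 0 < M := by positivity
  refine ⟨κ * M, by positivity, fun t ht x₀ hx₀ x₁ hx₁ θ hθ hD r hr => ?_⟩
  obtain ⟨E₁, hE₁, hreg⟩ := hθ.isRegularCurve ht
  have hfin : ∀ p q, 0 ≤ p → p ≤ q → q ≤ 1 →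
      S.dissipation (fun _ => t) θ p q ≤ ENNReal.ofReal B := by
    intro p q hp hpq hq
    refine le_trans ?_ hD
    rw [hreg.dissipation_eq hV hS hE₁ zero_le_one, (hreg.mono hp hq).dissipation_eq hV hS hE₁ hpq]
    exact ivar_mono _ hp hpq hq
  refine H (θ r) (hreg.psiAC.1 hr).1 t ht M hM0.le ?_
  have h1 : S.energy t (θ r) - S.energy t x₁ ≤ B := by
    have := (hreg.mono hr.1 le_rfl).energy_sub_le hV hS hE₁ hr.2
    rw [hθ.2.2.2] at this
    exact (ENNReal.ofReal_le_ofReal_iff hB).1 (this.trans (hfin r 1 hr.1 hr.2 le_rfl))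
  have h2 : S.Psi (θ r - x₀) ≤ B := by
    have := (hreg.mono le_rfl hr.2).Psi_le_dissipation hV hS hE₁ hr.1
      (ne_top_of_le_ne_top ENNReal.ofReal_ne_top (hfin 0 r le_rfl hr.1 hr.2))
    rw [hθ.2.2.1] at this
    refine this.trans ?_
    have h3 := ENNReal.toReal_mono ENNReal.ofReal_ne_top (hfin 0 r le_rfl hr.1 hr.2)
    rwa [ENNReal.toReal_ofReal hB] at h3
  have h3 : S.Psi (θ r) ≤ S.Psi x₀ + S.Psi (θ r - x₀) := by
    simpa using hS.Psi_add_le x₀ (θ r - x₀)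
  have h4 : S.Psi x₀ ≤ max C 0 := (hC ⟨x₀, hx₀, rfl⟩).trans (le_max_left _ _)
  have h5 : S.energy t x₁ ≤ E := hS.energy_le_of_mem ht hx₁
  linarith

/-- Existence of optimal transitions, parameterized with unit speed. -/
theorem Standing.exists_optimal_transition [CompleteSpace V] (hS : S.Standing)
    (hV : HasRadonNikodymProperty V) {E : ℝ} (hE : 0 < E) {B : ℝ} (hB : 0 ≤ B) :
    ∃ E' > 0, ∀ t ∈ Icc 0 S.T, ∀ x₀ ∈ S.sublevel E, ∀ x₁ ∈ S.sublevel E,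
      S.finslerCost t x₀ x₁ ≤ ENNReal.ofReal B → ∃ θ : ℝ → V, θ 0 = x₀ ∧
        θ (S.finslerCost t x₀ x₁).toReal = x₁ ∧
        MapsTo θ (Icc 0 (S.finslerCost t x₀ x₁).toReal) (S.sublevel E') ∧
        ∀ x y, 0 ≤ x → x < y → y ≤ (S.finslerCost t x₀ x₁).toReal →
          S.incCost (fun _ => t) θ x y ≤ ENNReal.ofReal (y - x) := by
  -- The bound `B + 1` leaves room for near-minimizers whose cost exceeds the infimum by at most 1.
  obtain ⟨E', hE', H⟩ := hS.exists_transition_bound hV hE (B := B + 1) (by linarith)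
  refine ⟨max E E', lt_max_of_lt_left hE, fun t ht x₀ hx₀ x₁ hx₁ hcost => ?_⟩
  have hfin : S.finslerCost t x₀ x₁ ≠ ⊤ := ne_top_of_le_ne_top ENNReal.ofReal_ne_top hcost
  set ℓ := (S.finslerCost t x₀ x₁).toReal with hℓ
  have hℓ0 : 0 ≤ ℓ := ENNReal.toReal_nonneg
  rcases hℓ0.eq_or_lt with h0 | hpos
  · have hz : S.finslerCost t x₀ x₁ = 0 := by
      rw [← ENNReal.ofReal_toReal hfin, ← hℓ, ← h0, ENNReal.ofReal_zero]
    have heq : x₀ = x₁ := by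
      have := hS.psiCost_le_finslerCost t x₀ x₁
      rw [hz] at this
      exact hS.eq_of_Psi_sub (ENNReal.ofReal_eq_zero.1 (le_zero_iff.1 this))
    refine ⟨fun _ => x₀, rfl, heq, fun _ _ => sublevel_mono (le_max_left _ _) hx₀, ?_⟩
    intro x y hx hxy hy
    linarith
  have hcostℓ : S.finslerCost t x₀ x₁ = ENNReal.ofReal ℓ := (ENNReal.ofReal_toReal hfin).symm
  have hℓB : ℓ ≤ B := (ENNReal.ofReal_le_ofReal_iff hB).1 (hcostℓ ▸ hcost)
  have hex : ∀ n : ℕ, ∃ θ : ℝ → V, MapsTo θ (Icc 0 1) (S.sublevel E') ∧ θ 0 = x₀ ∧ θ 1 = x₁ ∧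
      ∀ x y, 0 ≤ x → x < y → y ≤ 1 → S.incCost (fun _ => t) θ x y ≤
        ENNReal.ofReal ((ℓ + 2 / ((n : ℝ) + 1)) * (y - x)) := by
    intro n
    have hn : (0 : ℝ) < 1 / ((n : ℝ) + 1) := by positivity
    have hn1 : 1 / ((n : ℝ) + 1) ≤ 1 := by
      rw [div_le_one (by positivity)]
      linarith [(Nat.cast_nonneg n : (0 : ℝ) ≤ n)]
    have hlt : S.finslerCost t x₀ x₁ < ENNReal.ofReal (ℓ + 1 / ((n : ℝ) + 1)) := by
      rw [hcostℓ]
      exact (ENNReal.ofReal_lt_ofReal_iff (by linarith)).2 (by linarith)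
    obtain ⟨θ, hθ, hD⟩ : ∃ θ, S.IsTransition t x₀ x₁ θ ∧
        S.dissipation (fun _ => t) θ 0 1 < ENNReal.ofReal (ℓ + 1 / ((n : ℝ) + 1)) := by
      simpa only [finslerCost, iInf_lt_iff, exists_prop] using hlt
    have hmaps := H t ht x₀ hx₀ x₁ hx₁ θ hθ
      (hD.le.trans (ENNReal.ofReal_le_ofReal (by linarith)))
    obtain ⟨E₁, hE₁, hreg⟩ := hθ.isRegularCurve ht
    obtain ⟨ρ, hρm, _, hρ0, hρ1, hρ⟩ := hreg.exists_reparam hV hS hE₁ one_pos (ne_top_of_lt hD) hn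
    refine ⟨fun r => θ (ρ r), fun r hr => hmaps (hρm hr), ?_, ?_, fun x y hx hxy hy => ?_⟩
    · beta_reduce; rw [hρ0, hθ.2.2.1]
    · beta_reduce; rw [hρ1, hθ.2.2.2]
    · refine (hρ x y hx hxy hy).1.trans ((hρ x y hx hxy hy).2.trans (ENNReal.ofReal_le_ofReal ?_))
      refine mul_le_mul_of_nonneg_right ?_ (by linarith)
      have h1 := ENNReal.toReal_mono ENNReal.ofReal_ne_top hD.le
      rw [ENNReal.toReal_ofReal (by linarith)] at h1
      have h2 : 2 / ((n : ℝ) + 1) = 1 / ((n : ℝ) + 1) + 1 / ((n : ℝ) + 1) := by ring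
      linarith
  choose θ hθm hθ0 hθ1 hθinc using hex
  -- Pointwise limits along an ultrafilter exist in the compact sublevel. One `1 / (n + 1)` in the
  -- speed is the optimality gap and the other comes from the reparametrization, so the limit has
  -- speed at most `ℓ`.
  set l : Ultrafilter ℕ := hyperfilter ℕ with hl
  have hlim : ∀ r, ∃ v, r ∈ Icc (0 : ℝ) 1 → Tendsto (fun n => θ n r) l (𝓝 v) := by
    intro r
    by_cases hr : r ∈ Icc (0 : ℝ) 1
    · obtain ⟨v, _, hv⟩ := (hS.sublevel_compact E' hE').ultrafilter_le_nhds
        (l.map fun n => θ n r) (tendsto_principal.2 (Eventually.of_forall fun n => hθm n hr))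
      exact ⟨v, fun _ => hv⟩
    · exact ⟨0, fun h => absurd h hr⟩
  choose φ hφ using hlim
  have hφm : MapsTo φ (Icc 0 1) (S.sublevel E') := fun r hr =>
    (hS.sublevel_closed hE').mem_of_tendsto (hφ r hr) (Eventually.of_forall fun n => hθm n hr)
  have hφ0 : φ 0 = x₀ := by
    refine tendsto_nhds_unique (hφ 0 (by simp)) ?_
    simp only [hθ0]
    exact tendsto_const_nhds
  have hφ1 : φ 1 = x₁ := by
    refine tendsto_nhds_unique (hφ 1 (by simp)) ?_
    simp only [hθ1]
    exact tendsto_const_nhds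
  have hK : Tendsto (fun n : ℕ => ℓ + 2 / ((n : ℝ) + 1)) l (𝓝 ℓ) := by
    have h1 : Tendsto (fun n : ℕ => ℓ + 2 * (1 / ((n : ℝ) + 1))) atTop (𝓝 (ℓ + 2 * 0)) :=
      (tendsto_one_div_add_atTop_nhds_zero_nat.const_mul 2).const_add ℓ
    have h2 := h1.mono_left (Nat.hyperfilter_le_atTop)
    simpa only [mul_one_div, mul_zero, add_zero] using h2
  have hφinc : ∀ x y, 0 ≤ x → x < y → y ≤ 1 →
      S.incCost (fun _ => t) φ x y ≤ ENNReal.ofReal (ℓ * (y - x)) := by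
    intro x y hx hxy hy
    have hsub : Icc x y ⊆ Icc 0 1 := Icc_subset_Icc hx hy
    refine hS.incCost_le_of_tendsto l hE' ht (θ := θ) hxy (K := fun n => ℓ + 2 / ((n : ℝ) + 1))
      (K₁ := ℓ + 2) (fun n => (hθm n).mono_left hsub)
      (fun n p q hp hpq hq => hθinc n p q (hx.trans hp) hpq (hq.trans hy)) (fun n => ?_) hK
      fun z hz => hφ z (hsub hz)
    have : 2 / ((n : ℝ) + 1) ≤ 2 := by
      rw [div_le_iff₀ (by positivity)]
      linarith [(Nat.cast_nonneg n : (0 : ℝ) ≤ n)]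
    linarith
  refine ⟨fun s => φ (s / ℓ), by simpa using hφ0, ?_, ?_, ?_⟩
  · beta_reduce; rw [div_self hpos.ne', hφ1]
  · intro s hs
    exact sublevel_mono (le_max_right _ _)
      (hφm ⟨div_nonneg hs.1 hℓ0, (div_le_one hpos).2 hs.2⟩)
  · intro x y hx hxy hy
    have h1 : S.incCost (fun _ => t) (fun s => φ (s / ℓ)) x y ≤
        S.incCost (fun _ => t) φ (x / ℓ) (y / ℓ) := by
      refine incCost_comp_le (tt := fun _ => t) (ρ := fun s => s / ℓ) fun w hw => ?_
      refine ⟨w * ℓ, ⟨(div_le_iff₀ hpos).1 hw.1, (le_div_iff₀ hpos).1 hw.2⟩, ?_⟩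
      field_simp
    refine h1.trans ((hφinc _ _ (div_nonneg hx hℓ0) (by gcongr) ((div_le_one hpos).2 hy)).trans
      (le_of_eq ?_))
    congr 1
    field_simp

/-! ### The arclength of a curve of bounded variation -/

variable (S) in
/-- Curves in `BV([0,T]; D_E, Ψ)` with finite `𝔣`-total variation. -/
structure IsFiniteBV (E : ℝ) (u : ℝ → V) : Prop where
  standing : S.Standing
  pos : 0 < E
  isPsiBV : S.IsPsiBV (S.sublevel E) u
  finite : S.finslerVar u 0 S.T ≠ ⊤

variable (S) in
/-- The Finsler cost of the left jump. -/
def leftCost (u : ℝ → V) (t : ℝ) : ℝ := (S.finslerCost t (leftVal u t) (u t)).toReal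

variable (S) in
/-- The Finsler cost of the right jump. -/
def rightCost (u : ℝ → V) (t : ℝ) : ℝ := (S.finslerCost t (u t) (S.rightVal u t)).toReal

variable (S) in
/-- The arclength `t + Var_𝔣(u;[0,t])`. -/
def arc (u : ℝ → V) (t : ℝ) : ℝ := t + S.realFinslerVar u t

variable (S) in
/-- The left limit of the arclength. -/
def arcLeft (u : ℝ → V) (t : ℝ) : ℝ := S.arc u t - S.leftCost u t

variable (S) in
/-- The right limit of the arclength. -/
def arcRight (u : ℝ → V) (t : ℝ) : ℝ := S.arc u t + S.rightCost u t

theorem leftCost_nonneg (u : ℝ → V) (t : ℝ) : 0 ≤ S.leftCost u t := ENNReal.toReal_nonneg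

theorem rightCost_nonneg (u : ℝ → V) (t : ℝ) : 0 ≤ S.rightCost u t := ENNReal.toReal_nonneg

theorem arcLeft_le_arc (u : ℝ → V) (t : ℝ) : S.arcLeft u t ≤ S.arc u t :=
  sub_le_self _ (leftCost_nonneg u t)

theorem arc_le_arcRight (u : ℝ → V) (t : ℝ) : S.arc u t ≤ S.arcRight u t :=
  le_add_of_nonneg_right (rightCost_nonneg u t)

section

variable {E : ℝ} {u : ℝ → V}

theorem IsFiniteBV.leftCost_zero (h : S.IsFiniteBV E u) : S.leftCost u 0 = 0 := by
  rw [leftCost, leftVal_zero, h.standing.finslerCost_self h.pos 0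
    (h.isPsiBV.1 (left_mem_Icc.2 h.standing.T_pos.le)), ENNReal.toReal_zero]

theorem IsFiniteBV.rightCost_T (h : S.IsFiniteBV E u) : S.rightCost u S.T = 0 := by
  rw [rightCost, rightVal_T, h.standing.finslerCost_self h.pos S.T
    (h.isPsiBV.1 (right_mem_Icc.2 h.standing.T_pos.le)), ENNReal.toReal_zero]

theorem arc_zero (u : ℝ → V) : S.arc u 0 = 0 := by simp [arc, realFinslerVar_zero]

theorem incCost_congr {tt tt' : ℝ → ℝ} {uu uu' : ℝ → V} {x y : ℝ} (hxy : x ≤ y)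
    (ht : ∀ z ∈ Icc x y, tt z = tt' z) (hu : ∀ z ∈ Icc x y, uu z = uu' z) :
    S.incCost tt uu x y = S.incCost tt' uu' x y := by
  unfold incCost slopeCost
  rw [hu x (left_mem_Icc.2 hxy), hu y (right_mem_Icc.2 hxy)]
  congr 2
  exact biInf_congr fun z hz => by rw [ht z hz, hu z hz]

theorem IsFiniteBV.arcLeft_zero (h : S.IsFiniteBV E u) : S.arcLeft u 0 = 0 := by
  rw [arcLeft, arc_zero, h.leftCost_zero, sub_zero]

theorem IsFiniteBV.arcRight_T (h : S.IsFiniteBV E u) : S.arcRight u S.T = S.arc u S.T := by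
  rw [arcRight, h.rightCost_T, add_zero]

variable [CompleteSpace V]

theorem IsFiniteBV.leftVal_mem (h : S.IsFiniteBV E u) {t : ℝ} (ht : t ∈ Icc 0 S.T) :
    leftVal u t ∈ S.sublevel E := h.isPsiBV.leftVal_mem h.standing h.pos ht

theorem IsFiniteBV.rightVal_mem (h : S.IsFiniteBV E u) {t : ℝ} (ht : t ∈ Icc 0 S.T) :
    S.rightVal u t ∈ S.sublevel E := h.isPsiBV.rightVal_mem h.standing h.pos ht

theorem IsFiniteBV.realFinslerVar_mono (h : S.IsFiniteBV E u) {x y : ℝ} (hx : 0 ≤ x) (hxy : x ≤ y)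
    (hy : y ≤ S.T) : S.realFinslerVar u x ≤ S.realFinslerVar u y := by
  rcases hxy.eq_or_lt with rfl | hxy
  · exact le_rfl
  · exact (h.isPsiBV.finslerVar_eq_ofReal h.standing h.pos h.finite hx hxy hy).2

theorem IsFiniteBV.realFinslerVar_T (h : S.IsFiniteBV E u) :
    ENNReal.ofReal (S.realFinslerVar u S.T) = S.finslerVar u 0 S.T := by
  rw [(h.isPsiBV.finslerVar_eq_ofReal h.standing h.pos h.finite le_rfl h.standing.T_pos le_rfl).1,
    realFinslerVar_zero, sub_zero]

theorem IsFiniteBV.leftCost_le (h : S.IsFiniteBV E u) {t : ℝ} (ht : t ∈ Icc 0 S.T) :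
    S.finslerCost t (leftVal u t) (u t) ≤ ENNReal.ofReal (S.realFinslerVar u S.T) := by
  rcases ht.1.eq_or_lt with rfl | h0
  · rw [leftVal_zero, h.standing.finslerCost_self h.pos 0 (h.isPsiBV.1 ht)]
    exact zero_le
  · have h1 := h.isPsiBV.jumps_le_finslerVar h.standing h.pos le_rfl h0 ht.2
    rw [(h.isPsiBV.finslerVar_eq_ofReal h.standing h.pos h.finite le_rfl h0 ht.2).1,
      realFinslerVar_zero, sub_zero] at h1
    exact (le_add_self.trans h1).trans
      (ENNReal.ofReal_le_ofReal (h.realFinslerVar_mono h0.le ht.2 le_rfl))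

theorem IsFiniteBV.rightCost_le (h : S.IsFiniteBV E u) {t : ℝ} (ht : t ∈ Icc 0 S.T) :
    S.finslerCost t (u t) (S.rightVal u t) ≤ ENNReal.ofReal (S.realFinslerVar u S.T) := by
  rcases ht.2.eq_or_lt with rfl | h0
  · rw [rightVal_T, h.standing.finslerCost_self h.pos S.T (h.isPsiBV.1 ht)]
    exact zero_le
  · have h1 := h.isPsiBV.jumps_le_finslerVar h.standing h.pos ht.1 h0 le_rfl
    rw [(h.isPsiBV.finslerVar_eq_ofReal h.standing h.pos h.finite ht.1 h0 le_rfl).1] at h1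
    refine (le_self_add.trans (le_self_add.trans h1)).trans (ENNReal.ofReal_le_ofReal ?_)
    have := h.realFinslerVar_mono le_rfl ht.1 ht.2
    rw [realFinslerVar_zero] at this
    linarith

theorem IsFiniteBV.ofReal_leftCost (h : S.IsFiniteBV E u) {t : ℝ} (ht : t ∈ Icc 0 S.T) :
    ENNReal.ofReal (S.leftCost u t) = S.finslerCost t (leftVal u t) (u t) :=
  ENNReal.ofReal_toReal (ne_top_of_le_ne_top ENNReal.ofReal_ne_top (h.leftCost_le ht))

theorem IsFiniteBV.ofReal_rightCost (h : S.IsFiniteBV E u) {t : ℝ} (ht : t ∈ Icc 0 S.T) :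
    ENNReal.ofReal (S.rightCost u t) = S.finslerCost t (u t) (S.rightVal u t) :=
  ENNReal.ofReal_toReal (ne_top_of_le_ne_top ENNReal.ofReal_ne_top (h.rightCost_le ht))

theorem IsFiniteBV.jumps_le (h : S.IsFiniteBV E u) {x y : ℝ} (hx : 0 ≤ x) (hxy : x < y)
    (hy : y ≤ S.T) :
    S.rightCost u x + S.Psi (leftVal u y - S.rightVal u x) + S.leftCost u y ≤
      S.realFinslerVar u y - S.realFinslerVar u x := by
  have hxm : x ∈ Icc 0 S.T := ⟨hx, hxy.le.trans hy⟩
  have hym : y ∈ Icc 0 S.T := ⟨hx.trans hxy.le, hy⟩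
  have h1 := h.isPsiBV.jumps_le_finslerVar h.standing h.pos hx hxy hy
  rw [(h.isPsiBV.finslerVar_eq_ofReal h.standing h.pos h.finite hx hxy hy).1,
    ← h.ofReal_leftCost hym, ← h.ofReal_rightCost hxm, psiCost,
    ← ENNReal.ofReal_add (rightCost_nonneg u x) (h.standing.Psi_nonneg _),
    ← ENNReal.ofReal_add (add_nonneg (rightCost_nonneg u x) (h.standing.Psi_nonneg _))
      (leftCost_nonneg u y)] at h1
  exact (ENNReal.ofReal_le_ofReal_iff (sub_nonneg.2 (h.realFinslerVar_mono hx hxy.le hy))).1 h1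

theorem IsFiniteBV.arcRight_add_le (h : S.IsFiniteBV E u) {x y : ℝ} (hx : 0 ≤ x) (hxy : x < y)
    (hy : y ≤ S.T) : S.arcRight u x + (y - x) + S.Psi (leftVal u y - S.rightVal u x) ≤
      S.arcLeft u y := by
  have := h.jumps_le hx hxy hy
  simp only [arcRight, arcLeft, arc]
  linarith

theorem IsFiniteBV.arcRight_lt (h : S.IsFiniteBV E u) {x y : ℝ} (hx : 0 ≤ x) (hxy : x < y)
    (hy : y ≤ S.T) : S.arcRight u x < S.arcLeft u y := by
  linarith [h.arcRight_add_le hx hxy hy, h.standing.Psi_nonneg (leftVal u y - S.rightVal u x)]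

/-- With monotonicity this identifies `arcLeft` as the left limit of the arclength: near `t` the
𝔣-variation reduces to the Finsler cost of the left jump. The other `ε / 2` pays for the elapsed
time. -/
theorem IsFiniteBV.exists_arc_left (h : S.IsFiniteBV E u) {t : ℝ} (ht : t ∈ Ioc 0 S.T) {ε : ℝ}
    (hε : 0 < ε) : ∃ r ∈ Ico 0 t, S.arcLeft u t ≤ S.arc u r + ε := by
  obtain ⟨r, hr, H⟩ := h.isPsiBV.exists_finslerVar_le_left h.standing h.pos ht
    (h.isPsiBV.finslerVar_ne_top h.standing h.pos h.finite le_rfl ht.1 ht.2) (half_pos hε)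
  set r' := max r (t - ε / 2) with hr'
  have hrt : r' < t := max_lt hr.2 (by linarith)
  have h0 : 0 ≤ r' := hr.1.trans (le_max_left _ _)
  refine ⟨r', ⟨h0, hrt⟩, ?_⟩
  have h1 := H r' ⟨le_max_left _ _, hrt⟩
  rw [(h.isPsiBV.finslerVar_eq_ofReal h.standing h.pos h.finite h0 hrt ht.2).1,
    ← h.ofReal_leftCost (Ioc_subset_Icc_self ht),
    ← ENNReal.ofReal_add (leftCost_nonneg u t) (by linarith)] at h1
  have h2 := (ENNReal.ofReal_le_ofReal_iff (add_nonneg (leftCost_nonneg u t) (by linarith))).1 h1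
  simp only [arcLeft, arc]
  linarith [le_max_right r (t - ε / 2)]

theorem IsFiniteBV.exists_arc_right (h : S.IsFiniteBV E u) {t : ℝ} (ht : t ∈ Ico 0 S.T) {ε : ℝ}
    (hε : 0 < ε) : ∃ r ∈ Ioc t S.T, S.arc u r ≤ S.arcRight u t + ε := by
  obtain ⟨r, hr, H⟩ := h.isPsiBV.exists_finslerVar_le_right h.standing h.pos ht
    (h.isPsiBV.finslerVar_ne_top h.standing h.pos h.finite ht.1 ht.2 le_rfl) (half_pos hε)
  set r' := min r (t + ε / 2) with hr'
  have hrt : t < r' := lt_min hr.1 (by linarith)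
  have h0 : r' ≤ S.T := (min_le_left _ _).trans hr.2
  refine ⟨r', ⟨hrt, h0⟩, ?_⟩
  have h1 := H r' ⟨hrt, min_le_left _ _⟩
  rw [(h.isPsiBV.finslerVar_eq_ofReal h.standing h.pos h.finite ht.1 hrt h0).1,
    ← h.ofReal_rightCost (Ico_subset_Icc_self ht),
    ← ENNReal.ofReal_add (rightCost_nonneg u t) (by linarith)] at h1
  have h2 := (ENNReal.ofReal_le_ofReal_iff (add_nonneg (rightCost_nonneg u t) (by linarith))).1 h1
  simp only [arcRight, arc]
  linarith [min_le_right r (t + ε / 2)]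

theorem IsFiniteBV.arc_T_pos (h : S.IsFiniteBV E u) : 0 < S.arc u S.T := by
  have := h.realFinslerVar_mono le_rfl h.standing.T_pos.le le_rfl
  rw [realFinslerVar_zero] at this
  have := h.standing.T_pos
  simp only [arc]
  linarith

theorem IsFiniteBV.arcLeft_nonneg (h : S.IsFiniteBV E u) {t : ℝ} (ht : t ∈ Icc 0 S.T) :
    0 ≤ S.arcLeft u t := by
  rcases ht.1.eq_or_lt with rfl | h0
  · rw [h.arcLeft_zero]
  · have := h.arcRight_lt le_rfl h0 ht.2
    have h1 := arc_le_arcRight (S := S) u 0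
    rw [arc_zero] at h1
    linarith

theorem IsFiniteBV.arcRight_le (h : S.IsFiniteBV E u) {t : ℝ} (ht : t ∈ Icc 0 S.T) :
    S.arcRight u t ≤ S.arc u S.T := by
  rcases ht.2.eq_or_lt with rfl | h0
  · rw [h.arcRight_T]
  · exact (h.arcRight_lt ht.1 h0 le_rfl).le.trans (arcLeft_le_arc u _)

/-- The jump intervals of the arclength cover the whole parameter interval. -/
theorem IsFiniteBV.exists_time (h : S.IsFiniteBV E u) {x : ℝ} (hx : x ∈ Icc 0 (S.arc u S.T)) :
    ∃ t ∈ Icc 0 S.T, S.arcLeft u t ≤ x ∧ x ≤ S.arcRight u t := by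
  -- The time sought is the last one whose jump interval starts at or before `x`. The one-sided
  -- limits of the arclength show that `x` lies in the jump interval at this supremum.
  set R := {r | r ∈ Icc 0 S.T ∧ S.arcLeft u r ≤ x} with hR
  have h0 : (0 : ℝ) ∈ R := ⟨left_mem_Icc.2 h.standing.T_pos.le, by rw [h.arcLeft_zero]; exact hx.1⟩
  have hb : BddAbove R := ⟨S.T, fun r hr => hr.1.2⟩
  set t := sSup R with ht
  have ht0 : 0 ≤ t := le_csSup hb h0
  have htT : t ≤ S.T := csSup_le ⟨0, h0⟩ fun r hr => hr.1.2
  refine ⟨t, ⟨ht0, htT⟩, ?_, ?_⟩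
  · rcases ht0.eq_or_lt with heq | htpos
    · rw [← heq]; exact h0.2
    refine le_of_forall_pos_le_add fun ε hε => ?_
    obtain ⟨r, hr, hle⟩ := h.exists_arc_left ⟨htpos, htT⟩ hε
    obtain ⟨r', hr', hlt⟩ := exists_lt_of_lt_csSup ⟨0, h0⟩ hr.2
    have := h.arcRight_lt hr.1 hlt hr'.1.2
    linarith [arc_le_arcRight (S := S) u r, hr'.2]
  · rcases htT.eq_or_lt with heq | htlt
    · rw [heq, h.arcRight_T]; exact hx.2
    refine le_of_forall_pos_le_add fun ε hε => ?_
    obtain ⟨r, hr, hle⟩ := h.exists_arc_right ⟨ht0, htlt⟩ hε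
    have hrR : r ∉ R := fun hmem => absurd (le_csSup hb hmem) (not_le.2 hr.1)
    have : x < S.arcLeft u r := by
      by_contra hge
      exact hrR ⟨⟨ht0.trans hr.1.le, hr.2⟩, not_lt.1 hge⟩
    linarith [arcLeft_le_arc (S := S) u r]

theorem IsFiniteBV.time_unique (h : S.IsFiniteBV E u) {x t t' : ℝ} (ht : t ∈ Icc 0 S.T)
    (ht' : t' ∈ Icc 0 S.T) (h1 : S.arcLeft u t ≤ x) (h2 : x ≤ S.arcRight u t)
    (h1' : S.arcLeft u t' ≤ x) (h2' : x ≤ S.arcRight u t') : t = t' := by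
  rcases lt_trichotomy t t' with hlt | heq | hlt
  · linarith [h.arcRight_lt ht.1 hlt ht'.2]
  · exact heq
  · linarith [h.arcRight_lt ht'.1 hlt ht.2]

/-! ### The parameterized curve obtained by filling the jumps -/

variable (S) in
/-- `(tt,uu)` parameterizes the graph of `u`, with the jumps filled by optimal transitions. -/
structure IsCompletion (E : ℝ) (u : ℝ → V) (tt : ℝ → ℝ) (uu : ℝ → V) : Prop where
  time : ∀ x ∈ Icc 0 (S.arc u S.T),
    tt x ∈ Icc 0 S.T ∧ S.arcLeft u (tt x) ≤ x ∧ x ≤ S.arcRight u (tt x)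
  mapsTo : MapsTo uu (Icc 0 (S.arc u S.T)) (S.sublevel E)
  arc_eq : ∀ t ∈ Icc 0 S.T, uu (S.arc u t) = u t
  left_eq : ∀ t ∈ Icc 0 S.T, uu (S.arcLeft u t) = leftVal u t
  right_eq : ∀ t ∈ Icc 0 S.T, uu (S.arcRight u t) = S.rightVal u t
  left_inc : ∀ t ∈ Icc 0 S.T, ∀ x y, S.arcLeft u t ≤ x → x < y → y ≤ S.arc u t →
    S.incCost (fun _ => t) uu x y ≤ ENNReal.ofReal (y - x)
  right_inc : ∀ t ∈ Icc 0 S.T, ∀ x y, S.arc u t ≤ x → x < y → y ≤ S.arcRight u t →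
    S.incCost (fun _ => t) uu x y ≤ ENNReal.ofReal (y - x)

theorem IsFiniteBV.exists_isCompletion (h : S.IsFiniteBV E u) (hV : HasRadonNikodymProperty V) :
    ∃ E' > 0, ∃ tt uu, S.IsCompletion E' u tt uu := by
  have hS := h.standing
  have hB : 0 ≤ S.realFinslerVar u S.T := by
    have := h.realFinslerVar_mono le_rfl hS.T_pos.le le_rfl
    rwa [realFinslerVar_zero] at this
  obtain ⟨E', hE', H⟩ := hS.exists_optimal_transition hV h.pos hB
  have hex : ∀ x, ∃ t, x ∈ Icc 0 (S.arc u S.T) → t ∈ Icc 0 S.T ∧ S.arcLeft u t ≤ x ∧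
      x ≤ S.arcRight u t := by
    intro x
    by_cases hx : x ∈ Icc 0 (S.arc u S.T)
    · obtain ⟨t, ht, h1⟩ := h.exists_time hx
      exact ⟨t, fun _ => ⟨ht, h1⟩⟩
    · exact ⟨0, fun h' => absurd h' hx⟩
  choose tt htt using hex
  have hLex : ∀ t, ∃ θ : ℝ → V, t ∈ Icc 0 S.T → θ 0 = leftVal u t ∧ θ (S.leftCost u t) = u t ∧
      MapsTo θ (Icc 0 (S.leftCost u t)) (S.sublevel E') ∧
      ∀ x y, 0 ≤ x → x < y → y ≤ S.leftCost u t →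
        S.incCost (fun _ => t) θ x y ≤ ENNReal.ofReal (y - x) := by
    intro t
    by_cases ht : t ∈ Icc 0 S.T
    · obtain ⟨θ, hθ⟩ := H t ht _ (h.leftVal_mem ht) _ (h.isPsiBV.1 ht) (h.leftCost_le ht)
      exact ⟨θ, fun _ => hθ⟩
    · exact ⟨fun _ => 0, fun h' => absurd h' ht⟩
  have hRex : ∀ t, ∃ θ : ℝ → V, t ∈ Icc 0 S.T → θ 0 = u t ∧
      θ (S.rightCost u t) = S.rightVal u t ∧
      MapsTo θ (Icc 0 (S.rightCost u t)) (S.sublevel E') ∧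
      ∀ x y, 0 ≤ x → x < y → y ≤ S.rightCost u t →
        S.incCost (fun _ => t) θ x y ≤ ENNReal.ofReal (y - x) := by
    intro t
    by_cases ht : t ∈ Icc 0 S.T
    · obtain ⟨θ, hθ⟩ := H t ht _ (h.isPsiBV.1 ht) _ (h.rightVal_mem ht) (h.rightCost_le ht)
      exact ⟨θ, fun _ => hθ⟩
    · exact ⟨fun _ => 0, fun h' => absurd h' ht⟩
  choose θL hθL using hLex
  choose θR hθR using hRex
  classical
  -- Each `x` lies in the jump interval of a unique time. The left transition is used up to the
  -- arclength value and the right transition after it.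
  set uu : ℝ → V := fun x => if x ≤ S.arc u (tt x) then θL (tt x) (x - S.arcLeft u (tt x)) else
    θR (tt x) (x - S.arc u (tt x)) with huu
  have htime : ∀ t ∈ Icc 0 S.T, ∀ x, S.arcLeft u t ≤ x → x ≤ S.arcRight u t →
      x ∈ Icc 0 (S.arc u S.T) ∧ tt x = t := by
    intro t ht x h1 h2
    have hx : x ∈ Icc 0 (S.arc u S.T) :=
      ⟨(h.arcLeft_nonneg ht).trans h1, h2.trans (h.arcRight_le ht)⟩
    have := htt x hx
    exact ⟨hx, h.time_unique this.1 ht this.2.1 this.2.2 h1 h2⟩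
  have hd1 : ∀ t, S.arc u t - S.arcLeft u t = S.leftCost u t := fun t => by
    simp only [arcLeft]; ring
  have hd2 : ∀ t, S.arcRight u t - S.arc u t = S.rightCost u t := fun t => by
    simp only [arcRight]; ring
  have huL : ∀ t ∈ Icc 0 S.T, ∀ x, S.arcLeft u t ≤ x → x ≤ S.arc u t →
      uu x = θL t (x - S.arcLeft u t) := by
    intro t ht x h1 h2
    have := (htime t ht x h1 (h2.trans (arc_le_arcRight u t))).2
    simp only [huu, this, if_pos h2]
  have huR : ∀ t ∈ Icc 0 S.T, ∀ x, S.arc u t ≤ x → x ≤ S.arcRight u t →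
      uu x = θR t (x - S.arc u t) := by
    intro t ht x h1 h2
    -- At the arclength value itself both formulas apply and agree, since both transitions pass
    -- through `u t`.
    rcases h1.eq_or_lt with rfl | h1
    · rw [huL t ht _ (arcLeft_le_arc u t) le_rfl, hd1, (hθL t ht).2.1, sub_self, (hθR t ht).1]
    · have := (htime t ht x ((arcLeft_le_arc u t).trans h1.le) h2).2
      simp only [huu, this, if_neg (not_le.2 h1)]
  have hshift : ∀ (t c : ℝ) (θ : ℝ → V) (x y : ℝ),
      S.incCost (fun _ => t) (fun z => θ (z - c)) x y ≤ S.incCost (fun _ => t) θ (x - c) (y - c) :=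
    fun t c θ x y => incCost_comp_le (tt := fun _ => t) (ρ := fun z => z - c) fun w hw =>
      ⟨w + c, ⟨by linarith [hw.1], by linarith [hw.2]⟩, by simp⟩
  refine ⟨E', hE', tt, uu, htt, ?_, ?_, ?_, ?_, ?_, ?_⟩
  · intro x hx
    obtain ⟨ht, h1, h2⟩ := htt x hx
    rcases le_total x (S.arc u (tt x)) with hle | hle
    · rw [huL _ ht x h1 hle]
      exact (hθL _ ht).2.2.1 ⟨by linarith, by rw [← hd1]; linarith⟩
    · rw [huR _ ht x hle h2]
      exact (hθR _ ht).2.2.1 ⟨by linarith, by rw [← hd2]; linarith⟩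
  · intro t ht
    rw [huL t ht _ (arcLeft_le_arc u t) le_rfl, hd1, (hθL t ht).2.1]
  · intro t ht
    rw [huL t ht _ le_rfl (arcLeft_le_arc u t), sub_self, (hθL t ht).1]
  · intro t ht
    rw [huR t ht _ (arc_le_arcRight u t) le_rfl, hd2, (hθR t ht).2.1]
  · intro t ht x y hx hxy hy
    rw [incCost_congr (tt' := fun _ => t) (uu' := fun z => θL t (z - S.arcLeft u t)) hxy.le
      (fun _ _ => rfl) fun z hz => huL t ht z (hx.trans hz.1) (hz.2.trans hy)]
    refine (hshift _ _ _ _ _).trans (((hθL t ht).2.2.2 _ _ (by linarith) (by linarith)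
      (by rw [← hd1]; linarith)).trans (le_of_eq ?_))
    ring_nf
  · intro t ht x y hx hxy hy
    rw [incCost_congr (tt' := fun _ => t) (uu' := fun z => θR t (z - S.arc u t)) hxy.le
      (fun _ _ => rfl) fun z hz => huR t ht z (hx.trans hz.1) (hz.2.trans hy)]
    refine (hshift _ _ _ _ _).trans (((hθR t ht).2.2.2 _ _ (by linarith) (by linarith)
      (by rw [← hd2]; linarith)).trans (le_of_eq ?_))
    ring_nf

end

/-! ### Cost, admissibility and nondegeneracy of the completed curve -/

section

variable {E E' : ℝ} {u : ℝ → V} {tt : ℝ → ℝ} {uu : ℝ → V}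

/-- Jump times are countable, so their complement is dense, and off the jump set the curve is
stable. -/
theorem IsFiniteBV.exists_stable (h : S.IsFiniteBV E u) (hst : S.LocallyStable u) {s t : ℝ}
    (hs : 0 ≤ s) (hlt : s < t) (ht : t ≤ S.T) : ∃ r ∈ Ioo s t, S.IsStableAt r (u r) := by
  obtain ⟨r, hr, hsr, hrt⟩ :=
    ((h.isPsiBV.countable_jumpSet h.standing h.pos).dense_compl ℝ).exists_between hlt
  exact ⟨r, ⟨hsr, hrt⟩, hst r ⟨⟨hs.trans hsr.le, hrt.le.trans ht⟩, hr⟩⟩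

theorem IsCompletion.incCost_fiber_le (hC : S.IsCompletion E' u tt uu) (h : S.IsFiniteBV E u)
    {t x y : ℝ} (ht : t ∈ Icc 0 S.T) (hx : S.arcLeft u t ≤ x) (hxy : x < y)
    (hy : y ≤ S.arcRight u t) :
    S.incCost (fun _ => t) uu x y ≤ ENNReal.ofReal (y - x) := by
  rcases le_or_gt y (S.arc u t) with hle | hgt
  · exact hC.left_inc t ht x y hx hxy hle
  rcases le_or_gt (S.arc u t) x with hle | hlt
  · exact hC.right_inc t ht x y hle hxy hy
  refine (h.standing.incCost_subaddOn (fun _ => t) uu x y x _ y le_rfl hlt hgt le_rfl).trans ?_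
  refine (add_le_add (hC.left_inc t ht x _ hx hlt le_rfl)
    (hC.right_inc t ht _ y le_rfl hgt hy)).trans (le_of_eq ?_)
  rw [← ENNReal.ofReal_add (by linarith) (by linarith)]
  ring_nf

theorem IsCompletion.Psi_fiber_le (hC : S.IsCompletion E' u tt uu) (h : S.IsFiniteBV E u)
    {t x y : ℝ} (ht : t ∈ Icc 0 S.T) (hx : S.arcLeft u t ≤ x) (hxy : x ≤ y)
    (hy : y ≤ S.arcRight u t) : S.Psi (uu y - uu x) ≤ y - x := by
  rcases hxy.eq_or_lt with rfl | hlt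
  · rw [sub_self, h.standing.Psi_zero, sub_self]
  · exact (ENNReal.ofReal_le_ofReal_iff (by linarith)).1
      (le_self_add.trans (hC.incCost_fiber_le h ht hx hlt hy))

/-- If both the time speed and the metric derivative vanished, the slope part `w` would have
derivative at least 1, so `uu` would have a nonzero derivative. But then the metric derivative
equals Ψ of that derivative and is positive. -/
theorem Standing.speed_pos (hS : S.Standing) {v w : ℝ → ℝ} {s : ℝ} {q : ℝ≥0∞}
    (hv : DifferentiableAt ℝ v s) (hw : DifferentiableAt ℝ w s) (ht : DifferentiableAt ℝ tt s)
    (hsum : ∀ᶠ x in 𝓝 s, v x + w x = x - tt x)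
    (hm : S.metricDeriv uu s = ENNReal.ofReal (deriv v s))
    (hsl : q * ‖deriv uu s‖ₑ = ENNReal.ofReal (deriv w s)) :
    0 < ENNReal.ofReal (deriv tt s) + S.metricDeriv uu s := by
  by_contra hle
  obtain ⟨ht0, hm0⟩ := add_eq_zero.1 (nonpos_iff_eq_zero.1 (not_lt.1 hle))
  have hder : deriv v s + deriv w s = 1 - deriv tt s := by
    rw [← deriv_fun_add hv hw, EventuallyEq.deriv_eq hsum,
      deriv_fun_sub differentiableAt_fun_id ht, deriv_id'']
  have ht0' := ENNReal.ofReal_eq_zero.1 ht0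
  have hv0 := ENNReal.ofReal_eq_zero.1 (hm.symm.trans hm0)
  have hne : deriv uu s ≠ 0 := by
    intro h0
    rw [h0, enorm_zero, mul_zero] at hsl
    exact (ENNReal.ofReal_pos.2 (show 0 < deriv w s by linarith)).ne hsl
  rw [hS.metricDeriv_of_differentiableAt (differentiableAt_of_deriv_ne_zero hne)] at hm0
  exact (ENNReal.ofReal_pos.2 (hS.Psi_pos _ hne)).ne' hm0

variable [CompleteSpace V]

theorem IsCompletion.time_eq (hC : S.IsCompletion E' u tt uu) (h : S.IsFiniteBV E u) {t x : ℝ}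
    (ht : t ∈ Icc 0 S.T) (h1 : S.arcLeft u t ≤ x) (h2 : x ≤ S.arcRight u t) :
    x ∈ Icc 0 (S.arc u S.T) ∧ tt x = t := by
  have hx : x ∈ Icc 0 (S.arc u S.T) :=
    ⟨(h.arcLeft_nonneg ht).trans h1, h2.trans (h.arcRight_le ht)⟩
  obtain ⟨ht', h1', h2'⟩ := hC.time x hx
  exact ⟨hx, h.time_unique ht' ht h1' h2' h1 h2⟩

theorem IsCompletion.isSection (hC : S.IsCompletion E' u tt uu) (h : S.IsFiniteBV E u) :
    S.IsSection tt uu 0 (S.arc u S.T) u (S.arc u) := fun t ht =>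
  have := hC.time_eq h ht (arcLeft_le_arc u t) (arc_le_arcRight u t)
  ⟨this.1, this.2, hC.arc_eq t ht⟩

theorem IsCompletion.time_sub_le (hC : S.IsCompletion E' u tt uu) (h : S.IsFiniteBV E u)
    {x y : ℝ} (hx : 0 ≤ x) (hxy : x ≤ y) (hy : y ≤ S.arc u S.T) :
    tt x ≤ tt y ∧ tt y - tt x ≤ y - x := by
  obtain ⟨htx, hx1, hx2⟩ := hC.time x ⟨hx, hxy.trans hy⟩
  obtain ⟨hty, hy1, hy2⟩ := hC.time y ⟨hx.trans hxy, hy⟩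
  rcases lt_trichotomy (tt x) (tt y) with hlt | heq | hlt
  · refine ⟨hlt.le, ?_⟩
    have := h.arcRight_add_le htx.1 hlt hty.2
    linarith [h.standing.Psi_nonneg (leftVal u (tt y) - S.rightVal u (tt x))]
  · exact ⟨heq.le, by rw [heq]; linarith⟩
  · linarith [h.arcRight_lt hty.1 hlt htx.2]

/-- Within one fibre this is the unit speed of the transitions. Between two times there is a stable
time, so the infimum of the slope is zero. The Ψ-increment is then estimated through the right limit
at the first time and the left limit at the second. -/
theorem IsCompletion.incCost_le (hC : S.IsCompletion E' u tt uu) (h : S.IsFiniteBV E u)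
    (hst : S.LocallyStable u) {x y : ℝ} (hx : 0 ≤ x) (hxy : x < y) (hy : y ≤ S.arc u S.T) :
    S.incCost tt uu x y ≤ ENNReal.ofReal ((y - tt y) - (x - tt x)) := by
  obtain ⟨htx, hx1, hx2⟩ := hC.time x ⟨hx, hxy.le.trans hy⟩
  obtain ⟨hty, hy1, hy2⟩ := hC.time y ⟨hx.trans hxy.le, hy⟩
  rcases (hC.time_sub_le h hx hxy.le hy).1.eq_or_lt with heq | hlt
  · rw [← heq] at hy2
    have hcongr : S.incCost tt uu x y = S.incCost (fun _ => tt x) uu x y :=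
      incCost_congr hxy.le
        (fun z hz => (hC.time_eq h htx (hx1.trans hz.1) (hz.2.trans hy2)).2) fun _ _ => rfl
    rw [hcongr, ← heq]
    refine (hC.incCost_fiber_le h htx hx1 hxy hy2).trans (le_of_eq ?_)
    ring_nf
  · obtain ⟨r, hr, hrst⟩ := h.exists_stable hst htx.1 hlt hty.2
    have hrm : r ∈ Icc 0 S.T := ⟨htx.1.trans hr.1.le, hr.2.le.trans hty.2⟩
    have hrx := h.arcRight_lt htx.1 hr.1 hrm.2
    have hry := h.arcRight_lt hrm.1 hr.2 hty.2
    have hz : S.arc u r ∈ Icc x y :=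
      ⟨by linarith [arcLeft_le_arc (S := S) u r], by linarith [arc_le_arcRight (S := S) u r]⟩
    have hsl : S.slopeCost tt uu x y = 0 := by
      have h0 : (⨅ z ∈ Icc x y, S.slope (tt z) (uu z)) = 0 := by
        refine le_antisymm ((biInf_le _ hz).trans (le_of_eq ?_)) zero_le
        rw [(hC.isSection h r hrm).2.1, hC.arc_eq r hrm, slope_eq_zero_of_isStableAt hrst]
      rw [slopeCost, h0, zero_mul]
    rw [incCost, hsl, add_zero]
    refine ENNReal.ofReal_le_ofReal ?_
    have e1 := hC.Psi_fiber_le h htx hx1 hx2 le_rfl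
    have e2 := hC.Psi_fiber_le h hty le_rfl hy1 hy2
    rw [hC.right_eq _ htx] at e1
    rw [hC.left_eq _ hty] at e2
    have t1 := h.standing.Psi_triangle (uu x) (S.rightVal u (tt x)) (uu y)
    have t2 := h.standing.Psi_triangle (S.rightVal u (tt x)) (leftVal u (tt y)) (uu y)
    linarith [h.arcRight_add_le htx.1 hlt hty.2]

theorem IsCompletion.lipschitzOnWith (hC : S.IsCompletion E' u tt uu) (h : S.IsFiniteBV E u) :
    LipschitzOnWith 1 tt (Icc 0 (S.arc u S.T)) := by
  refine LipschitzOnWith.of_le_add fun x hx y hy => ?_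
  rcases le_total x y with hxy | hxy
  · have := (hC.time_sub_le h hx.1 hxy hy.2).1
    linarith [dist_nonneg (x := x) (y := y)]
  · have := (hC.time_sub_le h hy.1 hxy hx.2).2
    rw [Real.dist_eq]
    linarith [le_abs_self (x - y)]

theorem IsCompletion.isRegularCurve (hC : S.IsCompletion E' u tt uu) (h : S.IsFiniteBV E u)
    (hst : S.LocallyStable u) (hE' : 0 < E') :
    S.IsRegularCurve E' tt uu 0 (S.arc u S.T) := by
  refine h.standing.isRegularCurve_of_incCost_le hE' zero_le_one (fun x hx => (hC.time x hx).1)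
    (hC.lipschitzOnWith h).continuousOn hC.mapsTo fun x y hx hxy hy => ?_
  refine (hC.incCost_le h hst hx hxy hy).trans (ENNReal.ofReal_le_ofReal ?_)
  linarith [(hC.time_sub_le h hx hxy.le hy).1]

theorem IsCompletion.dissipation_le (hC : S.IsCompletion E' u tt uu) (h : S.IsFiniteBV E u)
    (hst : S.LocallyStable u) (hE' : 0 < E') (hV : HasRadonNikodymProperty V) {x y : ℝ}
    (hx : 0 ≤ x) (hxy : x ≤ y) (hy : y ≤ S.arc u S.T) :
    S.dissipation tt uu x y ≤ ENNReal.ofReal ((y - tt y) - (x - tt x)) := by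
  rw [((hC.isRegularCurve h hst hE').mono hx hy).dissipation_eq hV h.standing hE' hxy]
  rcases hxy.eq_or_lt with rfl | hlt
  · rw [ivar_self]; exact zero_le
  refine ivar_le_of_superaddOn (h := fun x y => ENNReal.ofReal ((y - tt y) - (x - tt x))) hlt
    (fun a b ha hab hb => hC.incCost_le h hst (hx.trans ha) hab (hb.trans hy)) ?_
  intro a b c ha hab hbc hc
  beta_reduce
  have h1 := (hC.time_sub_le h (hx.trans ha) hab.le (hbc.le.trans (hc.trans hy))).2
  have h2 := (hC.time_sub_le h ((hx.trans ha).trans hab.le) hbc.le (hc.trans hy)).2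
  rw [← ENNReal.ofReal_add (by linarith) (by linarith)]
  exact ENNReal.ofReal_le_ofReal (by linarith)

theorem IsCompletion.time_zero (hC : S.IsCompletion E' u tt uu) (h : S.IsFiniteBV E u) :
    tt 0 = 0 := by
  have := (hC.isSection h 0 (left_mem_Icc.2 h.standing.T_pos.le)).2.1
  rwa [arc_zero] at this

theorem IsCompletion.isSurjective (hC : S.IsCompletion E' u tt uu) (h : S.IsFiniteBV E u) :
    S.IsSurjective tt 0 (S.arc u S.T) :=
  ⟨hC.time_zero h, (hC.isSection h S.T (right_mem_Icc.2 h.standing.T_pos.le)).2.1⟩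

theorem IsCompletion.isAdmissible (hC : S.IsCompletion E' u tt uu) (h : S.IsFiniteBV E u)
    (hst : S.LocallyStable u) (hE' : 0 < E') (hV : HasRadonNikodymProperty V) :
    S.IsAdmissible tt uu 0 (S.arc u S.T) where
  mapsTo x hx := (hC.time x hx).1
  monotone x hx y hy hxy := (hC.time_sub_le h hx.1 hxy hy.2).1
  ac := by
    refine LipschitzOnWith.absolutelyContinuousOnInterval (K := 1) ?_
    rw [uIcc_of_le h.arc_T_pos.le]
    exact hC.lipschitzOnWith h
  psiAC := ⟨E', hE', (hC.isRegularCurve h hst hE').psiAC⟩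
  locallyAC := (hC.isRegularCurve h hst hE').locallyAC
  const c d hcd hsub := by
    have hc := (hsub (left_mem_Icc.2 hcd)).1
    have hd := (hsub (right_mem_Icc.2 hcd)).1
    obtain ⟨htc, hc1, hc2⟩ := hC.time c hc
    obtain ⟨htd, hd1, hd2⟩ := hC.time d hd
    by_contra hne
    -- If `tt` changed along an unstable interval, that interval would contain the arclength value
    -- of a stable time, where the slope is zero.
    obtain ⟨r, hr, hrst⟩ := h.exists_stable hst htc.1
      (lt_of_le_of_ne (hC.time_sub_le h hc.1 hcd hd.2).1 hne) htd.2
    have hrm : r ∈ Icc 0 S.T := ⟨htc.1.trans hr.1.le, hr.2.le.trans htd.2⟩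
    have hrx := h.arcRight_lt htc.1 hr.1 hrm.2
    have hry := h.arcRight_lt hrm.1 hr.2 htd.2
    have hz := (hsub (a := S.arc u r) ⟨by linarith [arcLeft_le_arc (S := S) u r],
      by linarith [arc_le_arcRight (S := S) u r]⟩).2
    rw [(hC.isSection h r hrm).2.1, hC.arc_eq r hrm, slope_eq_zero_of_isStableAt hrst] at hz
    exact lt_irrefl _ hz
  finite := (hC.dissipation_le h hst hE' hV le_rfl h.arc_T_pos.le le_rfl).trans_lt
    ENNReal.ofReal_lt_top

theorem IsCompletion.finslerVar_eq (hC : S.IsCompletion E' u tt uu) (h : S.IsFiniteBV E u)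
    (hst : S.LocallyStable u) (hE' : 0 < E') (hV : HasRadonNikodymProperty V) :
    S.finslerVar u 0 S.T = S.dissipation tt uu 0 (S.arc u S.T) := by
  refine le_antisymm ?_ ?_
  · have := (hC.isSection h).finslerVar_le (hC.isAdmissible h hst hE' hV) hV h.standing
      h.arc_T_pos.le (hC.isSurjective h) le_rfl h.standing.T_pos le_rfl
    rwa [arc_zero] at this
  · refine (hC.dissipation_le h hst hE' hV le_rfl h.arc_T_pos.le le_rfl).trans (le_of_eq ?_)
    rw [← h.realFinslerVar_T, (hC.isSurjective h).1, (hC.isSurjective h).2, arc]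
    congr 1
    ring

/-- The dissipations on `[0,x]` and on the rest are each bounded by the corresponding increment of x
- tt x. Their sum equals the sum of the bounds, because the total dissipation is the 𝔣-variation, so
both bounds are attained. -/
theorem IsCompletion.toReal_dissipation (hC : S.IsCompletion E' u tt uu) (h : S.IsFiniteBV E u)
    (hst : S.LocallyStable u) (hE' : 0 < E') (hV : HasRadonNikodymProperty V) {x : ℝ}
    (hx : x ∈ Icc 0 (S.arc u S.T)) : (S.dissipation tt uu 0 x).toReal = x - tt x := by
  have hA := hC.isAdmissible h hst hE' hV
  have h1 := hC.dissipation_le h hst hE' hV le_rfl hx.1 hx.2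
  have h2 := hC.dissipation_le h hst hE' hV hx.1 hx.2 le_rfl
  have h3 := hA.dissipation_eq_ofReal hV h.standing hx.1 hx.2 le_rfl
  rw [← hC.finslerVar_eq h hst hE' hV, ← h.realFinslerVar_T, ENNReal.toReal_ofReal (by
    have := h.realFinslerVar_mono le_rfl h.standing.T_pos.le le_rfl
    rwa [realFinslerVar_zero] at this)] at h3
  have l1 := (hC.time_sub_le h le_rfl hx.1 hx.2).2
  have l2 := (hC.time_sub_le h hx.1 hx.2 le_rfl).2
  have e1 := ENNReal.toReal_mono ENNReal.ofReal_ne_top h1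
  have e2 := ENNReal.toReal_mono ENNReal.ofReal_ne_top h2
  rw [ENNReal.toReal_ofReal (by linarith)] at e1 e2
  rw [hC.time_zero h] at e1 l1
  rw [(hC.isSurjective h).2] at e2
  have : S.arc u S.T = S.T + S.realFinslerVar u S.T := rfl
  linarith

/-- The Ψ-variation and the slope variation on `[0,x]` add up to x - tt x. Differentiating almost
everywhere gives the normalization used by `Standing.speed_pos`. -/
theorem IsCompletion.isNondegenerate (hC : S.IsCompletion E' u tt uu) (h : S.IsFiniteBV E u)
    (hst : S.LocallyStable u) (hE' : 0 < E') (hV : HasRadonNikodymProperty V) :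
    S.IsNondegenerate tt uu 0 (S.arc u S.T) := by
  have hS := h.standing
  have hL0 : 0 ≤ S.arc u S.T := h.arc_T_pos.le
  have hr := hC.isRegularCurve h hst hE'
  have hA := hC.isAdmissible h hst hE' hV
  have hDfin : ∀ x ∈ Icc 0 (S.arc u S.T), S.psiVar uu 0 x + ivar (S.slopeCost tt uu) 0 x ≠ ⊤ := by
    intro x hx
    rw [← hS.ivar_incCost, ← (hr.mono le_rfl hx.2).dissipation_eq hV hS hE' hx.1]
    exact hA.dissipation_ne_top hV hS le_rfl hx.1 hx.2
  have hsum : ∀ x ∈ Icc 0 (S.arc u S.T), (S.psiVar uu 0 x).toReal + (ivar (S.slopeCost tt uu) 0 x).toReal =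
      x - tt x := by
    intro x hx
    have hf := ENNReal.add_ne_top.1 (hDfin x hx)
    rw [← ENNReal.toReal_add hf.1 hf.2, ← hS.ivar_incCost,
      ← (hr.mono le_rfl hx.2).dissipation_eq hV hS hE' hx.1]
    exact hC.toReal_dissipation h hst hE' hV hx
  have hfin := ENNReal.add_ne_top.1 (hDfin _ (right_mem_Icc.2 hL0))
  have hv : ∀ᵐ s ∂volume.restrict (Icc 0 (S.arc u S.T)), s ∈ Ioo 0 (S.arc u S.T) ∧
      DifferentiableAt ℝ (fun s => (S.psiVar uu 0 s).toReal) s :=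
    (monotoneOn_toReal_ivar (fun x y => S.psiCost 0 (uu x) (uu y)) hfin.1).ae_differentiableAt_Icc
  have hw := (monotoneOn_toReal_ivar _ hfin.2).ae_differentiableAt_Icc
  refine ae_restrict_of_ae_restrict_of_subset Ioo_subset_Icc_self ?_
  filter_upwards [hv, hw, hA.monotone.ae_differentiableAt_Icc, hS.metricDeriv_ae_eq hL0 hr.psiAC,
    hr.slope_ae_eq hV hS hE' hL0 hfin.2] with s hvs hws hts hm hsl
  exact hS.speed_pos hvs.2 hws.2 hts.2
    (eventually_of_mem (Icc_mem_nhds hvs.1.1 hvs.1.2) hsum) hm hsl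

end

/-! ### The energy balance along the completed curve -/

section

variable {E E' : ℝ} {u : ℝ → V} {tt : ℝ → ℝ} {uu : ℝ → V}

theorem IsPsiBV.intervalIntegrable_power (hu : S.IsPsiBV (S.sublevel E) u) (hS : S.Standing)
    (hE : 0 < E) {x y : ℝ} (hx : x ∈ Icc 0 S.T) (hy : y ∈ Icc 0 S.T) :
    IntervalIntegrable (fun r => S.power r (u r)) volume x y := by
  refine ((hu.integrableOn_power hS hE).mono_set ?_).intervalIntegrable
  exact ordConnected_Icc.uIcc_subset hx hy

theorem IsPsiBV.continuousOn_integral_power (hu : S.IsPsiBV (S.sublevel E) u) (hS : S.Standing)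
    (hE : 0 < E) : ContinuousOn (fun t => ∫ r in (0 : ℝ)..t, S.power r (u r)) (Icc 0 S.T) :=
  intervalIntegral.continuousOn_primitive_interval (by
    rw [uIcc_of_le hS.T_pos.le]; exact hu.integrableOn_power hS hE) |>.mono (by
    rw [uIcc_of_le hS.T_pos.le])

variable [CompleteSpace V]

theorem IsRegularCurve.energy_sub_le_of_const {t c d : ℝ} (h : S.IsRegularCurve E tt uu c d)
    (hV : HasRadonNikodymProperty V) (hS : S.Standing) (hE : 0 < E) (hcd : c ≤ d)
    (ht : t ∈ Icc 0 S.T) (htt : ∀ s ∈ Icc c d, tt s = t) :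
    ENNReal.ofReal (S.energy t (uu c) - S.energy t (uu d)) ≤ S.dissipation tt uu c d :=
  (hS.energy_sub_le_finslerCost hV ht _ _).trans (h.finslerCost_le hV hS hE hcd htt)

theorem IsBVSolution.real_balance (hb : S.IsBVSolution u) (h : S.IsFiniteBV E u) {t : ℝ}
    (ht : t ∈ Icc 0 S.T) : S.realFinslerVar u t + S.energy t (u t) =
      S.energy 0 (u 0) + ∫ r in (0 : ℝ)..t, S.power r (u r) := by
  rcases ht.1.eq_or_lt with rfl | h0
  · simp [realFinslerVar_zero]
  have h1 := hb.balance t ⟨h0, ht.2⟩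
  have h2 := h.isPsiBV.finslerVar_eq_ofReal h.standing h.pos h.finite le_rfl h0 ht.2
  rw [realFinslerVar_zero, sub_zero] at h2
  rw [h2.1, EReal.coe_ennreal_ofReal, max_eq_left h2.2, ← EReal.coe_add] at h1
  exact EReal.coe_injective h1

/-- The drop is at most the Finsler cost by the chain rule. Conversely, the balance at times r
decreasing to t charges at least the cost of the right jump, and lower semicontinuity of the energy
compares the limit with the value at the right limit. -/
theorem IsBVSolution.right_balance (hb : S.IsBVSolution u) (h : S.IsFiniteBV E u)
    (hV : HasRadonNikodymProperty V) {t : ℝ} (ht : t ∈ Icc 0 S.T) :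
    S.energy t (S.rightVal u t) + S.rightCost u t = S.energy t (u t) := by
  have hS := h.standing
  rcases ht.2.eq_or_lt with rfl | hT
  · rw [h.rightCost_T, rightVal_T, add_zero]
  refine le_antisymm ?_ ?_
  · rw [← le_sub_iff_add_le]
    refine le_of_forall_lt_imp_le_of_dense fun y hy => ?_
    obtain ⟨hmem, hlim⟩ := h.isPsiBV.rightVal_spec hS h.pos ⟨ht.1, hT⟩
    have hpos : ∀ᶠ r in 𝓝[>] t, r ∈ Ioc t S.T := Ioc_mem_nhdsGT hT
    have hpair : Tendsto (fun r => (r, u r)) (𝓝[>] t)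
        (𝓝[Icc 0 S.T ×ˢ S.D] (t, S.rightVal u t)) := by
      refine tendsto_nhdsWithin_iff.2 ⟨(tendsto_nhdsWithin_of_tendsto_nhds tendsto_id).prodMk_nhds
        hlim, ?_⟩
      filter_upwards [hpos] with r hr
      have hr' : r ∈ Icc 0 S.T := ⟨ht.1.trans hr.1.le, hr.2⟩
      exact ⟨hr', (h.isPsiBV.1 hr').1⟩
    have hev := hpair.eventually (hS.energy_lsc (t, S.rightVal u t) ⟨ht, hmem.1⟩ y hy)
    have hI : Tendsto (fun s => ∫ r in (0 : ℝ)..s, S.power r (u r)) (𝓝[>] t)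
        (𝓝 (∫ r in (0 : ℝ)..t, S.power r (u r))) := by
      refine (h.isPsiBV.continuousOn_integral_power hS h.pos t ht).tendsto.mono_left ?_
      refine nhdsWithin_le_iff.2 ?_
      filter_upwards [hpos] with r hr using ⟨ht.1.trans hr.1.le, hr.2⟩
    have key := ge_of_tendsto (hI.const_add
      (S.energy 0 (u 0) - S.realFinslerVar u t - S.rightCost u t)) (b := y) (by
        filter_upwards [hev, hpos] with r hr hrt
        have e1 := hb.real_balance h ⟨ht.1.trans hrt.1.le, hrt.2⟩
        have e2 := h.jumps_le ht.1 hrt.1 hrt.2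
        have e3 := hS.Psi_nonneg (leftVal u r - S.rightVal u t)
        have e4 := leftCost_nonneg (S := S) u r
        linarith)
    linarith [hb.real_balance h ht]
  · have h1 := hS.energy_sub_le_finslerCost hV ht (u t) (S.rightVal u t)
    rw [← h.ofReal_rightCost ht, ENNReal.ofReal_le_ofReal_iff (rightCost_nonneg u t)] at h1
    linarith

/-- For the lower bound of the energy at the left limit, lower semicontinuity points the wrong way.
Stable times r increasing to t are used instead: there the slope vanishes, so the energy of `u r`
exceeds that of the left limit by at most twice a vanishing Ψ-distance. -/
theorem IsBVSolution.left_balance (hb : S.IsBVSolution u) (h : S.IsFiniteBV E u)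
    (hV : HasRadonNikodymProperty V) {t : ℝ} (ht : t ∈ Icc 0 S.T) :
    S.energy t (leftVal u t) = S.energy t (u t) + S.leftCost u t := by
  have hS := h.standing
  rcases ht.1.eq_or_lt with rfl | h0
  · rw [h.leftCost_zero, leftVal_zero, add_zero]
  refine le_antisymm ?_ ?_
  · have h1 := hS.energy_sub_le_finslerCost hV ht (leftVal u t) (u t)
    rw [← h.ofReal_leftCost ht, ENNReal.ofReal_le_ofReal_iff (leftCost_nonneg u t)] at h1
    linarith
  · obtain ⟨hmem, hlim⟩ := h.isPsiBV.leftVal_spec hS h.pos ⟨h0, ht.2⟩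
    have hpos : ∀ᶠ r in 𝓝[<] t, r ∈ Ico 0 t := Ico_mem_nhdsLT h0
    have hsub : 𝓝[<] t ≤ 𝓝[Icc 0 S.T] t := by
      refine nhdsWithin_le_iff.2 ?_
      filter_upwards [hpos] with r hr using ⟨hr.1, hr.2.le.trans ht.2⟩
    have hI := (h.isPsiBV.continuousOn_integral_power hS h.pos t ht).tendsto.mono_left hsub
    have hEn := (hS.energy_continuousOn hmem.1 t ht).tendsto.mono_left hsub
    have hPsi : Tendsto (fun r => S.Psi (leftVal u t - u r)) (𝓝[<] t) (𝓝 0) := by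
      have := (hS.Psi_continuous.tendsto _).comp (hlim.const_sub (leftVal u t))
      rwa [sub_self, hS.Psi_zero] at this
    obtain ⟨δ, hδ, H⟩ := hS.exists_energy_sub_le h.pos one_pos
    have hnear : ∀ᶠ r in 𝓝[<] t, ‖leftVal u t - u r‖ < δ := by
      have := (hlim.const_sub (leftVal u t)).norm
      rw [sub_self, norm_zero] at this
      exact this.eventually_lt_const hδ
    have hfreq : ∃ᶠ r in 𝓝[<] t, S.IsStableAt r (u r) := by
      refine (frequently_nhdsWithin_iff.2 ?_)
      rw [frequently_iff]
      intro U hU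
      obtain ⟨l, hl, hlU⟩ := exists_Ioc_subset_of_mem_nhds hU ⟨0, h0⟩
      obtain ⟨r, hr, hrst⟩ := h.exists_stable hb.locallyStable (le_max_right l 0)
        (max_lt hl h0) ht.2
      exact ⟨r, hlU ⟨(le_max_left l 0).trans_lt hr.1, hr.2.le⟩, hrst, hr.2⟩
    have key := le_of_tendsto_of_tendsto_of_frequently
      (hI.const_add (S.energy 0 (u 0) - S.realFinslerVar u t + S.leftCost u t))
      (hEn.add (hPsi.const_mul 2)) ((hfreq.and_eventually (hpos.and hnear)).mono (by
        rintro r ⟨hrst, hr, hrn⟩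
        have hr' : r ∈ Icc 0 S.T := ⟨hr.1, hr.2.le.trans ht.2⟩
        have hsl := slope_eq_zero_of_isStableAt hrst
        have e0 := H r hr' _ (h.isPsiBV.1 hr') _ hmem hrn (by simp [hsl])
        rw [hsl, ENNReal.toReal_zero, zero_mul, add_zero] at e0
        have e1 := hb.real_balance h hr'
        have e2 := h.jumps_le hr.1 hr.2 ht.2
        have e3 := hS.Psi_nonneg (leftVal u t - S.rightVal u r)
        have e4 := rightCost_nonneg (S := S) u r
        linarith))
    linarith [hb.real_balance h ht]

/-- On the jump interval the chain rule bounds the energy drops before and after `x` by the elapsed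
arclength. The jump relations say that the total drop equals the total length, so both inequalities
are equalities. -/
theorem IsCompletion.balance (hC : S.IsCompletion E' u tt uu) (h : S.IsFiniteBV E u)
    (hE' : 0 < E') (hV : HasRadonNikodymProperty V) (hb : S.IsBVSolution u) {x : ℝ}
    (hx : x ∈ Icc 0 (S.arc u S.T)) :
    x - tt x + S.energy (tt x) (uu x) =
      S.energy 0 (u 0) + ∫ r in (0 : ℝ)..(tt x), S.power r (u r) := by
  have hS := h.standing
  have hst := hb.locallyStable
  have hr := hC.isRegularCurve h hst hE'
  obtain ⟨ht, h1, h2⟩ := hC.time x hx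
  have hfib : ∀ c d, S.arcLeft u (tt x) ≤ c → c ≤ d → d ≤ S.arcRight u (tt x) →
      S.energy (tt x) (uu c) - S.energy (tt x) (uu d) ≤ d - c := by
    intro c d hc hcd hd
    have htc := hC.time_eq h ht hc (hcd.trans hd)
    have htd := hC.time_eq h ht (hc.trans hcd) hd
    have h1 := ((hr.mono htc.1.1 htd.1.2).energy_sub_le_of_const hV hS hE' hcd ht
      fun s hs => (hC.time_eq h ht (hc.trans hs.1) (hs.2.trans hd)).2).trans
      (hC.dissipation_le h hst hE' hV htc.1.1 hcd htd.1.2)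
    rw [htc.2, htd.2, ENNReal.ofReal_le_ofReal_iff (by linarith)] at h1
    linarith
  have e1 := hfib _ _ le_rfl h1 h2
  have e2 := hfib _ _ h1 h2 le_rfl
  rw [hC.left_eq _ ht, hb.left_balance h hV ht] at e1
  rw [hC.right_eq _ ht] at e2
  have e3 := hb.right_balance h hV ht
  have e4 := hb.real_balance h ht
  simp only [arcLeft, arcRight, arc] at e1 e2
  linarith

theorem IsCompletion.isParamSolution (hC : S.IsCompletion E' u tt uu) (h : S.IsFiniteBV E u)
    (hE' : 0 < E') (hV : HasRadonNikodymProperty V) (hb : S.IsBVSolution u) :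
    S.IsParamSolution tt uu 0 (S.arc u S.T) := by
  have hA := hC.isAdmissible h hb.locallyStable hE' hV
  refine ⟨hA, hC.isSurjective h, hC.isNondegenerate h hb.locallyStable hE' hV,
    fun x hx y hy hxy => ?_⟩
  rw [(hC.isSection h).balance_iff hA hV h.standing hx.1 hxy hy.2,
    hA.dissipation_eq_ofReal hV h.standing hx.1 hxy hy.2,
    hC.toReal_dissipation h hb.locallyStable hE' hV hx,
    hC.toReal_dissipation h hb.locallyStable hE' hV hy]
  have h0 : (0 : ℝ) ∈ Icc 0 S.T := left_mem_Icc.2 h.standing.T_pos.le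
  have hadd := intervalIntegral.integral_add_adjacent_intervals
    (h.isPsiBV.intervalIntegrable_power h.standing h.pos h0 (hC.time x hx).1)
    (h.isPsiBV.intervalIntegrable_power h.standing h.pos (hC.time x hx).1 (hC.time y hy).1)
  linarith [hC.balance h hE' hV hb hx, hC.balance h hE' hV hb hy]

/-- A locally stable curve with finite `𝔣`-total variation is selected from an admissible
parameterized curve with the same dissipation. -/
theorem IsFiniteBV.exists_parametrization (h : S.IsFiniteBV E u) (hst : S.LocallyStable u)
    (hV : HasRadonNikodymProperty V) :
    ∃ (L : ℝ) (tt : ℝ → ℝ) (uu : ℝ → V), 0 < L ∧ S.IsAdmissible tt uu 0 L ∧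
      S.IsSurjective tt 0 L ∧ S.IsNondegenerate tt uu 0 L ∧ S.IsSelection tt uu 0 L u ∧
      S.finslerVar u 0 S.T = S.dissipation tt uu 0 L ∧
      (S.IsBVSolution u → S.IsParamSolution tt uu 0 L) := by
  obtain ⟨E', hE', tt, uu, hC⟩ := h.exists_isCompletion hV
  exact ⟨S.arc u S.T, tt, uu, h.arc_T_pos, hC.isAdmissible h hst hE' hV, hC.isSurjective h,
    hC.isNondegenerate h hst hE' hV, fun t ht => ⟨_, hC.isSection h t ht⟩,
    hC.finslerVar_eq h hst hE' hV, fun hb => hC.isParamSolution h hE' hV hb⟩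

end

end RateIndependentSystem

end

theorem mainTheorem4 {V : Type*} [NormedAddCommGroup V] [NormedSpace ℝ V] [CompleteSpace V]
    [TopologicalSpace.SeparableSpace V] (hV : HasRadonNikodymProperty V)
    (S : RateIndependentSystem V) (hS : S.Standing) :
    -- (BVP1)
    (∀ (a b : ℝ) (tt : ℝ → ℝ) (uu : ℝ → V), a < b → S.IsAdmissible tt uu a b →
      S.IsSurjective tt a b → S.IsNondegenerate tt uu a b →
      ∀ u : ℝ → V, S.IsSelection tt uu a b u →
        (∃ E > 0, S.IsPsiBV (S.sublevel E) u) ∧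
        S.LocallyStable u ∧
        (∀ σ : ℝ → ℝ,
          (∀ t ∈ Set.Icc 0 S.T, σ t ∈ Set.Icc a b ∧ tt (σ t) = t ∧ uu (σ t) = u t) →
          ∀ t₀ t₁ : ℝ, 0 ≤ t₀ → t₀ < t₁ → t₁ ≤ S.T →
            S.finslerVar u t₀ t₁ ≤ S.dissipation tt uu (σ t₀) (σ t₁)) ∧
        S.finslerVar u 0 S.T < ⊤) ∧
    -- (BVP2)
    (∀ (a b : ℝ) (tt : ℝ → ℝ) (uu : ℝ → V), a < b → S.IsParamSolution tt uu a b →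
      ∀ u : ℝ → V, S.IsSelection tt uu a b u → S.IsBVSolution u) ∧
    -- (BVP3)
    (∀ (E : ℝ) (u : ℝ → V), 0 < E → S.IsPsiBV (S.sublevel E) u → S.LocallyStable u →
      S.finslerVar u 0 S.T < ⊤ →
      ∃ (L : ℝ) (tt : ℝ → ℝ) (uu : ℝ → V), 0 < L ∧ S.IsAdmissible tt uu 0 L ∧
        S.IsSurjective tt 0 L ∧ S.IsNondegenerate tt uu 0 L ∧ S.IsSelection tt uu 0 L u ∧
        S.finslerVar u 0 S.T = S.dissipation tt uu 0 L ∧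
        (S.IsBVSolution u → S.IsParamSolution tt uu 0 L)) := by
  exact ⟨fun _ _ _ _ hab h hsurj _ _ hu => h.selection_properties hV hS hab hsurj hu,
    fun _ _ _ _ hab h _ hu => h.isBVSolution hV hS hab hu,
    fun _ _ hE hu hst hfin =>
      RateIndependentSystem.IsFiniteBV.exists_parametrization ⟨hS, hE, hu, hfin.ne⟩ hst hV⟩
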